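/- **Setting.** Let $n\ge 4$ and let $Z\in\mathbb{R}^{n\times 4}$ be totally positive, i.e. all its $4\times4$ minors are nonzero and have the same sign. Write $Z_1,\dots,Z_n\in\mathbb{P}^3$ for the points given by its rows, with indices read cyclically ($Z_{n+j}=Z_j$). The amplituhedron $\mathcal{A}_n\subset \mathrm{Gr}_{\mathbb{R}}(2,4)$ is the set of row spaces of $X Z$, where $X$ runs over the real $2\times n$ matrices of rank $2$ with nonnegative $2\times 2$ minors. Its boundary is $\partial\mathcal{A}_n=\mathcal{A}_n\setminus\mathrm{int}(\mathcal{A}_n)$ (Euclidean interior in $\mathrm{Gr}_{\mathbb{R}}(2,4)$), and its algebraic boundary $\partial_a\mathcal{A}_n$ is the Zariski closure of $\partial\mathcal{A}_n$ in $\mathrm{Gr}_{\mathbb{C}}(2,4)$, the variety of lines in $\mathbb{P}^3_{\mathbb{C}}$. For a line $AB$ let $\langle ABij\rangle$ be the determinant with columns $A,B,Z_i,Z_j$. Assume that there is no line $AB$ in $\mathbb{P}^3_{\mathbb{C}}$ for which more than four of the $\langle ABi(i+1)\rangle$, $i=1,\dots,n$, vanish. The *closed strata* of $\partial_a\mathcal{A}_n$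 are the irreducible closed subsets obtained from the irreducible components of $\partial_a\mathcal{A}_n$ by repeatedly taking irreducible components of intersections of two sets already obtained. Consider the Schubert conditions on a line $AB$ $$L_{ij}\colon AB\cap Z_iZ_j\neq\emptyset,\qquad V_i\colon Z_i\in AB,\qquad P_{(i-1)i(i+1)}\colon AB\subset Z_{i-1}Z_iZ_{i+1},$$ where a product of conditions denotes the locus in $\mathrm{Gr}_{\mathbb C}(2,4)$ of the lines satisfying all of them. Put $e_i=\{i,i+1\}$ and $c_i=\{i-1,i,i+1\}$. **Theorem.** The algebraic boundary $\partial_a\mathcal{A}_n$ is the union of its closed strata, and the intersection of any two closed strata is a union of closed strata. The closed strata are exactly the irreducible components of the loci of the following $14$ types. The first digit of a type is the dimension of its loci, so there are $1,3,4,6$ types in dimensions $3,2,1,0$. The last column is the number of distinct loci of each type. | type | locus | indices | number | |---|---|---|---| | $(3,\mathrm{I})$ | $L_{i(i+1)}$ | all $i$ | $n$ | | $(2,\mathrm{I})$ | $V_i$ | all $i$ | $n$ | | $(2,\mathrm{II})$ | $P_{(i-1)i(i+1)}$ | all $i$ | $n$ | | $(2,\mathrm{III})$ | $L_{i(i+1)}L_{j(j+1)}$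 | $e_i\cap e_j=\emptyset$ | $\binom n2-n$ | | $(1,\mathrm{I})$ | $V_iL_{(i-1)(i+1)}$ | all $i$ | $n$ | | $(1,\mathrm{II})$ | $V_iL_{j(j+1)}$ | $i\notin e_j$ | $n(n-2)$ | | $(1,\mathrm{III})$ | $P_{(i-1)i(i+1)}L_{j(j+1)}$ | $c_i\cap e_j=\emptyset$ | $n(n-4)$ | | $(1,\mathrm{IV})$ | $L_{i(i+1)}L_{j(j+1)}L_{k(k+1)}$ | $e_i,e_j,e_k$ pairwise disjoint | $\binom n3-n(n-3)$ | | $(0,\mathrm{I})$ | $V_iV_j$ | $i\ne j$ | $\binom n2$ | | $(0,\mathrm{II})$ | $P_{(i-1)i(i+1)}P_{(j-1)j(j+1)}$ | $c_i\cap c_j=\emptyset$ | $\frac n2(n-5)$ | | $(0,\mathrm{III})$ | $V_iL_{(i-1)(i+1)}L_{j(j+1)}$ | $c_i\cap e_j=\emptyset$ | $n(n-4)$ | | $(0,\mathrm{IV})$ | $V_iL_{j(j+1)}L_{k(k+1)}$ | $e_j\cap e_k=\emptyset$, $i\notin e_j\cup e_k$ | $n\binom{n-3}2$ | | $(0,\mathrm{V})$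 | $P_{(i-1)i(i+1)}L_{j(j+1)}L_{k(k+1)}$ | $c_i\cap e_j=c_i\cap e_k=e_j\cap e_k=\emptyset$ | $n\binom{n-5}2$ | | $(0,\mathrm{VI})$ | $L_{i(i+1)}L_{j(j+1)}L_{k(k+1)}L_{l(l+1)}$ | $e_i,e_j,e_k,e_l$ pairwise disjoint | $\frac n{24}(n-5)(n-6)(n-7)$ | For $n=4$ the numbers for $(0,\mathrm{II})$, $(0,\mathrm{V})$ and $(0,\mathrm{VI})$ are to be read as $0$. Every locus is Zariski closed of the stated dimension. Every locus of a type other than $(0,\mathrm{VI})$ is irreducible, hence itself a closed stratum; every locus of type $(0,\mathrm{VI})$ consists of exactly two points, each of which is a closed stratum, and the pair is counted once. Each closed stratum is a component of exactly one locus, and each locus belongs to exactly one type. -/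

import Mathlib

/-- The Grassmannian `Gr_K(2, m)`: two-dimensional subspaces of `K^m`, i.e. lines in `ℙ^{m-1}`. -/
@[ext]
structure Gr (K : Type) [Field K] (m : ℕ) where
  space : Submodule K (Fin m → K)
  finrank_space : Module.finrank K space = 2

/-- The point of `Gr_K(2, m)` represented by a `2 × m` matrix of rank two: its row space. -/
def Gr.rowSpace {K : Type} [Field K] {m : ℕ} (X : Matrix (Fin 2) (Fin m) K)
    (hX : LinearIndependent K X.row) : Gr K m where
  space := Submodule.span K (Set.range X.row)
  finrank_space := by
    rw [finrank_span_eq_card hX, Fintype.card_fin]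

/-- The index set `{(i, j) : i < j}` of the Plücker coordinates. -/
abbrev PluckerIndex (m : ℕ) : Type := {p : Fin m × Fin m // p.1 < p.2}

/-- The Plücker coordinates (`2 × 2` minors) of a `2 × m` matrix. -/
def plucker {K : Type} [Field K] {m : ℕ} (X : Matrix (Fin 2) (Fin m) K) (p : PluckerIndex m) : K :=
  X 0 p.1.1 * X 1 p.1.2 - X 0 p.1.2 * X 1 p.1.1

/-- The Euclidean topology on the real Grassmannian `Gr_ℝ(2, 4)`: the quotient topology of the
space of real `2 × 4` matrices of rank two. -/
noncomputable instance Gr.euclideanTopology : TopologicalSpace (Gr ℝ 4) :=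
  TopologicalSpace.coinduced
    (fun X : {X : Matrix (Fin 2) (Fin 4) ℝ // LinearIndependent ℝ X.row} =>
      Gr.rowSpace X.1 X.2)
    inferInstance

/-- The Zariski topology on the complex Grassmannian `Gr_ℂ(2, 4) ⊆ ℙ⁵`. A basis of open sets is
given by the sets where a homogeneous polynomial in the six Plücker coordinates is nonzero. -/
instance Gr.zariskiTopology : TopologicalSpace (Gr ℂ 4) :=
  TopologicalSpace.generateFrom
    {U | ∃ (d : ℕ) (f : MvPolynomial (PluckerIndex 4) ℂ), f.IsHomogeneous d ∧
      U = {V | ∃ (X : Matrix (Fin 2) (Fin 4) ℂ) (hX : LinearIndependent ℂ X.row),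
        V = Gr.rowSpace X hX ∧ MvPolynomial.eval (plucker X) f ≠ 0}}

/-- An `n × 4` matrix is totally positive if all its maximal minors are nonzero and have the
same sign. -/
def TotallyPositive {n : ℕ} (Z : Matrix (Fin n) (Fin 4) ℝ) : Prop :=
  ∀ I J : Fin 4 → Fin n, StrictMono I → StrictMono J →
    0 < (Z.submatrix I id).det * (Z.submatrix J id).det

/-- The amplituhedron `𝒜_n(Z) ⊆ Gr_ℝ(2, 4)`: the image of the totally nonnegative Grassmannian
`Gr(2, n)_{≥ 0}` under `X ↦ X * Z`. -/
def amplituhedron {n : ℕ} (Z : Matrix (Fin n) (Fin 4) ℝ) : Set (Gr ℝ 4) :=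
  {Y | ∃ X : Matrix (Fin 2) (Fin n) ℝ, LinearIndependent ℝ X.row ∧
    (∀ p : PluckerIndex n, 0 ≤ plucker X p) ∧
    Y.space = Submodule.span ℝ (Set.range (X * Z).row)}

/-- The boundary of the amplituhedron in the Euclidean topology of `Gr_ℝ(2, 4)`. -/
def amplituhedronBoundary {n : ℕ} (Z : Matrix (Fin n) (Fin 4) ℝ) : Set (Gr ℝ 4) :=
  amplituhedron Z \ interior (amplituhedron Z)

/-- The algebraic boundary `∂_a 𝒜_n(Z)`: the Zariski closure in `Gr_ℂ(2, 4)` of the boundary of the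
amplituhedron, a real line being identified with its complexification. -/
def algebraicBoundary {n : ℕ} (Z : Matrix (Fin n) (Fin 4) ℝ) : Set (Gr ℂ 4) :=
  closure {V | ∃ Y ∈ amplituhedronBoundary Z,
    V.space = Submodule.span ℂ ((fun (v : Fin 4 → ℝ) (k : Fin 4) => (v k : ℂ)) '' Y.space)}

/-- The irreducible components of a subset `S` of a topological space: the maximal irreducible
subsets of `S`. -/
def componentsIn {T : Type} [TopologicalSpace T] (S : Set T) : Set (Set T) :=
  {C | Maximal (fun D => IsIrreducible D ∧ D ⊆ S) C}

/-- The closed strata obtained from `B` by intersecting irreducible components: the irreducible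
components of `B` are closed strata, and so are, repeatedly, the irreducible components of the
intersection of two closed strata. -/
inductive IsClosedStratum {T : Type} [TopologicalSpace T] (B : Set T) : Set T → Prop
  | component {C : Set T} (hC : C ∈ componentsIn B) : IsClosedStratum B C
  | inter {C D E : Set T} (hC : IsClosedStratum B C) (hD : IsClosedStratum B D)
      (hE : E ∈ componentsIn (C ∩ D)) : IsClosedStratum B E

/-- The `i`-th row of `Z` as a vector in `ℂ⁴`, representing the point `Z_i` of `ℙ³`. Indices in
`Fin n` are cyclic: `i + 1` and `i - 1` are taken modulo `n`. -/
def rowPoint {n : ℕ} (Z : Matrix (Fin n) (Fin 4) ℝ) (i : Fin n) : Fin 4 → ℂ :=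
  fun k => (Z i k : ℂ)

/-- The bracket `⟨A B i j⟩`, where `A` and `B` are the rows of `X`. -/
def bracket {n : ℕ} (Z : Matrix (Fin n) (Fin 4) ℝ) (X : Matrix (Fin 2) (Fin 4) ℂ)
    (i j : Fin n) : ℂ :=
  (Matrix.of ![X 0, X 1, rowPoint Z i, rowPoint Z j]).det

/-- There is no line `AB` in `ℙ³` for which more than four of the brackets `⟨A B i (i+1)⟩` vanish. -/
def GeneralPosition {n : ℕ} [NeZero n] (Z : Matrix (Fin n) (Fin 4) ℝ) : Prop :=
  ∀ X : Matrix (Fin 2) (Fin 4) ℂ, LinearIndependent ℂ X.row →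
    {i : Fin n | bracket Z X i (i + 1) = 0}.ncard ≤ 4

/-- `L_{ij}`: lines meeting the line `Z_i Z_j`. -/
def meetsLine {n : ℕ} (Z : Matrix (Fin n) (Fin 4) ℝ) (i j : Fin n) : Set (Gr ℂ 4) :=
  {V | V.space ⊓ Submodule.span ℂ {rowPoint Z i, rowPoint Z j} ≠ ⊥}

/-- `V_i`: lines containing the point `Z_i`. -/
def throughPoint {n : ℕ} (Z : Matrix (Fin n) (Fin 4) ℝ) (i : Fin n) : Set (Gr ℂ 4) :=
  {V | rowPoint Z i ∈ V.space}

/-- `P_{(i-1)i(i+1)}`: lines contained in the plane `Z_{i-1} Z_i Z_{i+1}`. -/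
def inPlane {n : ℕ} [NeZero n] (Z : Matrix (Fin n) (Fin 4) ℝ) (i : Fin n) : Set (Gr ℂ 4) :=
  {V | V.space ≤ Submodule.span ℂ {rowPoint Z (i - 1), rowPoint Z i, rowPoint Z (i + 1)}}

/-- The index pair `{i, i+1}`. -/
def edge {n : ℕ} [NeZero n] (i : Fin n) : Set (Fin n) := {i, i + 1}

/-- The index triple `{i-1, i, i+1}`. -/
def corner {n : ℕ} [NeZero n] (i : Fin n) : Set (Fin n) := {i - 1, i, i + 1}

/-- The fourteen types of strata; `dimKtypeR` is the type `(K, R)`. -/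
inductive StratumType : Type
  | dim3typeI
  | dim2typeI
  | dim2typeII
  | dim2typeIII
  | dim1typeI
  | dim1typeII
  | dim1typeIII
  | dim1typeIV
  | dim0typeI
  | dim0typeII
  | dim0typeIII
  | dim0typeIV
  | dim0typeV
  | dim0typeVI

/-- The dimension of the strata of a given type. -/
def StratumType.dim : StratumType → ℕ
  | .dim3typeI => 3
  | .dim2typeI => 2
  | .dim2typeII => 2
  | .dim2typeIII => 2
  | .dim1typeI => 1
  | .dim1typeII => 1
  | .dim1typeIII => 1
  | .dim1typeIV => 1
  | .dim0typeI => 0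
  | .dim0typeII => 0
  | .dim0typeIII => 0
  | .dim0typeIV => 0
  | .dim0typeV => 0
  | .dim0typeVI => 0

/-- The number of strata of each type. All divisions are exact. For `n ≥ 5` truncated subtraction
gives the same values as exact subtraction; for `n = 4` it makes the entries `(0, II)`, `(0, V)`,
`(0, VI)` equal to zero, which is the correct number. -/
def StratumType.count (n : ℕ) : StratumType → ℕ
  | .dim3typeI => n
  | .dim2typeI => n
  | .dim2typeII => n
  | .dim2typeIII => n.choose 2 - n
  | .dim1typeI => n
  | .dim1typeII => n * (n - 2)
  | .dim1typeIII => n * (n - 4)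
  | .dim1typeIV => n.choose 3 - n * (n - 3)
  | .dim0typeI => n.choose 2
  | .dim0typeII => n * (n - 5) / 2
  | .dim0typeIII => n * (n - 4)
  | .dim0typeIV => n * (n - 3).choose 2
  | .dim0typeV => n * (n - 5).choose 2
  | .dim0typeVI => n * (n - 5) * (n - 6) * (n - 7) / 24

/-- The strata of each type, given by Schubert conditions. -/
def strataOfType {n : ℕ} [NeZero n] (Z : Matrix (Fin n) (Fin 4) ℝ) :
    StratumType → Set (Set (Gr ℂ 4))
  | .dim3typeI => {S | ∃ i : Fin n, S = meetsLine Z i (i + 1)}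
  | .dim2typeI => {S | ∃ i : Fin n, S = throughPoint Z i}
  | .dim2typeII => {S | ∃ i : Fin n, S = inPlane Z i}
  | .dim2typeIII => {S | ∃ i j : Fin n, Disjoint (edge i) (edge j) ∧
      S = meetsLine Z i (i + 1) ∩ meetsLine Z j (j + 1)}
  | .dim1typeI => {S | ∃ i : Fin n, S = throughPoint Z i ∩ meetsLine Z (i - 1) (i + 1)}
  | .dim1typeII => {S | ∃ i j : Fin n, i ∉ edge j ∧
      S = throughPoint Z i ∩ meetsLine Z j (j + 1)}
  | .dim1typeIII => {S | ∃ i j : Fin n, Disjoint (corner i) (edge j) ∧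
      S = inPlane Z i ∩ meetsLine Z j (j + 1)}
  | .dim1typeIV => {S | ∃ i j k : Fin n, Disjoint (edge i) (edge j) ∧
      Disjoint (edge i) (edge k) ∧ Disjoint (edge j) (edge k) ∧
      S = meetsLine Z i (i + 1) ∩ meetsLine Z j (j + 1) ∩ meetsLine Z k (k + 1)}
  | .dim0typeI => {S | ∃ i j : Fin n, i ≠ j ∧ S = throughPoint Z i ∩ throughPoint Z j}
  | .dim0typeII => {S | ∃ i j : Fin n, Disjoint (corner i) (corner j) ∧
      S = inPlane Z i ∩ inPlane Z j}
  | .dim0typeIII => {S | ∃ i j : Fin n, Disjoint (corner i) (edge j) ∧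
      S = throughPoint Z i ∩ meetsLine Z (i - 1) (i + 1) ∩ meetsLine Z j (j + 1)}
  | .dim0typeIV => {S | ∃ i j k : Fin n, Disjoint (edge j) (edge k) ∧ i ∉ edge j ∧ i ∉ edge k ∧
      S = throughPoint Z i ∩ meetsLine Z j (j + 1) ∩ meetsLine Z k (k + 1)}
  | .dim0typeV => {S | ∃ i j k : Fin n, Disjoint (corner i) (edge j) ∧
      Disjoint (corner i) (edge k) ∧ Disjoint (edge j) (edge k) ∧
      S = inPlane Z i ∩ meetsLine Z j (j + 1) ∩ meetsLine Z k (k + 1)}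
  | .dim0typeVI => {S | ∃ i j k l : Fin n, Disjoint (edge i) (edge j) ∧
      Disjoint (edge i) (edge k) ∧ Disjoint (edge i) (edge l) ∧ Disjoint (edge j) (edge k) ∧
      Disjoint (edge j) (edge l) ∧ Disjoint (edge k) (edge l) ∧
      S = meetsLine Z i (i + 1) ∩ meetsLine Z j (j + 1) ∩ meetsLine Z k (k + 1) ∩
        meetsLine Z l (l + 1)}

/-! The algebraic boundary is the union of the hypersurfaces of lines meeting an edge `Z_i Z_{i+1}`
(`CyclicallyPositive.algebraicBoundary_eq`). Continued with period `n` up to sign, the rows of `Z`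
have all cyclically ordered brackets of one sign, so the expansion of `⟨AB i (i+1)⟩` in the minors
of a nonnegative matrix has terms of one sign only. If none of these brackets vanishes, the sequence
`⟨AB 1 m⟩` changes sign; conversely, a line with this sign pattern is the image of an explicit
nonnegative matrix. The pattern is an open condition, so such a line is interior and every boundary
line meets an edge. In the other direction each hypersurface contains a family of boundary lines
with positive real parameters, and a form that vanishes on this family vanishes on the whole
hypersurface.

The rest is incidence geometry of points of which no four are coplanar. A line meets two consecutive
edges only if it passes through their common vertex or lies in the corner plane
(`NoFourCoplanar.mem_or_inPlane`); this produces the conditions `V` and `P`. The loci of positive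
dimension consist of the lines spanned by pairs of vectors running through a linear space, hence are
irreducible (`Gr.isPreirreducible_family`). Four disjoint edges have exactly two common transversals
because the condition on the point where a transversal meets the last edge is a real binary
quadratic form, which total positivity forces to take both signs.

To identify the strata, let `Specializes Z V W` mean that `W` has all incidences of `V` with edges,
vertices and corner planes. A case distinction on the incidences of `V` finds a listed component
containing `V` all of whose members are such `W` (`IsGeneric.exists_listed`). The listed loci and
their intersections are stable under this relation, so each such intersection is a finite union of
listed components, and its irreducible components are among them. A single point of a pair of type
(0, VI) is not stable, but it can only meet another stratum in itself or not at all.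

Types are told apart by the incidences that hold on a whole component. At zero-dimensional loci one
must exclude unexpected incidences: the bound of four edges excludes most of them, and the remaining
ones contradict an inequality for convex hexagons (`CyclicallyPositive.not_meets`). Dimensions
follow from strict chains of loci and from the bound 4 for the Grassmannian, and the numbers of loci
from counting sets of pairwise disjoint edges on a cycle. -/

open Submodule

set_option linter.unusedSectionVars false

namespace Gr

/-! ### Lines as spans of two vectors, and their Plücker coordinates. -/

section Basis

variable {K : Type} [Field K] {m : ℕ}

/-- The Plücker coordinates of the span of two vectors. -/
def pairPlucker (x y : Fin m → K) (p : PluckerIndex m) : K :=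
  x p.1.1 * y p.1.2 - x p.1.2 * y p.1.1

theorem plucker_eq_pairPlucker (X : Matrix (Fin 2) (Fin m) K) :
    plucker X = pairPlucker (X 0) (X 1) := rfl

/-- The line through two points. -/
def ofPair (x y : Fin m → K) (h : LinearIndependent K ![x, y]) : Gr K m :=
  rowSpace (Matrix.of ![x, y]) h

@[simp]
theorem ofPair_space (x y : Fin m → K) (h : LinearIndependent K ![x, y]) :
    (ofPair x y h).space = span K {x, y} := by
  change span K (Set.range ![x, y]) = _
  rw [Matrix.range_cons, Matrix.range_cons, Matrix.range_empty, Set.union_empty,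
    Set.singleton_union]

theorem rowSpace_space (X : Matrix (Fin 2) (Fin m) K) (h : LinearIndependent K X.row) :
    (rowSpace X h).space = span K {X 0, X 1} := by
  change span K (Set.range fun i : Fin 2 => X i) = _
  congr 1
  ext v
  simp only [Set.mem_range, Fin.exists_fin_two, Set.mem_insert_iff, Set.mem_singleton_iff,
    eq_comm (a := v)]

theorem linearIndependent_row_iff (X : Matrix (Fin 2) (Fin m) K) :
    LinearIndependent K X.row ↔ LinearIndependent K ![X 0, X 1] := by
  have : X.row = ![X 0, X 1] := by
    ext i j
    fin_cases i <;> rfl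
  rw [this]

theorem pair_of_space_eq (V : Gr K m) {x y : Fin m → K} (h : V.space = span K {x, y}) :
    LinearIndependent K ![x, y] := by
  rw [linearIndependent_iff_card_eq_finrank_span, Fintype.card_fin, Set.finrank]
  rw [Matrix.range_cons, Matrix.range_cons, Matrix.range_empty, Set.union_empty,
    Set.singleton_union, ← h, V.finrank_space]

theorem exists_eq_rowSpace (V : Gr K m) :
    ∃ (X : Matrix (Fin 2) (Fin m) K) (hX : LinearIndependent K X.row), V = rowSpace X hX := by
  let b := Module.finBasisOfFinrankEq K V.space V.finrank_space
  have hb : LinearIndependent K (fun i => (b i : Fin m → K)) :=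
    b.linearIndependent.map' V.space.subtype (Submodule.ker_subtype _)
  refine ⟨Matrix.of fun i => (b i : Fin m → K), hb, ?_⟩
  ext1
  change V.space = span K (Set.range (fun i => (b i : Fin m → K)))
  have := congrArg (Submodule.map V.space.subtype) b.span_eq
  rw [Submodule.map_span, ← Set.range_comp, Submodule.map_top, Submodule.range_subtype] at this
  exact this.symm

theorem exists_space_eq_span (V : Gr K m) :
    ∃ x y : Fin m → K, V.space = span K {x, y} := by
  obtain ⟨X, hX, rfl⟩ := V.exists_eq_rowSpace
  exact ⟨_, _, rowSpace_space X hX⟩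

theorem eq_of_space_le {V W : Gr K m} (h : V.space ≤ W.space) : V = W := by
  ext1
  exact Submodule.eq_of_le_of_finrank_eq h (V.finrank_space.trans W.finrank_space.symm)

/-- A line is spanned by any two distinct points on it. -/
theorem space_eq_of_mem (V : Gr K m) {x y : Fin m → K} (hx : x ∈ V.space) (hy : y ∈ V.space)
    (h : LinearIndependent K ![x, y]) : V.space = span K {x, y} := by
  have hle : (ofPair x y h).space ≤ V.space := by
    rw [ofPair_space, span_le]
    rintro v (rfl | rfl)
    exacts [hx, hy]
  rw [← eq_of_space_le hle, ofPair_space]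

theorem exists_space_eq_of_mem (V : Gr K m) {x : Fin m → K} (hx : x ∈ V.space) (h0 : x ≠ 0) :
    ∃ y, V.space = span K {x, y} := by
  have hlt : span K {x} < V.space := by
    refine lt_of_le_of_ne (by simpa [span_le] using hx) fun h => ?_
    have h1 := V.finrank_space
    rw [← h, finrank_span_singleton h0] at h1
    omega
  obtain ⟨y, hy, hyx⟩ := SetLike.exists_of_lt hlt
  refine ⟨y, V.space_eq_of_mem hx hy ?_⟩
  rw [LinearIndependent.pair_iff' h0]
  intro a ha
  exact hyx (mem_span_singleton.2 ⟨a, ha⟩)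

/-- If all minors vanish, then `y i • x - x i • y = 0` for every `i`, and an index with `x i ≠ 0`
makes this a nontrivial relation. -/
theorem exists_pairPlucker_ne_zero {x y : Fin m → K} (h : LinearIndependent K ![x, y]) :
    ∃ p, pairPlucker x y p ≠ 0 := by
  by_contra! hp
  have key : ∀ i j, x i * y j - x j * y i = 0 := by
    intro i j
    rcases lt_trichotomy i j with hij | rfl | hij
    · exact hp ⟨(i, j), hij⟩
    · ring
    · have := hp ⟨(j, i), hij⟩
      simp only [pairPlucker] at this
      linear_combination -this
  rw [LinearIndependent.pair_iff] at h
  have hx : x ≠ 0 := by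
    rintro rfl
    simpa using (h 1 0 (by simp)).1
  obtain ⟨i, hi⟩ := Function.ne_iff.1 hx
  have := (h (y i) (-x i) (by
    ext j
    simp only [Pi.add_apply, Pi.smul_apply, smul_eq_mul, Pi.zero_apply]
    linear_combination -(key i j))).2
  exact hi (by simpa using this)

theorem linearIndependent_of_pairPlucker_ne_zero {x y : Fin m → K} {p : PluckerIndex m}
    (h : pairPlucker x y p ≠ 0) : LinearIndependent K ![x, y] := by
  rw [LinearIndependent.pair_iff]
  intro s t hst
  have h1 := congrFun hst p.1.1
  have h2 := congrFun hst p.1.2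
  simp only [Pi.add_apply, Pi.smul_apply, smul_eq_mul, Pi.zero_apply] at h1 h2
  simp only [pairPlucker] at h
  constructor
  · refine (mul_eq_zero.1 (?_ : s * _ = 0)).resolve_right h
    linear_combination y p.1.2 * h1 - y p.1.1 * h2
  · refine (mul_eq_zero.1 (?_ : t * _ = 0)).resolve_right h
    linear_combination x p.1.1 * h2 - x p.1.2 * h1

/-- Plücker coordinates are well defined up to a nonzero scalar. -/
theorem pairPlucker_eq_smul {x y x' y' : Fin m → K}
    (h' : LinearIndependent K ![x', y']) (hs : span K {x', y'} = span K {x, y}) :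
    ∃ c : K, c ≠ 0 ∧ pairPlucker x' y' = c • pairPlucker x y := by
  have hx : x' ∈ span K {x, y} := hs ▸ subset_span (by simp)
  have hy : y' ∈ span K {x, y} := hs ▸ subset_span (by simp)
  obtain ⟨a, b, rfl⟩ := mem_span_pair.1 hx
  obtain ⟨c, d, rfl⟩ := mem_span_pair.1 hy
  have key : pairPlucker (a • x + b • y) (c • x + d • y) = (a * d - b * c) • pairPlucker x y := by
    ext p
    simp only [pairPlucker, Pi.add_apply, Pi.smul_apply, smul_eq_mul]
    ring
  refine ⟨_, fun h0 => ?_, key⟩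
  obtain ⟨p, hp⟩ := exists_pairPlucker_ne_zero h'
  rw [key, h0] at hp
  simp at hp

theorem pairPlucker_smul_left (c : K) (x y : Fin m → K) :
    pairPlucker (c • x) y = c • pairPlucker x y := by
  ext p
  simp only [pairPlucker, Pi.smul_apply, smul_eq_mul]
  ring

end Basis

/-! ### The Zariski topology -/

section Zariski

open MvPolynomial

/-- The basic open set of lines at which a form in the Plücker coordinates does not vanish. -/
def basicOpen (f : MvPolynomial (PluckerIndex 4) ℂ) : Set (Gr ℂ 4) :=
  {V | ∃ (X : Matrix (Fin 2) (Fin 4) ℂ) (hX : LinearIndependent ℂ X.row),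
    V = rowSpace X hX ∧ eval (plucker X) f ≠ 0}

theorem eval_smul_of_isHomogeneous {σ : Type*} {f : MvPolynomial σ ℂ} {d : ℕ}
    (hf : f.IsHomogeneous d) (c : ℂ) (p : σ → ℂ) : eval (c • p) f = c ^ d * eval p f := by
  rw [eval_eq, eval_eq, Finset.mul_sum]
  refine Finset.sum_congr rfl fun e he => ?_
  have hd : ∑ i ∈ e.support, e i = d := by
    rw [← hf (mem_support_iff.1 he), Finsupp.weight_apply, Finsupp.sum]
    simp
  simp only [Pi.smul_apply, smul_eq_mul, mul_pow, Finset.prod_mul_distrib]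
  rw [Finset.prod_pow_eq_pow_sum, hd]
  ring

/-- Another spanning pair multiplies the Plücker coordinates by a nonzero scalar, and a form of
degree `d` by its `d`-th power; so any one pair decides membership. -/
theorem mem_basicOpen {f : MvPolynomial (PluckerIndex 4) ℂ} {d : ℕ} (hf : f.IsHomogeneous d)
    {V : Gr ℂ 4} {x y : Fin 4 → ℂ} (h : V.space = span ℂ {x, y}) :
    V ∈ basicOpen f ↔ eval (pairPlucker x y) f ≠ 0 := by
  have hxy := V.pair_of_space_eq h
  constructor
  · rintro ⟨X, hX, rfl, hne⟩
    rw [rowSpace_space] at h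
    obtain ⟨c, hc, e⟩ := pairPlucker_eq_smul ((linearIndependent_row_iff X).1 hX) h
    rw [plucker_eq_pairPlucker, e, eval_smul_of_isHomogeneous hf] at hne
    exact right_ne_zero_of_mul hne
  · intro hne
    refine ⟨Matrix.of ![x, y], hxy, ?_, hne⟩
    ext1
    rw [h]
    exact (ofPair_space x y hxy).symm

/-- A product of two forms is a form, so the generating sets are closed under intersection and are a
basis, not merely a subbasis. -/
theorem isTopologicalBasis_basicOpen : TopologicalSpace.IsTopologicalBasis
    {U | ∃ (d : ℕ) (f : MvPolynomial (PluckerIndex 4) ℂ), f.IsHomogeneous d ∧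
      U = basicOpen f} where
  exists_subset_inter := by
    rintro _ ⟨d, f, hf, rfl⟩ _ ⟨e, g, hg, rfl⟩ V ⟨hVf, hVg⟩
    have key : ∀ W, W ∈ basicOpen (f * g) ↔ W ∈ basicOpen f ∧ W ∈ basicOpen g := by
      intro W
      obtain ⟨x, y, h⟩ := W.exists_space_eq_span
      rw [mem_basicOpen hf h, mem_basicOpen hg h, mem_basicOpen (hf.mul hg) h, map_mul,
        mul_ne_zero_iff]
    exact ⟨_, ⟨d + e, f * g, hf.mul hg, rfl⟩, (key V).2 ⟨hVf, hVg⟩, fun W hW => (key W).1 hW⟩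
  sUnion_eq := by
    rw [Set.eq_univ_iff_forall]
    intro V
    obtain ⟨x, y, h⟩ := V.exists_space_eq_span
    exact ⟨_, ⟨0, 1, isHomogeneous_one _ _, rfl⟩,
      (mem_basicOpen (isHomogeneous_one _ _) h).2 (by simp)⟩
  eq_generateFrom := rfl

/-- The zero set of a form in the Plücker coordinates is closed. -/
theorem isClosed_of_form {S : Set (Gr ℂ 4)} {f : MvPolynomial (PluckerIndex 4) ℂ} {d : ℕ}
    (hf : f.IsHomogeneous d)
    (h : ∀ (V : Gr ℂ 4) x y, V.space = span ℂ {x, y} →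
      (V ∈ S ↔ eval (pairPlucker x y) f = 0)) : IsClosed S := by
  rw [← isOpen_compl_iff]
  have : Sᶜ = basicOpen f := by
    ext V
    obtain ⟨x, y, hxy⟩ := V.exists_space_eq_span
    rw [Set.mem_compl_iff, mem_basicOpen hf hxy, h V x y hxy]
  rw [this]
  exact isTopologicalBasis_basicOpen.isOpen ⟨d, f, hf, rfl⟩

/-- The line segment joining two pairs of vectors. -/
theorem eval_segment (x y x' y' : Fin 4 → ℂ) (f : MvPolynomial (PluckerIndex 4) ℂ) :
    ∃ P : Polynomial ℂ, ∀ s : ℂ,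
      P.eval s = eval (pairPlucker (x + s • (x' - x)) (y + s • (y' - y))) f := by
  let l (a b : Fin 4 → ℂ) (i : Fin 4) : Polynomial ℂ :=
    Polynomial.C (a i) + Polynomial.X * Polynomial.C (b i - a i)
  refine ⟨aeval (fun p : PluckerIndex 4 =>
    l x x' p.1.1 * l y y' p.1.2 - l x x' p.1.2 * l y y' p.1.1) f, fun s => ?_⟩
  rw [← Polynomial.coe_aeval_eq_eval, comp_aeval_apply, ← aeval_eq_eval]
  congr 2
  ext p
  simp [l, pairPlucker]

/-- A set of lines any two of which are joined by a linear pencil of pairs of points inside the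
set is irreducible. -/
theorem isPreirreducible_of_segment {S : Set (Gr ℂ 4)}
    (h : ∀ V ∈ S, ∀ W ∈ S, ∃ x y x' y', V.space = span ℂ {x, y} ∧ W.space = span ℂ {x', y'} ∧
      ∀ (s : ℂ) (U : Gr ℂ 4), U.space = span ℂ {x + s • (x' - x), y + s • (y' - y)} → U ∈ S) :
    IsPreirreducible S := by
  rintro U₁ U₂ hU₁ hU₂ ⟨V, hVS, hV⟩ ⟨W, hWS, hW⟩
  obtain ⟨_, ⟨d, f, hf, rfl⟩, hVf, hfU⟩ := isTopologicalBasis_basicOpen.exists_subset_of_mem_open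
    hV hU₁
  obtain ⟨_, ⟨e, g, hg, rfl⟩, hWg, hgU⟩ := isTopologicalBasis_basicOpen.exists_subset_of_mem_open
    hW hU₂
  obtain ⟨x, y, x', y', hVs, hWs, hS⟩ := h V hVS W hWS
  obtain ⟨p, hp⟩ := exists_pairPlucker_ne_zero (V.pair_of_space_eq hVs)
  obtain ⟨P, hP⟩ := eval_segment x y x' y' f
  obtain ⟨Q, hQ⟩ := eval_segment x y x' y' g
  obtain ⟨R, hR⟩ := eval_segment x y x' y' (X p)
  rw [mem_basicOpen hf hVs] at hVf
  rw [mem_basicOpen hg hWs] at hWg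
  have hP0 : P ≠ 0 := by
    rintro rfl
    have := hP 0
    simp only [Polynomial.eval_zero, zero_smul, add_zero] at this
    exact hVf this.symm
  have hQ0 : Q ≠ 0 := by
    rintro rfl
    have := hQ 1
    simp only [Polynomial.eval_zero, one_smul, add_sub_cancel] at this
    exact hWg this.symm
  have hR0 : R ≠ 0 := by
    rintro rfl
    have := hR 0
    simp only [Polynomial.eval_zero, zero_smul, add_zero, eval_X] at this
    exact hp this.symm
  -- `P` is nonzero at `0`, `Q` at `1` and `R` at `0`. A parameter avoiding all their roots gives a
  -- point in both open sets; `R` is there to keep the two vectors independent, so that they still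
  -- span a line.
  obtain ⟨s, hs⟩ : ∃ s, (P * Q * R).eval s ≠ 0 := by
    by_contra! hs
    exact mul_ne_zero (mul_ne_zero hP0 hQ0) hR0 (Polynomial.funext fun s => by simp [hs s])
  rw [Polynomial.eval_mul, Polynomial.eval_mul, mul_ne_zero_iff, mul_ne_zero_iff, hP, hQ, hR,
    eval_X] at hs
  have hind := linearIndependent_of_pairPlucker_ne_zero hs.2
  have hsp := ofPair_space _ _ hind
  exact ⟨_, hS s _ hsp, hfU ((mem_basicOpen hf hsp).2 hs.1.1), hgU ((mem_basicOpen hg hsp).2 hs.1.2)⟩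

/-- The lines spanned by the pairs of a linear family. -/
def family (T : Submodule ℂ ((Fin 4 → ℂ) × (Fin 4 → ℂ))) : Set (Gr ℂ 4) :=
  {V | ∃ p ∈ T, V.space = span ℂ {p.1, p.2}}

theorem isPreirreducible_family (T : Submodule ℂ ((Fin 4 → ℂ) × (Fin 4 → ℂ))) :
    IsPreirreducible (family T) := by
  refine isPreirreducible_of_segment ?_
  rintro V ⟨p, hp, hV⟩ W ⟨q, hq, hW⟩
  refine ⟨p.1, p.2, q.1, q.2, hV, hW, fun s U hU => ⟨p + s • (q - p), ?_, hU⟩⟩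
  exact T.add_mem hp (T.smul_mem s (T.sub_mem hq hp))

theorem isIrreducible_univ : IsIrreducible (Set.univ : Set (Gr ℂ 4)) := by
  have h : family ⊤ = Set.univ := by
    rw [Set.eq_univ_iff_forall]
    intro V
    obtain ⟨x, y, h⟩ := V.exists_space_eq_span
    exact ⟨(x, y), trivial, h⟩
  refine ⟨?_, h ▸ isPreirreducible_family ⊤⟩
  refine ⟨ofPair (Pi.single 0 1) (Pi.single 1 1) ?_, trivial⟩
  exact linearIndependent_of_pairPlucker_ne_zero (p := ⟨(0, 1), by decide⟩)
    (by simp [pairPlucker])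

end Zariski

end Gr

/-! ### Irreducible components and Krull dimension -/

section Components

variable {T : Type} [TopologicalSpace T]

theorem maximal_of_mem_componentsIn {S C : Set T} (hC : C ∈ componentsIn S) :
    Maximal (fun D => IsIrreducible D ∧ D ⊆ S) C := hC

theorem componentsIn_of_isIrreducible {S : Set T} (hS : IsIrreducible S) :
    componentsIn S = {S} := by
  ext C
  refine ⟨fun hC => ?_, ?_⟩
  · replace hC := maximal_of_mem_componentsIn hC
    exact subset_antisymm hC.prop.2 (hC.le_of_ge ⟨hS, subset_rfl⟩ hC.prop.2)
  · rintro rfl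
    exact ⟨⟨hS, subset_rfl⟩, fun D hD _ => hD.2⟩

theorem mem_componentsIn_self {S : Set T} (hS : IsIrreducible S) : S ∈ componentsIn S := by
  rw [componentsIn_of_isIrreducible hS]
  rfl

theorem IsIrreducible.exists_subset_of_subset_iUnion {ι : Type*} [Finite ι] {D : Set T}
    (hD : IsIrreducible D) {F : ι → Set T} (hF : ∀ i, IsClosed (F i)) (h : D ⊆ ⋃ i, F i) :
    ∃ i, D ⊆ F i := by
  have := isIrreducible_iff_sUnion_isClosed.1 hD (Set.finite_range F).toFinset
    (by simpa using hF) (by simpa [Set.sUnion_range] using h)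
  simpa using this

/-- An irreducible subset of a finite union of closed sets lies in one of them, so only the `F i`
can be maximal. The hypothesis `hne` excludes proper inclusions but permits repetitions in the
family. -/
theorem mem_componentsIn_iUnion {ι : Type*} [Finite ι] {F : ι → Set T}
    (hF : ∀ i, IsClosed (F i)) (hirr : ∀ i, IsIrreducible (F i))
    (hne : ∀ i j, F i ⊆ F j → F i = F j) (C : Set T) :
    C ∈ componentsIn (⋃ i, F i) ↔ ∃ i, C = F i := by
  constructor
  · intro hC
    replace hC := maximal_of_mem_componentsIn hC
    obtain ⟨i, hi⟩ := hC.prop.1.exists_subset_of_subset_iUnion hF hC.prop.2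
    exact ⟨i, subset_antisymm hi (hC.le_of_ge ⟨hirr i, Set.subset_iUnion F i⟩ hi)⟩
  · rintro ⟨i, rfl⟩
    refine ⟨⟨hirr i, Set.subset_iUnion F i⟩, fun D hD hiD => ?_⟩
    obtain ⟨j, hj⟩ := hD.1.exists_subset_of_subset_iUnion hF hD.2
    exact hj.trans (hne i j (le_trans hiD hj)).ge

theorem mem_componentsIn_finite {S : Set T} (hS : S.Finite) (h1 : ∀ x ∈ S, IsClosed {x})
    (C : Set T) : C ∈ componentsIn S ↔ ∃ x ∈ S, C = {x} := by
  have := hS.to_subtype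
  have := mem_componentsIn_iUnion (F := fun x : S => ({x.1} : Set T)) (fun x => h1 x x.2)
    (fun x => isIrreducible_singleton) (by
      intro i j h
      rw [Set.singleton_subset_singleton.1 h]) C
  have hu : ⋃ x : S, ({x.1} : Set T) = S := by
    ext
    simp
  rw [hu] at this
  simpa using this

end Components

section Dimension

variable {X : Type} [TopologicalSpace X]

/-- A proper closed subset of an irreducible closed set has smaller dimension. -/
theorem length_add_one_le_topologicalKrullDim {S T : Set X} (hS : IsClosed S)
    (hirr : IsIrreducible T) (hlt : S ⊂ T) (p : LTSeries (TopologicalSpace.IrreducibleCloseds S)) :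
    ((p.length + 1 : ℕ) : WithBot ℕ∞) ≤ topologicalKrullDim T := by
  have hemb : Topology.IsClosedEmbedding (Set.inclusion hlt.1) :=
    .inclusion hlt.1 (hS.preimage continuous_subtype_val)
  let f : TopologicalSpace.IrreducibleCloseds S → TopologicalSpace.IrreducibleCloseds T :=
    fun C => ⟨Set.inclusion hlt.1 '' C,
      C.isIrreducible'.image _ hemb.continuous.continuousOn, hemb.isClosedMap _ C.isClosed'⟩
  have hf : StrictMono f := by
    intro C D hCD
    rw [← SetLike.coe_ssubset_coe] at hCD ⊢
    exact hemb.injective.image_strictMono hCD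
  have hT' : IsIrreducible (Set.univ : Set T) := by
    have := Subtype.irreducibleSpace hirr
    exact IrreducibleSpace.isIrreducible_univ T
  let top : TopologicalSpace.IrreducibleCloseds T := ⟨Set.univ, hT', isClosed_univ⟩
  obtain ⟨t, htT, htS⟩ := Set.exists_of_ssubset hlt
  have hlast : (p.map f hf).last < top := by
    rw [← SetLike.coe_ssubset_coe]
    refine ⟨Set.subset_univ _, fun h => ?_⟩
    obtain ⟨s, -, hs⟩ := h (Set.mem_univ (⟨t, htT⟩ : T))
    have h2 : (s : X) = t := congrArg Subtype.val hs
    exact htS (h2 ▸ s.2)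
  exact Order.LTSeries.length_le_krullDim ((p.map f hf).snoc top hlast)

theorem succ_le_topologicalKrullDim {S T : Set X} (hS : IsClosed S)
    (hirr : IsIrreducible T) (hlt : S ⊂ T) {d : ℕ} (h : (d : WithBot ℕ∞) ≤ topologicalKrullDim S) :
    ((d + 1 : ℕ) : WithBot ℕ∞) ≤ topologicalKrullDim T := by
  obtain ⟨p, rfl⟩ := Order.le_krullDim_iff.1 h
  exact length_add_one_le_topologicalKrullDim hS hirr hlt p

theorem topologicalKrullDim_le_of_ssubset {S T : Set X} (hS : IsClosed S)
    (hirr : IsIrreducible T) (hlt : S ⊂ T) {d : ℕ}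
    (h : topologicalKrullDim T ≤ ((d + 1 : ℕ) : WithBot ℕ∞)) :
    topologicalKrullDim S ≤ (d : WithBot ℕ∞) := by
  refine iSup_le fun p => ?_
  have := (length_add_one_le_topologicalKrullDim hS hirr hlt p).trans h
  have h2 : p.length + 1 ≤ d + 1 := by exact_mod_cast this
  have h3 : p.length ≤ d := by omega
  exact_mod_cast h3

theorem topologicalKrullDim_of_finite {S : Set X} (hS : S.Finite) (hne : S.Nonempty)
    (h1 : ∀ x ∈ S, IsClosed {x}) : topologicalKrullDim S = 0 := by
  have := hS.to_subtype
  obtain ⟨x, hx⟩ := hne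
  have : T1Space S := ⟨fun x => by
    have : ({x} : Set S) = Subtype.val ⁻¹' {x.1} := by
      ext
      simp [Subtype.ext_iff]
    rw [this]
    exact (h1 x x.2).preimage continuous_subtype_val⟩
  have : DiscreteTopology S := inferInstance
  refine le_antisymm (topologicalKrullDim_zero_of_discreteTopology S) ?_
  have : Nonempty (TopologicalSpace.IrreducibleCloseds S) :=
    ⟨⟨{⟨x, hx⟩}, isIrreducible_singleton, isClosed_singleton⟩⟩
  exact Order.krullDim_nonneg

end Dimension

/-- Serves to extend a chain of cone ideals by the zero ideal below and the irrelevant ideal above.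
-/
theorem LTSeries.length_add_two_le_krullDim {α : Type*} [Preorder α] (q : LTSeries α) {b m : α}
    (hb : b < q.head) (hm : q.last < m) : ((q.length + 2 : ℕ) : WithBot ℕ∞) ≤ Order.krullDim α := by
  have hb' : b < (q.snoc m hm).head := by
    rw [RelSeries.head_snoc]
    exact hb
  have h := Order.LTSeries.length_le_krullDim ((q.snoc m hm).cons b hb')
  have hl : ((q.snoc m hm).cons b hb').length = q.length + 2 := by
    simp
  rwa [hl] at h

/-! ### The dimension of the Grassmannian -/

namespace Gr

open MvPolynomial

/-- The ideal of polynomials that vanish on the cone over a set of lines. -/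
def coneIdeal (C : Set (Gr ℂ 4)) : Ideal (MvPolynomial (PluckerIndex 4) ℂ) where
  carrier := {f | ∀ x y (V : Gr ℂ 4), V ∈ C → V.space = span ℂ {x, y} →
    eval (pairPlucker x y) f = 0}
  zero_mem' := by
    intro x y V _ _
    simp
  add_mem' := by
    intro f g hf hg x y V hV h
    rw [map_add, hf x y V hV h, hg x y V hV h, add_zero]
  smul_mem' := by
    intro c f hf x y V hV h
    rw [smul_eq_mul, map_mul, hf x y V hV h, mul_zero]

theorem mem_coneIdeal {C : Set (Gr ℂ 4)} {f : MvPolynomial (PluckerIndex 4) ℂ} :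
    f ∈ coneIdeal C ↔ ∀ x y (V : Gr ℂ 4), V ∈ C → V.space = span ℂ {x, y} →
      eval (pairPlucker x y) f = 0 := Iff.rfl

theorem span_smul_left {x y : Fin 4 → ℂ} {c : ℂ} (hc : c ≠ 0) :
    span ℂ {c • x, y} = span ℂ {x, y} := by
  rw [span_insert, span_insert, span_singleton_smul_eq hc.isUnit]

/-- The restriction of a polynomial to a line through the origin. -/
theorem exists_ray (f : MvPolynomial (PluckerIndex 4) ℂ) (p : PluckerIndex 4 → ℂ) :
    ∃ P : Polynomial ℂ, (∀ s : ℂ, P.eval s = eval (s • p) f) ∧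
      ∀ d, P.coeff d = eval p (homogeneousComponent d f) := by
  refine ⟨∑ d ∈ Finset.range (f.totalDegree + 1),
    Polynomial.monomial d (eval p (homogeneousComponent d f)), fun s => ?_, fun d => ?_⟩
  · conv_rhs => rw [← sum_homogeneousComponent f]
    rw [Polynomial.eval_finsetSum, map_sum]
    refine Finset.sum_congr rfl fun d _ => ?_
    rw [Polynomial.eval_monomial,
      eval_smul_of_isHomogeneous (homogeneousComponent_isHomogeneous d f), mul_comm]
  · rw [Polynomial.finsetSum_coeff]
    simp only [Polynomial.coeff_monomial]
    rw [Finset.sum_ite_eq' (Finset.range (f.totalDegree + 1)) d]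
    split_ifs with h
    · rfl
    · rw [homogeneousComponent_eq_zero, map_zero]
      simpa using h

/-- The cone is stable under scaling, so the restriction of `f` to a ray vanishes away from the
origin and is the zero polynomial; its coefficients are the values of the homogeneous components. -/
theorem homogeneousComponent_mem_coneIdeal {C : Set (Gr ℂ 4)}
    {f : MvPolynomial (PluckerIndex 4) ℂ} (hf : f ∈ coneIdeal C) (d : ℕ) :
    homogeneousComponent d f ∈ coneIdeal C := by
  intro x y V hV h
  obtain ⟨P, hP, hPd⟩ := exists_ray f (pairPlucker x y)
  have hP0 : P = 0 := by
    refine Polynomial.eq_zero_of_infinite_isRoot P (Set.Infinite.mono (s := {0}ᶜ) ?_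
      (Set.finite_singleton _).infinite_compl)
    intro s hs
    rw [Set.mem_ofPred_eq, Polynomial.IsRoot.def, hP, ← pairPlucker_smul_left]
    exact hf _ _ V hV (by rw [span_smul_left hs, h])
  rw [← hPd, hP0, Polynomial.coeff_zero]

/-- If neither factor vanishes on the cone, irreducibility yields one line over which both factors
are not identically zero on the ray, while their product is. -/
theorem coneIdeal_isPrime {C : Set (Gr ℂ 4)} (hC : IsIrreducible C) : (coneIdeal C).IsPrime := by
  refine Ideal.isPrime_iff.2 ⟨?_, ?_⟩
  · obtain ⟨V, hV⟩ := hC.nonempty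
    obtain ⟨x, y, h⟩ := V.exists_space_eq_span
    rw [Ne, Ideal.eq_top_iff_one]
    intro h1
    simpa using h1 x y V hV h
  · intro f g hfg
    by_contra! hne
    simp only [mem_coneIdeal, not_forall] at hne
    obtain ⟨⟨x, y, V, hV, hVs, hf⟩, ⟨x', y', W, hW, hWs, hg⟩⟩ := hne
    -- Only forms define open sets of lines, so `f` and `g` are replaced by homogeneous components
    -- that do not vanish at the given points.
    have hom : ∀ f : MvPolynomial (PluckerIndex 4) ℂ, ∀ p, eval p f ≠ 0 →
        ∃ d, eval p (homogeneousComponent d f) ≠ 0 := by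
      intro f p h
      by_contra! h0
      refine h ?_
      conv_lhs => rw [← sum_homogeneousComponent f]
      rw [map_sum]
      exact Finset.sum_eq_zero fun d _ => h0 d
    obtain ⟨d, hd⟩ := hom f _ hf
    obtain ⟨e, he⟩ := hom g _ hg
    have hfd := homogeneousComponent_isHomogeneous d f
    have hge := homogeneousComponent_isHomogeneous e g
    obtain ⟨U, hUC, hU1, hU2⟩ := hC.2 _ _
      (isTopologicalBasis_basicOpen.isOpen ⟨d, _, hfd, rfl⟩)
      (isTopologicalBasis_basicOpen.isOpen ⟨e, _, hge, rfl⟩)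
      ⟨V, hV, (mem_basicOpen hfd hVs).2 hd⟩ ⟨W, hW, (mem_basicOpen hge hWs).2 he⟩
    obtain ⟨a, b, hU⟩ := U.exists_space_eq_span
    rw [mem_basicOpen hfd hU] at hU1
    rw [mem_basicOpen hge hU] at hU2
    obtain ⟨P, hP, hPd⟩ := exists_ray f (pairPlucker a b)
    obtain ⟨Q, hQ, hQd⟩ := exists_ray g (pairPlucker a b)
    have hP0 : P ≠ 0 := by
      rintro rfl
      exact hU1 (by rw [← hPd, Polynomial.coeff_zero])
    have hQ0 : Q ≠ 0 := by
      rintro rfl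
      exact hU2 (by rw [← hQd, Polynomial.coeff_zero])
    refine mul_ne_zero hP0 hQ0 (Polynomial.eq_zero_of_infinite_isRoot _ (Set.Infinite.mono
      (s := {0}ᶜ) ?_ (Set.finite_singleton _).infinite_compl))
    intro s hs
    rw [Set.mem_ofPred_eq, Polynomial.IsRoot.def, Polynomial.eval_mul, hP, hQ,
      ← pairPlucker_smul_left, ← map_mul]
    exact hfg _ _ U hUC (by rw [span_smul_left hs, hU])

theorem coneIdeal_lt {C D : Set (Gr ℂ 4)} (hC : IsClosed C) (h : C ⊂ D) :
    coneIdeal D < coneIdeal C := by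
  refine lt_of_le_of_ne (fun f hf x y V hV => hf x y V (h.1 hV)) fun he => ?_
  obtain ⟨V, hVD, hVC⟩ := Set.exists_of_ssubset h
  obtain ⟨_, ⟨d, f, hf, rfl⟩, hVf, hfC⟩ := isTopologicalBasis_basicOpen.exists_subset_of_mem_open
    (a := V) hVC hC.isOpen_compl
  obtain ⟨x, y, hV⟩ := V.exists_space_eq_span
  rw [mem_basicOpen hf hV] at hVf
  have hfC' : f ∈ coneIdeal C := by
    intro a b W hW hWs
    by_contra h0
    exact hfC ((mem_basicOpen hf hWs).2 h0) hW
  rw [← he] at hfC'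
  exact hVf (hfC' x y V hVD hV)

/-- A chain of irreducible closed sets gives a chain of prime ideals in a polynomial ring in six
variables. All of them lie strictly above zero, because of the Plücker relation, and strictly below
the irrelevant ideal; this leaves length at most `6 - 2`. -/
theorem topologicalKrullDim_le : topologicalKrullDim (Gr ℂ 4) ≤ (4 : ℕ) := by
  refine iSup_le fun p => ?_
  let R := MvPolynomial (PluckerIndex 4) ℂ
  let I : TopologicalSpace.IrreducibleCloseds (Gr ℂ 4) → PrimeSpectrum R :=
    fun C => ⟨coneIdeal C, coneIdeal_isPrime C.isIrreducible'⟩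
  -- Cone ideals reverse inclusions, hence `Fin.rev`.
  let q : LTSeries (PrimeSpectrum R) := LTSeries.mk p.length (fun i => I (p i.rev))
    (fun i j hij => coneIdeal_lt (p j.rev).isClosed'
      (SetLike.coe_ssubset_coe.2 (p.strictMono (Fin.rev_lt_rev.2 hij))))
  let m : PrimeSpectrum R := ⟨RingHom.ker (eval (0 : PluckerIndex 4 → ℂ)), RingHom.ker_isPrime _⟩
  let b : PrimeSpectrum R := ⟨⊥, Ideal.isPrime_bot⟩
  have hpq : ∀ C : TopologicalSpace.IrreducibleCloseds (Gr ℂ 4), I C < m := by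
    intro C
    obtain ⟨V, hV⟩ := C.isIrreducible'.nonempty
    obtain ⟨x, y, h⟩ := V.exists_space_eq_span
    refine lt_of_le_of_ne (fun f hf => ?_) fun he => ?_
    · have := homogeneousComponent_mem_coneIdeal hf 0 x y V hV h
      rw [homogeneousComponent_zero, eval_C] at this
      rw [RingHom.mem_ker, eval_zero, constantCoeff_eq, this]
    · obtain ⟨k, hk⟩ := exists_pairPlucker_ne_zero (V.pair_of_space_eq h)
      have : (X k : R) ∈ m.asIdeal := by
        rw [RingHom.mem_ker, eval_X]
        rfl
      rw [← he] at this
      exact hk (by simpa using this x y V hV h)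
  have h0q : ∀ C : TopologicalSpace.IrreducibleCloseds (Gr ℂ 4), b < I C := by
    intro C
    refine lt_of_le_of_ne bot_le fun he => ?_
    let r (i j : Fin 4) (h : i < j) : R := X ⟨(i, j), h⟩
    have hmem : r 0 1 (by decide) * r 2 3 (by decide) - r 0 2 (by decide) * r 1 3 (by decide) +
        r 0 3 (by decide) * r 1 2 (by decide) ∈ (I C).asIdeal := by
      intro x y V _ _
      simp only [r, map_add, map_sub, map_mul, eval_X, pairPlucker]
      ring
    rw [← he] at hmem
    -- At the point with coordinates `01` and `23` equal to one and all others zero the Plücker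
    -- relation has the value one, so it is not the zero polynomial.
    have := congrArg (eval fun p : PluckerIndex 4 =>
      if p.1 = (0, 1) ∨ p.1 = (2, 3) then (1 : ℂ) else 0) ((Submodule.mem_bot _).1 hmem)
    simp [r] at this
  have hlen : ((p.length + 2 : ℕ) : WithBot ℕ∞) ≤ ringKrullDim R :=
    q.length_add_two_le_krullDim (h0q _) (hpq _)
  rw [MvPolynomial.ringKrullDim_of_isNoetherianRing, ringKrullDim_eq_zero_of_field, zero_add,
    Nat.card_eq_fintype_card] at hlen
  have h6 : p.length + 2 ≤ Fintype.card (PluckerIndex 4) := by exact_mod_cast hlen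
  have hc : Fintype.card (PluckerIndex 4) = 6 := rfl
  have h4 : p.length ≤ 4 := by omega
  exact_mod_cast h4

end Gr

/-! ### Brackets of four vectors -/

section Bracket

variable {K : Type} [Field K]

/-- The determinant of four vectors. -/
def br (a b c d : Fin 4 → K) : K := (Matrix.of ![a, b, c, d]).det

theorem br_apply (a b c d : Fin 4 → K) : br a b c d =
    (a 0 * b 1 - a 1 * b 0) * (c 2 * d 3 - c 3 * d 2) -
    (a 0 * b 2 - a 2 * b 0) * (c 1 * d 3 - c 3 * d 1) +
    (a 0 * b 3 - a 3 * b 0) * (c 1 * d 2 - c 2 * d 1) +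
    (a 1 * b 2 - a 2 * b 1) * (c 0 * d 3 - c 3 * d 0) -
    (a 1 * b 3 - a 3 * b 1) * (c 0 * d 2 - c 2 * d 0) +
    (a 2 * b 3 - a 3 * b 2) * (c 0 * d 1 - c 1 * d 0) := by
  simp only [br, Matrix.det_succ_row_zero, Fin.sum_univ_succ]
  simp [Fin.succAbove]
  ring

theorem br_add_smul_left (x y b c d : Fin 4 → K) (s t : K) :
    br (s • x + t • y) b c d = s * br x b c d + t * br y b c d := by
  simp only [br_apply, Pi.add_apply, Pi.smul_apply, smul_eq_mul]
  ring

theorem br_swap₁₂ (a b c d : Fin 4 → K) : br b a c d = -br a b c d := by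
  simp only [br_apply]
  ring

theorem br_swap₂₃ (a b c d : Fin 4 → K) : br a c b d = -br a b c d := by
  simp only [br_apply]
  ring

theorem br_swap₃₄ (a b c d : Fin 4 → K) : br a b d c = -br a b c d := by
  simp only [br_apply]
  ring

theorem br_rotate (a b c d : Fin 4 → K) : br b c d a = -br a b c d := by
  simp only [br_apply]
  ring

theorem br_swap_pairs (a b c d : Fin 4 → K) : br c d a b = br a b c d := by
  simp only [br_apply]
  ring

/-- Cramer's rule for five vectors in four-space. -/
theorem br_cramer (a b c d e : Fin 4 → K) :
    br b c d e • a - br a c d e • b + br a b d e • c - br a b c e • d + br a b c d • e = 0 := by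
  ext k
  simp only [br_apply, Pi.add_apply, Pi.sub_apply, Pi.smul_apply, smul_eq_mul, Pi.zero_apply]
  fin_cases k <;> simp only [Fin.zero_eta, Fin.mk_one, Fin.reduceFinMk] <;> ring

theorem linearIndependent_of_br_ne_zero {a b c d : Fin 4 → K} (h : br a b c d ≠ 0) :
    LinearIndependent K ![a, b, c, d] := by
  rw [br] at h
  have hu : IsUnit (Matrix.of ![a, b, c, d]) :=
    (Matrix.isUnit_iff_isUnit_det _).2 (isUnit_iff_ne_zero.2 h)
  exact Matrix.linearIndependent_rows_of_isUnit hu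

/-- Bracketing the relation with three of the four vectors leaves a single coefficient times the
bracket. -/
theorem coeff_eq_zero_of_br_ne_zero {a b c d : Fin 4 → K} (h : br a b c d ≠ 0) {α β γ δ : K}
    (h0 : α • a + β • b + γ • c + δ • d = 0) : α = 0 ∧ β = 0 ∧ γ = 0 ∧ δ = 0 := by
  have e (p q r : Fin 4 → K) : br (α • a + β • b + γ • c + δ • d) p q r = 0 := by
    rw [h0]
    simp only [br_apply, Pi.zero_apply]
    ring
  have e1 : α * br a b c d = 0 := by
    rw [← e b c d]
    simp only [br_apply, Pi.add_apply, Pi.smul_apply, smul_eq_mul]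
    ring
  have e2 : β * br a b c d = 0 := by
    rw [← neg_eq_zero, ← e a c d]
    simp only [br_apply, Pi.add_apply, Pi.smul_apply, smul_eq_mul]
    ring
  have e3 : γ * br a b c d = 0 := by
    rw [← e a b d]
    simp only [br_apply, Pi.add_apply, Pi.smul_apply, smul_eq_mul]
    ring
  have e4 : δ * br a b c d = 0 := by
    rw [← neg_eq_zero, ← e a b c]
    simp only [br_apply, Pi.add_apply, Pi.smul_apply, smul_eq_mul]
    ring
  exact ⟨(mul_eq_zero.1 e1).resolve_right h, (mul_eq_zero.1 e2).resolve_right h,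
    (mul_eq_zero.1 e3).resolve_right h, (mul_eq_zero.1 e4).resolve_right h⟩

/-- With coordinate vectors in the last two places the bracket becomes, up to sign, the
complementary Plücker coordinate of `u` and `v`. -/
theorem exists_br_ne_zero {u v : Fin 4 → K} (h : LinearIndependent K ![u, v]) :
    ∃ c d, br u v c d ≠ 0 := by
  by_contra! h0
  obtain ⟨p, hp⟩ := Gr.exists_pairPlucker_ne_zero h
  have e (k l : Fin 4) := h0 (Pi.single k 1) (Pi.single l 1)
  have e01 := e 2 3
  have e02 := e 1 3
  have e03 := e 1 2
  have e12 := e 0 3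
  have e13 := e 0 2
  have e23 := e 0 1
  simp [br_apply] at e01 e02 e03 e12 e13 e23
  obtain ⟨⟨i, j⟩, hij⟩ := p
  simp only [Gr.pairPlucker] at hp
  fin_cases i <;> fin_cases j <;> first | exact absurd hij (by decide) | (refine hp ?_; simp only [Fin.zero_eta, Fin.mk_one, Fin.reduceFinMk]; grind)

/-- Four vectors with vanishing bracket are dependent. -/
theorem exists_coeff_of_br_eq_zero {a b c d : Fin 4 → K} (h : br a b c d = 0) :
    ∃ α β γ δ : K, α • a + β • b + γ • c + δ • d = 0 ∧
      ¬ (α = 0 ∧ β = 0 ∧ γ = 0 ∧ δ = 0) := by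
  obtain ⟨w, hw, h0⟩ := Matrix.exists_vecMul_eq_zero_iff.2 h
  refine ⟨w 0, w 1, w 2, w 3, ?_, fun hz => hw ?_⟩
  · rw [← h0]
    ext k
    simp [Matrix.vecMul, dotProduct, Fin.sum_univ_succ, add_assoc]
  · ext i
    fin_cases i
    exacts [hz.1, hz.2.1, hz.2.2.1, hz.2.2.2]

end Bracket

/-! ### Closedness of the incidence conditions. -/

namespace Gr

open MvPolynomial

/-- The lines meeting the line `ab`. -/
def incident (a b : Fin 4 → ℂ) : Set (Gr ℂ 4) :=
  {V | ∀ x ∈ V.space, ∀ y ∈ V.space, br x y a b = 0}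

theorem mem_incident_iff {a b x y : Fin 4 → ℂ} {V : Gr ℂ 4} (h : V.space = span ℂ {x, y}) :
    V ∈ incident a b ↔ br x y a b = 0 := by
  constructor
  · intro hV
    exact hV x (h ▸ subset_span (by simp)) y (h ▸ subset_span (by simp))
  · intro h0 u hu v hv
    rw [h] at hu hv
    obtain ⟨s, t, rfl⟩ := mem_span_pair.1 hu
    obtain ⟨s', t', rfl⟩ := mem_span_pair.1 hv
    have : br (s • x + t • y) (s' • x + t' • y) a b = (s * t' - t * s') * br x y a b := by
      simp only [br_apply, Pi.add_apply, Pi.smul_apply, smul_eq_mul]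
      ring
    rw [this, h0, mul_zero]

/-- The bracket is a linear form in the Plücker coordinates of the line. -/
theorem isClosed_incident (a b : Fin 4 → ℂ) : IsClosed (incident a b) := by
  let t (i j : Fin 4) (h : i < j) (k l : Fin 4) : MvPolynomial (PluckerIndex 4) ℂ :=
    C (a k * b l - a l * b k) * X ⟨(i, j), h⟩
  have ht : ∀ i j h k l, (t i j h k l).IsHomogeneous 1 := fun i j h k l =>
    isHomogeneous_C_mul_X _ _
  refine isClosed_of_form (d := 1) (f := t 0 1 (by decide) 2 3 - t 0 2 (by decide) 1 3 +
    t 0 3 (by decide) 1 2 + t 1 2 (by decide) 0 3 - t 1 3 (by decide) 0 2 +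
    t 2 3 (by decide) 0 1) ?_ ?_
  · exact ((((((ht _ _ _ _ _).sub (ht _ _ _ _ _)).add (ht _ _ _ _ _)).add
      (ht _ _ _ _ _)).sub (ht _ _ _ _ _)).add (ht _ _ _ _ _))
  · intro V x y h
    rw [mem_incident_iff h]
    simp only [t, map_add, map_sub, map_mul, eval_C, eval_X, pairPlucker, br_apply]
    refine Eq.congr ?_ rfl
    ring

/-- A linear relation among the four spanning vectors is the same as a common vector of the two
planes they span in pairs; independence within each pair makes a nontrivial relation correspond to a
nonzero vector. -/
theorem mem_incident_iff_inf_ne_bot {a b : Fin 4 → ℂ} (hab : LinearIndependent ℂ ![a, b])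
    {V : Gr ℂ 4} : V ∈ incident a b ↔ V.space ⊓ span ℂ {a, b} ≠ ⊥ := by
  obtain ⟨x, y, h⟩ := V.exists_space_eq_span
  rw [mem_incident_iff h, Submodule.ne_bot_iff]
  have hxy := LinearIndependent.pair_iff.1 (V.pair_of_space_eq h)
  have hab' := LinearIndependent.pair_iff.1 hab
  constructor
  · intro h0
    obtain ⟨α, β, γ, δ, hz, hne⟩ := exists_coeff_of_br_eq_zero h0
    refine ⟨α • x + β • y, ⟨h ▸ mem_span_pair.2 ⟨α, β, rfl⟩, mem_span_pair.2 ⟨-γ, -δ, ?_⟩⟩, ?_⟩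
    · rw [← sub_eq_zero, ← neg_eq_zero, ← hz]
      module
    · intro hv
      have h1 := hxy α β hv
      rw [hv, zero_add] at hz
      have h2 := hab' γ δ hz
      exact hne ⟨h1.1, h1.2, h2.1, h2.2⟩
  · rintro ⟨v, ⟨hv1, hv2⟩, hv0⟩
    rw [SetLike.mem_coe, h] at hv1
    obtain ⟨α, β, rfl⟩ := mem_span_pair.1 hv1
    obtain ⟨γ, δ, hv⟩ := mem_span_pair.1 hv2
    by_contra hbr
    have := coeff_eq_zero_of_br_ne_zero hbr (α := α) (β := β) (γ := -γ) (δ := -δ) (by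
      rw [← sub_eq_zero] at hv
      rw [← neg_eq_zero, ← hv]
      module)
    exact hv0 (by simp [this.1, this.2.1])

/-- The lines through a point form a closed set. -/
theorem isClosed_setOf_mem (x : Fin 4 → ℂ) : IsClosed {V : Gr ℂ 4 | x ∈ V.space} := by
  -- A line passes through `x` exactly when it meets every line through `x`. For dependent `x` and
  -- `b` the condition is empty and does no harm.
  have : {V : Gr ℂ 4 | x ∈ V.space} = ⋂ b, incident x b := by
    ext V
    obtain ⟨u, v, h⟩ := V.exists_space_eq_span
    rw [Set.mem_iInter, Set.mem_ofPred_eq]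
    simp only [mem_incident_iff h]
    constructor
    · intro hx b
      rw [h] at hx
      obtain ⟨s, t, rfl⟩ := mem_span_pair.1 hx
      simp only [br_apply, Pi.add_apply, Pi.smul_apply, smul_eq_mul]
      ring
    · intro h0
      obtain ⟨c, d, hcd⟩ := exists_br_ne_zero (V.pair_of_space_eq h)
      -- Since all brackets `⟨x u v ·⟩` vanish, Cramer's rule expresses `x` through `u` and `v`
      -- alone.
      have hc := br_cramer x u v c d
      have h1 : br x u v d = 0 := by
        have := h0 d
        rw [br_swap₂₃, br_swap₁₂] at this
        simpa using this
      have h2 : br x u v c = 0 := by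
        have := h0 c
        rw [br_swap₂₃, br_swap₁₂] at this
        simpa using this
      rw [h1, h2, zero_smul, zero_smul, sub_zero, add_zero] at hc
      rw [h, mem_span_pair]
      refine ⟨(br u v c d)⁻¹ * br x v c d, -(br u v c d)⁻¹ * br x u c d, ?_⟩
      have : br u v c d • x = br x v c d • u - br x u c d • v := by
        rw [← sub_eq_zero, ← hc]
        module
      have hx := inv_smul_smul₀ hcd x
      rw [this] at hx
      conv_rhs => rw [← hx]
      module
  rw [this]
  exact isClosed_iInter fun b => isClosed_incident x b

theorem isClosed_singleton (V : Gr ℂ 4) : IsClosed {V} := by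
  obtain ⟨x, y, h⟩ := V.exists_space_eq_span
  have : {V} = {W : Gr ℂ 4 | x ∈ W.space} ∩ {W : Gr ℂ 4 | y ∈ W.space} := by
    ext W
    constructor
    · rintro rfl
      rw [Set.mem_inter_iff, Set.mem_ofPred_eq, Set.mem_ofPred_eq, h]
      exact ⟨subset_span (by simp), subset_span (by simp)⟩
    · rintro ⟨hx, hy⟩
      exact (eq_of_space_le (by
        rw [h, span_le]
        rintro _ (rfl | rfl)
        exacts [hx, hy])).symm
  rw [this]
  exact (isClosed_setOf_mem x).inter (isClosed_setOf_mem y)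

/-- A line and a subspace of complementary-plus-one dimension inside `P` meet. -/
theorem inf_ne_bot {V : Gr ℂ 4} {W P : Submodule ℂ (Fin 4 → ℂ)} (hV : V.space ≤ P) (hW : W ≤ P)
    (h : Module.finrank ℂ P < Module.finrank ℂ W + 2) : V.space ⊓ W ≠ ⊥ := by
  intro h0
  have h1 := Submodule.finrank_sup_add_finrank_inf_eq V.space W
  have h2 := Submodule.finrank_mono (sup_le hV hW)
  rw [h0, finrank_bot, V.finrank_space] at h1
  omega

/-- The lines in a plane form a closed set. -/
theorem isClosed_setOf_le {a b c : Fin 4 → ℂ} (h : LinearIndependent ℂ ![a, b, c]) :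
    IsClosed {V : Gr ℂ 4 | V.space ≤ span ℂ {a, b, c}} := by
  have hfin : Module.finrank ℂ (span ℂ {a, b, c}) = 3 := by
    have := finrank_span_eq_card h
    rwa [Matrix.range_cons, Matrix.range_cons, Matrix.range_cons, Matrix.range_empty,
      Set.union_empty, Set.singleton_union, Set.singleton_union, Fintype.card_fin] at this
  have hrel : ∀ {α β γ : ℂ}, α • a + β • b + γ • c = 0 → α = 0 ∧ β = 0 ∧ γ = 0 := by
    intro α β γ h0
    have := Fintype.linearIndependent_iff.1 h ![α, β, γ]
      (by simpa [Fin.sum_univ_succ, add_assoc] using h0)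
    exact ⟨this 0, this 1, this 2⟩
  have hab : LinearIndependent ℂ ![a, b] := LinearIndependent.pair_iff.2 fun s t h => by
    have := hrel (α := s) (β := t) (γ := 0) (by simpa using h)
    exact ⟨this.1, this.2.1⟩
  have hbc : LinearIndependent ℂ ![b, c] := LinearIndependent.pair_iff.2 fun s t h => by
    have := hrel (α := 0) (β := s) (γ := t) (by simpa using h)
    exact ⟨this.2.1, this.2.2⟩
  have hac : LinearIndependent ℂ ![a, c] := LinearIndependent.pair_iff.2 fun s t h => by
    have := hrel (α := s) (β := 0) (γ := t) (by simpa using h)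
    exact ⟨this.1, this.2.2⟩
  have hdim : ∀ {x y : Fin 4 → ℂ}, LinearIndependent ℂ ![x, y] →
      Module.finrank ℂ (span ℂ {x, y}) = 2 := fun hxy => by
    rw [← ofPair_space _ _ hxy, finrank_space]
  -- A line lies in the plane exactly when it meets the three sides of the triangle. The sides have
  -- no common point, so two of the meeting points differ, and these span the line.
  have : {V : Gr ℂ 4 | V.space ≤ span ℂ {a, b, c}} =
      incident a b ∩ incident b c ∩ incident a c := by
    ext V
    rw [Set.mem_inter_iff, Set.mem_inter_iff, mem_incident_iff_inf_ne_bot hab,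
      mem_incident_iff_inf_ne_bot hbc, mem_incident_iff_inf_ne_bot hac]
    constructor
    · intro hV
      refine ⟨⟨inf_ne_bot hV (span_mono ?_) ?_, inf_ne_bot hV (span_mono ?_) ?_⟩,
        inf_ne_bot hV (span_mono ?_) ?_⟩
      all_goals first
        | rw [hfin, hdim (by assumption)]; norm_num
        | (rintro _ (rfl | rfl) <;> simp)
    · rintro ⟨⟨h1, h2⟩, h3⟩
      obtain ⟨u, ⟨hu, hu'⟩, hu0⟩ := (Submodule.ne_bot_iff _).1 h1
      obtain ⟨v, ⟨hv, hv'⟩, hv0⟩ := (Submodule.ne_bot_iff _).1 h2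
      obtain ⟨w, ⟨hw, hw'⟩, hw0⟩ := (Submodule.ne_bot_iff _).1 h3
      obtain ⟨α, β, rfl⟩ := mem_span_pair.1 hu'
      obtain ⟨γ, δ, rfl⟩ := mem_span_pair.1 hv'
      obtain ⟨ε, ζ, rfl⟩ := mem_span_pair.1 hw'
      have mem : ∀ r s t : ℂ, r • a + s • b + t • c ∈ span ℂ {a, b, c} := fun r s t =>
        mem_span_triple.2 ⟨r, s, t, rfl⟩
      have key : ∀ x y, x ∈ V.space → y ∈ V.space → x ∈ span ℂ {a, b, c} →
          y ∈ span ℂ {a, b, c} → x ≠ 0 → (∀ k : ℂ, k • x ≠ y) → V.space ≤ span ℂ {a, b, c} := by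
        intro x y hx hy hx' hy' h0 hk
        rw [V.space_eq_of_mem hx hy ((LinearIndependent.pair_iff' h0).2 hk), span_le]
        rintro _ (rfl | rfl)
        exacts [hx', hy']
      have m1 : α • a + β • b ∈ span ℂ {a, b, c} := by simpa using mem α β 0
      have m2 : γ • b + δ • c ∈ span ℂ {a, b, c} := by simpa using mem 0 γ δ
      have m3 : ε • a + ζ • c ∈ span ℂ {a, b, c} := by simpa using mem ε 0 ζ
      by_cases hk : ∃ k : ℂ, k • (α • a + β • b) = γ • b + δ • c
      · by_cases hl : ∃ k : ℂ, k • (α • a + β • b) = ε • a + ζ • c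
        · exfalso
          obtain ⟨k, hk⟩ := hk
          obtain ⟨l, hl⟩ := hl
          have e1 := hrel (α := k * α) (β := k * β - γ) (γ := -δ) (by
            rw [← sub_eq_zero] at hk
            rw [← hk]
            module)
          have e2 := hrel (α := l * α - ε) (β := l * β) (γ := -ζ) (by
            rw [← sub_eq_zero] at hl
            rw [← hl]
            module)
          obtain ⟨e1, e1', e1''⟩ := e1
          obtain ⟨e2, e2', e2''⟩ := e2
          have hk0 : k ≠ 0 := by
            rintro rfl
            rw [zero_smul] at hk
            exact hv0 hk.symm
          have hl0 : l ≠ 0 := by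
            rintro rfl
            rw [zero_smul] at hl
            exact hw0 hl.symm
          have hα : α = 0 := by simpa [hk0] using e1
          have hβ : β = 0 := by simpa [hl0] using e2'
          exact hu0 (by simp [hα, hβ])
        · push Not at hl
          exact key _ _ hu hw m1 m3 hu0 hl
      · push Not at hk
        exact key _ _ hu hv m1 m2 hu0 hk
  rw [this]
  exact ((isClosed_incident _ _).inter (isClosed_incident _ _)).inter (isClosed_incident _ _)

theorem isPreirreducible_of_prod {S : Set (Gr ℂ 4)} (W₁ W₂ : Submodule ℂ (Fin 4 → ℂ))
    (h : ∀ V ∈ S, ∃ x ∈ W₁, ∃ y ∈ W₂, V.space = span ℂ {x, y})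
    (h' : ∀ x ∈ W₁, ∀ y ∈ W₂, ∀ V : Gr ℂ 4, V.space = span ℂ {x, y} → V ∈ S) :
    IsPreirreducible S := by
  have : S = family (W₁.prod W₂) := by
    ext V
    constructor
    · intro hV
      obtain ⟨x, hx, y, hy, e⟩ := h V hV
      exact ⟨(x, y), ⟨hx, hy⟩, e⟩
    · rintro ⟨p, hp, e⟩
      exact h' p.1 hp.1 p.2 hp.2 V e
  rw [this]
  exact isPreirreducible_family _

end Gr

/-! ### Cyclic indices -/

section Cyclic

variable {n : ℕ} [NeZero n]

/-- Cyclic successors in a form accessible to `omega`: either an ordinary successor or the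
wrap-around to zero. Statements about positions of vertices and edges on the cycle are reduced to
this. -/
theorem val_add_one_cases (hn : 2 ≤ n) (i : Fin n) :
    ((i + 1).val = i.val + 1 ∧ i.val + 1 < n) ∨ ((i + 1).val = 0 ∧ i.val + 1 = n) := by
  have h1 : (1 : Fin n).val = 1 := by rw [Fin.val_one', Nat.mod_eq_of_lt (by omega)]
  rw [Fin.val_add, h1]
  have := i.isLt
  rcases Nat.lt_or_ge (i.val + 1) n with h | h
  · left
    rw [Nat.mod_eq_of_lt h]
    omega
  · right
    have : i.val + 1 = n := by omega
    rw [this, Nat.mod_self]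
    omega

theorem val_sub_one_cases (hn : 2 ≤ n) (i : Fin n) :
    ((i - 1).val + 1 = i.val) ∨ ((i - 1).val + 1 = n ∧ i.val = 0) := by
  have := val_add_one_cases hn (i - 1)
  rw [sub_add_cancel] at this
  omega

theorem mem_edge {i j : Fin n} : i ∈ edge j ↔ i = j ∨ i = j + 1 := Iff.rfl

theorem mem_corner {i j : Fin n} : i ∈ corner j ↔ i = j - 1 ∨ i = j ∨ i = j + 1 := Iff.rfl

theorem disjoint_edge_edge {i j : Fin n} :
    Disjoint (edge i) (edge j) ↔ i ≠ j ∧ i ≠ j + 1 ∧ i + 1 ≠ j := by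
  rw [Set.disjoint_left]
  simp only [mem_edge, not_or]
  constructor
  · intro h
    have h1 := h (Or.inl rfl)
    have h2 := h (Or.inr rfl)
    exact ⟨h1.1, h1.2, h2.1⟩
  · rintro ⟨h1, h2, h3⟩ a (rfl | rfl)
    · exact ⟨h1, h2⟩
    · exact ⟨h3, fun h => h1 (add_right_cancel h)⟩

theorem disjoint_corner_edge {i j : Fin n} : Disjoint (corner i) (edge j) ↔
    i - 1 ≠ j ∧ i - 1 ≠ j + 1 ∧ i ≠ j ∧ i ≠ j + 1 ∧ i + 1 ≠ j ∧ i + 1 ≠ j + 1 := by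
  rw [Set.disjoint_left]
  simp only [mem_corner, mem_edge, not_or]
  constructor
  · intro h
    have h1 := h (Or.inl rfl)
    have h2 := h (Or.inr (Or.inl rfl))
    have h3 := h (Or.inr (Or.inr rfl))
    exact ⟨h1.1, h1.2, h2.1, h2.2, h3.1, h3.2⟩
  · rintro ⟨h1, h2, h3, h4, h5, h6⟩ a (rfl | rfl | rfl)
    exacts [⟨h1, h2⟩, ⟨h3, h4⟩, ⟨h5, h6⟩]

theorem disjoint_corner_corner {i j : Fin n} : Disjoint (corner i) (corner j) ↔
    (i - 1 ≠ j - 1 ∧ i - 1 ≠ j ∧ i - 1 ≠ j + 1) ∧ (i ≠ j - 1 ∧ i ≠ j ∧ i ≠ j + 1) ∧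
      (i + 1 ≠ j - 1 ∧ i + 1 ≠ j ∧ i + 1 ≠ j + 1) := by
  rw [Set.disjoint_left]
  simp only [mem_corner, not_or]
  constructor
  · intro h
    exact ⟨h (Or.inl rfl), h (Or.inr (Or.inl rfl)), h (Or.inr (Or.inr rfl))⟩
  · rintro ⟨h1, h2, h3⟩ a (rfl | rfl | rfl)
    exacts [h1, h2, h3]

theorem exists_ne_three (hn : 4 ≤ n) (a b c : Fin n) : ∃ d, d ≠ a ∧ d ≠ b ∧ d ≠ c := by
  obtain ⟨d, -, hd⟩ := Finset.exists_mem_notMem_of_card_lt_card (s := {a, b, c})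
    (t := (Finset.univ : Finset (Fin n))) (by
      have := Finset.card_le_three (a := a) (b := b) (c := c)
      rw [Finset.card_univ, Fintype.card_fin]
      omega)
  simp only [Finset.mem_insert, Finset.mem_singleton, not_or] at hd
  exact ⟨d, hd.1, hd.2.1, hd.2.2⟩

end Cyclic

/-! ### Points in general position and their Schubert conditions -/

section Incidence

variable {n : ℕ} [NeZero n] {Z : Matrix (Fin n) (Fin 4) ℝ}

/-- No four of the points `Z_i` are coplanar. -/
def NoFourCoplanar (Z : Matrix (Fin n) (Fin 4) ℝ) : Prop :=
  ∀ a b c d : Fin n, a ≠ b → a ≠ c → a ≠ d → b ≠ c → b ≠ d → c ≠ d →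
    br (rowPoint Z a) (rowPoint Z b) (rowPoint Z c) (rowPoint Z d) ≠ 0

/-- The lines meeting the edge `Z_i Z_{i+1}`. -/
abbrev onEdge (Z : Matrix (Fin n) (Fin 4) ℝ) (i : Fin n) : Set (Gr ℂ 4) := meetsLine Z i (i + 1)

theorem NoFourCoplanar.rel (hI : NoFourCoplanar Z) {a b c d : Fin n} (hab : a ≠ b) (hac : a ≠ c)
    (had : a ≠ d) (hbc : b ≠ c) (hbd : b ≠ d) (hcd : c ≠ d) {α β γ δ : ℂ}
    (h : α • rowPoint Z a + β • rowPoint Z b + γ • rowPoint Z c + δ • rowPoint Z d = 0) :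
    α = 0 ∧ β = 0 ∧ γ = 0 ∧ δ = 0 :=
  coeff_eq_zero_of_br_ne_zero (hI a b c d hab hac had hbc hbd hcd) h

theorem NoFourCoplanar.rel_three (hI : NoFourCoplanar Z) (hn : 4 ≤ n) {a b c : Fin n}
    (hab : a ≠ b) (hac : a ≠ c) (hbc : b ≠ c) {α β γ : ℂ}
    (h : α • rowPoint Z a + β • rowPoint Z b + γ • rowPoint Z c = 0) :
    α = 0 ∧ β = 0 ∧ γ = 0 := by
  obtain ⟨d, h1, h2, h3⟩ := exists_ne_three hn a b c
  have := hI.rel hab hac h1.symm hbc h2.symm h3.symm (α := α) (β := β) (γ := γ) (δ := 0)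
    (by simpa using h)
  exact ⟨this.1, this.2.1, this.2.2.1⟩

theorem NoFourCoplanar.linearIndependent_pair (hI : NoFourCoplanar Z) (hn : 4 ≤ n) {a b : Fin n}
    (hab : a ≠ b) : LinearIndependent ℂ ![rowPoint Z a, rowPoint Z b] := by
  obtain ⟨c, h1, h2, -⟩ := exists_ne_three hn a b b
  refine LinearIndependent.pair_iff.2 fun s t h => ?_
  have := hI.rel_three hn hab h1.symm h2.symm (α := s) (β := t) (γ := 0) (by simpa using h)
  exact ⟨this.1, this.2.1⟩

theorem NoFourCoplanar.ne_zero (hI : NoFourCoplanar Z) (hn : 4 ≤ n) (a : Fin n) :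
    rowPoint Z a ≠ 0 := by
  obtain ⟨b, hb, -⟩ := exists_ne_three hn a a a
  exact (hI.linearIndependent_pair hn hb.symm).ne_zero 0

theorem NoFourCoplanar.linearIndependent_triple (hI : NoFourCoplanar Z) (hn : 4 ≤ n)
    {a b c : Fin n} (hab : a ≠ b) (hac : a ≠ c) (hbc : b ≠ c) :
    LinearIndependent ℂ ![rowPoint Z a, rowPoint Z b, rowPoint Z c] := by
  rw [Fintype.linearIndependent_iff]
  intro g hg
  have := hI.rel_three hn hab hac hbc (α := g 0) (β := g 1) (γ := g 2)
    (by simpa [Fin.sum_univ_succ, add_assoc] using hg)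
  intro i
  fin_cases i
  exacts [this.1, this.2.1, this.2.2]

theorem NoFourCoplanar.finrank_pair (hI : NoFourCoplanar Z) (hn : 4 ≤ n) {a b : Fin n}
    (hab : a ≠ b) : Module.finrank ℂ (span ℂ {rowPoint Z a, rowPoint Z b}) = 2 := by
  rw [← Gr.ofPair_space _ _ (hI.linearIndependent_pair hn hab), Gr.finrank_space]

theorem NoFourCoplanar.finrank_triple (hI : NoFourCoplanar Z) (hn : 4 ≤ n) {a b c : Fin n}
    (hab : a ≠ b) (hac : a ≠ c) (hbc : b ≠ c) :
    Module.finrank ℂ (span ℂ {rowPoint Z a, rowPoint Z b, rowPoint Z c}) = 3 := by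
  have := finrank_span_eq_card (hI.linearIndependent_triple hn hab hac hbc)
  rwa [Matrix.range_cons, Matrix.range_cons, Matrix.range_cons, Matrix.range_empty,
    Set.union_empty, Set.singleton_union, Set.singleton_union, Fintype.card_fin] at this

theorem mem_meetsLine_iff {V : Gr ℂ 4} {i j : Fin n} : V ∈ meetsLine Z i j ↔
    ∃ v ∈ V.space, v ≠ 0 ∧ ∃ γ δ : ℂ, γ • rowPoint Z i + δ • rowPoint Z j = v := by
  change V.space ⊓ _ ≠ ⊥ ↔ _
  rw [Submodule.ne_bot_iff]
  constructor
  · rintro ⟨v, ⟨h1, h2⟩, h0⟩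
    exact ⟨v, h1, h0, mem_span_pair.1 h2⟩
  · rintro ⟨v, h1, h0, h2⟩
    exact ⟨v, ⟨h1, mem_span_pair.2 h2⟩, h0⟩

theorem mem_throughPoint {V : Gr ℂ 4} {i : Fin n} :
    V ∈ throughPoint Z i ↔ rowPoint Z i ∈ V.space := Iff.rfl

theorem mem_inPlane {V : Gr ℂ 4} {i : Fin n} : V ∈ inPlane Z i ↔
    V.space ≤ span ℂ {rowPoint Z (i - 1), rowPoint Z i, rowPoint Z (i + 1)} := Iff.rfl

theorem NoFourCoplanar.isClosed_meetsLine (hI : NoFourCoplanar Z) (hn : 4 ≤ n) {i j : Fin n}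
    (hij : i ≠ j) : IsClosed (meetsLine Z i j) := by
  have : meetsLine Z i j = Gr.incident (rowPoint Z i) (rowPoint Z j) := by
    ext V
    rw [Gr.mem_incident_iff_inf_ne_bot (hI.linearIndependent_pair hn hij)]
    rfl
  rw [this]
  exact Gr.isClosed_incident _ _

theorem ne_add_one (hn : 4 ≤ n) (i : Fin n) : i ≠ i + 1 := by
  have := val_add_one_cases (by omega) i
  omega

theorem sub_one_ne (hn : 4 ≤ n) (i : Fin n) : i - 1 ≠ i := by
  have := val_sub_one_cases (by omega) i
  omega

theorem sub_one_ne_add_one (hn : 4 ≤ n) (i : Fin n) : i - 1 ≠ i + 1 := by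
  have := val_sub_one_cases (by omega) i
  have := val_add_one_cases (by omega) i
  omega

theorem NoFourCoplanar.isClosed_onEdge (hI : NoFourCoplanar Z) (hn : 4 ≤ n) (i : Fin n) :
    IsClosed (onEdge Z i) := hI.isClosed_meetsLine hn (ne_add_one hn i)

theorem isClosed_throughPoint (i : Fin n) : IsClosed (throughPoint Z i) :=
  Gr.isClosed_setOf_mem _

theorem NoFourCoplanar.isClosed_inPlane (hI : NoFourCoplanar Z) (hn : 4 ≤ n) (i : Fin n) :
    IsClosed (inPlane Z i) :=
  Gr.isClosed_setOf_le (hI.linearIndependent_triple hn (sub_one_ne hn i)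
    (sub_one_ne_add_one hn i) (ne_add_one hn i))

theorem NoFourCoplanar.finrank_plane (hI : NoFourCoplanar Z) (hn : 4 ≤ n) (i : Fin n) :
    Module.finrank ℂ (span ℂ {rowPoint Z (i - 1), rowPoint Z i, rowPoint Z (i + 1)}) = 3 :=
  hI.finrank_triple hn (sub_one_ne hn i) (sub_one_ne_add_one hn i) (ne_add_one hn i)

theorem NoFourCoplanar.meets_of_mem_left (hI : NoFourCoplanar Z) (hn : 4 ≤ n) {V : Gr ℂ 4}
    {i : Fin n} (j : Fin n) (h : V ∈ throughPoint Z i) : V ∈ meetsLine Z i j :=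
  mem_meetsLine_iff.2 ⟨_, h, hI.ne_zero hn i, 1, 0, by simp⟩

theorem NoFourCoplanar.meets_of_mem_right (hI : NoFourCoplanar Z) (hn : 4 ≤ n) {V : Gr ℂ 4}
    {j : Fin n} (i : Fin n) (h : V ∈ throughPoint Z j) : V ∈ meetsLine Z i j :=
  mem_meetsLine_iff.2 ⟨_, h, hI.ne_zero hn j, 0, 1, by simp⟩

theorem NoFourCoplanar.onEdge_of_mem (hI : NoFourCoplanar Z) (hn : 4 ≤ n) {V : Gr ℂ 4}
    {i : Fin n} (h : V ∈ throughPoint Z i) : V ∈ onEdge Z i := hI.meets_of_mem_left hn _ h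

theorem NoFourCoplanar.onEdge_pred_of_mem (hI : NoFourCoplanar Z) (hn : 4 ≤ n) {V : Gr ℂ 4}
    {i : Fin n} (h : V ∈ throughPoint Z i) : V ∈ onEdge Z (i - 1) := by
  rw [onEdge, sub_add_cancel]
  exact hI.meets_of_mem_right hn _ h

theorem NoFourCoplanar.meets_of_le (hI : NoFourCoplanar Z) (hn : 4 ≤ n) {V : Gr ℂ 4}
    {a b c : Fin n} (hab : a ≠ b) (hac : a ≠ c) (hbc : b ≠ c)
    (h : V.space ≤ span ℂ {rowPoint Z a, rowPoint Z b, rowPoint Z c}) : V ∈ meetsLine Z b c := by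
  refine Gr.inf_ne_bot h (span_mono (by simp)) ?_
  rw [hI.finrank_triple hn hab hac hbc, hI.finrank_pair hn hbc]
  norm_num

theorem NoFourCoplanar.onEdge_of_inPlane (hI : NoFourCoplanar Z) (hn : 4 ≤ n) {V : Gr ℂ 4}
    {i : Fin n} (h : V ∈ inPlane Z i) : V ∈ onEdge Z i :=
  hI.meets_of_le hn (sub_one_ne hn i) (sub_one_ne_add_one hn i) (ne_add_one hn i) h

theorem NoFourCoplanar.onEdge_pred_of_inPlane (hI : NoFourCoplanar Z) (hn : 4 ≤ n) {V : Gr ℂ 4}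
    {i : Fin n} (h : V ∈ inPlane Z i) : V ∈ onEdge Z (i - 1) := by
  rw [onEdge, sub_add_cancel]
  refine hI.meets_of_le hn (a := i + 1) (sub_one_ne_add_one hn i).symm (ne_add_one hn i).symm
    (sub_one_ne hn i) (h.trans (span_mono ?_))
  rintro _ (rfl | rfl | rfl) <;> simp

theorem Gr.space_le_of_mem {V : Gr ℂ 4} {W : Submodule ℂ (Fin 4 → ℂ)} {x y : Fin 4 → ℂ}
    (hx : x ∈ V.space) (hy : y ∈ V.space) (h : LinearIndependent ℂ ![x, y]) (hx' : x ∈ W)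
    (hy' : y ∈ W) : V.space ≤ W := by
  rw [V.space_eq_of_mem hx hy h, span_le]
  rintro _ (rfl | rfl)
  exacts [hx', hy']

/-- Take points of the line on both edges. If one of them is the vertex `Z_i`, the first case holds;
otherwise they are distinct points of the corner plane and span the line. -/
theorem NoFourCoplanar.mem_or_inPlane (hI : NoFourCoplanar Z) (hn : 4 ≤ n) {V : Gr ℂ 4}
    {i : Fin n} (h : V ∈ onEdge Z (i - 1)) (h' : V ∈ onEdge Z i) :
    V ∈ throughPoint Z i ∨ V ∈ inPlane Z i := by
  rw [onEdge, sub_add_cancel] at h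
  obtain ⟨v, hv, hv0, γ, δ, rfl⟩ := mem_meetsLine_iff.1 h
  obtain ⟨w, hw, hw0, γ', δ', rfl⟩ := mem_meetsLine_iff.1 h'
  by_cases hγ : γ = 0
  · left
    have hδ : δ ≠ 0 := by
      rintro rfl
      simp [hγ] at hv0
    rw [hγ, zero_smul, zero_add] at hv
    exact (V.space.smul_mem_iff hδ).1 hv
  by_cases hδ' : δ' = 0
  · left
    have hγ' : γ' ≠ 0 := by
      rintro rfl
      simp [hδ'] at hw0
    rw [hδ', zero_smul, add_zero] at hw
    exact (V.space.smul_mem_iff hγ').1 hw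
  right
  refine Gr.space_le_of_mem hv hw ?_ ?_ ?_
  · refine LinearIndependent.pair_iff.2 fun s t h0 => ?_
    have := hI.rel_three hn (sub_one_ne hn i) (sub_one_ne_add_one hn i) (ne_add_one hn i)
      (α := s * γ) (β := s * δ + t * γ') (γ := t * δ') (by
        rw [← h0]
        module)
    exact ⟨by simpa [hγ] using this.1, by simpa [hδ'] using this.2.2⟩
  · exact mem_span_triple.2 ⟨γ, δ, 0, by simp⟩
  · exact mem_span_triple.2 ⟨0, γ', δ', by simp⟩

theorem NoFourCoplanar.space_eq (hI : NoFourCoplanar Z) (hn : 4 ≤ n) {V : Gr ℂ 4}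
    {i j : Fin n} (hij : i ≠ j) (h : V ∈ throughPoint Z i) (h' : V ∈ throughPoint Z j) :
    V.space = span ℂ {rowPoint Z i, rowPoint Z j} :=
  V.space_eq_of_mem h h' (hI.linearIndependent_pair hn hij)

theorem NoFourCoplanar.exists_join (hI : NoFourCoplanar Z) (hn : 4 ≤ n) {i j : Fin n}
    (hij : i ≠ j) : ∃ V, V ∈ throughPoint Z i ∧ V ∈ throughPoint Z j := by
  refine ⟨Gr.ofPair _ _ (hI.linearIndependent_pair hn hij), ?_, ?_⟩ <;>
  · rw [mem_throughPoint, Gr.ofPair_space]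
    exact subset_span (by simp)

/-- A common point of `Z_i Z_j` and `Z_k Z_l` with four different indices would be a relation among
four independent vectors. Joins of vertices therefore have completely known incidences and are used
later as test lines. -/
theorem NoFourCoplanar.meets_join_iff (hI : NoFourCoplanar Z) (hn : 4 ≤ n) {V : Gr ℂ 4}
    {i j k l : Fin n} (hij : i ≠ j) (hkl : k ≠ l) (h : V ∈ throughPoint Z i)
    (h' : V ∈ throughPoint Z j) : V ∈ meetsLine Z k l ↔ k = i ∨ k = j ∨ l = i ∨ l = j := by
  constructor
  · intro hV
    by_contra! hne
    obtain ⟨v, hv, hv0, γ, δ, rfl⟩ := mem_meetsLine_iff.1 hV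
    rw [hI.space_eq hn hij h h'] at hv
    obtain ⟨α, β, hv⟩ := mem_span_pair.1 hv
    have := hI.rel hij hne.1.symm hne.2.2.1.symm hne.2.1.symm hne.2.2.2.symm hkl (α := α) (β := β)
      (γ := -γ) (δ := -δ) (by
        rw [← sub_eq_zero] at hv
        rw [← hv]
        module)
    exact hv0 (by rw [← hv, this.1, this.2.1]; simp)
  · rintro (rfl | rfl | rfl | rfl)
    exacts [hI.meets_of_mem_left hn _ h, hI.meets_of_mem_left hn _ h',
      hI.meets_of_mem_right hn _ h, hI.meets_of_mem_right hn _ h']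

theorem NoFourCoplanar.mem_join_iff (hI : NoFourCoplanar Z) (hn : 4 ≤ n) {V : Gr ℂ 4}
    {i j k : Fin n} (hij : i ≠ j) (h : V ∈ throughPoint Z i)
    (h' : V ∈ throughPoint Z j) : V ∈ throughPoint Z k ↔ k = i ∨ k = j := by
  constructor
  · intro hV
    by_contra! hne
    rw [mem_throughPoint, hI.space_eq hn hij h h'] at hV
    obtain ⟨α, β, hv⟩ := mem_span_pair.1 hV
    have := hI.rel_three hn hij hne.1.symm hne.2.symm (α := α) (β := β) (γ := -1) (by
      rw [hv]
      module)
    simp at this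
  · rintro (rfl | rfl)
    exacts [h, h']

theorem NoFourCoplanar.eq_of_mem_plane (hI : NoFourCoplanar Z) {a b c d : Fin n}
    (hbc : b ≠ c) (hbd : b ≠ d) (hcd : c ≠ d)
    (h : rowPoint Z a ∈ span ℂ {rowPoint Z b, rowPoint Z c, rowPoint Z d}) :
    a = b ∨ a = c ∨ a = d := by
  by_contra! hne
  obtain ⟨α, β, γ, hv⟩ := mem_span_triple.1 h
  have := hI.rel hne.1 hne.2.1 hne.2.2 hbc hbd hcd (α := -1) (β := α) (γ := β) (δ := γ) (by
    rw [← hv]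
    module)
  simp at this

theorem NoFourCoplanar.mem_corner (hI : NoFourCoplanar Z) (hn : 4 ≤ n) {V : Gr ℂ 4}
    {i j : Fin n} (h : V ∈ throughPoint Z i) (h' : V ∈ inPlane Z j) :
    i = j - 1 ∨ i = j ∨ i = j + 1 :=
  hI.eq_of_mem_plane (sub_one_ne hn j) (sub_one_ne_add_one hn j) (ne_add_one hn j) (h' h)

theorem rowPoint_mem_plane {i j : Fin n} (h : i = j - 1 ∨ i = j ∨ i = j + 1) :
    rowPoint Z i ∈ span ℂ {rowPoint Z (j - 1), rowPoint Z j, rowPoint Z (j + 1)} := by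
  refine subset_span ?_
  rcases h with rfl | rfl | rfl <;> simp

theorem NoFourCoplanar.inPlane_join_iff (hI : NoFourCoplanar Z) (hn : 4 ≤ n) {V : Gr ℂ 4}
    {i j k : Fin n} (hij : i ≠ j) (h : V ∈ throughPoint Z i) (h' : V ∈ throughPoint Z j) :
    V ∈ inPlane Z k ↔ (i = k - 1 ∨ i = k ∨ i = k + 1) ∧ (j = k - 1 ∨ j = k ∨ j = k + 1) := by
  constructor
  · intro hV
    exact ⟨hI.mem_corner hn h hV, hI.mem_corner hn h' hV⟩
  · rintro ⟨hi, hj⟩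
    exact Gr.space_le_of_mem h h' (hI.linearIndependent_pair hn hij) (rowPoint_mem_plane hi)
      (rowPoint_mem_plane hj)

/-- Neighbouring corner planes share the edge `Z_i Z_{i+1}`. Comparing the two expansions of a
vector in the independent points `Z_{i-1}, …, Z_{i+2}` kills the outer coefficients. -/
theorem NoFourCoplanar.join_of_inPlane (hI : NoFourCoplanar Z) (hn : 4 ≤ n) {V : Gr ℂ 4}
    {i : Fin n} (h : V ∈ inPlane Z i) (h' : V ∈ inPlane Z (i + 1)) :
    V ∈ throughPoint Z i ∧ V ∈ throughPoint Z (i + 1) := by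
  have hle : V.space ≤ (Gr.ofPair _ _ (hI.linearIndependent_pair hn (ne_add_one hn i))).space := by
    intro v hv
    obtain ⟨α, β, γ, h1⟩ := mem_span_triple.1 (h hv)
    have h2 := h' hv
    rw [add_sub_cancel_right] at h2
    obtain ⟨α', β', γ', h2⟩ := mem_span_triple.1 h2
    have e1 := val_add_one_cases (by omega) i
    have e2 := val_add_one_cases (by omega) (i + 1)
    have e3 := val_sub_one_cases (by omega) i
    have := hI.rel (a := i - 1) (b := i) (c := i + 1) (d := i + 1 + 1) (by omega) (by omega)
      (by omega) (by omega) (by omega) (by omega) (α := α) (β := β - α') (γ := γ - β') (δ := -γ')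
      (by
        rw [← sub_self v]
        conv_rhs => rw [← h1]
        rw [← h1] at h2
        rw [← sub_eq_zero] at h2
        rw [sub_self, ← neg_eq_zero, ← h2]
        module)
    rw [Gr.ofPair_space, ← h1, this.1, zero_smul, zero_add]
    exact mem_span_pair.2 ⟨β, γ, rfl⟩
  rw [Gr.eq_of_space_le hle]
  constructor <;>
  · rw [mem_throughPoint, Gr.ofPair_space]
    exact subset_span (by simp)

/-- A line through `Z_i` meets `Z_a Z_b` if and only if it lies in the plane `Z_i Z_a Z_b`. -/
theorem NoFourCoplanar.meets_iff_le (hI : NoFourCoplanar Z) (hn : 4 ≤ n) {V : Gr ℂ 4}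
    {i a b : Fin n} (hia : i ≠ a) (hib : i ≠ b) (hab : a ≠ b) (h : V ∈ throughPoint Z i) :
    V ∈ meetsLine Z a b ↔ V.space ≤ span ℂ {rowPoint Z i, rowPoint Z a, rowPoint Z b} := by
  constructor
  · intro hV
    obtain ⟨v, hv, hv0, γ, δ, rfl⟩ := mem_meetsLine_iff.1 hV
    refine Gr.space_le_of_mem h hv ?_ ?_ ?_
    · refine LinearIndependent.pair_iff.2 fun s t h0 => ?_
      have := hI.rel_three hn hia hib hab (α := s) (β := t * γ) (γ := t * δ) (by
        rw [← h0]
        module)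
      refine ⟨this.1, ?_⟩
      by_contra ht
      have h1 : γ = 0 := by simpa [ht] using this.2.1
      have h2 : δ = 0 := by simpa [ht] using this.2.2
      exact hv0 (by simp [h1, h2])
    · exact mem_span_triple.2 ⟨1, 0, 0, by simp⟩
    · exact mem_span_triple.2 ⟨0, γ, δ, by simp⟩
  · intro hV
    exact hI.meets_of_le hn hia hib hab hV

/-- For lines through the vertex, meeting the diagonal `Z_{i-1} Z_{i+1}` is lying in the corner
plane. This replaces the diagonal by the plane in the types (1, I) and (0, III). -/
theorem NoFourCoplanar.throughPoint_inter_meetsLine (hI : NoFourCoplanar Z) (hn : 4 ≤ n)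
    (i : Fin n) :
    throughPoint Z i ∩ meetsLine Z (i - 1) (i + 1) = throughPoint Z i ∩ inPlane Z i := by
  ext V
  refine and_congr_right fun h => ?_
  rw [hI.meets_iff_le hn (sub_one_ne hn i).symm (ne_add_one hn i) (sub_one_ne_add_one hn i) h,
    mem_inPlane, Set.insert_comm]

end Incidence

/-! ### Irreducibility of the loci -/

section Loci

variable {n : ℕ} [NeZero n] {Z : Matrix (Fin n) (Fin 4) ℝ}

theorem Gr.left_ne_zero {V : Gr ℂ 4} {x y : Fin 4 → ℂ} (h : V.space = span ℂ {x, y}) : x ≠ 0 :=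
  (V.pair_of_space_eq h).ne_zero 0

theorem Gr.right_ne_zero {V : Gr ℂ 4} {x y : Fin 4 → ℂ} (h : V.space = span ℂ {x, y}) : y ≠ 0 :=
  (V.pair_of_space_eq h).ne_zero 1

theorem Gr.left_mem {V : Gr ℂ 4} {x y : Fin 4 → ℂ} (h : V.space = span ℂ {x, y}) : x ∈ V.space :=
  h ▸ subset_span (by simp)

theorem Gr.right_mem {V : Gr ℂ 4} {x y : Fin 4 → ℂ} (h : V.space = span ℂ {x, y}) : y ∈ V.space :=
  h ▸ subset_span (by simp)

theorem mem_meetsLine_of_mem {V : Gr ℂ 4} {i j : Fin n} {v : Fin 4 → ℂ} (hv : v ∈ V.space)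
    (h0 : v ≠ 0) (h : v ∈ span ℂ {rowPoint Z i, rowPoint Z j}) : V ∈ meetsLine Z i j :=
  mem_meetsLine_iff.2 ⟨v, hv, h0, mem_span_pair.1 h⟩

theorem exists_mem_of_mem_meetsLine {V : Gr ℂ 4} {i j : Fin n} (h : V ∈ meetsLine Z i j) :
    ∃ v ∈ V.space, v ≠ 0 ∧ v ∈ span ℂ {rowPoint Z i, rowPoint Z j} := by
  obtain ⟨v, hv, h0, h1⟩ := mem_meetsLine_iff.1 h
  exact ⟨v, hv, h0, mem_span_pair.2 h1⟩

theorem mem_throughPoint_of_span {V : Gr ℂ 4} {i : Fin n} {v : Fin 4 → ℂ} (hv : v ∈ V.space)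
    (h0 : v ≠ 0) (h : v ∈ span ℂ {rowPoint Z i}) : V ∈ throughPoint Z i := by
  obtain ⟨c, rfl⟩ := mem_span_singleton.1 h
  have hc : c ≠ 0 := by
    rintro rfl
    simp at h0
  exact (V.space.smul_mem_iff hc).1 hv

/-- A line of the locus is spanned by a vector of the edge and an arbitrary vector, so the locus is
parametrised by a product of linear spaces. Most irreducibility proofs below have this form and
differ only in the two factors. -/
theorem NoFourCoplanar.isIrreducible_meetsLine (hI : NoFourCoplanar Z) (hn : 4 ≤ n) {i j : Fin n}
    (hij : i ≠ j) : IsIrreducible (meetsLine Z i j) := by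
  refine ⟨?_, Gr.isPreirreducible_of_prod (span ℂ {rowPoint Z i, rowPoint Z j}) ⊤ ?_ ?_⟩
  · obtain ⟨V, h, -⟩ := hI.exists_join hn hij
    exact ⟨V, hI.meets_of_mem_left hn _ h⟩
  · intro V hV
    obtain ⟨v, hv, h0, h1⟩ := exists_mem_of_mem_meetsLine hV
    obtain ⟨y, hy⟩ := V.exists_space_eq_of_mem hv h0
    exact ⟨v, h1, y, trivial, hy⟩
  · intro x hx y _ V hV
    exact mem_meetsLine_of_mem (Gr.left_mem hV) (Gr.left_ne_zero hV) hx

theorem NoFourCoplanar.isIrreducible_onEdge (hI : NoFourCoplanar Z) (hn : 4 ≤ n) (i : Fin n) :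
    IsIrreducible (onEdge Z i) := hI.isIrreducible_meetsLine hn (ne_add_one hn i)

theorem NoFourCoplanar.isIrreducible_throughPoint (hI : NoFourCoplanar Z) (hn : 4 ≤ n)
    (i : Fin n) : IsIrreducible (throughPoint Z i) := by
  refine ⟨?_, Gr.isPreirreducible_of_prod (span ℂ {rowPoint Z i}) ⊤ ?_ ?_⟩
  · obtain ⟨V, h, -⟩ := hI.exists_join hn (ne_add_one hn i)
    exact ⟨V, h⟩
  · intro V hV
    obtain ⟨y, hy⟩ := V.exists_space_eq_of_mem hV (hI.ne_zero hn i)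
    exact ⟨_, mem_span_singleton_self _, y, trivial, hy⟩
  · intro x hx y _ V hV
    exact mem_throughPoint_of_span (Gr.left_mem hV) (Gr.left_ne_zero hV) hx

theorem NoFourCoplanar.join_mem_inPlane (hI : NoFourCoplanar Z) (hn : 4 ≤ n) {V : Gr ℂ 4}
    {i : Fin n} (h : V ∈ throughPoint Z i) (h' : V ∈ throughPoint Z (i + 1)) : V ∈ inPlane Z i :=
  (hI.inPlane_join_iff hn (ne_add_one hn i) h h').2 ⟨Or.inr (Or.inl rfl), Or.inr (Or.inr rfl)⟩

theorem NoFourCoplanar.isIrreducible_inPlane (hI : NoFourCoplanar Z) (hn : 4 ≤ n)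
    (i : Fin n) : IsIrreducible (inPlane Z i) := by
  refine ⟨?_, Gr.isPreirreducible_of_prod
    (span ℂ {rowPoint Z (i - 1), rowPoint Z i, rowPoint Z (i + 1)})
    (span ℂ {rowPoint Z (i - 1), rowPoint Z i, rowPoint Z (i + 1)}) ?_ ?_⟩
  · obtain ⟨V, h, h'⟩ := hI.exists_join hn (ne_add_one hn i)
    exact ⟨V, hI.join_mem_inPlane hn h h'⟩
  · intro V hV
    obtain ⟨x, y, h⟩ := V.exists_space_eq_span
    exact ⟨x, hV (Gr.left_mem h), y, hV (Gr.right_mem h), h⟩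
  · intro x hx y hy V hV
    exact Gr.space_le_of_mem (Gr.left_mem hV) (Gr.right_mem hV) (V.pair_of_space_eq hV) hx hy

theorem NoFourCoplanar.linearIndependent_of_mem_lines (hI : NoFourCoplanar Z) {i j k l : Fin n}
    (hij : i ≠ j) (hik : i ≠ k) (hil : i ≠ l) (hjk : j ≠ k) (hjl : j ≠ l) (hkl : k ≠ l)
    {x y : Fin 4 → ℂ} (hx : x ∈ span ℂ {rowPoint Z i, rowPoint Z j})
    (hy : y ∈ span ℂ {rowPoint Z k, rowPoint Z l}) (hx0 : x ≠ 0) (hy0 : y ≠ 0) :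
    LinearIndependent ℂ ![x, y] := by
  obtain ⟨α, β, rfl⟩ := mem_span_pair.1 hx
  obtain ⟨γ, δ, rfl⟩ := mem_span_pair.1 hy
  refine LinearIndependent.pair_iff.2 fun s t h0 => ?_
  have := hI.rel hij hik hil hjk hjl hkl (α := s * α) (β := s * β) (γ := t * γ) (δ := t * δ) (by
    rw [← h0]
    module)
  obtain ⟨h1, h2, h3, h4⟩ := this
  constructor
  · by_contra hs
    have e1 : α = 0 := by simpa [hs] using h1
    have e2 : β = 0 := by simpa [hs] using h2
    exact hx0 (by simp [e1, e2])
  · by_contra ht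
    have e1 : γ = 0 := by simpa [ht] using h3
    have e2 : δ = 0 := by simpa [ht] using h4
    exact hy0 (by simp [e1, e2])

theorem NoFourCoplanar.linearIndependent_of_mem_line (hI : NoFourCoplanar Z) (hn : 4 ≤ n)
    {i k l : Fin n} (hik : i ≠ k) (hil : i ≠ l) (hkl : k ≠ l) {y : Fin 4 → ℂ}
    (hy : y ∈ span ℂ {rowPoint Z k, rowPoint Z l}) (hy0 : y ≠ 0) :
    LinearIndependent ℂ ![rowPoint Z i, y] := by
  obtain ⟨d, h1, h2, h3⟩ := exists_ne_three hn i k l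
  exact hI.linearIndependent_of_mem_lines h1.symm hik hil h2 h3 hkl
    (mem_span_pair.2 ⟨1, 0, by simp⟩) hy (hI.ne_zero hn i) hy0

theorem NoFourCoplanar.isIrreducible_onEdge_inter_onEdge (hI : NoFourCoplanar Z) (hn : 4 ≤ n)
    {i j : Fin n} (hij : Disjoint (edge i) (edge j)) :
    IsIrreducible (onEdge Z i ∩ onEdge Z j) := by
  obtain ⟨h1, h2, h3⟩ := disjoint_edge_edge.1 hij
  refine ⟨?_, Gr.isPreirreducible_of_prod (span ℂ {rowPoint Z i, rowPoint Z (i + 1)})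
    (span ℂ {rowPoint Z j, rowPoint Z (j + 1)}) ?_ ?_⟩
  · obtain ⟨V, h, h'⟩ := hI.exists_join hn h1
    exact ⟨V, hI.onEdge_of_mem hn h, hI.onEdge_of_mem hn h'⟩
  · rintro V ⟨hV, hV'⟩
    obtain ⟨v, hv, hv0, hvl⟩ := exists_mem_of_mem_meetsLine hV
    obtain ⟨w, hw, hw0, hwl⟩ := exists_mem_of_mem_meetsLine hV'
    exact ⟨v, hvl, w, hwl, V.space_eq_of_mem hv hw (hI.linearIndependent_of_mem_lines
      (ne_add_one hn i) h1 h2 h3 (by simpa using h1) (ne_add_one hn j) hvl hwl hv0 hw0)⟩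
  · intro x hx y hy V hV
    exact ⟨mem_meetsLine_of_mem (Gr.left_mem hV) (Gr.left_ne_zero hV) hx,
      mem_meetsLine_of_mem (Gr.right_mem hV) (Gr.right_ne_zero hV) hy⟩

theorem NoFourCoplanar.isIrreducible_throughPoint_inter_inPlane (hI : NoFourCoplanar Z)
    (hn : 4 ≤ n) (i : Fin n) : IsIrreducible (throughPoint Z i ∩ inPlane Z i) := by
  refine ⟨?_, Gr.isPreirreducible_of_prod (span ℂ {rowPoint Z i})
    (span ℂ {rowPoint Z (i - 1), rowPoint Z i, rowPoint Z (i + 1)}) ?_ ?_⟩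
  · obtain ⟨V, h, h'⟩ := hI.exists_join hn (ne_add_one hn i)
    exact ⟨V, h, hI.join_mem_inPlane hn h h'⟩
  · rintro V ⟨hV, hV'⟩
    obtain ⟨y, hy⟩ := V.exists_space_eq_of_mem hV (hI.ne_zero hn i)
    exact ⟨_, mem_span_singleton_self _, y, hV' (Gr.right_mem hy), hy⟩
  · intro x hx y hy V hV
    have h := mem_throughPoint_of_span (Gr.left_mem hV) (Gr.left_ne_zero hV) hx
    refine ⟨h, Gr.space_le_of_mem (Gr.left_mem hV) (Gr.right_mem hV) (V.pair_of_space_eq hV)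
      (span_mono ?_ hx) hy⟩
    rintro _ rfl
    simp

theorem NoFourCoplanar.isIrreducible_throughPoint_inter_onEdge (hI : NoFourCoplanar Z)
    (hn : 4 ≤ n) {i j : Fin n} (hij : i ∉ edge j) :
    IsIrreducible (throughPoint Z i ∩ onEdge Z j) := by
  rw [mem_edge, not_or] at hij
  refine ⟨?_, Gr.isPreirreducible_of_prod (span ℂ {rowPoint Z i})
    (span ℂ {rowPoint Z j, rowPoint Z (j + 1)}) ?_ ?_⟩
  · obtain ⟨V, h, h'⟩ := hI.exists_join hn hij.1
    exact ⟨V, h, hI.onEdge_of_mem hn h'⟩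
  · rintro V ⟨hV, hV'⟩
    obtain ⟨w, hw, hw0, hwl⟩ := exists_mem_of_mem_meetsLine hV'
    exact ⟨_, mem_span_singleton_self _, w, hwl, V.space_eq_of_mem hV hw
      (hI.linearIndependent_of_mem_line hn hij.1 hij.2 (ne_add_one hn j) hwl hw0)⟩
  · intro x hx y hy V hV
    exact ⟨mem_throughPoint_of_span (Gr.left_mem hV) (Gr.left_ne_zero hV) hx,
      mem_meetsLine_of_mem (Gr.right_mem hV) (Gr.right_ne_zero hV) hy⟩

/-- The intersection point of a corner plane with a disjoint edge. -/
theorem NoFourCoplanar.exists_planePoint (hI : NoFourCoplanar Z) (hn : 4 ≤ n) {i j : Fin n}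
    (hij : Disjoint (corner i) (edge j)) : ∃ q : Fin 4 → ℂ, q ≠ 0 ∧
      q ∈ span ℂ {rowPoint Z (i - 1), rowPoint Z i, rowPoint Z (i + 1)} ∧
      q ∈ span ℂ {rowPoint Z j, rowPoint Z (j + 1)} ∧
      ∀ V ∈ inPlane Z i, V ∈ onEdge Z j ↔ q ∈ V.space := by
  have hd := disjoint_corner_edge.1 hij
  set P := span ℂ {rowPoint Z (i - 1), rowPoint Z i, rowPoint Z (i + 1)} with hP
  let U := Gr.ofPair _ _ (hI.linearIndependent_pair hn (ne_add_one hn j))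
  have hU : U.space = span ℂ {rowPoint Z j, rowPoint Z (j + 1)} := Gr.ofPair_space _ _ _
  have hne : U.space ⊓ P ≠ ⊥ := by
    refine Gr.inf_ne_bot (P := ⊤) le_top le_top ?_
    rw [finrank_top, hI.finrank_plane hn]
    simp
  obtain ⟨q, ⟨hqU, hqP⟩, hq0⟩ := (Submodule.ne_bot_iff _).1 hne
  refine ⟨q, hq0, hqP, hU ▸ hqU, fun V hV => ⟨fun h => ?_, fun h => ?_⟩⟩
  · obtain ⟨v, hv, hv0, hvl⟩ := exists_mem_of_mem_meetsLine h
    by_cases hk : ∃ k : ℂ, k • v = q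
    · obtain ⟨k, rfl⟩ := hk
      exact V.space.smul_mem _ hv
    · exfalso
      push Not at hk
      have hle := Gr.space_le_of_mem (V := U) (hU ▸ hvl) hqU
        ((LinearIndependent.pair_iff' hv0).2 hk) (hV hv) hqP
      rcases hI.eq_of_mem_plane (sub_one_ne hn i) (sub_one_ne_add_one hn i) (ne_add_one hn i)
        (hle (Gr.left_mem hU)) with h1 | h1 | h1
      exacts [hd.1 h1.symm, hd.2.2.1 h1.symm, hd.2.2.2.2.1 h1.symm]
  · exact mem_meetsLine_of_mem h hq0 (hU ▸ hqU)

theorem NoFourCoplanar.linearIndependent_planePoint (hI : NoFourCoplanar Z) (hn : 4 ≤ n)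
    {i j a : Fin n} (hij : Disjoint (corner i) (edge j)) (ha : a = i - 1 ∨ a = i ∨ a = i + 1)
    {q : Fin 4 → ℂ} (hq : q ∈ span ℂ {rowPoint Z j, rowPoint Z (j + 1)}) (hq0 : q ≠ 0) :
    LinearIndependent ℂ ![rowPoint Z a, q] := by
  have hd := disjoint_corner_edge.1 hij
  rcases ha with rfl | rfl | rfl
  · exact hI.linearIndependent_of_mem_line hn hd.1 hd.2.1 (ne_add_one hn j) hq hq0
  · exact hI.linearIndependent_of_mem_line hn hd.2.2.1 hd.2.2.2.1 (ne_add_one hn j) hq hq0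
  · exact hI.linearIndependent_of_mem_line hn hd.2.2.2.2.1 hd.2.2.2.2.2 (ne_add_one hn j) hq hq0

theorem NoFourCoplanar.exists_mem_inPlane_onEdge (hI : NoFourCoplanar Z) (hn : 4 ≤ n)
    {i j a : Fin n} (hij : Disjoint (corner i) (edge j)) (ha : a = i - 1 ∨ a = i ∨ a = i + 1) :
    ∃ V ∈ inPlane Z i ∩ onEdge Z j, V ∈ throughPoint Z a := by
  obtain ⟨q, hq0, hqP, hqL, hq⟩ := hI.exists_planePoint hn hij
  have hind := hI.linearIndependent_planePoint hn hij ha hqL hq0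
  have hsp := Gr.ofPair_space _ _ hind
  have hP : Gr.ofPair _ _ hind ∈ inPlane Z i :=
    Gr.space_le_of_mem (Gr.left_mem hsp) (Gr.right_mem hsp) hind (rowPoint_mem_plane ha) hqP
  exact ⟨_, ⟨hP, (hq _ hP).2 (Gr.right_mem hsp)⟩, Gr.left_mem hsp⟩

/-- The locus is a pencil: the first factor consists of the multiples of the point where the edge
pierces the plane, the second is the plane. -/
theorem NoFourCoplanar.isIrreducible_inPlane_inter_onEdge (hI : NoFourCoplanar Z)
    (hn : 4 ≤ n) {i j : Fin n} (hij : Disjoint (corner i) (edge j)) :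
    IsIrreducible (inPlane Z i ∩ onEdge Z j) := by
  refine ⟨?_, Gr.isPreirreducible_of_prod
    (span ℂ {rowPoint Z (i - 1), rowPoint Z i, rowPoint Z (i + 1)} ⊓
      span ℂ {rowPoint Z j, rowPoint Z (j + 1)})
    (span ℂ {rowPoint Z (i - 1), rowPoint Z i, rowPoint Z (i + 1)}) ?_ ?_⟩
  · obtain ⟨V, hV, -⟩ := hI.exists_mem_inPlane_onEdge hn hij (Or.inl rfl)
    exact ⟨V, hV⟩
  · rintro V ⟨hV, hV'⟩
    obtain ⟨w, hw, hw0, hwl⟩ := exists_mem_of_mem_meetsLine hV'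
    obtain ⟨y, hy⟩ := V.exists_space_eq_of_mem hw hw0
    exact ⟨w, ⟨hV hw, hwl⟩, y, hV (Gr.right_mem hy), hy⟩
  · intro x hx y hy V hV
    exact ⟨Gr.space_le_of_mem (Gr.left_mem hV) (Gr.right_mem hV) (V.pair_of_space_eq hV) hx.1 hy,
      mem_meetsLine_of_mem (Gr.left_mem hV) (Gr.left_ne_zero hV) hx.2⟩

/-- The point in which the plane spanned by `x` and the line `ab` meets the line `cd`. -/
noncomputable def transversalPoint (a b c d : Fin 4 → ℂ) : (Fin 4 → ℂ) →ₗ[ℂ] (Fin 4 → ℂ) where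
  toFun x := br x a b d • c - br x a b c • d
  map_add' x y := by
    have h (e : Fin 4 → ℂ) : br (x + y) a b e = br x a b e + br y a b e := by
      simpa using br_add_smul_left x y a b e 1 1
    rw [h, h]
    module
  map_smul' s x := by
    have h (e : Fin 4 → ℂ) : br (s • x) a b e = s * br x a b e := by
      simpa using br_add_smul_left x x a b e s 0
    rw [h, h, RingHom.id_apply]
    module

theorem transversalPoint_apply (a b c d x : Fin 4 → ℂ) :
    transversalPoint a b c d x = br x a b d • c - br x a b c • d := rfl

theorem transversalPoint_mem (a b c d x : Fin 4 → ℂ) :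
    transversalPoint a b c d x ∈ span ℂ {c, d} :=
  mem_span_pair.2 ⟨br x a b d, -br x a b c, by rw [transversalPoint_apply]; module⟩

section Regulus

variable {i j k : Fin n}

/-- If both coefficients vanish, Cramer's rule puts `x` on the line `Z_j Z_{j+1}`, which has no
point in common with the disjoint edge `i`. -/
theorem NoFourCoplanar.transversalPoint_ne_zero (hI : NoFourCoplanar Z) (hn : 4 ≤ n)
    (hij : Disjoint (edge i) (edge j)) (hjk : Disjoint (edge j) (edge k)) {x : Fin 4 → ℂ}
    (hx : x ∈ span ℂ {rowPoint Z i, rowPoint Z (i + 1)}) (hx0 : x ≠ 0) :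
    transversalPoint (rowPoint Z j) (rowPoint Z (j + 1)) (rowPoint Z k) (rowPoint Z (k + 1)) x
      ≠ 0 := by
  obtain ⟨h1, h2, h3⟩ := disjoint_edge_edge.1 hij
  obtain ⟨h4, h5, h6⟩ := disjoint_edge_edge.1 hjk
  intro h
  rw [transversalPoint_apply] at h
  have hk := LinearIndependent.pair_iff.1 (hI.linearIndependent_pair hn (ne_add_one hn k))
  rw [sub_eq_add_neg, ← neg_smul] at h
  obtain ⟨e1, e2⟩ := hk _ _ h
  rw [neg_eq_zero] at e2
  have hne := hI j (j + 1) k (k + 1) (ne_add_one hn j) h4 h5 h6 (by simpa using h4)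
    (ne_add_one hn k)
  have hc := br_cramer x (rowPoint Z j) (rowPoint Z (j + 1)) (rowPoint Z k) (rowPoint Z (k + 1))
  rw [e1, e2, zero_smul, zero_smul, sub_zero, add_zero] at hc
  refine hx0 ?_
  set B := br (rowPoint Z j) (rowPoint Z (j + 1)) (rowPoint Z k) (rowPoint Z (k + 1))
  obtain ⟨α, β, rfl⟩ := mem_span_pair.1 hx
  set x' := α • rowPoint Z i + β • rowPoint Z (i + 1)
  have := hI.rel (ne_add_one hn i) h1 h2 h3 (by simpa using h1) (ne_add_one hn j)
    (α := B * α) (β := B * β)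
    (γ := -br x' (rowPoint Z (j + 1)) (rowPoint Z k) (rowPoint Z (k + 1)))
    (δ := br x' (rowPoint Z j) (rowPoint Z k) (rowPoint Z (k + 1))) (by
      rw [← hc]
      simp only [x']
      module)
  have hα : α = 0 := (mul_eq_zero.1 this.1).resolve_left hne
  have hβ : β = 0 := (mul_eq_zero.1 this.2.1).resolve_left hne
  simp [x', hα, hβ]

/-- A line through `x` that meets edge `j` lies in the plane spanned by `x` and that edge, and this
plane cuts edge `k` in the transversal point. So the point `x` determines the transversal. -/
theorem NoFourCoplanar.transversalPoint_mem_space_iff (hI : NoFourCoplanar Z) (hn : 4 ≤ n)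
    (hij : Disjoint (edge i) (edge j)) (hik : Disjoint (edge i) (edge k))
    (hjk : Disjoint (edge j) (edge k)) {x : Fin 4 → ℂ}
    (hx : x ∈ span ℂ {rowPoint Z i, rowPoint Z (i + 1)}) (hx0 : x ≠ 0) {V : Gr ℂ 4}
    (hV : x ∈ V.space) : V ∈ onEdge Z j ∩ onEdge Z k ↔
      transversalPoint (rowPoint Z j) (rowPoint Z (j + 1)) (rowPoint Z k) (rowPoint Z (k + 1)) x
        ∈ V.space := by
  obtain ⟨h1, h2, h3⟩ := disjoint_edge_edge.1 hik
  have hind {y : Fin 4 → ℂ} (hy : y ∈ span ℂ {rowPoint Z k, rowPoint Z (k + 1)}) (hy0 : y ≠ 0) :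
      LinearIndependent ℂ ![x, y] := hI.linearIndependent_of_mem_lines
        (ne_add_one hn i) h1 h2 h3 (by simpa using h1) (ne_add_one hn k) hx hy hx0 hy0
  have hmeet := Gr.mem_incident_iff_inf_ne_bot (V := V)
    (hI.linearIndependent_pair hn (ne_add_one hn j))
  set a := rowPoint Z j
  set b := rowPoint Z (j + 1)
  set c := rowPoint Z k
  set d := rowPoint Z (k + 1)
  constructor
  · rintro ⟨hVj, hVk⟩
    obtain ⟨y, hy, hy0, hyk⟩ := exists_mem_of_mem_meetsLine hVk
    have h0 : br x y a b = 0 :=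
      (Gr.mem_incident_iff (V.space_eq_of_mem hV hy (hind hyk hy0))).1 (hmeet.2 hVj)
    obtain ⟨γ, δ, rfl⟩ := mem_span_pair.1 hyk
    have h0' : γ * br x a b c + δ * br x a b d = 0 := by
      rw [← h0]
      simp only [br_apply, Pi.add_apply, Pi.smul_apply, smul_eq_mul]
      ring
    rw [transversalPoint_apply]
    by_cases hγ : γ = 0
    · have hδ : δ ≠ 0 := by
        rintro rfl
        simp [hγ] at hy0
      have : br x a b d = 0 := by simpa [hγ, hδ] using h0'
      rw [this, zero_smul, zero_sub, ← neg_smul]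
      rw [hγ, zero_smul, zero_add, V.space.smul_mem_iff hδ] at hy
      exact V.space.smul_mem _ hy
    · have : br x a b d • c - br x a b c • d = (br x a b d * γ⁻¹) • (γ • c + δ • d) := by
        have e : br x a b c = -(br x a b d * γ⁻¹ * δ) := by
          field_simp
          linear_combination h0'
        rw [e, smul_add, smul_smul, smul_smul, inv_mul_cancel_right₀ hγ]
        module
      rw [this]
      exact V.space.smul_mem _ hy
  · intro hy
    have hyk := transversalPoint_mem a b c d x
    have hy0 := hI.transversalPoint_ne_zero hn hij hjk hx hx0
    refine ⟨hmeet.1 ?_, mem_meetsLine_of_mem hy hy0 hyk⟩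
    rw [Gr.mem_incident_iff (V.space_eq_of_mem hV hy (hind hyk hy0)), transversalPoint_apply]
    simp only [br_apply, Pi.sub_apply, Pi.smul_apply, smul_eq_mul]
    ring

theorem NoFourCoplanar.linearIndependent_transversalPoint (hI : NoFourCoplanar Z) (hn : 4 ≤ n)
    (hij : Disjoint (edge i) (edge j)) (hik : Disjoint (edge i) (edge k))
    (hjk : Disjoint (edge j) (edge k)) {x : Fin 4 → ℂ}
    (hx : x ∈ span ℂ {rowPoint Z i, rowPoint Z (i + 1)}) (hx0 : x ≠ 0) :
    LinearIndependent ℂ ![x, transversalPoint (rowPoint Z j) (rowPoint Z (j + 1)) (rowPoint Z k)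
      (rowPoint Z (k + 1)) x] := by
  obtain ⟨h1, h2, h3⟩ := disjoint_edge_edge.1 hik
  exact hI.linearIndependent_of_mem_lines
        (ne_add_one hn i) h1 h2 h3 (by simpa using h1) (ne_add_one hn k) hx
        (transversalPoint_mem _ _ _ _ _) hx0 (hI.transversalPoint_ne_zero hn hij hjk hx hx0)

/-- Three pairwise disjoint edges have a unique common transversal through each point of the
first one. -/
theorem NoFourCoplanar.exists_transversal (hI : NoFourCoplanar Z) (hn : 4 ≤ n)
    (hij : Disjoint (edge i) (edge j)) (hik : Disjoint (edge i) (edge k))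
    (hjk : Disjoint (edge j) (edge k)) {x : Fin 4 → ℂ}
    (hx : x ∈ span ℂ {rowPoint Z i, rowPoint Z (i + 1)}) (hx0 : x ≠ 0) :
    ∃ V ∈ onEdge Z i ∩ onEdge Z j ∩ onEdge Z k, x ∈ V.space := by
  have hsp := Gr.ofPair_space _ _ (hI.linearIndependent_transversalPoint hn hij hik hjk hx hx0)
  have := (hI.transversalPoint_mem_space_iff hn hij hik hjk hx hx0 (Gr.left_mem hsp)).2
    (Gr.right_mem hsp)
  exact ⟨_, ⟨⟨mem_meetsLine_of_mem (Gr.left_mem hsp) hx0 hx, this.1⟩, this.2⟩, Gr.left_mem hsp⟩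

/-- The transversal point depends linearly on `x`, so the spanning pairs form the graph of a linear
map over the first edge. This is a linear family, although not a product as for the other loci. -/
theorem NoFourCoplanar.isIrreducible_regulus (hI : NoFourCoplanar Z) (hn : 4 ≤ n)
    (hij : Disjoint (edge i) (edge j)) (hik : Disjoint (edge i) (edge k))
    (hjk : Disjoint (edge j) (edge k)) :
    IsIrreducible (onEdge Z i ∩ onEdge Z j ∩ onEdge Z k) := by
  constructor
  · obtain ⟨V, hV, -⟩ := hI.exists_transversal hn hij hik hjk (x := rowPoint Z i)
      (subset_span (by simp)) (hI.ne_zero hn i)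
    exact ⟨V, hV⟩
  · set Φ := transversalPoint (rowPoint Z j) (rowPoint Z (j + 1)) (rowPoint Z k)
      (rowPoint Z (k + 1)) with hΦ
    have : onEdge Z i ∩ onEdge Z j ∩ onEdge Z k = Gr.family
        ((span ℂ {rowPoint Z i, rowPoint Z (i + 1)}).map (LinearMap.id.prod Φ)) := by
      ext V
      constructor
      · rintro ⟨⟨hi, hj⟩, hk⟩
        obtain ⟨x, hx, hx0, hxl⟩ := exists_mem_of_mem_meetsLine hi
        have := (hI.transversalPoint_mem_space_iff hn hij hik hjk hxl hx0 hx).1 ⟨hj, hk⟩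
        exact ⟨_, mem_map_of_mem hxl, V.space_eq_of_mem hx this
          (hI.linearIndependent_transversalPoint hn hij hik hjk hxl hx0)⟩
      · rintro ⟨_, ⟨x, hx, rfl⟩, hV⟩
        change V.space = span ℂ {x, Φ x} at hV
        have hx0 := Gr.left_ne_zero hV
        have := (hI.transversalPoint_mem_space_iff hn hij hik hjk hx hx0 (Gr.left_mem hV)).2
          (Gr.right_mem hV)
        exact ⟨⟨mem_meetsLine_of_mem (Gr.left_mem hV) hx0 hx, this.1⟩, this.2⟩
    rw [this]
    exact Gr.isPreirreducible_family _

end Regulus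

/-! ### Loci consisting of one line -/

theorem Gr.exists_forall_mem_iff {x y : Fin 4 → ℂ} (h : LinearIndependent ℂ ![x, y]) :
    ∃ U : Gr ℂ 4, ∀ V : Gr ℂ 4, x ∈ V.space ∧ y ∈ V.space ↔ V = U := by
  have hsp := ofPair_space _ _ h
  refine ⟨ofPair x y h, fun V => ⟨fun hV => ?_, ?_⟩⟩
  · exact (eq_of_space_le (space_le_of_mem (left_mem hsp) (right_mem hsp) h hV.1 hV.2)).symm
  · rintro rfl
    exact ⟨left_mem hsp, right_mem hsp⟩

/-- Two planes meet in a unique line. -/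
theorem Gr.exists_forall_le_iff {P Q : Submodule ℂ (Fin 4 → ℂ)} (hP : Module.finrank ℂ P = 3)
    (hQ : Module.finrank ℂ Q = 3) (h : ¬ P ≤ Q) :
    ∃ U : Gr ℂ 4, ∀ V : Gr ℂ 4, V.space ≤ P ∧ V.space ≤ Q ↔ V = U := by
  have h1 := Submodule.finrank_sup_add_finrank_inf_eq P Q
  have h2 : Module.finrank ℂ ↥(P ⊔ Q) ≤ 4 := (Submodule.finrank_le _).trans (by simp)
  have h3 : Q < P ⊔ Q := lt_of_le_of_ne le_sup_right fun he => h (he ▸ le_sup_left)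
  have h4 := Submodule.finrank_lt_finrank_of_lt h3
  refine ⟨⟨P ⊓ Q, by omega⟩, fun V => ⟨fun hV => ?_, ?_⟩⟩
  · exact eq_of_space_le (le_inf hV.1 hV.2)
  · rintro rfl
    exact ⟨inf_le_left, inf_le_right⟩

theorem NoFourCoplanar.join_eq_singleton (hI : NoFourCoplanar Z) (hn : 4 ≤ n) {i j : Fin n}
    (hij : i ≠ j) : ∃ U, throughPoint Z i ∩ throughPoint Z j = {U} := by
  obtain ⟨U, hU⟩ := Gr.exists_forall_mem_iff (hI.linearIndependent_pair hn hij)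
  exact ⟨U, Set.ext hU⟩

theorem NoFourCoplanar.inPlane_inter_inPlane_eq_singleton (hI : NoFourCoplanar Z) (hn : 4 ≤ n)
    {i j : Fin n} (hij : Disjoint (corner i) (corner j)) :
    ∃ U, inPlane Z i ∩ inPlane Z j = {U} := by
  obtain ⟨U, hU⟩ := Gr.exists_forall_le_iff (hI.finrank_plane hn i) (hI.finrank_plane hn j) (by
    intro hle
    have hd := (disjoint_corner_corner.1 hij).2.1
    have := hI.eq_of_mem_plane (sub_one_ne hn j) (sub_one_ne_add_one hn j) (ne_add_one hn j)
      (hle (rowPoint_mem_plane (Or.inr (Or.inl rfl))))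
    tauto)
  exact ⟨U, Set.ext hU⟩

theorem NoFourCoplanar.throughPoint_inter_inPlane_inter_onEdge_eq_singleton
    (hI : NoFourCoplanar Z) (hn : 4 ≤ n) {i j : Fin n} (hij : Disjoint (corner i) (edge j)) :
    ∃ U, throughPoint Z i ∩ inPlane Z i ∩ onEdge Z j = {U} := by
  obtain ⟨q, hq0, hqP, hqL, hq⟩ := hI.exists_planePoint hn hij
  have hind := hI.linearIndependent_planePoint hn hij (Or.inr (Or.inl rfl)) hqL hq0
  obtain ⟨U, hU⟩ := Gr.exists_forall_mem_iff hind
  refine ⟨U, Set.ext fun V => ?_⟩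
  rw [Set.mem_singleton_iff, ← hU]
  constructor
  · rintro ⟨⟨h1, h2⟩, h3⟩
    exact ⟨h1, (hq V h2).1 h3⟩
  · rintro ⟨h1, h2⟩
    have hP : V ∈ inPlane Z i :=
      Gr.space_le_of_mem h1 h2 hind (rowPoint_mem_plane (Or.inr (Or.inl rfl))) hqP
    exact ⟨⟨h1, hP⟩, (hq V hP).2 h2⟩

/-- The line is the intersection of the planes spanned by `Z_i` and either edge. -/
theorem NoFourCoplanar.throughPoint_inter_onEdge_inter_onEdge_eq_singleton
    (hI : NoFourCoplanar Z) (hn : 4 ≤ n) {i j k : Fin n} (hjk : Disjoint (edge j) (edge k))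
    (hij : i ∉ edge j) (hik : i ∉ edge k) :
    ∃ U, throughPoint Z i ∩ onEdge Z j ∩ onEdge Z k = {U} := by
  rw [mem_edge, not_or] at hij hik
  obtain ⟨h1, h2, h3⟩ := disjoint_edge_edge.1 hjk
  obtain ⟨U, hU⟩ := Gr.exists_forall_le_iff
    (hI.finrank_triple hn hij.1 hij.2 (ne_add_one hn j))
    (hI.finrank_triple hn hik.1 hik.2 (ne_add_one hn k)) (by
      intro hle
      have := hI.eq_of_mem_plane hik.1 hik.2 (ne_add_one hn k)
        (hle (subset_span (by simp) : rowPoint Z j ∈ _))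
      rcases this with h | h | h
      exacts [hij.1 h.symm, h1 h, h2 h])
  -- If `Z_i` were not on `U`, then `U` and `Z_i` would together span both planes, which would then
  -- coincide.
  have hUi : U ∈ throughPoint Z i := by
    by_contra hUi
    have hle := (hU U).2 rfl
    obtain ⟨x, y, hxy⟩ := U.exists_space_eq_span
    have hlt : U.space < U.space ⊔ span ℂ {rowPoint Z i} := lt_of_le_of_ne le_sup_left
      fun he => hUi (by
        rw [mem_throughPoint, he]
        exact mem_sup_right (mem_span_singleton_self _))
    have hf := Submodule.finrank_lt_finrank_of_lt hlt
    have hz : ∀ a b, span ℂ {rowPoint Z i} ≤ span ℂ {rowPoint Z i, rowPoint Z a, rowPoint Z b} :=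
      fun a b => span_mono (by simp)
    have hj := Submodule.eq_of_le_of_finrank_le (sup_le hle.1 (hz _ _)) (by
      rw [hI.finrank_triple hn hij.1 hij.2 (ne_add_one hn j)]
      have := U.finrank_space
      omega)
    have hle2 := sup_le hle.2 (hz _ _)
    rw [hj] at hle2
    have := hI.eq_of_mem_plane hik.1 hik.2 (ne_add_one hn k)
      (hle2 (subset_span (by simp) : rowPoint Z j ∈ _))
    rcases this with h | h | h
    exacts [hij.1 h.symm, h1 h, h2 h]
  refine ⟨U, Set.ext fun V => ?_⟩
  rw [Set.mem_singleton_iff]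
  constructor
  · rintro ⟨⟨h1, h2⟩, h3⟩
    exact (hU V).1 ⟨(hI.meets_iff_le hn hij.1 hij.2 (ne_add_one hn j) h1).1 h2,
      (hI.meets_iff_le hn hik.1 hik.2 (ne_add_one hn k) h1).1 h3⟩
  · rintro rfl
    have hle := (hU V).2 rfl
    exact ⟨⟨hUi, (hI.meets_iff_le hn hij.1 hij.2 (ne_add_one hn j) hUi).2 hle.1⟩,
      (hI.meets_iff_le hn hik.1 hik.2 (ne_add_one hn k) hUi).2 hle.2⟩

/-- The line joins the two points in which the edges pierce the plane; these differ because the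
edges are disjoint. -/
theorem NoFourCoplanar.inPlane_inter_onEdge_inter_onEdge_eq_singleton
    (hI : NoFourCoplanar Z) (hn : 4 ≤ n) {i j k : Fin n} (hij : Disjoint (corner i) (edge j))
    (hik : Disjoint (corner i) (edge k)) (hjk : Disjoint (edge j) (edge k)) :
    ∃ U, inPlane Z i ∩ onEdge Z j ∩ onEdge Z k = {U} := by
  obtain ⟨q, hq0, hqP, hqL, hq⟩ := hI.exists_planePoint hn hij
  obtain ⟨r, hr0, hrP, hrL, hr⟩ := hI.exists_planePoint hn hik
  obtain ⟨h1, h2, h3⟩ := disjoint_edge_edge.1 hjk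
  have hind := hI.linearIndependent_of_mem_lines (ne_add_one hn j) h1 h2 h3 (by simpa using h1)
    (ne_add_one hn k) hqL hrL hq0 hr0
  obtain ⟨U, hU⟩ := Gr.exists_forall_mem_iff hind
  refine ⟨U, Set.ext fun V => ?_⟩
  rw [Set.mem_singleton_iff, ← hU]
  constructor
  · rintro ⟨⟨h1, h2⟩, h3⟩
    exact ⟨(hq V h1).1 h2, (hr V h1).1 h3⟩
  · rintro ⟨h1, h2⟩
    have hP : V ∈ inPlane Z i := Gr.space_le_of_mem h1 h2 hind hqP hrP
    exact ⟨⟨hP, (hq V hP).2 h1⟩, (hr V hP).2 h2⟩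

end Loci

/-! ### Positivity -/

section Brackets

variable {K : Type} [Field K]

theorem br_last_sum (p q a b c d : Fin 4 → K) (α β γ δ ε : K) :
    br p q a (α • p - β • q + γ • b - δ • c + ε • d) =
      γ * br p q a b - δ * br p q a c + ε * br p q a d := by
  simp only [br_apply, Pi.add_apply, Pi.sub_apply, Pi.smul_apply, smul_eq_mul]
  ring

/-- The three-term Plücker relation. -/
theorem br_plucker (p q a b c d : Fin 4 → K) :
    br p q a b * br p q c d - br p q a c * br p q b d + br p q a d * br p q b c = 0 := by
  have h := br_last_sum p q a b c d (br q b c d) (br p b c d) (br p q c d) (br p q b d)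
    (br p q b c)
  rw [br_cramer p q b c d] at h
  have h0 : br p q a 0 = 0 := by
    simp only [br_apply, Pi.zero_apply]
    ring
  rw [h0] at h
  linear_combination -h

theorem br_neg₁ (a b c d : Fin 4 → K) : br (-a) b c d = -br a b c d := by
  simp only [br_apply, Pi.neg_apply]
  ring

theorem br_neg₂ (a b c d : Fin 4 → K) : br a (-b) c d = -br a b c d := by
  simp only [br_apply, Pi.neg_apply]
  ring

theorem br_neg₃ (a b c d : Fin 4 → K) : br a b (-c) d = -br a b c d := by
  simp only [br_apply, Pi.neg_apply]
  ring

theorem br_neg₄ (a b c d : Fin 4 → K) : br a b c (-d) = -br a b c d := by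
  simp only [br_apply, Pi.neg_apply]
  ring

end Brackets

theorem mul_pos_of_mul_pos {ε x y : ℝ} (hx : 0 < ε * x) (hy : 0 < ε * y) : 0 < x * y := by
  have h := mul_pos hx hy
  have hε : 0 < ε * ε := mul_self_pos.2 (left_ne_zero_of_mul hx.ne')
  refine pos_of_mul_pos_right (a := ε * ε) ?_ hε.le
  linarith [mul_mul_mul_comm ε x ε y]

/-- A vector of `ℝ⁴` as a vector of `ℂ⁴`. -/
def complexify (v : Fin 4 → ℝ) : Fin 4 → ℂ := fun k => (v k : ℂ)

theorem br_complexify (a b c d : Fin 4 → ℝ) :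
    br (complexify a) (complexify b) (complexify c) (complexify d) =
    ((br a b c d : ℝ) : ℂ) := by
  simp only [br_apply, complexify]
  push_cast
  ring

theorem rowPoint_eq_complexify {n : ℕ} (Z : Matrix (Fin n) (Fin 4) ℝ) (i : Fin n) :
    rowPoint Z i = complexify (Z i) := rfl

theorem complexify_neg (v : Fin 4 → ℝ) : complexify (-v) = -complexify v := by
  ext k
  simp [complexify]

section Hexagon

/-- The alternating edges of a convex hexagon are not concurrent. -/
theorem br_hexagon_pos {ε : ℝ} {p v₁ v₂ v₃ v₄ v₅ v₆ : Fin 4 → ℝ}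
    (h456 : 0 < ε * br p v₄ v₅ v₆)
    (h346 : 0 < ε * br p v₃ v₄ v₆) (h234 : 0 < ε * br p v₂ v₃ v₄) (h136 : 0 < ε * br p v₁ v₃ v₆)
    (h236 : 0 < ε * br p v₂ v₃ v₆) (h146 : 0 < ε * br p v₁ v₄ v₆) (h345 : 0 < ε * br p v₃ v₄ v₅) :
    0 < br p v₁ v₄ v₅ * br p v₂ v₃ v₆ - br p v₁ v₂ v₃ * br p v₄ v₅ v₆ := by
  -- The relations `e1` and `e2` are three-term Plücker relations with common vectors `p, v₃` and
  -- `p, v₄`, reordered so that every bracket starts with `p`, followed by increasing indices.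
  have e1 : br p v₁ v₃ v₄ * br p v₂ v₃ v₆ - br p v₁ v₂ v₃ * br p v₃ v₄ v₆ =
      br p v₂ v₃ v₄ * br p v₁ v₃ v₆ := by
    have := br_plucker p v₃ v₁ v₂ v₄ v₆
    rw [br_swap₂₃ p v₁ v₃ v₄, br_swap₂₃ p v₁ v₃ v₆, br_swap₂₃ p v₂ v₃ v₄, br_swap₂₃ p v₂ v₃ v₆,
      br_swap₂₃ p v₁ v₃ v₂, br_swap₃₄ p v₁ v₂ v₃] at this
    linear_combination -this
  have e2 : br p v₁ v₄ v₅ * br p v₃ v₄ v₆ - br p v₁ v₃ v₄ * br p v₄ v₅ v₆ =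
      br p v₁ v₄ v₆ * br p v₃ v₄ v₅ := by
    have := br_plucker p v₄ v₁ v₃ v₅ v₆
    rw [br_swap₂₃ p v₁ v₄ v₅, br_swap₂₃ p v₁ v₄ v₆, br_swap₂₃ p v₃ v₄ v₅, br_swap₂₃ p v₃ v₄ v₆,
      br_swap₂₃ p v₁ v₄ v₃, br_swap₃₄ p v₁ v₃ v₄] at this
    linear_combination -this
  -- Eliminating `⟨p v₁ v₃ v₄⟩` from the two relations writes the difference, up to a square, as a
  -- sum of products of brackets of equal sign.
  have h : br p v₃ v₄ v₆ ^ 2 *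
      (br p v₁ v₄ v₅ * br p v₂ v₃ v₆ - br p v₁ v₂ v₃ * br p v₄ v₅ v₆) =
      (br p v₃ v₄ v₆ * br p v₄ v₅ v₆) * (br p v₂ v₃ v₄ * br p v₁ v₃ v₆) +
      (br p v₃ v₄ v₆ * br p v₂ v₃ v₆) * (br p v₁ v₄ v₆ * br p v₃ v₄ v₅) := by
    rw [← e1, ← e2]
    ring
  have hp : 0 < br p v₃ v₄ v₆ ^ 2 := by
    have := right_ne_zero_of_mul h346.ne'
    positivity
  refine pos_of_mul_pos_right ?_ hp.le
  rw [h]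
  exact add_pos (mul_pos (mul_pos_of_mul_pos h346 h456) (mul_pos_of_mul_pos h234 h136))
    (mul_pos (mul_pos_of_mul_pos h346 h236) (mul_pos_of_mul_pos h146 h345))

end Hexagon

/-! ### Cyclic positivity -/

section CyclicPositivity

variable {n : ℕ} [NeZero n] {Z : Matrix (Fin n) (Fin 4) ℝ}

/-- The rows of `Z`, continued with period `n` up to sign. -/
def cyclicRow (Z : Matrix (Fin n) (Fin 4) ℝ) (m : ℕ) : Fin 4 → ℝ :=
  (-1 : ℝ) ^ (m / n) • Z (Fin.ofNat n m)

theorem cyclicRow_of_lt (i : Fin n) : cyclicRow Z i = Z i := by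
  rw [cyclicRow, Nat.div_eq_of_lt i.isLt, pow_zero, one_smul, Fin.ofNat_val_eq_self]

theorem cyclicRow_add (m : ℕ) : cyclicRow Z (m + n) = -cyclicRow Z m := by
  have h : Fin.ofNat n (m + n) = Fin.ofNat n m := by
    ext
    simp [Fin.ofNat]
  rw [cyclicRow, cyclicRow, h, Nat.add_div_right _ (NeZero.pos n), pow_succ]
  simp

/-- All cyclically ordered brackets have the sign of `ε`. -/
def CyclicallyPositive (Z : Matrix (Fin n) (Fin 4) ℝ) (ε : ℝ) : Prop :=
  ∀ a b c d : ℕ, a < b → b < c → c < d → d < a + n →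
    0 < ε * br (cyclicRow Z a) (cyclicRow Z b) (cyclicRow Z c) (cyclicRow Z d)

theorem TotallyPositive.exists_pos (hn : 4 ≤ n) (hZ : TotallyPositive Z) :
    ∃ ε : ℝ, ∀ a b c d : Fin n, a < b → b < c → c < d → 0 < ε * br (Z a) (Z b) (Z c) (Z d) := by
  refine ⟨(Z.submatrix (Fin.castLE hn) id).det, fun a b c d hab hbc hcd => ?_⟩
  have h := hZ (Fin.castLE hn) ![a, b, c, d] (Fin.strictMono_castLE hn) (by
    intro i j hij
    fin_cases i <;> fin_cases j <;> first
      | exact absurd hij (by decide)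
      | assumption
      | exact hab.trans hbc
      | exact hbc.trans hcd
      | exact (hab.trans hbc).trans hcd)
  have e : Z.submatrix ![a, b, c, d] id = Matrix.of ![Z a, Z b, Z c, Z d] := by
    ext i j
    fin_cases i <;> rfl
  rwa [e] at h

/-- A row taken from the next period is minus an original row, and moving the last vector to the
front is an odd permutation of four vectors. The two signs cancel, however many of the indices have
passed `n`. -/
theorem TotallyPositive.cyclicallyPositive (hn : 4 ≤ n) (hZ : TotallyPositive Z) :
    ∃ ε, CyclicallyPositive Z ε := by
  obtain ⟨ε, hε⟩ := hZ.exists_pos hn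
  refine ⟨ε, fun a => ?_⟩
  induction a using Nat.strong_induction_on with
  | _ a ih =>
  intro b c d hab hbc hcd hda
  have hlow : ∀ m, m < n → ∃ i : Fin n, i.val = m ∧ cyclicRow Z m = Z i := fun m hm =>
    ⟨⟨m, hm⟩, rfl, cyclicRow_of_lt ⟨m, hm⟩⟩
  have hhigh : ∀ m, n ≤ m → m < 2 * n → ∃ i : Fin n, i.val + n = m ∧ cyclicRow Z m = -Z i := by
    intro m hm hm'
    refine ⟨⟨m - n, by omega⟩, by simp; omega, ?_⟩
    rw [← cyclicRow_of_lt (Z := Z) ⟨m - n, by omega⟩, ← cyclicRow_add]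
    simp only
    rw [Nat.sub_add_cancel hm]
  rcases Nat.lt_or_ge a n with ha | ha
  · obtain ⟨a', ha', ea⟩ := hlow a ha
    rw [ea]
    rcases Nat.lt_or_ge b n with hb | hb
    · obtain ⟨b', hb', eb⟩ := hlow b hb
      rw [eb]
      rcases Nat.lt_or_ge c n with hc | hc
      · obtain ⟨c', hc', ec⟩ := hlow c hc
        rw [ec]
        rcases Nat.lt_or_ge d n with hd | hd
        · obtain ⟨d', hd', ed⟩ := hlow d hd
          rw [ed]
          exact hε _ _ _ _ (by omega) (by omega) (by omega)
        · obtain ⟨d', hd', ed⟩ := hhigh d hd (by omega)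
          rw [ed, br_neg₄, br_rotate (Z d') (Z a') (Z b') (Z c'), neg_neg]
          exact hε _ _ _ _ (by omega) (by omega) (by omega)
      · obtain ⟨c', hc', ec⟩ := hhigh c hc (by omega)
        obtain ⟨d', hd', ed⟩ := hhigh d (by omega) (by omega)
        rw [ec, ed, br_neg₃, br_neg₄, neg_neg, br_swap_pairs (Z c') (Z d') (Z a') (Z b')]
        exact hε _ _ _ _ (by omega) (by omega) (by omega)
    · obtain ⟨b', hb', eb⟩ := hhigh b hb (by omega)
      obtain ⟨c', hc', ec⟩ := hhigh c (by omega) (by omega)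
      obtain ⟨d', hd', ed⟩ := hhigh d (by omega) (by omega)
      rw [eb, ec, ed, br_neg₂, br_neg₃, br_neg₄, neg_neg,
        ← br_rotate (Z a') (Z b') (Z c') (Z d')]
      exact hε _ _ _ _ (by omega) (by omega) (by omega)
  -- All four indices are beyond the first period. Shifting them back changes four signs, which
  -- cancel in the bracket.
  · obtain ⟨a', rfl⟩ : ∃ k, a = k + n := ⟨a - n, by omega⟩
    obtain ⟨b', rfl⟩ : ∃ k, b = k + n := ⟨b - n, by omega⟩
    obtain ⟨c', rfl⟩ : ∃ k, c = k + n := ⟨c - n, by omega⟩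
    obtain ⟨d', rfl⟩ : ∃ k, d = k + n := ⟨d - n, by omega⟩
    have := ih a' (by have := NeZero.pos n; omega) b' c' d' (by omega) (by omega) (by omega)
      (by omega)
    simpa only [cyclicRow_add, br_neg₁, br_neg₂, br_neg₃, br_neg₄, neg_neg] using this

theorem ofNat_add_one (m : ℕ) : Fin.ofNat n (m + 1) = Fin.ofNat n m + 1 := by
  ext
  simp [Fin.ofNat, Fin.val_add]

theorem ofNat_add_self_sub_one (i : Fin n) : Fin.ofNat n (i.val + n - 1) = i - 1 := by
  rw [eq_sub_iff_add_eq, ← ofNat_add_one]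
  have := NeZero.pos n
  rw [Nat.sub_add_cancel (by omega)]
  ext
  simp [Fin.ofNat, Nat.mod_eq_of_lt i.isLt]

theorem exists_lift (i x : Fin n) : ∃ m, i.val ≤ m ∧ m < i.val + n ∧ Fin.ofNat n m = x := by
  have hi := i.isLt
  have hx := x.isLt
  rcases Nat.lt_or_ge x.val i.val with h | h
  · refine ⟨x.val + n, by omega, by omega, ?_⟩
    ext
    simp [Fin.ofNat, Nat.mod_eq_of_lt x.isLt]
  · exact ⟨x.val, h, by omega, Fin.ofNat_val_eq_self x⟩

/-- The sign introduced by the periodic continuation does not affect incidences, so cyclic rows may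
stand for the points themselves. -/
theorem complexify_cyclicRow_mem_iff (W : Submodule ℂ (Fin 4 → ℂ)) (m : ℕ) :
    complexify (cyclicRow Z m) ∈ W ↔ rowPoint Z (Fin.ofNat n m) ∈ W := by
  rw [cyclicRow, rowPoint_eq_complexify]
  rcases neg_one_pow_eq_or ℝ (m / n) with h | h
  · rw [h, one_smul]
  · rw [h, neg_smul, one_smul, complexify_neg, neg_mem_iff]

theorem span_complexify_cyclicRow (a b : ℕ) :
    span ℂ {complexify (cyclicRow Z a), complexify (cyclicRow Z b)} =
      span ℂ {rowPoint Z (Fin.ofNat n a), rowPoint Z (Fin.ofNat n b)} := by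
  apply le_antisymm <;> rw [span_le]
  · rintro _ (rfl | rfl) <;> rw [SetLike.mem_coe, complexify_cyclicRow_mem_iff] <;>
      exact subset_span (by simp)
  · rintro _ (rfl | rfl) <;> rw [SetLike.mem_coe, ← complexify_cyclicRow_mem_iff] <;>
      exact subset_span (by simp)

/-- Sorting the four indices changes the determinant by the sign of a permutation, and for
increasing indices it is nonzero. -/
theorem TotallyPositive.noFourCoplanar (hn : 4 ≤ n) (hZ : TotallyPositive Z) :
    NoFourCoplanar Z := by
  obtain ⟨ε, hε⟩ := hZ.exists_pos hn
  intro a b c d hab hac had hbc hbd hcd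
  rw [rowPoint_eq_complexify, rowPoint_eq_complexify, rowPoint_eq_complexify,
    rowPoint_eq_complexify, br_complexify, Complex.ofReal_ne_zero]
  let f : Fin 4 → Fin n := ![a, b, c, d]
  have hf : Function.Injective f := by
    intro i j hij
    fin_cases i <;> fin_cases j <;> simp_all [f]
  let g := f ∘ Tuple.sort f
  have hg : StrictMono g :=
    (Tuple.monotone_sort f).strictMono_of_injective (hf.comp (Tuple.sort f).injective)
  have h := hε _ _ _ _ (hg (show (0 : Fin 4) < 1 by decide)) (hg (show (1 : Fin 4) < 2 by decide))
    (hg (show (2 : Fin 4) < 3 by decide))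
  have e1 : br (Z a) (Z b) (Z c) (Z d) = (Z.submatrix f id).det := by
    have : Z.submatrix f id = Matrix.of ![Z a, Z b, Z c, Z d] := by
      ext i j
      fin_cases i <;> rfl
    rw [this, br]
  have e2 : br (Z (g 0)) (Z (g 1)) (Z (g 2)) (Z (g 3)) = (Z.submatrix g id).det := by
    have : Z.submatrix g id = Matrix.of ![Z (g 0), Z (g 1), Z (g 2), Z (g 3)] := by
      ext i j
      fin_cases i <;> rfl
    rw [this, br]
  have e3 : Z.submatrix g id = (Z.submatrix f id).submatrix (Tuple.sort f) id := rfl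
  rw [e2, e3, Matrix.det_permute] at h
  rw [e1]
  exact right_ne_zero_of_mul (right_ne_zero_of_mul h.ne')

/-- Seen from `Z_i`, the remaining points in cyclic order form a convex polygon. A line through
`Z_i` in its corner plane becomes a point on the side joining the neighbours `Z_{i+1}` and
`Z_{i-1}`; if it met two further disjoint edges, three alternating edge lines of a convex hexagon
would be concurrent. -/
theorem CyclicallyPositive.not_meets {ε : ℝ} (hI : NoFourCoplanar Z) (hc : CyclicallyPositive Z ε)
    (hn : 4 ≤ n) {i j k : Fin n} (hij : Disjoint (corner i) (edge j))
    (hik : Disjoint (corner i) (edge k)) (hjk : Disjoint (edge j) (edge k)) {V : Gr ℂ 4}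
    (h : V ∈ throughPoint Z i) (hP : V ∈ inPlane Z i) (hj : V ∈ onEdge Z j)
    (hk : V ∈ onEdge Z k) : False := by
  obtain ⟨mj, hj1, hj2, rfl⟩ := exists_lift i j
  obtain ⟨mk, hk1, hk2, rfl⟩ := exists_lift i k
  wlog hlt : mj < mk generalizing mj mk
  · rcases Nat.lt_or_ge mk mj with h' | h'
    · exact this mk hk1 hk2 hik hk mj hj1 hj2 hij hj hjk.symm h'
    · have : mj = mk := by omega
      subst this
      exact (disjoint_edge_edge.1 hjk).1 rfl
  have dj := disjoint_corner_edge.1 hij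
  have dk := disjoint_corner_edge.1 hik
  have djk := disjoint_edge_edge.1 hjk
  have ei : Fin.ofNat n i.val = i := Fin.ofNat_val_eq_self i
  have ei' := ofNat_add_self_sub_one i
  rw [← ofNat_add_one] at dj dk djk
  have a1 : mj ≠ i.val := fun e => dj.2.2.1 (by rw [e, ei])
  have a2 : mj ≠ i.val + 1 := fun e => dj.2.2.2.2.1 (by rw [e, ofNat_add_one, ei])
  have a3 : mk ≠ i.val + n - 1 := fun e => dk.1 (by rw [e, ei'])
  have a4 : mk + 1 ≠ i.val + n - 1 := fun e => dk.2.1 (by rw [e, ei'])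
  have a5 : mk ≠ mj + 1 := fun e => djk.2.2 (by rw [← ofNat_add_one, e])
  -- The line is spanned by `Z_i` and a point `α Z_{i-1} + β Z_{i+1}`. Each of the two edges gives a
  -- linear equation for `α` and `β`.
  have hmeet : V ∈ meetsLine Z (i - 1) (i + 1) := by
    have := (hI.throughPoint_inter_meetsLine hn i).ge ⟨h, hP⟩
    exact this.2
  have i1 : i + 1 = Fin.ofNat n (i.val + 1) := by rw [ofNat_add_one, ei]
  have hp : complexify (cyclicRow Z i.val) ∈ V.space := by
    rw [complexify_cyclicRow_mem_iff, ei]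
    exact h
  obtain ⟨w, hw, hw0, hwl⟩ := exists_mem_of_mem_meetsLine hmeet
  have hV : ∀ u ∈ V.space, ∀ v ∈ V.space, ∀ m : ℕ, V ∈ onEdge Z (Fin.ofNat n m) →
      br u v (complexify (cyclicRow Z m)) (complexify (cyclicRow Z (m + 1))) = 0 := by
    intro u hu v hv m hm
    have hspan := span_complexify_cyclicRow (Z := Z) m (m + 1)
    rw [ofNat_add_one] at hspan
    have hne := ne_add_one hn (Fin.ofNat n m)
    let U := Gr.ofPair _ _ (hI.linearIndependent_pair hn hne)
    have hU : U.space = span ℂ {complexify (cyclicRow Z m), complexify (cyclicRow Z (m + 1))} := by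
      rw [hspan]
      exact Gr.ofPair_space _ _ _
    have := (Gr.mem_incident_iff_inf_ne_bot (U.pair_of_space_eq hU) (V := V)).2 (by
      rw [hspan]
      exact hm)
    exact this u hu v hv
  have hi' := i.isLt
  rw [i1, ← ei', ← span_complexify_cyclicRow] at hwl
  obtain ⟨α, β, rfl⟩ := mem_span_pair.1 hwl
  have hexp : ∀ m, br (complexify (cyclicRow Z i.val))
      (α • complexify (cyclicRow Z (i.val + n - 1)) + β • complexify (cyclicRow Z (i.val + 1)))
      (complexify (cyclicRow Z m)) (complexify (cyclicRow Z (m + 1))) =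
      α * (br (cyclicRow Z i.val) (cyclicRow Z m) (cyclicRow Z (m + 1))
        (cyclicRow Z (i.val + n - 1)) : ℝ) +
      β * (br (cyclicRow Z i.val) (cyclicRow Z (i.val + 1)) (cyclicRow Z m)
        (cyclicRow Z (m + 1)) : ℝ) := by
    intro m
    rw [← br_complexify, ← br_complexify]
    simp only [br_apply, Pi.add_apply, Pi.smul_apply, smul_eq_mul]
    ring
  have r1 := hV _ hp _ hw mj hj
  have r2 := hV _ hp _ hw mk hk
  rw [hexp] at r1 r2
  have hex := br_hexagon_pos (ε := ε) (p := cyclicRow Z i.val) (v₁ := cyclicRow Z (i.val + 1))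
    (v₂ := cyclicRow Z mj) (v₃ := cyclicRow Z (mj + 1)) (v₄ := cyclicRow Z mk)
    (v₅ := cyclicRow Z (mk + 1)) (v₆ := cyclicRow Z (i.val + n - 1))
    (hc _ _ _ _ (by omega) (by omega) (by omega) (by omega))
    (hc _ _ _ _ (by omega) (by omega) (by omega) (by omega))
    (hc _ _ _ _ (by omega) (by omega) (by omega) (by omega))
    (hc _ _ _ _ (by omega) (by omega) (by omega) (by omega))
    (hc _ _ _ _ (by omega) (by omega) (by omega) (by omega))
    (hc _ _ _ _ (by omega) (by omega) (by omega) (by omega))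
    (hc _ _ _ _ (by omega) (by omega) (by omega) (by omega))
  set b145 := br (cyclicRow Z i.val) (cyclicRow Z (i.val + 1)) (cyclicRow Z mk)
    (cyclicRow Z (mk + 1))
  set b236 := br (cyclicRow Z i.val) (cyclicRow Z mj) (cyclicRow Z (mj + 1))
    (cyclicRow Z (i.val + n - 1))
  set b123 := br (cyclicRow Z i.val) (cyclicRow Z (i.val + 1)) (cyclicRow Z mj)
    (cyclicRow Z (mj + 1))
  set b456 := br (cyclicRow Z i.val) (cyclicRow Z mk) (cyclicRow Z (mk + 1))
    (cyclicRow Z (i.val + n - 1))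
  -- The hexagon expression is the determinant of the two equations, up to sign; hence both unknowns
  -- vanish.
  have hD : ((b145 * b236 - b123 * b456 : ℝ) : ℂ) ≠ 0 := Complex.ofReal_ne_zero.2 hex.ne'
  push_cast at hD
  have hα : α = 0 := by
    refine (mul_eq_zero.1 (?_ : α * _ = 0)).resolve_right hD
    linear_combination (b145 : ℂ) * r1 - (b123 : ℂ) * r2
  have hβ : β = 0 := by
    refine (mul_eq_zero.1 (?_ : β * _ = 0)).resolve_right hD
    linear_combination (b236 : ℂ) * r2 - (b456 : ℂ) * r1
  exact hw0 (by rw [hα, hβ]; simp)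

end CyclicPositivity

/-! ### Four pairwise disjoint edges have exactly two common transversals -/

theorem br_cycle_last {K : Type} [Field K] (p a b c : Fin 4 → K) : br p b c a = br p a b c := by
  simp only [br_apply]
  ring

/-- For `x` on the line `v₆ v₇`, consider the quadratic form `⟨x 0 2 3⟩⟨x 1 4 5⟩ - ⟨x 1 2 3⟩⟨x 0 4
5⟩`. The first inequality says that it is positive at `v₇`. Where `⟨x 0 2 3⟩` vanishes its value is
minus the product in the second inequality, so it is negative there. -/
theorem transversal_quadric_sign {ε : ℝ} {v : Fin 8 → Fin 4 → ℝ}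
    (hv : ∀ a b c d : Fin 8, a < b → b < c → c < d → 0 < ε * br (v a) (v b) (v c) (v d)) :
    0 < br (v 7) (v 0) (v 2) (v 3) * br (v 7) (v 1) (v 4) (v 5) -
        br (v 7) (v 1) (v 2) (v 3) * br (v 7) (v 0) (v 4) (v 5) ∧
      0 < (br (v 7) (v 0) (v 2) (v 3) * br (v 6) (v 1) (v 2) (v 3) -
          br (v 6) (v 0) (v 2) (v 3) * br (v 7) (v 1) (v 2) (v 3)) *
        (br (v 7) (v 0) (v 2) (v 3) * br (v 6) (v 0) (v 4) (v 5) -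
          br (v 6) (v 0) (v 2) (v 3) * br (v 7) (v 0) (v 4) (v 5)) := by
  have h7 : ∀ a b c : Fin 8, a < b → b < c → c < 7 → 0 < -ε * br (v 7) (v a) (v b) (v c) := by
    intro a b c hab hbc hc
    have := hv a b c 7 hab hbc hc
    rw [br_rotate (v 7)] at this
    linarith
  have h7' : ∀ a b c : Fin 8, a < b → b < c → c < 7 → 0 < -ε * br (v 7) (v b) (v c) (v a) := by
    intro a b c hab hbc hc
    rw [br_cycle_last]
    exact h7 a b c hab hbc hc
  have h0 : ∀ a b c : Fin 8, 0 < a → a < b → b < c → 0 < ε * br (v 0) (v a) (v b) (v c) :=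
    fun a b c ha hab hbc => hv 0 a b c ha hab hbc
  have h0' : ∀ a b c : Fin 8, 0 < a → a < b → b < c → 0 < ε * br (v 0) (v c) (v a) (v b) := by
    intro a b c ha hab hbc
    rw [← br_cycle_last]
    exact h0 a b c ha hab hbc
  -- Two hexagons are used: the one seen from `v₇`, whose orientation is `-ε`, and the one seen from
  -- `v₀`.
  have e1 := br_hexagon_pos (ε := -ε) (p := v 7) (v₁ := v 1) (v₂ := v 2) (v₃ := v 3) (v₄ := v 4)
    (v₅ := v 5) (v₆ := v 0) (h7' _ _ _ (by decide) (by decide) (by decide))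
    (h7' _ _ _ (by decide) (by decide) (by decide)) (h7 _ _ _ (by decide) (by decide) (by decide))
    (h7' _ _ _ (by decide) (by decide) (by decide)) (h7' _ _ _ (by decide) (by decide) (by decide))
    (h7' _ _ _ (by decide) (by decide) (by decide)) (h7 _ _ _ (by decide) (by decide) (by decide))
  have e2 := br_hexagon_pos (ε := ε) (p := v 0) (v₁ := v 7) (v₂ := v 2) (v₃ := v 3) (v₄ := v 4)
    (v₅ := v 5) (v₆ := v 6) (h0 _ _ _ (by decide) (by decide) (by decide))
    (h0 _ _ _ (by decide) (by decide) (by decide)) (h0 _ _ _ (by decide) (by decide) (by decide))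
    (h0' _ _ _ (by decide) (by decide) (by decide)) (h0 _ _ _ (by decide) (by decide) (by decide))
    (h0' _ _ _ (by decide) (by decide) (by decide)) (h0 _ _ _ (by decide) (by decide) (by decide))
  refine ⟨?_, mul_pos_of_neg_of_neg ?_ ?_⟩
  · rw [br_cycle_last (v 7) (v 0) (v 2) (v 3), br_cycle_last (v 7) (v 0) (v 4) (v 5)] at e1
    linarith
  -- The first factor is, up to sign, `⟨2 3 6 7⟩⟨0 1 2 3⟩` by a Plücker relation, and both of these
  -- brackets have the sign of `ε`.
  · have hp := br_plucker (v 2) (v 3) (v 6) (v 7) (v 0) (v 1)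
    have hpos := mul_pos_of_mul_pos (hv 2 3 6 7 (by decide) (by decide) (by decide))
      (hv 0 1 2 3 (by decide) (by decide) (by decide))
    rw [← br_swap_pairs (v 0) (v 1) (v 2) (v 3)] at hpos
    rw [br_swap_pairs (v 7) (v 0) (v 2) (v 3), br_swap_pairs (v 6) (v 1) (v 2) (v 3),
      br_swap_pairs (v 6) (v 0) (v 2) (v 3), br_swap_pairs (v 7) (v 1) (v 2) (v 3)] at hp
    linarith
  · have r1 : br (v 7) (v 0) (v 2) (v 3) = -br (v 0) (v 7) (v 2) (v 3) := br_swap₁₂ _ _ _ _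
    have r2 : br (v 6) (v 0) (v 4) (v 5) = -br (v 0) (v 4) (v 5) (v 6) := by
      rw [br_swap₁₂, ← br_cycle_last (v 0) (v 6) (v 4) (v 5)]
    have r3 : br (v 6) (v 0) (v 2) (v 3) = -br (v 0) (v 2) (v 3) (v 6) := by
      rw [br_swap₁₂, ← br_cycle_last (v 0) (v 6) (v 2) (v 3)]
    have r4 : br (v 7) (v 0) (v 4) (v 5) = -br (v 0) (v 7) (v 4) (v 5) := br_swap₁₂ _ _ _ _
    rw [r1, r2, r3, r4]
    linarith

/-- A real binary quadratic form `C t² + B s t + A s²` with `C > 0` that takes a negative value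
has two distinct real roots `t / s`. -/
theorem exists_roots_of_neg {A B C s₀ t₀ : ℝ} (hC : 0 < C)
    (h : A * s₀ ^ 2 + B * s₀ * t₀ + C * t₀ ^ 2 < 0) : ∃ r₁ r₂ : ℝ, r₁ ≠ r₂ ∧
      ∀ s t : ℂ, A * s ^ 2 + B * s * t + C * t ^ 2 = C * ((t - r₁ * s) * (t - r₂ * s)) := by
  -- Completing the square: with a nonpositive discriminant and `C > 0` the form would be
  -- nonnegative everywhere.
  have hd : 0 < B ^ 2 - 4 * A * C := by
    by_contra! hd
    nlinarith [sq_nonneg (2 * C * t₀ + B * s₀), sq_nonneg s₀, mul_pos hC hC,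
      mul_nonneg (sub_nonneg.2 hd) (sq_nonneg s₀), mul_neg_of_pos_of_neg hC h]
  have hs := Real.sq_sqrt hd.le
  have hs0 := Real.sqrt_pos.2 hd
  set D := √(B ^ 2 - 4 * A * C)
  refine ⟨(-B + D) / (2 * C), (-B - D) / (2 * C), ?_, fun s t => ?_⟩
  · intro he
    field_simp at he
    linarith
  · have hs' : (D : ℂ) ^ 2 = B ^ 2 - 4 * A * C := by exact_mod_cast hs
    have hC' : (C : ℂ) ≠ 0 := Complex.ofReal_ne_zero.2 hC.ne'
    push_cast
    field_simp
    linear_combination (s ^ 2) * hs'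

section FourEdges

variable {n : ℕ} [NeZero n] {Z : Matrix (Fin n) (Fin 4) ℝ}

theorem br_transversalPoint (x a b c d e f : Fin 4 → ℂ) :
    br x (transversalPoint a b c d x) e f =
      br x d a b * br x c e f - br x c a b * br x d e f := by
  have h (β γ : ℂ) : br x (β • c - γ • d) e f = β * br x c e f - γ * br x d e f := by
    simp only [br_apply, Pi.sub_apply, Pi.smul_apply, smul_eq_mul]
    ring
  rw [transversalPoint_apply, h, br_cycle_last x d a b, br_cycle_last x c a b]

/-- A transversal of the edges `l`, `j`, `i` is determined by its point `x` on edge `l`. It meets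
edge `k` when a quadratic form in the coordinates of `x` vanishes, and the sign conditions give this
form two distinct real roots. -/
theorem CyclicallyPositive.encard_four_edges_of_lt {ε : ℝ} (hI : NoFourCoplanar Z)
    (hc : CyclicallyPositive Z ε) (hn : 4 ≤ n) {i j k l : Fin n} (hij : i < j) (hjk : j < k)
    (hkl : k < l) (dij : Disjoint (edge i) (edge j)) (dil : Disjoint (edge i) (edge l)) (djk : Disjoint (edge j) (edge k))
    (djl : Disjoint (edge j) (edge l)) (dkl : Disjoint (edge k) (edge l)) :
    (onEdge Z i ∩ onEdge Z j ∩ onEdge Z k ∩ onEdge Z l).encard = 2 := by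
  have nil := disjoint_edge_edge.1 dil
  have nij := disjoint_edge_edge.1 dij
  have njk := disjoint_edge_edge.1 djk
  have nkl := disjoint_edge_edge.1 dkl
  have hi := val_add_one_cases (by omega) i
  have hj := val_add_one_cases (by omega) j
  have hk := val_add_one_cases (by omega) k
  have hl := val_add_one_cases (by omega) l
  -- Only the last edge can wrap around the end of the index range. For that reason `l + 1` is taken
  -- as a natural number and its point as a cyclic row, while the first seven indices stay below
  -- `n`.
  let m : Fin 8 → ℕ := ![i, i + 1, j, j + 1, k, k + 1, l, l + 1]
  have hm : StrictMono m := by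
    rw [Fin.strictMono_iff_lt_succ]
    intro a
    fin_cases a <;> simp [m] <;> omega
  have hm7 : m 7 < m 0 + n := by
    simp only [m, Matrix.cons_val]
    have := l.isLt
    omega
  have hv : ∀ a b c d : Fin 8, a < b → b < c → c < d → 0 < ε * br (cyclicRow Z (m a))
      (cyclicRow Z (m b)) (cyclicRow Z (m c)) (cyclicRow Z (m d)) := by
    intro a b c d hab hbc hcd
    have h7 := hm.monotone (Fin.le_last d)
    have h0 := hm.monotone (Fin.zero_le a)
    exact hc _ _ _ _ (hm hab) (hm hbc) (hm hcd)
      (lt_of_le_of_lt h7 (lt_of_lt_of_le hm7 (Nat.add_le_add_right h0 n)))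
  obtain ⟨hC, hq⟩ := transversal_quadric_sign (v := fun a => cyclicRow Z (m a)) hv
  have m0 : cyclicRow Z (m 0) = Z i := cyclicRow_of_lt i
  have m1 : cyclicRow Z (m 1) = Z (i + 1) := by
    rw [← cyclicRow_of_lt (Z := Z) (i + 1)]
    congr 1
    simp only [m, Matrix.cons_val]
    omega
  have m2 : cyclicRow Z (m 2) = Z j := cyclicRow_of_lt j
  have m3 : cyclicRow Z (m 3) = Z (j + 1) := by
    rw [← cyclicRow_of_lt (Z := Z) (j + 1)]
    congr 1
    simp only [m, Matrix.cons_val]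
    omega
  have m4 : cyclicRow Z (m 4) = Z k := cyclicRow_of_lt k
  have m5 : cyclicRow Z (m 5) = Z (k + 1) := by
    rw [← cyclicRow_of_lt (Z := Z) (k + 1)]
    congr 1
    simp only [m, Matrix.cons_val]
    omega
  have m6 : m 6 = l.val := rfl
  have m7 : m 7 = l.val + 1 := rfl
  simp only [m0, m1, m2, m3, m4, m5, m6, m7] at hC hq
  have hlval : Fin.ofNat n l.val = l := Fin.ofNat_val_eq_self l
  have hspan := span_complexify_cyclicRow (Z := Z) l.val (l.val + 1)
  rw [ofNat_add_one, hlval] at hspan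
  set v7 := cyclicRow Z l.val with hv7
  set v8 := cyclicRow Z (l.val + 1) with hv8
  set p1 := br v7 (Z i) (Z j) (Z (j + 1))
  set p1' := br v8 (Z i) (Z j) (Z (j + 1))
  set p2 := br v7 (Z (i + 1)) (Z k) (Z (k + 1))
  set p2' := br v8 (Z (i + 1)) (Z k) (Z (k + 1))
  set p3 := br v7 (Z (i + 1)) (Z j) (Z (j + 1))
  set p3' := br v8 (Z (i + 1)) (Z j) (Z (j + 1))
  set p4 := br v7 (Z i) (Z k) (Z (k + 1))
  set p4' := br v8 (Z i) (Z k) (Z (k + 1))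
  -- `A`, `B`, `C` are the coefficients of the form in `s • v7 + t • v8`. The pair `(p1', -p1)` is
  -- the zero of `⟨x i j (j+1)⟩`, where the form is negative.
  obtain ⟨r₁, r₂, hr, hroot⟩ := exists_roots_of_neg (A := p1 * p2 - p3 * p4)
    (B := p1 * p2' + p1' * p2 - p3 * p4' - p3' * p4) (s₀ := p1') (t₀ := -p1) hC (by
      linear_combination (exp := 1) hq)
  set Φ := transversalPoint (rowPoint Z j) (rowPoint Z (j + 1)) (rowPoint Z i)
    (rowPoint Z (i + 1)) with hΦ
  have hquad : ∀ s t : ℂ, br (s • complexify v7 + t • complexify v8)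
      (Φ (s • complexify v7 + t • complexify v8)) (rowPoint Z k) (rowPoint Z (k + 1)) =
      -((p1' * p2' - p3' * p4' : ℝ) * ((t - r₁ * s) * (t - r₂ * s))) := by
    intro s t
    rw [← hroot, br_transversalPoint]
    simp only [br_add_smul_left, rowPoint_eq_complexify, br_complexify]
    push_cast
    ring
  have hT : LinearIndependent ℂ ![complexify v7, complexify v8] := by
    let U := Gr.ofPair _ _ (hI.linearIndependent_pair hn (ne_add_one hn l))
    exact U.pair_of_space_eq (by rw [hspan]; exact Gr.ofPair_space _ _ _)
  have hT' := LinearIndependent.pair_iff.1 hT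
  have hmem : ∀ s t : ℂ, s • complexify v7 + t • complexify v8 ∈
      span ℂ {rowPoint Z l, rowPoint Z (l + 1)} := fun s t => by
    rw [← hspan]
    exact mem_span_pair.2 ⟨s, t, rfl⟩
  have hx0 : ∀ r : ℂ, (1 : ℂ) • complexify v7 + r • complexify v8 ≠ 0 := fun r h => by
    simpa using (hT' _ _ h).1
  have hC' : ((p1' * p2' - p3' * p4' : ℝ) : ℂ) ≠ 0 := Complex.ofReal_ne_zero.2 hC.ne'
  have hline : ∀ {x : Fin 4 → ℂ} {V : Gr ℂ 4}, x ∈ span ℂ {rowPoint Z l, rowPoint Z (l + 1)} →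
      x ≠ 0 → x ∈ V.space → V ∈ onEdge Z i → V ∈ onEdge Z j → V.space = span ℂ {x, Φ x} := by
    intro x V hx h0 hxV hVi hVj
    exact V.space_eq_of_mem hxV
      ((hI.transversalPoint_mem_space_iff hn djl.symm dil.symm dij.symm hx h0 hxV).1 ⟨hVj, hVi⟩)
      (hI.linearIndependent_transversalPoint hn djl.symm dil.symm dij.symm hx h0)
  have hedge : ∀ {x : Fin 4 → ℂ} {V : Gr ℂ 4}, V.space = span ℂ {x, Φ x} → (V ∈ onEdge Z k ↔
      br x (Φ x) (rowPoint Z k) (rowPoint Z (k + 1)) = 0) := by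
    intro x V hV
    rw [← Gr.mem_incident_iff hV,
      Gr.mem_incident_iff_inf_ne_bot (hI.linearIndependent_pair hn (ne_add_one hn k))]
    rfl
  have hex : ∀ r : ℝ, r = r₁ ∨ r = r₂ → ∃ V ∈ onEdge Z i ∩ onEdge Z j ∩ onEdge Z k ∩ onEdge Z l,
      (1 : ℂ) • complexify v7 + (r : ℂ) • complexify v8 ∈ V.space := by
    intro r hr
    obtain ⟨V, ⟨⟨hVl, hVj⟩, hVi⟩, hxV⟩ := hI.exists_transversal hn djl.symm dil.symm dij.symm
      (hmem 1 r) (hx0 r)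
    refine ⟨V, ⟨⟨⟨hVi, hVj⟩, ?_⟩, hVl⟩, hxV⟩
    rw [hedge (hline (hmem 1 r) (hx0 r) hxV hVi hVj), hquad]
    rcases hr with rfl | rfl <;> simp
  obtain ⟨V₁, hV₁, hx₁⟩ := hex r₁ (Or.inl rfl)
  obtain ⟨V₂, hV₂, hx₂⟩ := hex r₂ (Or.inr rfl)
  have huniq : ∀ r : ℂ, ∀ V ∈ onEdge Z i ∩ onEdge Z j ∩ onEdge Z k ∩ onEdge Z l,
      ∀ W ∈ onEdge Z i ∩ onEdge Z j ∩ onEdge Z k ∩ onEdge Z l,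
      (1 : ℂ) • complexify v7 + r • complexify v8 ∈ V.space →
      (1 : ℂ) • complexify v7 + r • complexify v8 ∈ W.space → V = W := by
    intro r V hV W hW hxV hxW
    ext1
    rw [hline (hmem 1 r) (hx0 r) hxV hV.1.1.1 hV.1.1.2,
      hline (hmem 1 r) (hx0 r) hxW hW.1.1.1 hW.1.1.2]
  -- A line through two different points of edge `l` is the line of that edge, and this does not
  -- meet the disjoint edge `i`.
  have hne : V₁ ≠ V₂ := by
    rintro rfl
    have hmul : ((r₁ : ℂ) - r₂) • complexify v8 ∈ V₁.space := by
      have := V₁.space.sub_mem hx₁ hx₂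
      convert this using 1
      module
    have h8 : complexify v8 ∈ V₁.space := by
      refine (V₁.space.smul_mem_iff ?_).1 hmul
      rw [sub_ne_zero]
      exact_mod_cast hr
    have h7 : complexify v7 ∈ V₁.space := by
      have := V₁.space.sub_mem hx₁ (V₁.space.smul_mem (r₁ : ℂ) h8)
      simpa using this
    have t7 : V₁ ∈ throughPoint Z l := by
      rw [hv7, complexify_cyclicRow_mem_iff, hlval] at h7
      exact h7
    have t8 : V₁ ∈ throughPoint Z (l + 1) := by
      rw [hv8, complexify_cyclicRow_mem_iff, ofNat_add_one, hlval] at h8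
      exact h8
    have := (hI.meets_join_iff hn (ne_add_one hn l) (ne_add_one hn i) t7 t8).1 hV₁.1.1.1
    rcases this with h | h | h | h
    · exact nil.1 h
    · exact nil.2.1 h
    · exact nil.2.2 h
    · exact nil.1 (add_right_cancel h)
  have hS : onEdge Z i ∩ onEdge Z j ∩ onEdge Z k ∩ onEdge Z l = {V₁, V₂} := by
    ext V
    constructor
    · intro hV
      obtain ⟨x, hxV, hx0', hxl⟩ := exists_mem_of_mem_meetsLine hV.2
      have hxl' := hxl
      rw [← hspan] at hxl'
      obtain ⟨s, t, rfl⟩ := mem_span_pair.1 hxl'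
      have h0 := (hedge (hline hxl hx0' hxV hV.1.1.1 hV.1.1.2)).1 hV.1.2
      rw [hquad, neg_eq_zero, mul_eq_zero, or_iff_right hC', mul_eq_zero, sub_eq_zero,
        sub_eq_zero] at h0
      have key : ∀ r : ℂ, t = r * s →
          (1 : ℂ) • complexify v7 + r • complexify v8 ∈ V.space := by
        rintro r rfl
        have hs : s ≠ 0 := by
          rintro rfl
          simp at hx0'
        refine (V.space.smul_mem_iff hs).1 ?_
        convert hxV using 1
        module
      rcases h0 with h0 | h0
      · exact Or.inl (huniq r₁ V hV V₁ hV₁ (key _ h0) hx₁)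
      · exact Or.inr (huniq r₂ V hV V₂ hV₂ (key _ h0) hx₂)
    · rintro (rfl | rfl)
      exacts [hV₁, hV₂]
  rw [hS, Set.encard_pair hne]

/-- A four-element set of indices, listed in increasing order. -/
theorem exists_sorted_four {i j k l : Fin n} (hij : i ≠ j) (hik : i ≠ k) (hil : i ≠ l)
    (hjk : j ≠ k) (hjl : j ≠ l) (hkl : k ≠ l) : ∃ a b c d : Fin n, a < b ∧ b < c ∧ c < d ∧
      ({a, b, c, d} : Finset (Fin n)) = {i, j, k, l} := by
  have hcard : ({i, j, k, l} : Finset (Fin n)).card = 4 := by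
    rw [Finset.card_insert_of_notMem (by simp [hij, hik, hil]),
      Finset.card_insert_of_notMem (by simp [hjk, hjl]),
      Finset.card_insert_of_notMem (by simp [hkl]), Finset.card_singleton]
  let f := ({i, j, k, l} : Finset (Fin n)).orderEmbOfFin hcard
  refine ⟨f 0, f 1, f 2, f 3, f.strictMono (by decide), f.strictMono (by decide),
    f.strictMono (by decide), ?_⟩
  have := Finset.image_orderEmbOfFin_univ ({i, j, k, l} : Finset (Fin n)) hcard
  ext x
  rw [Finset.ext_iff] at this
  rw [← this x, Finset.mem_image]
  simp only [Finset.mem_insert, Finset.mem_singleton]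
  constructor
  · rintro (rfl | rfl | rfl | rfl)
    exacts [⟨0, Finset.mem_univ _, rfl⟩, ⟨1, Finset.mem_univ _, rfl⟩,
      ⟨2, Finset.mem_univ _, rfl⟩, ⟨3, Finset.mem_univ _, rfl⟩]
  · rintro ⟨a, -, rfl⟩
    fin_cases a <;> simp [f]

/-- The lines meeting all edges of a set. -/
def onEdges (Z : Matrix (Fin n) (Fin 4) ℝ) (s : Finset (Fin n)) : Set (Gr ℂ 4) :=
  {V | ∀ i ∈ s, V ∈ onEdge Z i}

theorem onEdges_pair (i j : Fin n) : onEdges Z {i, j} = onEdge Z i ∩ onEdge Z j := by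
  ext V
  simp [onEdges]

theorem onEdges_triple (i j k : Fin n) :
    onEdges Z {i, j, k} = onEdge Z i ∩ onEdge Z j ∩ onEdge Z k := by
  ext V
  simp only [onEdges, Set.mem_ofPred_eq, Finset.mem_insert, Finset.mem_singleton,
    forall_eq_or_imp, forall_eq, Set.mem_inter_iff, and_assoc]

theorem onEdges_quadruple (i j k l : Fin n) :
    onEdges Z {i, j, k, l} = onEdge Z i ∩ onEdge Z j ∩ onEdge Z k ∩ onEdge Z l := by
  ext V
  simp only [onEdges, Set.mem_ofPred_eq, Finset.mem_insert, Finset.mem_singleton,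
    forall_eq_or_imp, forall_eq, Set.mem_inter_iff, and_assoc]

/-- The edges of a set of indices are pairwise disjoint. -/
def EdgesDisjoint (s : Finset (Fin n)) : Prop :=
  ∀ i ∈ s, ∀ j ∈ s, i ≠ j → Disjoint (edge i) (edge j)

theorem edgesDisjoint_quadruple {i j k l : Fin n} (dij : Disjoint (edge i) (edge j))
    (dik : Disjoint (edge i) (edge k)) (dil : Disjoint (edge i) (edge l))
    (djk : Disjoint (edge j) (edge k)) (djl : Disjoint (edge j) (edge l))
    (dkl : Disjoint (edge k) (edge l)) : EdgesDisjoint {i, j, k, l} := by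
  intro a ha b hb hab
  simp only [Finset.mem_insert, Finset.mem_singleton] at ha hb
  rcases ha with rfl | rfl | rfl | rfl <;> rcases hb with rfl | rfl | rfl | rfl <;> first
    | exact absurd rfl hab
    | assumption
    | (apply Disjoint.symm; assumption)

theorem edgesDisjoint_triple {i j k : Fin n} (dij : Disjoint (edge i) (edge j))
    (dik : Disjoint (edge i) (edge k)) (djk : Disjoint (edge j) (edge k)) :
    EdgesDisjoint {i, j, k} := by
  intro a ha b hb hab
  simp only [Finset.mem_insert, Finset.mem_singleton] at ha hb
  rcases ha with rfl | rfl | rfl <;> rcases hb with rfl | rfl | rfl <;> first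
    | exact absurd rfl hab
    | assumption
    | (apply Disjoint.symm; assumption)

/-- The set of transversals is symmetric in the four edges, so the indices may be sorted. -/
theorem CyclicallyPositive.encard_four_edges {ε : ℝ} (hI : NoFourCoplanar Z)
    (hc : CyclicallyPositive Z ε) (hn : 4 ≤ n) {i j k l : Fin n}
    (dij : Disjoint (edge i) (edge j)) (dik : Disjoint (edge i) (edge k))
    (dil : Disjoint (edge i) (edge l)) (djk : Disjoint (edge j) (edge k))
    (djl : Disjoint (edge j) (edge l)) (dkl : Disjoint (edge k) (edge l)) :
    (onEdge Z i ∩ onEdge Z j ∩ onEdge Z k ∩ onEdge Z l).encard = 2 := by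
  obtain ⟨a, b, c, d, hab, hbc, hcd, hs⟩ := exists_sorted_four (disjoint_edge_edge.1 dij).1
    (disjoint_edge_edge.1 dik).1 (disjoint_edge_edge.1 dil).1 (disjoint_edge_edge.1 djk).1
    (disjoint_edge_edge.1 djl).1 (disjoint_edge_edge.1 dkl).1
  have hd := edgesDisjoint_quadruple dij dik dil djk djl dkl
  rw [← onEdges_quadruple, ← hs, onEdges_quadruple]
  rw [← hs] at hd
  exact hc.encard_four_edges_of_lt hI hn hab hbc hcd
    (hd _ (by simp) _ (by simp) hab.ne)
    (hd _ (by simp) _ (by simp) (hab.trans (hbc.trans hcd)).ne)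
    (hd _ (by simp) _ (by simp) hbc.ne) (hd _ (by simp) _ (by simp) (hbc.trans hcd).ne)
    (hd _ (by simp) _ (by simp) hcd.ne)

end FourEdges

/-! ### Brackets on the amplituhedron -/

section Bilinear

variable {K : Type} [Field K] {n : ℕ}

/-- The bracket as a linear form in its first argument. -/
def brForm (b c d : Fin 4 → K) : (Fin 4 → K) →ₗ[K] K where
  toFun a := br a b c d
  map_add' x y := by simpa using br_add_smul_left x y b c d 1 1
  map_smul' s x := by simpa using br_add_smul_left x x b c d s 0

theorem brForm_apply (a b c d : Fin 4 → K) : brForm b c d a = br a b c d := rfl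

open Matrix in
theorem br_vecMul_left (x : Fin n → K) (Z : Matrix (Fin n) (Fin 4) K) (b c d : Fin 4 → K) :
    br (x ᵥ* Z) b c d = ∑ i, x i * br (Z i) b c d := by
  rw [← brForm_apply, Matrix.vecMul_eq_sum, map_sum]
  simp only [map_smul, brForm_apply, smul_eq_mul]

open Matrix in
theorem br_vecMul_vecMul (x y : Fin n → K) (Z : Matrix (Fin n) (Fin 4) K) (c d : Fin 4 → K) :
    br (x ᵥ* Z) (y ᵥ* Z) c d = ∑ i, ∑ j, x i * y j * br (Z i) (Z j) c d := by
  rw [br_vecMul_left]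
  refine Finset.sum_congr rfl fun i _ => ?_
  rw [br_swap₁₂, br_vecMul_left, ← Finset.sum_neg_distrib, Finset.mul_sum]
  refine Finset.sum_congr rfl fun j _ => ?_
  rw [br_swap₁₂]
  ring

open Matrix in
-- This is the Cauchy–Binet expansion of the bracket in the minors of the coefficient matrix.
-- Summing over ordered pairs counts every minor twice, hence the factor `2`.
theorem two_mul_br_vecMul_vecMul (x y : Fin n → K) (Z : Matrix (Fin n) (Fin 4) K)
    (c d : Fin 4 → K) : 2 * br (x ᵥ* Z) (y ᵥ* Z) c d =
      ∑ i, ∑ j, (x i * y j - x j * y i) * br (Z i) (Z j) c d := by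
  have h : ∑ i, ∑ j, x j * y i * br (Z i) (Z j) c d = -br (x ᵥ* Z) (y ᵥ* Z) c d := by
    rw [Finset.sum_comm, br_vecMul_vecMul, ← Finset.sum_neg_distrib]
    refine Finset.sum_congr rfl fun i _ => ?_
    rw [← Finset.sum_neg_distrib]
    refine Finset.sum_congr rfl fun j _ => ?_
    rw [br_swap₁₂]
    ring
  simp only [sub_mul, Finset.sum_sub_distrib]
  rw [h, ← br_vecMul_vecMul]
  ring

/-- The bracket depends on its first two arguments linearly through their Plücker coordinates, so
changing the spanning pair rescales all brackets by one common factor. -/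
theorem exists_br_eq_smul {x y x' y' : Fin 4 → K} (h' : LinearIndependent K ![x', y'])
    (hs : span K {x', y'} = span K {x, y}) :
    ∃ δ : K, δ ≠ 0 ∧ ∀ c d, br x' y' c d = δ * br x y c d := by
  obtain ⟨δ, h0, hδ⟩ := Gr.pairPlucker_eq_smul h' hs
  refine ⟨δ, h0, fun c d => ?_⟩
  have h (i j : Fin 4) (hij : i < j) := congrFun hδ ⟨(i, j), hij⟩
  simp only [Gr.pairPlucker, Pi.smul_apply, smul_eq_mul] at h
  have h01 := h 0 1 (by decide)
  have h02 := h 0 2 (by decide)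
  have h03 := h 0 3 (by decide)
  have h12 := h 1 2 (by decide)
  have h13 := h 1 3 (by decide)
  have h23 := h 2 3 (by decide)
  simp only [br_apply]
  linear_combination (c 2 * d 3 - c 3 * d 2) * h01 - (c 1 * d 3 - c 3 * d 1) * h02 +
    (c 1 * d 2 - c 2 * d 1) * h03 + (c 0 * d 3 - c 3 * d 0) * h12 -
    (c 0 * d 2 - c 2 * d 0) * h13 + (c 0 * d 1 - c 1 * d 0) * h23

end Bilinear

/-! ### Signs of the consecutive brackets on the amplituhedron. -/

section Amplituhedron

variable {n : ℕ} [NeZero n] {Z : Matrix (Fin n) (Fin 4) ℝ}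

open Matrix

/-- Full rank of the coefficient matrix need not be assumed: its image under `Z` already spans a
line. -/
theorem mem_amplituhedron_of_space_eq {x y : Fin n → ℝ} {Y : Gr ℝ 4}
    (h : ∀ a b, a < b → 0 ≤ x a * y b - x b * y a) (hY : Y.space = span ℝ {x ᵥ* Z, y ᵥ* Z}) :
    Y ∈ amplituhedron Z := by
  refine ⟨Matrix.of ![x, y], ?_, fun p => h _ _ p.2, ?_⟩
  · rw [Gr.linearIndependent_row_iff]
    have hl := Y.pair_of_space_eq hY
    refine LinearIndependent.of_comp (Matrix.vecMulLinear Z) ?_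
    convert hl using 1
    ext i j
    fin_cases i <;> rfl
  · rw [hY]
    congr 1
    ext v
    simp only [Set.mem_range, Fin.exists_fin_two, Set.mem_insert_iff, Set.mem_singleton_iff,
      eq_comm (a := v)]
    rfl

theorem exists_of_mem_amplituhedron {Y : Gr ℝ 4} (hY : Y ∈ amplituhedron Z) :
    ∃ x y : Fin n → ℝ, (∀ a b, a < b → 0 ≤ x a * y b - x b * y a) ∧
      Y.space = span ℝ {x ᵥ* Z, y ᵥ* Z} := by
  obtain ⟨X, -, h, hs⟩ := hY
  refine ⟨X 0, X 1, fun a b hab => h ⟨(a, b), hab⟩, ?_⟩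
  rw [hs]
  congr 1
  ext v
  simp only [Set.mem_range, Fin.exists_fin_two, Set.mem_insert_iff, Set.mem_singleton_iff,
    eq_comm (a := v)]
  rfl

theorem cyclicRow_zero : cyclicRow Z 0 = Z 0 := by
  simpa using cyclicRow_of_lt (Z := Z) 0

theorem cyclicRow_self : cyclicRow Z n = -Z 0 := by
  rw [← cyclicRow_zero (Z := Z), ← cyclicRow_add, zero_add]

theorem br_eq_zero_of_eq₁₃ {K : Type} [Field K] (a b d : Fin 4 → K) : br a b a d = 0 := by
  simp only [br_apply]; ring

theorem br_eq_zero_of_eq₁₄ {K : Type} [Field K] (a b c : Fin 4 → K) : br a b c a = 0 := by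
  simp only [br_apply]; ring

theorem br_eq_zero_of_eq₂₃ {K : Type} [Field K] (a b d : Fin 4 → K) : br a b b d = 0 := by
  simp only [br_apply]; ring

theorem br_eq_zero_of_eq₂₄ {K : Type} [Field K] (a b c : Fin 4 → K) : br a b c b = 0 := by
  simp only [br_apply]; ring

/-- The edge at `m` lies after, between or before `a` and `b`; in each case an even permutation
restores the cyclic order. The last hypothesis excludes the edge that wraps around to `Z_0` when `a`
is zero. -/
theorem CyclicallyPositive.br_pos {ε : ℝ} (hc : CyclicallyPositive Z ε) {a b : Fin n} (hab : a < b)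
    {m : ℕ} (hm : m < n) (h1 : a.val ≠ m) (h2 : a.val ≠ m + 1) (h3 : b.val ≠ m)
    (h4 : b.val ≠ m + 1) (h5 : m + 1 = n → a.val ≠ 0) :
    0 < ε * br (Z a) (Z b) (cyclicRow Z m) (cyclicRow Z (m + 1)) := by
  rw [← cyclicRow_of_lt (Z := Z) a, ← cyclicRow_of_lt (Z := Z) b]
  have hb := b.isLt
  have hab' : a.val < b.val := hab
  rcases Nat.lt_or_ge b.val m with h | h
  · exact hc _ _ _ _ hab' h (by omega) (by omega)
  · rcases Nat.lt_or_ge a.val m with h' | h'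
    · rw [← br_cycle_last]
      exact hc _ _ _ _ h' (by omega) (by omega) (by omega)
    · rw [br_swap_pairs (cyclicRow Z m) (cyclicRow Z (m + 1)) (cyclicRow Z a) (cyclicRow Z b)]
      exact hc _ _ _ _ (by omega) (by omega) hab' (by omega)

theorem CyclicallyPositive.br_nonneg {ε : ℝ} (hc : CyclicallyPositive Z ε) {a b : Fin n}
    (hab : a < b) {m : ℕ} (hm : m < n) :
    0 ≤ ε * br (Z a) (Z b) (cyclicRow Z m) (cyclicRow Z (m + 1)) := by
  by_cases h1 : a.val = m
  · rw [← h1, cyclicRow_of_lt, br_eq_zero_of_eq₁₃, mul_zero]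
  by_cases h2 : a.val = m + 1
  · rw [← h2, cyclicRow_of_lt, br_eq_zero_of_eq₁₄, mul_zero]
  by_cases h3 : b.val = m
  · rw [← h3, cyclicRow_of_lt, br_eq_zero_of_eq₂₃, mul_zero]
  by_cases h4 : b.val = m + 1
  · rw [← h4, cyclicRow_of_lt, br_eq_zero_of_eq₂₄, mul_zero]
  by_cases h5 : m + 1 = n ∧ a.val = 0
  · have ha : a = 0 := by
      ext
      simp [h5.2]
    rw [h5.1, cyclicRow_self, ha, br_neg₄, br_eq_zero_of_eq₁₄, neg_zero, mul_zero]
  · exact (hc.br_pos hab hm h1 h2 h3 h4 fun h => fun h' => h5 ⟨h, h'⟩).le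

/-- Every term of the expansion of a bracket in minors is nonnegative. -/
theorem CyclicallyPositive.term_nonneg {ε : ℝ} (hc : CyclicallyPositive Z ε) {x y : Fin n → ℝ}
    (h : ∀ a b, a < b → 0 ≤ x a * y b - x b * y a) {m : ℕ} (hm : m < n) (a b : Fin n) :
    0 ≤ (x a * y b - x b * y a) *
      (ε * br (Z a) (Z b) (cyclicRow Z m) (cyclicRow Z (m + 1))) := by
  rcases lt_trichotomy a b with hab | rfl | hab
  · exact mul_nonneg (h a b hab) (hc.br_nonneg hab hm)
  · simp
  · have := mul_nonneg (h b a hab) (hc.br_nonneg hab hm)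
    rw [br_swap₁₂]
    linarith

theorem two_mul_br_eq_sum (ε : ℝ) (x y : Fin n → ℝ) (c d : Fin 4 → ℝ) :
    2 * (ε * br (x ᵥ* Z) (y ᵥ* Z) c d) =
      ∑ a, ∑ b, (x a * y b - x b * y a) * (ε * br (Z a) (Z b) c d) := by
  have := two_mul_br_vecMul_vecMul x y Z c d
  calc 2 * (ε * br (x ᵥ* Z) (y ᵥ* Z) c d) = ε * (2 * br (x ᵥ* Z) (y ᵥ* Z) c d) := by ring
    _ = _ := by
      rw [this, Finset.mul_sum]
      refine Finset.sum_congr rfl fun a _ => ?_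
      rw [Finset.mul_sum]
      exact Finset.sum_congr rfl fun b _ => by ring

theorem CyclicallyPositive.bracket_nonneg {ε : ℝ} (hc : CyclicallyPositive Z ε) {x y : Fin n → ℝ}
    (h : ∀ a b, a < b → 0 ≤ x a * y b - x b * y a) {m : ℕ} (hm : m < n) :
    0 ≤ ε * br (x ᵥ* Z) (y ᵥ* Z) (cyclicRow Z m) (cyclicRow Z (m + 1)) := by
  have := two_mul_br_eq_sum (Z := Z) ε x y (cyclicRow Z m) (cyclicRow Z (m + 1))
  have h0 : 0 ≤ ∑ a, ∑ b, (x a * y b - x b * y a) *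
      (ε * br (Z a) (Z b) (cyclicRow Z m) (cyclicRow Z (m + 1))) :=
    Finset.sum_nonneg fun a _ => Finset.sum_nonneg fun b _ => hc.term_nonneg h hm a b
  linarith

/-- All terms of the expansion have the same sign, so one nonzero term suffices. -/
theorem CyclicallyPositive.bracket_pos {ε : ℝ} (hc : CyclicallyPositive Z ε) (hn : 4 ≤ n) {x y : Fin n → ℝ}
    (h : ∀ a b, a < b → 0 ≤ x a * y b - x b * y a) {m : ℕ} (hm : m < n) {a b : Fin n}
    (h0 : x a * y b - x b * y a ≠ 0)
    (h1 : br (Z a) (Z b) (cyclicRow Z m) (cyclicRow Z (m + 1)) ≠ 0) :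
    0 < ε * br (x ᵥ* Z) (y ᵥ* Z) (cyclicRow Z m) (cyclicRow Z (m + 1)) := by
  have hε : ε ≠ 0 := by
    rintro rfl
    have := hc 0 1 2 3 (by decide) (by decide) (by decide) (by omega)
    simp at this
  have := two_mul_br_eq_sum (Z := Z) ε x y (cyclicRow Z m) (cyclicRow Z (m + 1))
  have hpos : 0 < ∑ a, ∑ b, (x a * y b - x b * y a) *
      (ε * br (Z a) (Z b) (cyclicRow Z m) (cyclicRow Z (m + 1))) := by
    refine lt_of_lt_of_le ?_ (Finset.single_le_sum (f := fun a => ∑ b, (x a * y b - x b * y a) *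
      (ε * br (Z a) (Z b) (cyclicRow Z m) (cyclicRow Z (m + 1))))
      (fun a _ => Finset.sum_nonneg fun b _ => hc.term_nonneg h hm a b) (Finset.mem_univ a))
    refine lt_of_lt_of_le ?_ (Finset.single_le_sum (f := fun b => (x a * y b - x b * y a) *
      (ε * br (Z a) (Z b) (cyclicRow Z m) (cyclicRow Z (m + 1))))
      (fun b _ => hc.term_nonneg h hm a b) (Finset.mem_univ b))
    exact lt_of_le_of_ne (hc.term_nonneg h hm a b)
      (mul_ne_zero h0 (mul_ne_zero hε h1)).symm
  linarith

end Amplituhedron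

/-! ### Boundary lines meet an edge. -/

section Interior

variable {n : ℕ} [NeZero n] {Z : Matrix (Fin n) (Fin 4) ℝ}

open Matrix Topology

theorem br_cramer_mem_span {K : Type} [Field K] (p q b c d : Fin 4 → K) :
    br p q c d • b - br p q b d • c + br p q b c • d ∈ span K {p, q} := by
  refine mem_span_pair.2 ⟨-br q b c d, br p b c d, ?_⟩
  rw [eq_comm, ← sub_eq_zero, ← br_cramer p q b c d]
  module

/-- A line whose brackets with consecutive points are positive, and such that the brackets with
the first point change sign, lies in the amplituhedron. -/
theorem CyclicallyPositive.mem_amplituhedron {ε : ℝ} (hc : CyclicallyPositive Z ε) (hn : 4 ≤ n)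
    {Y : Gr ℝ 4} {y₁ y₂ : Fin 4 → ℝ} (hY : Y.space = span ℝ {y₁, y₂}) {δ : ℝ}
    (hd : ∀ m < n, 0 < δ * br y₁ y₂ (cyclicRow Z m) (cyclicRow Z (m + 1))) {p : ℕ} (hp : p < n)
    (hs : δ * br y₁ y₂ (Z 0) (cyclicRow Z p) < 0) : Y ∈ amplituhedron Z := by
  set s : ℕ → ℝ := fun m => δ * br y₁ y₂ (Z 0) (cyclicRow Z m) with hsdef
  have hs1 : 0 < s 1 := by
    have := hd 0 (by omega)
    rwa [cyclicRow_zero] at this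
  have hs0 : s 0 = 0 := by
    simp only [hsdef, cyclicRow_zero]
    rw [show br y₁ y₂ (Z 0) (Z 0) = 0 by simp only [br_apply]; ring, mul_zero]
  -- This is positivity for the last edge: since `cyclicRow Z n` is `-Z 0`, that bracket equals the
  -- one with `Z 0` in front.
  have hsl : 0 < s (n - 1) := by
    have := hd (n - 1) (by omega)
    rw [Nat.sub_add_cancel (by omega), cyclicRow_self, br_neg₄, ← br_swap₃₄] at this
    exact this
  have hp0 : p ≠ 0 := by
    rintro rfl
    exact hs.ne hs0
  have hp1 : p ≠ 1 := by
    rintro rfl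
    exact hs.not_gt hs1
  -- The sequence `s` is positive at both ends and negative at `p`. So it becomes negative in a step
  -- from `i` to `i + 1` before `p`, and positive again in a step from `j` to `j + 1` after it.
  obtain ⟨i, hi1, hip, hsi, hsi'⟩ : ∃ i, 1 ≤ i ∧ i < p ∧ 0 ≤ s i ∧ s (i + 1) < 0 := by
    by_contra! hcon
    have : ∀ m, 1 ≤ m → m ≤ p → 0 ≤ s m := by
      intro m hm
      induction m, hm using Nat.le_induction with
      | base => exact fun _ => hs1.le
      | succ m hm ih => exact fun h => hcon m hm (by omega) (ih (by omega))
    exact (this p (by omega) le_rfl).not_gt hs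
  obtain ⟨j, hpj, hjn, hsj, hsj'⟩ : ∃ j, p ≤ j ∧ j + 1 < n ∧ s j ≤ 0 ∧ 0 < s (j + 1) := by
    by_contra! hcon
    have : ∀ m, p ≤ m → m < n → s m ≤ 0 := by
      intro m hm
      induction m, hm using Nat.le_induction with
      | base => exact fun _ => hs.le
      | succ m hm ih => exact fun h => hcon m hm (by omega) (ih (by omega))
    exact (this (n - 1) (by omega) (by omega)).not_gt hsl
  let e : ℕ → Fin n → ℝ := fun m => Pi.single (Fin.ofNat n m) 1
  have he : ∀ m, m < n → (e m) ᵥ* Z = cyclicRow Z m := by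
    intro m hm
    simp only [e, Matrix.single_one_vecMul]
    rw [cyclicRow, Nat.div_eq_of_lt hm, pow_zero, one_smul]
    rfl
  have he' : ∀ (m : ℕ) (a : Fin n), m < n → e m a = if a.val = m then 1 else 0 := by
    intro m a hm
    simp only [e, Pi.single_apply]
    congr 1
    rw [eq_iff_iff, Fin.ext_iff]
    simp [Fin.ofNat, Nat.mod_eq_of_lt hm]
  set d : ℕ → ℝ := fun m => δ * br y₁ y₂ (cyclicRow Z m) (cyclicRow Z (m + 1)) with hddef
  -- By Cramer's rule these are the points in which the line meets the planes through `Z_0` and the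
  -- edges `i` and `j`. The choice of `i` makes all entries of `x` nonnegative; in `y`, only the
  -- entry at `0` is negative.
  let x : Fin n → ℝ := d i • e 0 - s (i + 1) • e i + s i • e (i + 1)
  let y : Fin n → ℝ := -(d j • e 0 - s (j + 1) • e j + s j • e (j + 1))
  have hdi : 0 < d i := hd i (by omega)
  have hdj : 0 < d j := hd j (by omega)
  have hx : x ᵥ* Z = d i • Z 0 - s (i + 1) • cyclicRow Z i + s i • cyclicRow Z (i + 1) := by
    simp only [x, Matrix.add_vecMul, Matrix.sub_vecMul, Matrix.smul_vecMul]
    rw [he 0 (by omega), he i (by omega), he (i + 1) (by omega), cyclicRow_zero]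
  have hy : y ᵥ* Z = -(d j • Z 0 - s (j + 1) • cyclicRow Z j + s j • cyclicRow Z (j + 1)) := by
    simp only [y, Matrix.neg_vecMul, Matrix.add_vecMul, Matrix.sub_vecMul, Matrix.smul_vecMul]
    rw [he 0 (by omega), he j (by omega), he (j + 1) (by omega), cyclicRow_zero]
  have hmem : ∀ m, d m • Z 0 - s (m + 1) • cyclicRow Z m + s m • cyclicRow Z (m + 1) ∈
      Y.space := by
    intro m
    rw [hY]
    have := (span ℝ {y₁, y₂}).smul_mem δ
      (br_cramer_mem_span y₁ y₂ (Z 0) (cyclicRow Z m) (cyclicRow Z (m + 1)))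
    convert this using 1
    simp only [hddef, hsdef]
    module
  -- A nonzero bracket shows that the two points are distinct, so that they span the line.
  have hpos : 0 < ε * br (x ᵥ* Z) (y ᵥ* Z) (cyclicRow Z i) (cyclicRow Z (i + 1)) := by
    have e1 : ε * br (x ᵥ* Z) (y ᵥ* Z) (cyclicRow Z i) (cyclicRow Z (i + 1)) =
        d i * (s (j + 1) *
          (ε * br (cyclicRow Z 0) (cyclicRow Z i) (cyclicRow Z (i + 1)) (cyclicRow Z j)) +
          -s j *
          (ε * br (cyclicRow Z 0) (cyclicRow Z i) (cyclicRow Z (i + 1)) (cyclicRow Z (j + 1)))) := by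
      rw [hx, hy, cyclicRow_zero]
      simp only [br_apply, Pi.add_apply, Pi.sub_apply, Pi.smul_apply, smul_eq_mul, Pi.neg_apply]
      ring
    rw [e1]
    refine mul_pos hdi ?_
    have t2 : 0 < ε * br (cyclicRow Z 0) (cyclicRow Z i) (cyclicRow Z (i + 1))
        (cyclicRow Z (j + 1)) := hc _ _ _ _ (by omega) (by omega) (by omega) (by omega)
    rcases Nat.lt_or_ge (i + 1) j with hij | hij
    · exact add_pos_of_pos_of_nonneg
        (mul_pos hsj' (hc _ _ _ _ (by omega) (by omega) hij (by omega)))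
        (mul_nonneg (neg_nonneg.2 hsj) t2.le)
    -- The descending and ascending steps share a vertex. One term degenerates, but the other is
    -- strictly positive because `s (i + 1)` is negative.
    · have hij' : j = i + 1 := by omega
      subst hij'
      rw [show br (cyclicRow Z 0) (cyclicRow Z i) (cyclicRow Z (i + 1)) (cyclicRow Z (i + 1)) = 0 by
        simp only [br_apply]; ring, mul_zero, mul_zero, zero_add]
      exact mul_pos (neg_pos.2 hsi') t2
  have hli := linearIndependent_of_br_ne_zero (right_ne_zero_of_mul hpos.ne')
  refine mem_amplituhedron_of_space_eq (x := x) (y := y) ?_ ?_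
  · have hx' : ∀ a : Fin n, x a = d i * (if a.val = 0 then 1 else 0) -
        s (i + 1) * (if a.val = i then 1 else 0) + s i * (if a.val = i + 1 then 1 else 0) := by
      intro a
      rw [← he' 0 a (by omega), ← he' i a (by omega), ← he' (i + 1) a (by omega)]
      rfl
    have hy' : ∀ a : Fin n, y a = -(d j * (if a.val = 0 then 1 else 0) -
        s (j + 1) * (if a.val = j then 1 else 0) + s j * (if a.val = j + 1 then 1 else 0)) := by
      intro a
      rw [← he' 0 a (by omega), ← he' j a (by omega), ← he' (j + 1) a (by omega)]
      rfl
    have hxn : ∀ a : Fin n, 0 ≤ x a := by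
      intro a
      rw [hx']
      split_ifs <;> first | omega | (simp only [mul_one, mul_zero]; linarith)
    have hyn : ∀ a : Fin n, a.val ≠ 0 → 0 ≤ y a := by
      intro a ha
      rw [hy', if_neg ha]
      split_ifs <;> first | omega | (simp only [mul_one, mul_zero]; linarith)
    have hxz : ∀ a : Fin n, i + 1 < a.val → x a = 0 := by
      intro a ha
      rw [hx', if_neg (by omega), if_neg (by omega), if_neg (by omega)]
      ring
    have hyz : ∀ a : Fin n, a.val ≠ 0 → a.val < j → y a = 0 := by
      intro a ha ha'
      rw [hy', if_neg (by omega), if_neg (by omega), if_neg (by omega)]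
      ring
    intro a b hab
    have hab' : a.val < b.val := hab
    by_cases ha : a.val = 0
    · have hx0 : x a = d i := by
        rw [hx', if_pos ha, if_neg (by omega), if_neg (by omega)]
        ring
      have hy0 : y a = -d j := by
        rw [hy', if_pos ha, if_neg (by omega), if_neg (by omega)]
        ring
      rw [hx0, hy0]
      have := mul_nonneg hdi.le (hyn b (by omega))
      have := mul_nonneg (hxn b) hdj.le
      linarith
    -- Apart from the index `0`, the support of `x` ends at `i + 1`, which is at most `j`, where the
    -- support of `y` begins. So the negative term of the minor vanishes.
    · have h1 := mul_nonneg (hxn a) (hyn b (by omega))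
      have h2 : x b * y a = 0 := by
        rcases Nat.lt_or_ge (i + 1) b.val with hb | hb
        · rw [hxz b hb, zero_mul]
        · rw [hyz a ha (by omega), mul_zero]
      linarith
  · refine Y.space_eq_of_mem ?_ ?_ ?_
    · rw [hx]
      exact hmem i
    · rw [hy]
      exact neg_mem (hmem j)
    · have := hli.comp ![0, 1] (by decide)
      convert this using 1
      ext a b
      fin_cases a <;> rfl

/-- The lines with positive consecutive brackets whose brackets with the first point change
sign. -/
def signChange (Z : Matrix (Fin n) (Fin 4) ℝ) : Set (Gr ℝ 4) :=
  {Y | ∃ (y₁ y₂ : Fin 4 → ℝ) (δ : ℝ), Y.space = span ℝ {y₁, y₂} ∧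
    (∀ m < n, 0 < δ * br y₁ y₂ (cyclicRow Z m) (cyclicRow Z (m + 1))) ∧
    ∃ p < n, δ * br y₁ y₂ (Z 0) (cyclicRow Z p) < 0}

theorem CyclicallyPositive.signChange_subset {ε : ℝ} (hc : CyclicallyPositive Z ε) (hn : 4 ≤ n) :
    signChange Z ⊆ amplituhedron Z := by
  rintro Y ⟨y₁, y₂, δ, hY, hd, p, hp, hs⟩
  exact hc.mem_amplituhedron hn hY hd hp hs

theorem continuous_br {T : Type*} [TopologicalSpace T] {f g h k : T → Fin 4 → ℝ}
    (hf : Continuous f) (hg : Continuous g) (hh : Continuous h) (hk : Continuous k) :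
    Continuous fun t => br (f t) (g t) (h t) (k t) := by
  simp only [br_apply]
  have hf' := continuous_pi_iff.1 hf
  have hg' := continuous_pi_iff.1 hg
  have hh' := continuous_pi_iff.1 hh
  have hk' := continuous_pi_iff.1 hk
  fun_prop

theorem isOpen_signChange : IsOpen (signChange Z) := by
  rw [isOpen_coinduced]
  -- Changing the spanning vectors only rescales `δ`, so the conditions can be imposed on the rows
  -- of the representing matrix, where they are open.
  have : (fun X : {X : Matrix (Fin 2) (Fin 4) ℝ // LinearIndependent ℝ X.row} =>
      Gr.rowSpace X.1 X.2) ⁻¹' signChange Z = ⋃ δ : ℝ,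
      {X | (∀ m < n, 0 < δ * br (X.1 0) (X.1 1) (cyclicRow Z m) (cyclicRow Z (m + 1))) ∧
        ∃ p < n, δ * br (X.1 0) (X.1 1) (Z 0) (cyclicRow Z p) < 0} := by
    ext X
    simp only [Set.mem_preimage, Set.mem_iUnion, Set.mem_ofPred_eq]
    constructor
    · rintro ⟨y₁, y₂, δ, hY, hd, p, hp, hs⟩
      have hl := (Gr.rowSpace X.1 X.2).pair_of_space_eq hY
      rw [Gr.rowSpace_space] at hY
      obtain ⟨γ, h0, hγ⟩ := exists_br_eq_smul hl hY.symm
      refine ⟨δ * γ, fun m hm => ?_, p, hp, ?_⟩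
      · rw [mul_assoc, ← hγ]
        exact hd m hm
      · rw [mul_assoc, ← hγ]
        exact hs
    · rintro ⟨δ, hd, p, hp, hs⟩
      exact ⟨X.1 0, X.1 1, δ, Gr.rowSpace_space _ _, hd, p, hp, hs⟩
  rw [this]
  refine isOpen_iUnion fun δ => ?_
  have hcont : ∀ c d : Fin 4 → ℝ, Continuous
      fun X : {X : Matrix (Fin 2) (Fin 4) ℝ // LinearIndependent ℝ X.row} =>
        δ * br (X.1 0) (X.1 1) c d := fun c d => continuous_const.mul
    (continuous_br ((continuous_apply 0).comp continuous_subtype_val)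
      ((continuous_apply 1).comp continuous_subtype_val) continuous_const continuous_const)
  refine IsOpen.and ?_ ?_
  · have : ∀ m : ℕ, IsOpen
        {X : {X : Matrix (Fin 2) (Fin 4) ℝ // LinearIndependent ℝ X.row} |
          0 < δ * br (X.1 0) (X.1 1) (cyclicRow Z m) (cyclicRow Z (m + 1))} :=
      fun m => isOpen_lt continuous_const (hcont _ _)
    have h := (Set.finite_Iio n).isOpen_biInter fun m _ => this m
    convert h using 2
    ext X
    simp
  · have : ∀ m : ℕ, IsOpen
        {X : {X : Matrix (Fin 2) (Fin 4) ℝ // LinearIndependent ℝ X.row} |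
          δ * br (X.1 0) (X.1 1) (Z 0) (cyclicRow Z m) < 0} :=
      fun m => isOpen_lt (hcont _ _) continuous_const
    have h := isOpen_biUnion (s := Set.Iio n) fun m _ => this m
    convert h using 2
    ext X
    simp

/-- On the amplituhedron, if no consecutive bracket vanishes then the brackets with the first
point change sign. -/
theorem CyclicallyPositive.mem_signChange {ε : ℝ} (hc : CyclicallyPositive Z ε) (hn : 4 ≤ n)
    {x y : Fin n → ℝ} (h : ∀ a b, a < b → 0 ≤ x a * y b - x b * y a) {Y : Gr ℝ 4}
    (hY : Y.space = span ℝ {x ᵥ* Z, y ᵥ* Z})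
    (h0 : ∀ m < n, br (x ᵥ* Z) (y ᵥ* Z) (cyclicRow Z m) (cyclicRow Z (m + 1)) ≠ 0) :
    Y ∈ signChange Z := by
  have hε : ε ≠ 0 := by
    rintro rfl
    have := hc 0 1 2 3 (by decide) (by decide) (by decide) (by omega)
    simp at this
  set y₁ := x ᵥ* Z with hy₁
  set y₂ := y ᵥ* Z with hy₂
  have hd : ∀ m < n, 0 < ε * br y₁ y₂ (cyclicRow Z m) (cyclicRow Z (m + 1)) := fun m hm =>
    lt_of_le_of_ne (hc.bracket_nonneg h hm) (mul_ne_zero hε (h0 m hm)).symm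
  refine ⟨y₁, y₂, ε, hY, hd, ?_⟩
  by_contra! hs
  have hs' : ∀ m, m + 1 < n → 0 < ε * br y₁ y₂ (Z 0) (cyclicRow Z (m + 1)) := by
    intro m
    induction m with
    | zero =>
      intro _
      rw [← cyclicRow_zero (Z := Z)]
      exact hd 0 (by omega)
    | succ m ih =>
      intro hm
      refine lt_of_le_of_ne (hs _ hm) fun hz => ?_
      have hz' : br y₁ y₂ (Z 0) (cyclicRow Z (m + 1 + 1)) = 0 :=
        (mul_eq_zero.1 hz.symm).resolve_left hε
      -- Suppose that there is no sign change and that a bracket with `Z_0` vanishes. Then this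
      -- relation equates the sum of a positive and a nonnegative product with zero. So without a
      -- sign change all these brackets are strictly positive.
      have hpl := br_plucker y₁ y₂ (Z 0) (cyclicRow Z (m + 1)) (cyclicRow Z (m + 1 + 1))
        (cyclicRow Z (m + 1 + 1 + 1))
      rw [hz'] at hpl
      have h3 : 0 ≤ ε * br y₁ y₂ (Z 0) (cyclicRow Z (m + 1 + 1 + 1)) := by
        rcases Nat.lt_or_ge (m + 1 + 1 + 1) n with h' | h'
        · exact hs _ h'
        · have : m + 1 + 1 + 1 = n := by omega
          rw [this, cyclicRow_self, br_neg₄]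
          rw [show br y₁ y₂ (Z 0) (Z 0) = 0 by simp only [br_apply]; ring]
          simp
      have p1 := mul_pos (ih (by omega)) (hd (m + 1 + 1) hm)
      have p2 := mul_nonneg h3 (hd (m + 1) (by omega)).le
      have : ε * br y₁ y₂ (Z 0) (cyclicRow Z (m + 1)) *
          (ε * br y₁ y₂ (cyclicRow Z (m + 1 + 1)) (cyclicRow Z (m + 1 + 1 + 1))) +
          ε * br y₁ y₂ (Z 0) (cyclicRow Z (m + 1 + 1 + 1)) *
          (ε * br y₁ y₂ (cyclicRow Z (m + 1)) (cyclicRow Z (m + 1 + 1))) = 0 := by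
        linear_combination ε ^ 2 * hpl
      linarith
  set s : Fin n → ℝ := fun a => ε * br y₁ y₂ (Z 0) (Z a) with hsdef
  have hspos : ∀ a : Fin n, a ≠ 0 → 0 < s a := by
    intro a ha
    have ha' : a.val ≠ 0 := fun h => ha (Fin.ext (by simpa using h))
    have := hs' (a.val - 1) (by omega)
    rwa [Nat.sub_add_cancel (by omega), cyclicRow_of_lt] at this
  have hs00 : s 0 = 0 := by
    simp only [hsdef]
    rw [show br y₁ y₂ (Z 0) (Z 0) = 0 by simp only [br_apply]; ring, mul_zero]
  -- The weighted sum is, up to sign, `ε ⟨y₁ y₂ Z_0 z⟩` for a point `z` equal to `y₁` or `y₂`.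
  have hsum : ∀ z : Fin n → ℝ, (z ᵥ* Z = y₁ ∨ z ᵥ* Z = y₂) → ∑ a, z a * s a = 0 := by
    intro z hz
    have e1 : ∑ a, z a * s a = ε * ∑ a, z a * br (Z a) y₁ (Z 0) y₂ := by
      rw [Finset.mul_sum]
      refine Finset.sum_congr rfl fun a _ => ?_
      simp only [hsdef, br_apply]
      ring
    rw [e1, ← br_vecMul_left]
    rcases hz with hz | hz <;> rw [hz] <;> simp only [br_apply] <;> ring
  have hx := hsum x (Or.inl rfl)
  have hy := hsum y (Or.inr rfl)
  -- Let `b` be the first nonzero column after the zeroth. Its minors with the other nonzero-index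
  -- columns, taken with `b` first, are nonnegative, and their sum with positive weights `s`
  -- vanishes by `hsum`. So all of them are zero, and the columns other than the zeroth are
  -- proportional.
  have hpar : ∀ a b : Fin n, a ≠ 0 → b ≠ 0 → x a * y b - x b * y a = 0 := by
    by_cases hne : ∀ b : Fin n, b ≠ 0 → x b = 0 ∧ y b = 0
    · intro a b ha hb
      rw [(hne a ha).1, (hne b hb).1]
      ring
    push Not at hne
    have hex : ∃ k : ℕ, ∃ hk : k < n, k ≠ 0 ∧ ¬ (x ⟨k, hk⟩ = 0 ∧ y ⟨k, hk⟩ = 0) := by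
      obtain ⟨b, hb, hb'⟩ := hne
      exact ⟨b, b.isLt, fun h => hb (Fin.ext (by simpa using h)), fun h => hb' h.1 h.2⟩
    classical
    obtain ⟨hk, hk0, hk'⟩ := Nat.find_spec hex
    have hmin := fun m hm => Nat.find_min hex (m := m) hm
    set b : Fin n := ⟨Nat.find hex, hk⟩ with hb
    have hterm : ∀ a ∈ Finset.univ, 0 ≤ (x b * y a - x a * y b) * s a := by
      intro a _
      by_cases ha : a = 0
      · rw [ha, hs00, mul_zero]
      refine mul_nonneg ?_ (hspos a ha).le
      rcases lt_or_ge b a with hab | hab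
      · exact h b a hab
      · rcases hab.eq_or_lt with rfl | hab
        · exact (sub_self _).ge
        · have := hmin a hab
          push Not at this
          obtain ⟨hz1, hz2⟩ := this a.isLt fun h => ha (Fin.ext (by simpa using h))
          rw [show x a = 0 from hz1, show y a = 0 from hz2]
          simp
    have hz : ∑ a, (x b * y a - x a * y b) * s a = 0 := by
      calc _ = x b * ∑ a, y a * s a - y b * ∑ a, x a * s a := by
            rw [Finset.mul_sum, Finset.mul_sum, ← Finset.sum_sub_distrib]
            exact Finset.sum_congr rfl fun a _ => by ring
        _ = 0 := by rw [hx, hy]; ring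
    have hall := (Finset.sum_eq_zero_iff_of_nonneg hterm).1 hz
    have hb0 : ∀ a : Fin n, a ≠ 0 → x b * y a - x a * y b = 0 := fun a ha =>
      (mul_eq_zero.1 (hall a (Finset.mem_univ a))).resolve_right (hspos a ha).ne'
    intro a c ha hc'
    have q1 := hb0 a ha
    have q2 := hb0 c hc'
    by_cases hxb : x b = 0
    · have hyb : y b ≠ 0 := fun h => hk' ⟨hxb, h⟩
      rw [hxb] at q1 q2
      have : x a = 0 := by
        have : x a * y b = 0 := by linarith
        exact (mul_eq_zero.1 this).resolve_right hyb
      have h2 : x c = 0 := by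
        have : x c * y b = 0 := by linarith
        exact (mul_eq_zero.1 this).resolve_right hyb
      rw [this, h2]
      ring
    · have hm : x b * (x a * y c - x c * y a) = 0 := by
        linear_combination x a * q2 - x c * q1
      exact (mul_eq_zero.1 hm).resolve_left hxb
  -- With all minors away from column `0` equal to zero, every term in the expansion of `⟨AB 0 1⟩`
  -- vanishes: the terms with column `0` repeat the vector `Z_0`. This contradicts positivity.
  have hlast := two_mul_br_eq_sum (Z := Z) ε x y (cyclicRow Z 0) (cyclicRow Z (0 + 1))
  have h1 := hd 0 (by omega)
  rw [Finset.sum_eq_zero] at hlast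
  · linarith
  intro a _
  refine Finset.sum_eq_zero fun b _ => ?_
  rw [cyclicRow_zero]
  by_cases ha : a = 0
  · rw [ha, br_eq_zero_of_eq₁₃]
    ring
  by_cases hb : b = 0
  · rw [hb, br_eq_zero_of_eq₂₃]
    ring
  rw [hpar a b ha hb, zero_mul]

theorem br_cyclicRow_eq_zero_iff (y₁ y₂ : Fin 4 → ℝ) (a b : ℕ) :
    br y₁ y₂ (cyclicRow Z a) (cyclicRow Z b) = 0 ↔
      br y₁ y₂ (Z (Fin.ofNat n a)) (Z (Fin.ofNat n b)) = 0 := by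
  rw [cyclicRow, cyclicRow]
  rcases neg_one_pow_eq_or ℝ (a / n) with h | h <;>
    rcases neg_one_pow_eq_or ℝ (b / n) with h' | h' <;> rw [h, h'] <;>
    simp only [one_smul, neg_smul, br_neg₃, br_neg₄, neg_neg, neg_eq_zero]

/-- A line of the amplituhedron with no vanishing consecutive bracket has the sign-change pattern,
and the open set of such lines is contained in the amplituhedron. -/
theorem CyclicallyPositive.exists_bracket_eq_zero {ε : ℝ} (hc : CyclicallyPositive Z ε)
    (hn : 4 ≤ n) {Y : Gr ℝ 4} (hY : Y ∈ amplituhedronBoundary Z) {y₁ y₂ : Fin 4 → ℝ}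
    (hs : Y.space = span ℝ {y₁, y₂}) : ∃ i : Fin n, br y₁ y₂ (Z i) (Z (i + 1)) = 0 := by
  obtain ⟨hA, hint⟩ := hY
  obtain ⟨x, y, h, hxy⟩ := exists_of_mem_amplituhedron hA
  by_contra! hcon
  obtain ⟨δ, h0, hδ⟩ := exists_br_eq_smul (Y.pair_of_space_eq hxy) (hxy.symm.trans hs)
  refine hint (interior_maximal (hc.signChange_subset hn) isOpen_signChange
    (hc.mem_signChange hn h hxy fun m hm => ?_))
  rw [hδ]
  refine mul_ne_zero h0 ?_
  rw [Ne, br_cyclicRow_eq_zero_iff, ofNat_add_one]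
  exact hcon _

end Interior

/-! ### Boundary lines are Zariski dense in each edge hypersurface. -/

section Density

variable {n : ℕ} [NeZero n] {Z : Matrix (Fin n) (Fin 4) ℝ}

open Matrix Topology

theorem span_image_complexify (y₁ y₂ : Fin 4 → ℝ) :
    span ℂ ((fun (v : Fin 4 → ℝ) (k : Fin 4) => (v k : ℂ)) '' (span ℝ {y₁, y₂} : Set _)) =
      span ℂ {complexify y₁, complexify y₂} := by
  apply le_antisymm <;> rw [span_le]
  · rintro _ ⟨v, hv, rfl⟩
    obtain ⟨a, b, rfl⟩ := mem_span_pair.1 hv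
    refine mem_span_pair.2 ⟨a, b, ?_⟩
    ext k
    simp [complexify]
  · rintro _ (rfl | rfl)
    · exact subset_span ⟨y₁, subset_span (by simp), rfl⟩
    · exact subset_span ⟨y₂, subset_span (by simp), rfl⟩

theorem NoFourCoplanar.br_ne_zero (hI : NoFourCoplanar Z) {a b c d : Fin n} (hab : a ≠ b)
    (hac : a ≠ c) (had : a ≠ d) (hbc : b ≠ c) (hbd : b ≠ d) (hcd : c ≠ d) :
    br (Z a) (Z b) (Z c) (Z d) ≠ 0 := by
  have := hI a b c d hab hac had hbc hbd hcd
  rwa [rowPoint_eq_complexify, rowPoint_eq_complexify, rowPoint_eq_complexify,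
    rowPoint_eq_complexify, br_complexify, Complex.ofReal_ne_zero] at this

/-- The signs of the coefficients of a boundary point on the `i`-th edge. -/
def edgeSign (i : Fin n) : ℝ := if i.val + 1 < n then 1 else -1

/-- The sign jumps right after `i`, so that every minor of the edge row with the cut row is
nonnegative. For the edge that wraps around, the entry at vertex `0` is negated instead, by
`edgeSign`. -/
def cutSign (i a : Fin n) : ℝ := if a ≤ i then -1 else 1

theorem edgeSign_mul_self (i : Fin n) : edgeSign i * edgeSign i = 1 := by
  rw [edgeSign]
  split_ifs <;> norm_num

theorem cutSign_mul_self (i a : Fin n) : cutSign i a * cutSign i a = 1 := by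
  rw [cutSign]
  split_ifs <;> norm_num

/-- The first row of a totally nonnegative matrix representing a boundary point. -/
def edgeRow (i : Fin n) (α β : ℝ) : Fin n → ℝ :=
  α • Pi.single i 1 + (β * edgeSign i) • Pi.single (i + 1) 1

/-- The second row of a totally nonnegative matrix representing a boundary point. -/
def cutRow (i : Fin n) (c : Fin n → ℝ) : Fin n → ℝ := fun a => c a * cutSign i a

theorem edgeRow_vecMul (i : Fin n) (α β : ℝ) :
    edgeRow i α β ᵥ* Z = α • Z i + (β * edgeSign i) • Z (i + 1) := by
  rw [edgeRow, Matrix.add_vecMul, Matrix.smul_vecMul, Matrix.smul_vecMul,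
    Matrix.single_one_vecMul, Matrix.single_one_vecMul]
  rfl

theorem edgeRow_minor_nonneg (hn : 4 ≤ n) (i : Fin n) {α β : ℝ} (hα : 0 < α) (hβ : 0 < β)
    {c : Fin n → ℝ} (hc : ∀ a, 0 < c a) (a b : Fin n) (hab : a < b) :
    0 ≤ edgeRow i α β a * cutRow i c b - edgeRow i α β b * cutRow i c a := by
  have h := val_add_one_cases (by omega) i
  have hca := hc a
  have hcb := hc b
  have p1 := mul_pos hα hca
  have p2 := mul_pos hα hcb
  have p3 := mul_pos hβ hca
  have p4 := mul_pos hβ hcb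
  simp only [edgeRow, cutRow, edgeSign, cutSign, Pi.add_apply, Pi.smul_apply, Pi.single_apply,
    smul_eq_mul]
  split_ifs <;> first | omega | linarith

/-- The minor on columns `i` and `b`, with `b` off the vertices involved, is a nonzero term. The
resulting strict inequality on edge `i + 1` serves as a reference for the orientation. -/
theorem CyclicallyPositive.edgeRow_bracket_pos {ε : ℝ} (hc : CyclicallyPositive Z ε)
    (hI : NoFourCoplanar Z) (hn : 4 ≤ n) (i : Fin n) {α β : ℝ} (hα : 0 < α) (hβ : 0 < β)
    {c : Fin n → ℝ} (hc' : ∀ a, 0 < c a) :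
    0 < ε * br (edgeRow i α β ᵥ* Z) (cutRow i c ᵥ* Z) (cyclicRow Z (i + 1 : Fin n).val)
      (cyclicRow Z ((i + 1 : Fin n).val + 1)) := by
  obtain ⟨b, hb1, hb2, hb3⟩ := exists_ne_three hn i (i + 1) (i + 1 + 1)
  have h1 := ne_add_one hn i
  have h2 := ne_add_one hn (i + 1)
  have h3 : i ≠ i + 1 + 1 := by
    have := sub_one_ne_add_one hn (i + 1)
    rwa [add_sub_cancel_right] at this
  refine hc.bracket_pos hn (edgeRow_minor_nonneg hn i hα hβ hc') (i + 1).isLt (a := i) (b := b)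
    ?_ ?_
  · have e1 : edgeRow i α β i = α := by simp [edgeRow, h1]
    have e2 : edgeRow i α β b = 0 := by simp [edgeRow, hb1, hb2]
    rw [e1, e2, zero_mul, sub_zero, cutRow]
    refine mul_ne_zero hα.ne' (mul_ne_zero (hc' b).ne' ?_)
    rw [cutSign]
    split_ifs <;> norm_num
  · rw [Ne, br_cyclicRow_eq_zero_iff, ofNat_add_one, Fin.ofNat_val_eq_self]
    exact hI.br_ne_zero hb1.symm h1 h3 hb2 hb3 h2

/-- Move the point on edge `i` towards `Z_{i+2}` by a parameter `t`. The bracket of edge `i` is then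
`t` times a nonzero constant and changes sign at `t = 0`, while that of edge `i + 1` stays positive.
On the amplituhedron the two cannot have opposite signs. -/
theorem CyclicallyPositive.not_mem_interior {ε : ℝ} (hc : CyclicallyPositive Z ε)
    (hI : NoFourCoplanar Z) (hn : 4 ≤ n) (i : Fin n) {α β : ℝ} (hα : 0 < α) (hβ : 0 < β)
    {c : Fin n → ℝ} (hc' : ∀ a, 0 < c a) {Y : Gr ℝ 4}
    (hY : Y.space = span ℝ {edgeRow i α β ᵥ* Z, cutRow i c ᵥ* Z}) :
    Y ∉ interior (amplituhedron Z) := by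
  intro hmem
  have hpos := hc.edgeRow_bracket_pos hI hn i hα hβ hc'
  set j : Fin n := i + 1 with hj
  set y₁ := edgeRow i α β ᵥ* Z with hy₁
  set y₂ := cutRow i c ᵥ* Z with hy₂
  set w := Z (j + 1)
  have hε : ε ≠ 0 := left_ne_zero_of_mul hpos.ne'
  have hy₁' : y₁ = α • Z i + (β * edgeSign i) • Z j := edgeRow_vecMul i α β
  have hj' : cyclicRow Z j = Z j := cyclicRow_of_lt j
  -- The slope of the bracket of edge `i` is, up to a nonzero factor, the bracket of edge `i + 1`,
  -- which is known to be nonzero.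
  have hq : br w y₂ (cyclicRow Z i) (cyclicRow Z (i.val + 1)) ≠ 0 := by
    rw [Ne, br_cyclicRow_eq_zero_iff, ofNat_add_one, Fin.ofNat_val_eq_self]
    intro h0
    refine right_ne_zero_of_mul hpos.ne' ?_
    rw [br_cyclicRow_eq_zero_iff, ofNat_add_one, Fin.ofNat_val_eq_self, hy₁']
    have : br (α • Z i + (β * edgeSign i) • Z j) y₂ (Z j) (Z (j + 1)) =
        α * br w y₂ (Z i) (Z j) := by
      simp only [br_apply, Pi.add_apply, Pi.smul_apply, smul_eq_mul, w]
      ring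
    rw [this, h0, mul_zero]
  have hz : br y₁ y₂ (cyclicRow Z i) (cyclicRow Z (i.val + 1)) = 0 := by
    rw [br_cyclicRow_eq_zero_iff, ofNat_add_one, Fin.ofNat_val_eq_self, hy₁']
    simp only [br_apply, Pi.add_apply, Pi.smul_apply, smul_eq_mul, hj]
    ring
  have hopen : IsOpen {X : Matrix (Fin 2) (Fin 4) ℝ | ∃ hX : LinearIndependent ℝ X.row,
      Gr.rowSpace X hX ∈ interior (amplituhedron Z)} := by
    have h1 : IsOpen ((fun X : {X : Matrix (Fin 2) (Fin 4) ℝ // LinearIndependent ℝ X.row} =>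
      Gr.rowSpace X.1 X.2) ⁻¹' interior (amplituhedron Z)) :=
      isOpen_coinduced.1 isOpen_interior
    have h2 : IsOpen {X : Matrix (Fin 2) (Fin 4) ℝ | LinearIndependent ℝ X.row} :=
      isOpen_setOfPred_linearIndependent (𝕜 := ℝ) (E := Fin 4 → ℝ) (ι := Fin 2)
    convert h2.isOpenMap_subtype_val _ h1 using 1
    ext X
    constructor
    · rintro ⟨hX, h⟩
      exact ⟨⟨X, hX⟩, h, rfl⟩
    · rintro ⟨⟨X, hX⟩, h, rfl⟩
      exact ⟨hX, h⟩
  let γ : ℝ → Matrix (Fin 2) (Fin 4) ℝ := fun t => Matrix.of ![y₁ + t • w, y₂]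
  have hγ0 : ∀ t, γ t 0 = y₁ + t • w := fun _ => rfl
  have hγ1 : ∀ t, γ t 1 = y₂ := fun _ => rfl
  have hγ : Continuous γ := by
    refine continuous_pi fun r => ?_
    fin_cases r
    · exact (continuous_const.add (continuous_id.smul continuous_const) :
        Continuous fun t : ℝ => y₁ + t • w)
    · exact (continuous_const : Continuous fun t : ℝ => y₂)
  have ev1 : ∀ᶠ t in 𝓝 (0 : ℝ), ∃ hX : LinearIndependent ℝ (γ t).row,
      Gr.rowSpace (γ t) hX ∈ interior (amplituhedron Z) := by
    refine hγ.continuousAt.eventually (hopen.mem_nhds ?_)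
    have hl : LinearIndependent ℝ (γ 0).row := by
      rw [Gr.linearIndependent_row_iff]
      rw [hγ0, hγ1, zero_smul, add_zero]
      exact Y.pair_of_space_eq hY
    refine ⟨hl, ?_⟩
    convert hmem
    ext1
    rw [Gr.rowSpace_space, hY, hγ0, hγ1, zero_smul, add_zero]
  have ev2 : ∀ᶠ t in 𝓝 (0 : ℝ), 0 < ε * br (y₁ + t • w) y₂ (cyclicRow Z j)
      (cyclicRow Z (j.val + 1)) := by
    have hcont : Continuous fun t : ℝ => ε * br (y₁ + t • w) y₂ (cyclicRow Z j)
        (cyclicRow Z (j.val + 1)) :=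
      continuous_const.mul (continuous_br (continuous_const.add
        (continuous_id.smul continuous_const)) continuous_const continuous_const continuous_const)
    refine hcont.continuousAt.eventually (lt_mem_nhds ?_)
    simpa using hpos
  have key : ∀ᶠ t in 𝓝 (0 : ℝ), 0 ≤ t * (ε * br w y₂ (cyclicRow Z i)
      (cyclicRow Z (i.val + 1))) := by
    filter_upwards [ev1, ev2] with t ⟨hX, hA⟩ ht
    obtain ⟨x, y, hxy, hs⟩ := exists_of_mem_amplituhedron (interior_subset hA)
    have hl := Gr.pair_of_space_eq _ hs
    rw [Gr.rowSpace_space] at hs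
    obtain ⟨δ, h0, hδ⟩ := exists_br_eq_smul hl hs.symm
    have b1 := hc.bracket_nonneg hxy (m := j) j.isLt
    have b2 := hc.bracket_nonneg hxy (m := i) i.isLt
    rw [hδ, hγ0, hγ1] at b1 b2
    -- The representing matrix determines the spanning pair only up to a factor; the positive
    -- bracket of edge `i + 1` fixes its sign.
    have hδ0 : 0 < δ := by
      by_contra! hneg
      have hlt : δ < 0 := lt_of_le_of_ne hneg h0
      have := mul_neg_of_neg_of_pos hlt ht
      linarith
    have e : br (y₁ + t • w) y₂ (cyclicRow Z i) (cyclicRow Z (i.val + 1)) =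
        t * br w y₂ (cyclicRow Z i) (cyclicRow Z (i.val + 1)) := by
      have := br_add_smul_left y₁ w y₂ (cyclicRow Z i) (cyclicRow Z (i.val + 1)) 1 t
      rw [one_smul, hz, mul_zero, zero_add] at this
      exact this
    rw [e] at b2
    refine nonneg_of_mul_nonneg_right (a := δ) ?_ hδ0
    linarith
  obtain ⟨r, hr, hball⟩ := Metric.eventually_nhds_iff.1 key
  -- Taking both signs of the parameter forces the slope to be zero.
  have k1 := hball (y := r / 2) (by rw [Real.dist_eq, sub_zero, abs_of_pos (by linarith)]; linarith)
  have k2 := hball (y := -(r / 2)) (by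
    rw [Real.dist_eq, sub_zero, abs_neg, abs_of_pos (by linarith)]; linarith)
  have : r / 2 * (ε * br w y₂ (cyclicRow Z i) (cyclicRow Z (i.val + 1))) = 0 := by linarith
  exact mul_ne_zero (by linarith) (mul_ne_zero hε hq) this

/-- The complexification of the boundary of the amplituhedron. -/
def complexBoundary (Z : Matrix (Fin n) (Fin 4) ℝ) : Set (Gr ℂ 4) :=
  {V | ∃ Y ∈ amplituhedronBoundary Z,
    V.space = span ℂ ((fun (v : Fin 4 → ℝ) (k : Fin 4) => (v k : ℂ)) '' Y.space)}

theorem CyclicallyPositive.mem_complexBoundary {ε : ℝ} (hc : CyclicallyPositive Z ε)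
    (hI : NoFourCoplanar Z) (hn : 4 ≤ n) (i : Fin n) {α β : ℝ} (hα : 0 < α) (hβ : 0 < β)
    {c : Fin n → ℝ} (hc' : ∀ a, 0 < c a) : ∃ V ∈ complexBoundary Z,
      V.space = span ℂ {complexify (edgeRow i α β ᵥ* Z), complexify (cutRow i c ᵥ* Z)} := by
  have hb := right_ne_zero_of_mul (hc.edgeRow_bracket_pos hI hn i hα hβ hc').ne'
  have hl : ∀ {K : Type} [Field K] {a b c d : Fin 4 → K}, br a b c d ≠ 0 →
      LinearIndependent K ![a, b] := by
    intro K _ a b c d h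
    have := (linearIndependent_of_br_ne_zero h).comp ![0, 1] (by decide)
    convert this using 1
    ext r k
    fin_cases r <;> rfl
  refine ⟨Gr.ofPair _ _ (hl (a := complexify (edgeRow i α β ᵥ* Z))
    (b := complexify (cutRow i c ᵥ* Z)) (c := complexify (cyclicRow Z (i + 1 : Fin n).val))
    (d := complexify (cyclicRow Z ((i + 1 : Fin n).val + 1))) ?_), ?_, Gr.ofPair_space _ _ _⟩
  · rw [br_complexify, Complex.ofReal_ne_zero]
    exact hb
  · refine ⟨Gr.ofPair _ _ (hl hb), ⟨?_, ?_⟩, ?_⟩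
    · exact mem_amplituhedron_of_space_eq (edgeRow_minor_nonneg hn i hα hβ hc')
        (Gr.ofPair_space _ _ _)
    · exact hc.not_mem_interior hI hn i hα hβ hc' (Gr.ofPair_space _ _ _)
    · rw [Gr.ofPair_space, Gr.ofPair_space, span_image_complexify]

theorem NoFourCoplanar.exists_eq_sum (hI : NoFourCoplanar Z) (hn : 4 ≤ n) (y : Fin 4 → ℂ) :
    ∃ c : Fin n → ℂ, y = ∑ a, c a • rowPoint Z a := by
  let e : Fin 4 → Fin n := Fin.castLE hn
  have he : Function.Injective e := Fin.castLE_injective hn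
  have hl := linearIndependent_of_br_ne_zero (hI (e 0) (e 1) (e 2) (e 3) (he.ne (by decide))
    (he.ne (by decide)) (he.ne (by decide)) (he.ne (by decide)) (he.ne (by decide))
    (he.ne (by decide)))
  have htop : span ℂ (Set.range (rowPoint Z)) = ⊤ := by
    rw [eq_top_iff, ← hl.span_eq_top_of_card_eq_finrank (by simp), span_le]
    rintro _ ⟨r, rfl⟩
    fin_cases r <;> exact subset_span ⟨_, rfl⟩
  have hy : y ∈ span ℂ (Set.range (rowPoint Z)) := htop ▸ mem_top
  obtain ⟨c, hc⟩ := (Submodule.mem_span_range_iff_exists_fun ℂ).1 hy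
  exact ⟨c, hc.symm⟩

-- In the coefficients of the edge row and the cut row, a form becomes a polynomial in free
-- variables. If it vanishes on the boundary, it vanishes at all positive real values of these
-- variables, hence identically. Complex values of the same variables reach every line meeting the
-- edge.
open MvPolynomial in
theorem CyclicallyPositive.onEdge_subset {ε : ℝ} (hc : CyclicallyPositive Z ε)
    (hI : NoFourCoplanar Z) (hn : 4 ≤ n) (i : Fin n) :
    onEdge Z i ⊆ closure (complexBoundary Z) := by
  intro V hV
  rw [Gr.isTopologicalBasis_basicOpen.mem_closure_iff]
  rintro _ ⟨d, f, hf, rfl⟩ hVf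
  by_contra hempty
  rw [Set.not_nonempty_iff_eq_empty] at hempty
  let px : Fin 4 → MvPolynomial (Fin 2 ⊕ Fin n) ℂ := fun k =>
    X (Sum.inl 0) * C (rowPoint Z i k) + X (Sum.inl 1) * C (edgeSign i * rowPoint Z (i + 1) k)
  let py : Fin 4 → MvPolynomial (Fin 2 ⊕ Fin n) ℂ := fun k =>
    ∑ a, X (Sum.inr a) * C (cutSign i a * rowPoint Z a k)
  let P : MvPolynomial (Fin 2 ⊕ Fin n) ℂ :=
    bind₁ (fun p : PluckerIndex 4 => px p.1.1 * py p.1.2 - px p.1.2 * py p.1.1) f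
  have hP : ∀ u : Fin 2 ⊕ Fin n → ℂ, eval u P = eval (Gr.pairPlucker
      (u (Sum.inl 0) • rowPoint Z i + (u (Sum.inl 1) * edgeSign i) • rowPoint Z (i + 1))
      (∑ a, (u (Sum.inr a) * cutSign i a) • rowPoint Z a)) f := by
    intro u
    simp only [P]
    rw [← coe_aeval_eq_eval, RingHom.coe_coe, aeval_bind₁, aeval_def, ← coe_eval₂Hom]
    change eval _ f = _
    congr 2
    ext p
    simp [px, py, Gr.pairPlucker, aeval_def, mul_assoc]
  -- A polynomial vanishing on a product of infinite sets is zero; here each set consists of the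
  -- positive reals.
  have hP0 : P = 0 := by
    refine MvPolynomial.funext_set (fun _ => (fun t : ℝ => (t : ℂ)) '' Set.Ioi 0) (fun _ =>
      (Set.Ioi_infinite 0).image Complex.ofReal_injective.injOn) fun u hu => ?_
    rw [map_zero, hP]
    have hu' : ∀ r, ∃ t : ℝ, 0 < t ∧ (t : ℂ) = u r := fun r => hu r (Set.mem_univ r)
    choose t ht htu using hu'
    obtain ⟨W, hW, hWs⟩ := hc.mem_complexBoundary hI hn i (ht (Sum.inl 0)) (ht (Sum.inl 1))
      (fun a => ht (Sum.inr a))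
    by_contra hne
    refine Set.notMem_empty W (hempty ▸ ⟨?_, hW⟩)
    have e1 : complexify (edgeRow i (t (Sum.inl 0)) (t (Sum.inl 1)) ᵥ* Z) =
        u (Sum.inl 0) • rowPoint Z i + (u (Sum.inl 1) * edgeSign i) • rowPoint Z (i + 1) := by
      rw [edgeRow_vecMul, ← htu, ← htu]
      ext k
      simp [complexify, rowPoint]
    have e2 : complexify (cutRow i (fun a => t (Sum.inr a)) ᵥ* Z) =
        ∑ a, (u (Sum.inr a) * cutSign i a) • rowPoint Z a := by
      rw [Matrix.vecMul_eq_sum]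
      ext k
      simp [complexify, rowPoint, htu, cutRow]
    rw [Gr.mem_basicOpen hf hWs, e1, e2]
    exact hne
  obtain ⟨x, hxV, hx0, hx⟩ := exists_mem_of_mem_meetsLine hV
  obtain ⟨α, β, rfl⟩ := mem_span_pair.1 hx
  obtain ⟨y, hy⟩ := V.exists_space_eq_of_mem hxV hx0
  obtain ⟨c, rfl⟩ := hI.exists_eq_sum hn y
  rw [Gr.mem_basicOpen hf hy] at hVf
  refine hVf ?_
  -- The signs have square one, so multiplying the wanted coefficients by them cancels the signs
  -- built into the parametrisation.
  have h := hP (Sum.elim ![α, β * edgeSign i] fun a => c a * cutSign i a)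
  rw [hP0, map_zero] at h
  rw [h]
  have s1 : (edgeSign i : ℂ) * edgeSign i = 1 := by exact_mod_cast edgeSign_mul_self i
  have s2 : ∀ a, (cutSign i a : ℂ) * cutSign i a = 1 := fun a => by
    exact_mod_cast cutSign_mul_self i a
  simp [mul_assoc, s1, s2]

theorem CyclicallyPositive.algebraicBoundary_eq {ε : ℝ} (hc : CyclicallyPositive Z ε)
    (hI : NoFourCoplanar Z) (hn : 4 ≤ n) : algebraicBoundary Z = ⋃ i, onEdge Z i := by
  apply Set.Subset.antisymm
  · refine closure_minimal ?_ (isClosed_iUnion_of_finite fun i => hI.isClosed_onEdge hn i)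
    rintro V ⟨Y, hY, hV⟩
    obtain ⟨y₁, y₂, hs⟩ := Y.exists_space_eq_span
    rw [hs, span_image_complexify] at hV
    obtain ⟨i, hi⟩ := hc.exists_bracket_eq_zero hn hY hs
    refine Set.mem_iUnion.2 ⟨i, ?_⟩
    refine (Gr.mem_incident_iff_inf_ne_bot (hI.linearIndependent_pair hn (ne_add_one hn i))).1 ?_
    rw [Gr.mem_incident_iff hV, rowPoint_eq_complexify, rowPoint_eq_complexify, br_complexify, hi,
      Complex.ofReal_zero]
  · exact Set.iUnion_subset fun i => hc.onEdge_subset hI hn i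

end Density

/-! ### Local incidence rules for a line meeting several edges. -/

section Incidence

variable {n : ℕ} [NeZero n]

theorem disjoint_edge_of_ne {j k : Fin n} (hjk : j ≠ k) (h1 : k ≠ j + 1) (h2 : j ≠ k + 1) :
    Disjoint (edge j) (edge k) :=
  disjoint_edge_edge.2 ⟨hjk, h2, h1.symm⟩

/-- The hypotheses on `Z` in the form in which they are used. -/
structure IsGeneric (Z : Matrix (Fin n) (Fin 4) ℝ) : Prop where
  four_le : 4 ≤ n
  noFourCoplanar : NoFourCoplanar Z
  positive : ∃ ε, CyclicallyPositive Z ε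
  card_le_four : ∀ (V : Gr ℂ 4) (s : Finset (Fin n)), (∀ m ∈ s, V ∈ onEdge Z m) → s.card ≤ 4

variable {Z : Matrix (Fin n) (Fin 4) ℝ}

theorem isGeneric_of_totallyPositive (hn : 4 ≤ n) (hZ : TotallyPositive Z)
    (hgen : GeneralPosition Z) : IsGeneric Z where
  four_le := hn
  noFourCoplanar := hZ.noFourCoplanar hn
  positive := hZ.cyclicallyPositive hn
  card_le_four V s hs := by
    obtain ⟨X, hX, rfl⟩ := V.exists_eq_rowSpace
    refine le_trans ?_ (hgen X hX)
    rw [← Set.ncard_coe_finset]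
    refine Set.ncard_le_ncard (fun m hm => ?_) (Set.toFinite _)
    have := (Gr.mem_incident_iff_inf_ne_bot ((hZ.noFourCoplanar hn).linearIndependent_pair hn
      (ne_add_one hn m)) (V := Gr.rowSpace X hX)).2 (hs m hm)
    exact (Gr.mem_incident_iff (Gr.rowSpace_space X hX)).1 this

namespace IsGeneric

variable {V : Gr ℂ 4}

theorem mem_or_inPlane_succ (h : IsGeneric Z) {j : Fin n} (h1 : V ∈ onEdge Z j)
    (h2 : V ∈ onEdge Z (j + 1)) : V ∈ throughPoint Z (j + 1) ∨ V ∈ inPlane Z (j + 1) := by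
  refine h.noFourCoplanar.mem_or_inPlane h.four_le ?_ h2
  rwa [add_sub_cancel_right]

/-- Otherwise the line would lie in two neighbouring corner planes, and their intersection passes
through the vertex anyway. -/
theorem mem_succ_of_inPlane (h : IsGeneric Z) {i : Fin n} (h1 : V ∈ inPlane Z i)
    (h2 : V ∈ onEdge Z (i + 1)) : V ∈ throughPoint Z (i + 1) := by
  rcases h.mem_or_inPlane_succ (h.noFourCoplanar.onEdge_of_inPlane h.four_le h1) h2 with h3 | h3
  · exact h3
  · exact (h.noFourCoplanar.join_of_inPlane h.four_le h1 h3).2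

theorem mem_pred_of_inPlane (h : IsGeneric Z) {i : Fin n} (h1 : V ∈ inPlane Z i)
    (h2 : V ∈ onEdge Z (i - 1 - 1)) : V ∈ throughPoint Z (i - 1) := by
  have h3 := h.noFourCoplanar.onEdge_pred_of_inPlane h.four_le h1
  rcases h.noFourCoplanar.mem_or_inPlane h.four_le h2 h3 with h4 | h4
  · exact h4
  · exact (h.noFourCoplanar.join_of_inPlane h.four_le h4 (by rwa [sub_add_cancel])).1

theorem disjoint_corner_edge_of_inPlane (h : IsGeneric Z) {i m : Fin n} (h1 : V ∈ inPlane Z i)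
    (h2 : V ∈ onEdge Z m) (ha : V ∉ throughPoint Z (i + 1)) (hb : V ∉ throughPoint Z (i - 1))
    (hm : m ≠ i - 1) (hm' : m ≠ i) : Disjoint (corner i) (edge m) := by
  rw [disjoint_corner_edge]
  refine ⟨hm.symm, fun e => ?_, hm'.symm, fun e => hm ?_, fun e => ?_, fun e => hm' ?_⟩
  · exact hb (h.mem_pred_of_inPlane h1 (by rwa [e, add_sub_cancel_right]))
  · rw [e, add_sub_cancel_right]
  · exact ha (h.mem_succ_of_inPlane h1 (by rwa [e]))
  · exact (add_right_cancel e).symm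

/-- If the common vertex were not on the line, line and vertex would span both corner planes. Equal
corner planes have equal vertex sets, because no four vertices are coplanar, and then `i` and `j`
agree. -/
theorem mem_of_inPlane_inPlane (h : IsGeneric Z) {i j a : Fin n} (hij : i ≠ j)
    (h1 : V ∈ inPlane Z i) (h2 : V ∈ inPlane Z j) (hi : a = i - 1 ∨ a = i ∨ a = i + 1)
    (hj : a = j - 1 ∨ a = j ∨ a = j + 1) : V ∈ throughPoint Z a := by
  by_contra hV
  have hn := h.four_le
  have hI := h.noFourCoplanar
  have hlt : V.space < V.space ⊔ span ℂ {rowPoint Z a} := by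
    refine lt_of_le_of_ne le_sup_left fun e => hV ?_
    rw [mem_throughPoint, e]
    exact mem_sup_right (mem_span_singleton_self _)
  have hr := Submodule.finrank_lt_finrank_of_lt hlt
  rw [V.finrank_space] at hr
  have key : ∀ k : Fin n, V ∈ inPlane Z k → (a = k - 1 ∨ a = k ∨ a = k + 1) →
      V.space ⊔ span ℂ {rowPoint Z a} =
        span ℂ {rowPoint Z (k - 1), rowPoint Z k, rowPoint Z (k + 1)} := by
    intro k hk ha
    refine Submodule.eq_of_le_of_finrank_le (sup_le hk ?_) ?_
    · rw [span_singleton_le_iff_mem]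
      exact rowPoint_mem_plane ha
    · rw [hI.finrank_plane hn]
      exact hr
  have e := (key i h1 hi).symm.trans (key j h2 hj)
  have hmem : ∀ b, (b = j - 1 ∨ b = j ∨ b = j + 1) → b = i - 1 ∨ b = i ∨ b = i + 1 := by
    intro b hb
    refine hI.eq_of_mem_plane (sub_one_ne hn i) (sub_one_ne_add_one hn i) (ne_add_one hn i) ?_
    rw [e]
    exact rowPoint_mem_plane hb
  have i1 := hmem (j - 1) (Or.inl rfl)
  have i2 := hmem j (Or.inr (Or.inl rfl))
  have i3 := hmem (j + 1) (Or.inr (Or.inr rfl))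
  have a1 := val_add_one_cases (by omega) i
  have a2 := val_sub_one_cases (by omega) i
  have a3 := val_add_one_cases (by omega) j
  have a4 := val_sub_one_cases (by omega) j
  omega

/-- A line through `Z_i` meeting the opposite side `Z_{i+1} Z_{i+2}` lies in the plane of the three
points. So the edge already implies the plane, and no extra type of locus arises. -/
theorem inPlane_succ_of_mem (h : IsGeneric Z) {i : Fin n} (h1 : V ∈ throughPoint Z i)
    (h2 : V ∈ onEdge Z (i + 1)) : V ∈ inPlane Z (i + 1) := by
  have hn := h.four_le
  have hne : i ≠ i + 1 + 1 := by
    have := sub_one_ne_add_one hn (i + 1)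
    rwa [add_sub_cancel_right] at this
  have := (h.noFourCoplanar.meets_iff_le hn (ne_add_one hn i) hne (ne_add_one hn (i + 1)) h1).1 h2
  rwa [mem_inPlane, add_sub_cancel_right]

theorem inPlane_pred_of_mem (h : IsGeneric Z) {i : Fin n} (h1 : V ∈ throughPoint Z i)
    (h2 : V ∈ onEdge Z (i - 1 - 1)) : V ∈ inPlane Z (i - 1) := by
  have hn := h.four_le
  have hne : i ≠ i - 1 - 1 := by
    have := sub_one_ne_add_one hn (i - 1)
    rw [sub_add_cancel] at this
    exact this.symm
  have := (h.noFourCoplanar.meets_iff_le hn hne (by rw [sub_add_cancel]; exact (sub_one_ne hn i).symm)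
    (ne_add_one hn _) h1).1 h2
  rw [mem_inPlane, sub_add_cancel]
  rw [sub_add_cancel] at this
  convert this using 2
  ext x
  simp only [Set.mem_insert_iff, Set.mem_singleton_iff]
  tauto

/-- Two edges met by a line through exactly one vertex, which lies on neither, are disjoint. -/
theorem disjoint_edge_of_mem (h : IsGeneric Z) {i j k : Fin n}
    (hu : ∀ m, V ∈ throughPoint Z m → m = i) (hi : V ∈ throughPoint Z i) (hj : V ∈ onEdge Z j)
    (hk : V ∈ onEdge Z k) (hij : i ∉ edge j) (hik : i ∉ edge k) (hjk : j ≠ k) :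
    Disjoint (edge j) (edge k) := by
  have key : ∀ {j k : Fin n}, V ∈ onEdge Z j → V ∈ onEdge Z k → i ∉ edge j → i ∉ edge k →
      k = j + 1 → False := by
    rintro j k hj hk hij hik rfl
    rw [mem_edge] at hij hik
    push Not at hij hik
    rcases h.mem_or_inPlane_succ hj hk with h3 | h3
    · exact hij.2 (hu _ h3).symm
    · rcases h.noFourCoplanar.mem_corner h.four_le hi h3 with e | e | e
      · rw [add_sub_cancel_right] at e
        exact hij.1 e
      · exact hij.2 e
      · exact hik.2 e
  exact disjoint_edge_of_ne hjk (key hj hk hij hik) (key hk hj hik hij)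

/-- `W` satisfies all the incidences satisfied by `V`. -/
def Specializes (Z : Matrix (Fin n) (Fin 4) ℝ) (V W : Gr ℂ 4) : Prop :=
  (∀ m, V ∈ onEdge Z m → W ∈ onEdge Z m) ∧ (∀ m, V ∈ throughPoint Z m → W ∈ throughPoint Z m) ∧
    ∀ m, V ∈ inPlane Z m → W ∈ inPlane Z m

end IsGeneric

end Incidence

/-! ### The listed locus determined by the incidences of a line. -/

section Strata

variable {n : ℕ} [NeZero n] {Z : Matrix (Fin n) (Fin 4) ℝ}

namespace IsGeneric

theorem mem_strataOfType_dim1typeI (h : IsGeneric Z) {S : Set (Gr ℂ 4)} :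
    S ∈ strataOfType Z .dim1typeI ↔ ∃ i, S = throughPoint Z i ∩ inPlane Z i := by
  refine exists_congr fun i => ?_
  rw [h.noFourCoplanar.throughPoint_inter_meetsLine h.four_le]

theorem mem_strataOfType_dim0typeIII (h : IsGeneric Z) {S : Set (Gr ℂ 4)} :
    S ∈ strataOfType Z .dim0typeIII ↔ ∃ i j, Disjoint (corner i) (edge j) ∧
      S = throughPoint Z i ∩ inPlane Z i ∩ onEdge Z j := by
  refine exists_congr fun i => exists_congr fun j => ?_
  rw [h.noFourCoplanar.throughPoint_inter_meetsLine h.four_le]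

theorem isClosed_of_mem (h : IsGeneric Z) {t : StratumType} {S : Set (Gr ℂ 4)}
    (hS : S ∈ strataOfType Z t) : IsClosed S := by
  have hn := h.four_le
  have hI := h.noFourCoplanar
  have hL := hI.isClosed_onEdge hn
  have hV := isClosed_throughPoint (Z := Z)
  have hP := hI.isClosed_inPlane hn
  have hM := fun i => hI.isClosed_meetsLine hn (sub_one_ne_add_one hn i)
  cases t
  · obtain ⟨i, rfl⟩ := hS
    exact hL i
  · obtain ⟨i, rfl⟩ := hS
    exact hV i
  · obtain ⟨i, rfl⟩ := hS
    exact hP i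
  · obtain ⟨i, j, -, rfl⟩ := hS
    exact (hL i).inter (hL j)
  · obtain ⟨i, rfl⟩ := hS
    exact (hV i).inter (hM i)
  · obtain ⟨i, j, -, rfl⟩ := hS
    exact (hV i).inter (hL j)
  · obtain ⟨i, j, -, rfl⟩ := hS
    exact (hP i).inter (hL j)
  · obtain ⟨i, j, k, -, -, -, rfl⟩ := hS
    exact ((hL i).inter (hL j)).inter (hL k)
  · obtain ⟨i, j, -, rfl⟩ := hS
    exact (hV i).inter (hV j)
  · obtain ⟨i, j, -, rfl⟩ := hS
    exact (hP i).inter (hP j)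
  · obtain ⟨i, j, -, rfl⟩ := hS
    exact ((hV i).inter (hM i)).inter (hL j)
  · obtain ⟨i, j, k, -, -, -, rfl⟩ := hS
    exact ((hV i).inter (hL j)).inter (hL k)
  · obtain ⟨i, j, k, -, -, -, rfl⟩ := hS
    exact ((hP i).inter (hL j)).inter (hL k)
  · obtain ⟨i, j, k, l, -, -, -, -, -, -, rfl⟩ := hS
    exact (((hL i).inter (hL j)).inter (hL k)).inter (hL l)

theorem exists_eq_singleton (h : IsGeneric Z) {t : StratumType} {S : Set (Gr ℂ 4)}
    (hS : S ∈ strataOfType Z t) (ht : t.dim = 0) (ht' : t ≠ .dim0typeVI) : ∃ U, S = {U} := by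
  have hn := h.four_le
  have hI := h.noFourCoplanar
  cases t
  case dim0typeI =>
    obtain ⟨i, j, hij, rfl⟩ := hS
    exact hI.join_eq_singleton hn hij
  case dim0typeII =>
    obtain ⟨i, j, hij, rfl⟩ := hS
    exact hI.inPlane_inter_inPlane_eq_singleton hn hij
  case dim0typeIII =>
    obtain ⟨i, j, hij, rfl⟩ := h.mem_strataOfType_dim0typeIII.1 hS
    exact hI.throughPoint_inter_inPlane_inter_onEdge_eq_singleton hn hij
  case dim0typeIV =>
    obtain ⟨i, j, k, hjk, hij, hik, rfl⟩ := hS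
    exact hI.throughPoint_inter_onEdge_inter_onEdge_eq_singleton hn hjk hij hik
  case dim0typeV =>
    obtain ⟨i, j, k, hij, hik, hjk, rfl⟩ := hS
    exact hI.inPlane_inter_onEdge_inter_onEdge_eq_singleton hn hij hik hjk
  case dim0typeVI => exact absurd rfl ht'
  all_goals exact absurd ht (by decide)

theorem encard_dim0typeVI (h : IsGeneric Z) {S : Set (Gr ℂ 4)}
    (hS : S ∈ strataOfType Z .dim0typeVI) : S.encard = 2 := by
  obtain ⟨ε, hc⟩ := h.positive
  obtain ⟨i, j, k, l, h1, h2, h3, h4, h5, h6, rfl⟩ := hS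
  exact hc.encard_four_edges h.noFourCoplanar h.four_le h1 h2 h3 h4 h5 h6

theorem finite_of_dim_eq_zero (h : IsGeneric Z) {t : StratumType} {S : Set (Gr ℂ 4)}
    (hS : S ∈ strataOfType Z t) (ht : t.dim = 0) : S.Finite ∧ S.Nonempty := by
  by_cases ht' : t = .dim0typeVI
  · subst ht'
    have := h.encard_dim0typeVI hS
    refine ⟨Set.finite_of_encard_eq_coe (k := 2) this, ?_⟩
    rw [← Set.encard_ne_zero, this]
    decide
  · obtain ⟨U, rfl⟩ := h.exists_eq_singleton hS ht ht'
    exact ⟨Set.finite_singleton U, Set.singleton_nonempty U⟩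

theorem isIrreducible_of_mem (h : IsGeneric Z) {t : StratumType} {S : Set (Gr ℂ 4)}
    (hS : S ∈ strataOfType Z t) (ht : t ≠ .dim0typeVI) : IsIrreducible S := by
  have hn := h.four_le
  have hI := h.noFourCoplanar
  by_cases h0 : t.dim = 0
  · obtain ⟨U, rfl⟩ := h.exists_eq_singleton hS h0 ht
    exact isIrreducible_singleton
  cases t
  case dim3typeI =>
    obtain ⟨i, rfl⟩ := hS
    exact hI.isIrreducible_onEdge hn i
  case dim2typeI =>
    obtain ⟨i, rfl⟩ := hS
    exact hI.isIrreducible_throughPoint hn i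
  case dim2typeII =>
    obtain ⟨i, rfl⟩ := hS
    exact hI.isIrreducible_inPlane hn i
  case dim2typeIII =>
    obtain ⟨i, j, hij, rfl⟩ := hS
    exact hI.isIrreducible_onEdge_inter_onEdge hn hij
  case dim1typeI =>
    obtain ⟨i, rfl⟩ := h.mem_strataOfType_dim1typeI.1 hS
    exact hI.isIrreducible_throughPoint_inter_inPlane hn i
  case dim1typeII =>
    obtain ⟨i, j, hij, rfl⟩ := hS
    exact hI.isIrreducible_throughPoint_inter_onEdge hn hij
  case dim1typeIII =>
    obtain ⟨i, j, hij, rfl⟩ := hS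
    exact hI.isIrreducible_inPlane_inter_onEdge hn hij
  case dim1typeIV =>
    obtain ⟨i, j, k, hij, hik, hjk, rfl⟩ := hS
    exact hI.isIrreducible_regulus hn hij hik hjk
  all_goals exact absurd rfl h0

theorem componentsIn_of_mem (h : IsGeneric Z) {t : StratumType} {S : Set (Gr ℂ 4)}
    (hS : S ∈ strataOfType Z t) (ht : t ≠ .dim0typeVI) : componentsIn S = {S} :=
  componentsIn_of_isIrreducible (h.isIrreducible_of_mem hS ht)

theorem mem_componentsIn_of_dim_eq_zero (h : IsGeneric Z) {t : StratumType} {S : Set (Gr ℂ 4)}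
    (hS : S ∈ strataOfType Z t) (ht : t.dim = 0) (C : Set (Gr ℂ 4)) :
    C ∈ componentsIn S ↔ ∃ U ∈ S, C = {U} :=
  mem_componentsIn_finite (h.finite_of_dim_eq_zero hS ht).1 (fun U _ => Gr.isClosed_singleton U) C

/-- The irreducible components of the listed loci. -/
def Listed (Z : Matrix (Fin n) (Fin 4) ℝ) (C : Set (Gr ℂ 4)) : Prop :=
  ∃ t, ∃ S ∈ strataOfType Z t, C ∈ componentsIn S

variable {V : Gr ℂ 4}

/-- An irreducible locus is its own component, so it is enough to check that its members have all
incidences of `V`. -/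
theorem exists_listed_of_positive_dim (h : IsGeneric Z) {t : StratumType} {S : Set (Gr ℂ 4)}
    (hS : S ∈ strataOfType Z t) (ht : t ≠ .dim0typeVI) (hV : V ∈ S)
    (hle : ∀ W ∈ S, Specializes Z V W) :
    ∃ C, Listed Z C ∧ V ∈ C ∧ ∀ W ∈ C, Specializes Z V W :=
  ⟨S, ⟨t, S, hS, mem_componentsIn_self (h.isIrreducible_of_mem hS ht)⟩, hV, hle⟩

/-- The component is the point `V` itself, so there are no further incidences to compare. -/
theorem exists_listed_of_dim_eq_zero (h : IsGeneric Z) {t : StratumType} {S : Set (Gr ℂ 4)}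
    (hS : S ∈ strataOfType Z t) (ht : t.dim = 0) (hV : V ∈ S) :
    ∃ C, Listed Z C ∧ V ∈ C ∧ ∀ W ∈ C, Specializes Z V W := by
  refine ⟨{V}, ⟨t, S, hS, (h.mem_componentsIn_of_dim_eq_zero hS ht _).2 ⟨V, hV, rfl⟩⟩, rfl, ?_⟩
  rintro W rfl
  exact ⟨fun _ => id, fun _ => id, fun _ => id⟩

/-- The edges at the vertex are met automatically. Any other edge met must be disjoint from the
corner, as otherwise a second vertex would lie on the line; it gives type (0, III). Without such an
edge the type is (1, I). -/
theorem exists_listed_of_mem_inPlane (h : IsGeneric Z) {i : Fin n}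
    (hu : ∀ m, V ∈ throughPoint Z m → m = i) (hi : V ∈ throughPoint Z i)
    (hB : V ∈ inPlane Z i) : ∃ C, Listed Z C ∧ V ∈ C ∧ ∀ W ∈ C, Specializes Z V W := by
  have hn := h.four_le
  have hI := h.noFourCoplanar
  by_cases hj : ∃ j, Disjoint (corner i) (edge j) ∧ V ∈ onEdge Z j
  · obtain ⟨j, hij, hj⟩ := hj
    exact h.exists_listed_of_dim_eq_zero (t := .dim0typeIII)
      (h.mem_strataOfType_dim0typeIII.2 ⟨i, j, hij, rfl⟩) rfl ⟨⟨hi, hB⟩, hj⟩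
  push Not at hj
  have n1 : V ∉ throughPoint Z (i + 1) := fun e => ne_add_one hn i (hu _ e).symm
  have n2 : V ∉ throughPoint Z (i - 1) := fun e => sub_one_ne hn i (hu _ e)
  refine h.exists_listed_of_positive_dim (t := .dim1typeI)
    (h.mem_strataOfType_dim1typeI.2 ⟨i, rfl⟩) (by simp) ⟨hi, hB⟩ ?_
  rintro W ⟨hWi, hWB⟩
  refine ⟨fun m hm => ?_, fun m hm => hu m hm ▸ hWi, fun m hm => ?_⟩
  · by_cases e1 : m = i - 1
    · rw [e1]
      exact hI.onEdge_pred_of_mem hn hWi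
    by_cases e2 : m = i
    · rw [e2]
      exact hI.onEdge_of_mem hn hWi
    exact absurd hm (hj m (h.disjoint_corner_edge_of_inPlane hB hm n1 n2 e1 e2))
  · rcases hI.mem_corner hn hi hm with e | e | e
    · rw [eq_comm, sub_eq_iff_eq_add] at e
      rw [e] at hm
      exact absurd (hI.join_of_inPlane hn hB hm).2 n1
    · rw [← e]
      exact hWB
    · rw [e] at hB
      have := hu _ (hI.join_of_inPlane hn hm hB).1
      rw [this]
      exact hWB

/-- The number of edges met away from the vertex decides: at least two give (0, IV), one gives (1,
II), none gives (2, I). -/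
theorem exists_listed_of_not_mem_inPlane (h : IsGeneric Z) {i : Fin n}
    (hu : ∀ m, V ∈ throughPoint Z m → m = i) (hi : V ∈ throughPoint Z i)
    (hB : V ∉ inPlane Z i) : ∃ C, Listed Z C ∧ V ∈ C ∧ ∀ W ∈ C, Specializes Z V W := by
  have hn := h.four_le
  have hI := h.noFourCoplanar
  have hne : ∀ m, i ∉ edge m ↔ m ≠ i - 1 ∧ m ≠ i := by
    intro m
    rw [mem_edge, not_or, Ne, Ne, eq_sub_iff_add_eq, eq_comm (a := i), eq_comm (a := i), and_comm]
  have hWE : ∀ W ∈ throughPoint Z i, ∀ m, i ∈ edge m → W ∈ onEdge Z m := by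
    intro W hW m hm
    rcases hm with e | e
    · exact e ▸ hI.onEdge_of_mem hn hW
    · rw [Set.mem_singleton_iff, ← sub_eq_iff_eq_add] at e
      exact e ▸ hI.onEdge_pred_of_mem hn hW
  -- A corner plane containing the line contains the vertex, hence belongs to a neighbour of `i`,
  -- and then the far edge of that corner is met. Containments in planes are thus consequences of
  -- incidences with edges.
  have hBne : ∀ m, V ∈ inPlane Z m →
      (m = i + 1 ∧ V ∈ onEdge Z (i + 1)) ∨ (m = i - 1 ∧ V ∈ onEdge Z (i - 1 - 1)) := by
    intro m hm
    rcases hI.mem_corner hn hi hm with e | e | e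
    · rw [eq_comm, sub_eq_iff_eq_add] at e
      exact Or.inl ⟨e, e ▸ hI.onEdge_of_inPlane hn hm⟩
    · exact absurd (e ▸ hm) hB
    · rw [← sub_eq_iff_eq_add, eq_comm] at e
      exact Or.inr ⟨e, e ▸ hI.onEdge_pred_of_inPlane hn hm⟩
  by_cases hj : ∃ j, i ∉ edge j ∧ V ∈ onEdge Z j
  · obtain ⟨j, hij, hj⟩ := hj
    by_cases hk : ∃ k, k ≠ j ∧ i ∉ edge k ∧ V ∈ onEdge Z k
    · obtain ⟨k, hkj, hik, hk⟩ := hk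
      exact h.exists_listed_of_dim_eq_zero (t := .dim0typeIV)
        ⟨i, j, k, h.disjoint_edge_of_mem hu hi hj hk hij hik hkj.symm, hij, hik, rfl⟩ rfl
        ⟨⟨hi, hj⟩, hk⟩
    push Not at hk
    refine h.exists_listed_of_positive_dim (t := .dim1typeII) ⟨i, j, hij, rfl⟩ (by simp)
      ⟨hi, hj⟩ ?_
    rintro W ⟨hWi, hWj⟩
    have hWE' : ∀ m, V ∈ onEdge Z m → W ∈ onEdge Z m := by
      intro m hm
      by_cases e : m = j
      · exact e ▸ hWj
      by_cases e' : i ∈ edge m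
      · exact hWE W hWi m e'
      · exact absurd hm (hk m e e')
    refine ⟨hWE', fun m hm => hu m hm ▸ hWi, fun m hm => ?_⟩
    rcases hBne m hm with ⟨rfl, h1⟩ | ⟨rfl, h1⟩
    · exact h.inPlane_succ_of_mem hWi (hWE' _ h1)
    · exact h.inPlane_pred_of_mem hWi (hWE' _ h1)
  · push Not at hj
    refine h.exists_listed_of_positive_dim (t := .dim2typeI) ⟨i, rfl⟩ (by simp) hi ?_
    intro W hWi
    refine ⟨fun m hm => hWE W hWi m ?_, fun m hm => hu m hm ▸ hWi, fun m hm => ?_⟩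
    · by_contra e
      exact hj m e hm
    · have a1 := val_add_one_cases (by omega) i
      have a2 := val_sub_one_cases (by omega) i
      have a3 := val_sub_one_cases (by omega) (i - 1)
      rcases hBne m hm with ⟨-, h1⟩ | ⟨-, h1⟩
      · refine absurd h1 (hj _ ((hne _).2 ⟨?_, ?_⟩)) <;> omega
      · refine absurd h1 (hj _ ((hne _).2 ⟨?_, ?_⟩)) <;> omega

/-- A second corner plane is disjoint from the first, since a shared vertex would lie on the line;
this is type (0, II). With one plane, the number of further edges decides between (0, V), (1, III)
and (2, II). -/
theorem exists_listed_of_inPlane (h : IsGeneric Z) (hA : ∀ m, V ∉ throughPoint Z m) {i : Fin n}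
    (hB : V ∈ inPlane Z i) : ∃ C, Listed Z C ∧ V ∈ C ∧ ∀ W ∈ C, Specializes Z V W := by
  have hn := h.four_le
  have hI := h.noFourCoplanar
  by_cases h2 : ∃ j, i ≠ j ∧ V ∈ inPlane Z j
  · obtain ⟨j, hij, hj⟩ := h2
    refine h.exists_listed_of_dim_eq_zero (t := .dim0typeII) ⟨i, j, ?_, rfl⟩ rfl ⟨hB, hj⟩
    rw [Set.disjoint_left]
    intro a ha ha'
    exact hA a (h.mem_of_inPlane_inPlane hij hB hj ha ha')
  push Not at h2
  have hd : ∀ m, V ∈ onEdge Z m → m ≠ i - 1 → m ≠ i → Disjoint (corner i) (edge m) :=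
    fun m hm => h.disjoint_corner_edge_of_inPlane hB hm (hA _) (hA _)
  have hWE : ∀ W ∈ inPlane Z i, ∀ m, (m = i - 1 ∨ m = i) → W ∈ onEdge Z m := by
    rintro W hW m (rfl | rfl)
    · exact hI.onEdge_pred_of_inPlane hn hW
    · exact hI.onEdge_of_inPlane hn hW
  have hWB : ∀ W ∈ inPlane Z i, ∀ m, V ∈ inPlane Z m → W ∈ inPlane Z m := by
    intro W hW m hm
    by_cases e : i = m
    · exact e ▸ hW
    · exact absurd hm (h2 m e)
  by_cases hj : ∃ j, (j ≠ i - 1 ∧ j ≠ i) ∧ V ∈ onEdge Z j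
  · obtain ⟨j, hij, hj⟩ := hj
    by_cases hk : ∃ k, k ≠ j ∧ (k ≠ i - 1 ∧ k ≠ i) ∧ V ∈ onEdge Z k
    · obtain ⟨k, hkj, hik, hk⟩ := hk
      have key : ∀ {j k : Fin n}, V ∈ onEdge Z j → V ∈ onEdge Z k → (j ≠ i - 1 ∧ j ≠ i) →
          k ≠ j + 1 := by
        rintro j k hj hk hij rfl
        rcases h.mem_or_inPlane_succ hj hk with h3 | h3
        · exact hA _ h3
        · by_cases e : i = j + 1
          · exact hij.1 (by rw [e, add_sub_cancel_right])
          · exact h2 _ e h3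
      exact h.exists_listed_of_dim_eq_zero (t := .dim0typeV)
        ⟨i, j, k, hd j hj hij.1 hij.2, hd k hk hik.1 hik.2,
          disjoint_edge_of_ne hkj.symm (key hj hk hij) (key hk hj hik), rfl⟩ rfl ⟨⟨hB, hj⟩, hk⟩
    push Not at hk
    refine h.exists_listed_of_positive_dim (t := .dim1typeIII)
      ⟨i, j, hd j hj hij.1 hij.2, rfl⟩ (by simp) ⟨hB, hj⟩ ?_
    rintro W ⟨hWi, hWj⟩
    refine ⟨fun m hm => ?_, fun m hm => absurd hm (hA m), hWB W hWi⟩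
    by_cases e : m = j
    · exact e ▸ hWj
    by_cases e' : m = i - 1 ∨ m = i
    · exact hWE W hWi m e'
    · push Not at e'
      exact absurd hm (hk m e e')
  · push Not at hj
    refine h.exists_listed_of_positive_dim (t := .dim2typeII) ⟨i, rfl⟩ (by simp) hB ?_
    intro W hWi
    refine ⟨fun m hm => hWE W hWi m ?_, fun m hm => absurd hm (hA m), hWB W hWi⟩
    by_contra e
    push Not at e
    exact hj m e hm

/-- With no vertex and no corner plane, consecutive edges cannot both be met, so the edges met are
pairwise disjoint and their number, up to four, determines the type. -/
theorem exists_listed_of_onEdge (h : IsGeneric Z) (hA : ∀ m, V ∉ throughPoint Z m)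
    (hB : ∀ m, V ∉ inPlane Z m) {i : Fin n} (hi : V ∈ onEdge Z i) :
    ∃ C, Listed Z C ∧ V ∈ C ∧ ∀ W ∈ C, Specializes Z V W := by
  have hd : ∀ {j k : Fin n}, V ∈ onEdge Z j → V ∈ onEdge Z k → k ≠ j →
      Disjoint (edge j) (edge k) := by
    have key : ∀ {j k : Fin n}, V ∈ onEdge Z j → V ∈ onEdge Z k → k ≠ j + 1 := by
      rintro j k hj hk rfl
      rcases h.mem_or_inPlane_succ hj hk with h3 | h3
      · exact hA _ h3
      · exact hB _ h3
    exact fun {_ _} hj hk hjk => disjoint_edge_of_ne hjk.symm (key hj hk) (key hk hj)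
  have hle : ∀ {W}, (∀ m, V ∈ onEdge Z m → W ∈ onEdge Z m) → Specializes Z V W := fun hW =>
    ⟨hW, fun m hm => absurd hm (hA m), fun m hm => absurd hm (hB m)⟩
  by_cases hj : ∃ j, j ≠ i ∧ V ∈ onEdge Z j
  · obtain ⟨j, hji, hj⟩ := hj
    by_cases hk : ∃ k, (k ≠ i ∧ k ≠ j) ∧ V ∈ onEdge Z k
    · obtain ⟨k, ⟨hki, hkj⟩, hk⟩ := hk
      by_cases hl : ∃ l, (l ≠ i ∧ l ≠ j ∧ l ≠ k) ∧ V ∈ onEdge Z l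
      · obtain ⟨l, ⟨hli, hlj, hlk⟩, hl⟩ := hl
        exact h.exists_listed_of_dim_eq_zero (t := .dim0typeVI)
          ⟨i, j, k, l, hd hi hj hji, hd hi hk hki, hd hi hl hli, hd hj hk hkj, hd hj hl hlj,
            hd hk hl hlk, rfl⟩ rfl ⟨⟨⟨hi, hj⟩, hk⟩, hl⟩
      push Not at hl
      refine h.exists_listed_of_positive_dim (t := .dim1typeIV)
        ⟨i, j, k, hd hi hj hji, hd hi hk hki, hd hj hk hkj, rfl⟩ (by simp) ⟨⟨hi, hj⟩, hk⟩ ?_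
      rintro W ⟨⟨hWi, hWj⟩, hWk⟩
      refine hle fun m hm => ?_
      by_cases e1 : m = i
      · exact e1 ▸ hWi
      by_cases e2 : m = j
      · exact e2 ▸ hWj
      by_cases e3 : m = k
      · exact e3 ▸ hWk
      exact absurd hm (hl m ⟨e1, e2, e3⟩)
    push Not at hk
    refine h.exists_listed_of_positive_dim (t := .dim2typeIII)
      ⟨i, j, hd hi hj hji, rfl⟩ (by simp) ⟨hi, hj⟩ ?_
    rintro W ⟨hWi, hWj⟩
    refine hle fun m hm => ?_
    by_cases e1 : m = i
    · exact e1 ▸ hWi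
    by_cases e2 : m = j
    · exact e2 ▸ hWj
    exact absurd hm (hk m ⟨e1, e2⟩)
  push Not at hj
  refine h.exists_listed_of_positive_dim (t := .dim3typeI) ⟨i, rfl⟩ (by simp) hi ?_
  intro W hWi
  refine hle fun m hm => ?_
  by_cases e1 : m = i
  · exact e1 ▸ hWi
  exact absurd hm (hj m e1)

/-- Every line of the algebraic boundary lies in a listed component all of whose members satisfy
the incidences of the line. -/
theorem exists_listed (h : IsGeneric Z) {i : Fin n} (hi : V ∈ onEdge Z i) :
    ∃ C, Listed Z C ∧ V ∈ C ∧ ∀ W ∈ C, Specializes Z V W := by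
  by_cases h1 : ∃ i j, i ≠ j ∧ V ∈ throughPoint Z i ∧ V ∈ throughPoint Z j
  · obtain ⟨i, j, hij, h1, h2⟩ := h1
    exact h.exists_listed_of_dim_eq_zero (t := .dim0typeI) ⟨i, j, hij, rfl⟩ rfl ⟨h1, h2⟩
  push Not at h1
  by_cases h2 : ∃ i, V ∈ throughPoint Z i
  · obtain ⟨i, hi⟩ := h2
    have hu : ∀ m, V ∈ throughPoint Z m → m = i := fun m hm => by
      by_contra e
      exact h1 m i e hm hi
    by_cases hB : V ∈ inPlane Z i
    · exact h.exists_listed_of_mem_inPlane hu hi hB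
    · exact h.exists_listed_of_not_mem_inPlane hu hi hB
  push Not at h2
  by_cases h3 : ∃ i, V ∈ inPlane Z i
  · obtain ⟨i, hi⟩ := h3
    exact h.exists_listed_of_inPlane h2 hi
  push Not at h3
  exact h.exists_listed_of_onEdge h2 h3 hi

end IsGeneric

end Strata

/-! ### The incidences common to all lines of a locus. -/

section GenericData

variable {n : ℕ} [NeZero n] {Z : Matrix (Fin n) (Fin 4) ℝ}

namespace IsGeneric

variable {V : Gr ℂ 4} {S : Set (Gr ℂ 4)}

theorem onEdge_of_mem_edge (h : IsGeneric Z) {a m : Fin n} (ha : a = m ∨ a = m + 1)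
    (hV : V ∈ throughPoint Z a) : V ∈ onEdge Z m := by
  rcases ha with rfl | rfl
  · exact h.noFourCoplanar.onEdge_of_mem h.four_le hV
  · exact h.noFourCoplanar.meets_of_mem_right h.four_le _ hV

/-- The join `Z_a Z_b` is used as a test line: an incidence valid on all of `S` holds for it, and
its incidences are known. Several such joins in a locus narrow the common incidences down to the
evident ones. -/
theorem eq_of_subset_onEdge (h : IsGeneric Z) {a b m : Fin n} (hab : a ≠ b)
    (hS : throughPoint Z a ∩ throughPoint Z b ⊆ S) (hm : S ⊆ onEdge Z m) :
    m = a ∨ m = b ∨ m + 1 = a ∨ m + 1 = b := by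
  obtain ⟨V, ha, hb⟩ := h.noFourCoplanar.exists_join h.four_le hab
  exact (h.noFourCoplanar.meets_join_iff h.four_le hab (ne_add_one h.four_le m) ha hb).1
    (hm (hS ⟨ha, hb⟩))

theorem eq_of_subset_throughPoint (h : IsGeneric Z) {a b m : Fin n} (hab : a ≠ b)
    (hS : throughPoint Z a ∩ throughPoint Z b ⊆ S) (hm : S ⊆ throughPoint Z m) :
    m = a ∨ m = b := by
  obtain ⟨V, ha, hb⟩ := h.noFourCoplanar.exists_join h.four_le hab
  exact (h.noFourCoplanar.mem_join_iff h.four_le hab ha hb).1 (hm (hS ⟨ha, hb⟩))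

theorem eq_of_subset_inPlane (h : IsGeneric Z) {a b m : Fin n} (hab : a ≠ b)
    (hS : throughPoint Z a ∩ throughPoint Z b ⊆ S) (hm : S ⊆ inPlane Z m) :
    (a = m - 1 ∨ a = m ∨ a = m + 1) ∧ (b = m - 1 ∨ b = m ∨ b = m + 1) := by
  obtain ⟨V, ha, hb⟩ := h.noFourCoplanar.exists_join h.four_le hab
  exact (h.noFourCoplanar.inPlane_join_iff h.four_le hab ha hb).1 (hm (hS ⟨ha, hb⟩))

theorem subset_onEdge_of_throughPoint (h : IsGeneric Z) {m : Fin n} (hm : S ⊆ throughPoint Z m) :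
    S ⊆ onEdge Z (m - 1) ∧ S ⊆ onEdge Z m :=
  ⟨fun _ hV => h.noFourCoplanar.onEdge_pred_of_mem h.four_le (hm hV),
    fun _ hV => h.noFourCoplanar.onEdge_of_mem h.four_le (hm hV)⟩

theorem subset_onEdge_of_inPlane (h : IsGeneric Z) {m : Fin n} (hm : S ⊆ inPlane Z m) :
    S ⊆ onEdge Z (m - 1) ∧ S ⊆ onEdge Z m :=
  ⟨fun _ hV => h.noFourCoplanar.onEdge_pred_of_inPlane h.four_le (hm hV),
    fun _ hV => h.noFourCoplanar.onEdge_of_inPlane h.four_le (hm hV)⟩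

/-- Here the general position hypothesis enters: a fifth edge is excluded. -/
theorem onEdge_eq_or_of_four (h : IsGeneric Z) {a b c d m : Fin n} (hab : a ≠ b) (hac : a ≠ c)
    (had : a ≠ d) (hbc : b ≠ c) (hbd : b ≠ d) (hcd : c ≠ d) (ha : V ∈ onEdge Z a)
    (hb : V ∈ onEdge Z b) (hc : V ∈ onEdge Z c) (hd : V ∈ onEdge Z d) (hm : V ∈ onEdge Z m) :
    m = a ∨ m = b ∨ m = c ∨ m = d := by
  by_contra! hne
  have := h.card_le_four V {m, a, b, c, d} (by
    simp only [Finset.mem_insert, Finset.mem_singleton, forall_eq_or_imp, forall_eq]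
    exact ⟨hm, ha, hb, hc, hd⟩)
  rw [Finset.card_insert_of_notMem (by simp [hne]),
    Finset.card_insert_of_notMem (by simp [hab, hac, had]),
    Finset.card_insert_of_notMem (by simp [hbc, hbd]),
    Finset.card_insert_of_notMem (by simp [hcd]), Finset.card_singleton] at this
  omega

theorem data_onEdge (h : IsGeneric Z) (i : Fin n) :
    (∀ m, onEdge Z i ⊆ onEdge Z m ↔ m = i) ∧ (∀ m, ¬ onEdge Z i ⊆ throughPoint Z m) ∧
      ∀ m, ¬ onEdge Z i ⊆ inPlane Z m := by
  have hn := h.four_le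
  have a1 := val_add_one_cases (by omega) i
  have hE : ∀ m, onEdge Z i ⊆ onEdge Z m ↔ m = i := by
    intro m
    refine ⟨fun hm => ?_, fun hm => hm ▸ subset_rfl⟩
    obtain ⟨b, hb1, hb2, hb3⟩ := exists_ne_three hn m (m + 1) i
    obtain ⟨c, hc1, hc2, hc3⟩ := exists_ne_three hn m (m + 1) (i + 1)
    have k1 := h.eq_of_subset_onEdge hb3.symm
      (fun V hV => h.onEdge_of_mem_edge (Or.inl rfl) hV.1) hm
    have k2 := h.eq_of_subset_onEdge hc3.symm
      (fun V hV => h.onEdge_of_mem_edge (Or.inr rfl) hV.1) hm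
    have a2 := val_add_one_cases (by omega) m
    omega
  refine ⟨hE, fun m hm => ?_, fun m hm => ?_⟩
  · have k1 := (hE _).1 (h.subset_onEdge_of_throughPoint hm).1
    have k2 := (hE _).1 (h.subset_onEdge_of_throughPoint hm).2
    exact sub_one_ne hn m (k1.trans k2.symm)
  · have k1 := (hE _).1 (h.subset_onEdge_of_inPlane hm).1
    have k2 := (hE _).1 (h.subset_onEdge_of_inPlane hm).2
    exact sub_one_ne hn m (k1.trans k2.symm)

theorem data_throughPoint (h : IsGeneric Z) (i : Fin n) :
    (∀ m, throughPoint Z i ⊆ onEdge Z m ↔ m = i - 1 ∨ m = i) ∧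
      (∀ m, throughPoint Z i ⊆ throughPoint Z m ↔ m = i) ∧
      ∀ m, ¬ throughPoint Z i ⊆ inPlane Z m := by
  have hn := h.four_le
  have a2 := val_sub_one_cases (by omega) i
  refine ⟨fun m => ⟨fun hm => ?_, ?_⟩, fun m => ⟨fun hm => ?_, fun hm => hm ▸ subset_rfl⟩,
    fun m hm => ?_⟩
  · obtain ⟨b, hb1, hb2, hb3⟩ := exists_ne_three hn m (m + 1) i
    have k1 := h.eq_of_subset_onEdge hb3.symm Set.inter_subset_left hm
    have a2 := val_add_one_cases (by omega) m
    omega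
  · have := h.subset_onEdge_of_throughPoint (subset_refl (throughPoint Z i))
    rintro (rfl | rfl)
    exacts [this.1, this.2]
  · obtain ⟨b, hb1, -, hb3⟩ := exists_ne_three hn m m i
    have k1 := h.eq_of_subset_throughPoint hb3.symm Set.inter_subset_left hm
    omega
  · obtain ⟨b, hb1, hb2, hb3⟩ := exists_ne_three hn (m - 1) m (m + 1)
    have k0 := h.eq_of_subset_inPlane (ne_add_one hn i) Set.inter_subset_left hm
    have k1 := h.eq_of_subset_inPlane (b := b) (a := i) (by rintro rfl; omega)
      Set.inter_subset_left hm
    omega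

theorem join_subset_inPlane (h : IsGeneric Z) {a b i : Fin n} (hab : a ≠ b)
    (ha : a = i - 1 ∨ a = i ∨ a = i + 1) (hb : b = i - 1 ∨ b = i ∨ b = i + 1) :
    throughPoint Z a ∩ throughPoint Z b ⊆ inPlane Z i := fun _ hV =>
  (h.noFourCoplanar.inPlane_join_iff h.four_le hab hV.1 hV.2).2 ⟨ha, hb⟩

theorem data_inPlane (h : IsGeneric Z) (i : Fin n) :
    (∀ m, inPlane Z i ⊆ onEdge Z m ↔ m = i - 1 ∨ m = i) ∧
      (∀ m, ¬ inPlane Z i ⊆ throughPoint Z m) ∧ ∀ m, inPlane Z i ⊆ inPlane Z m ↔ m = i := by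
  have hn := h.four_le
  have a1 := val_add_one_cases (by omega) i
  have a2 := val_sub_one_cases (by omega) i
  have j1 := h.join_subset_inPlane (sub_one_ne hn i) (Or.inl rfl) (Or.inr (Or.inl rfl))
  have j2 := h.join_subset_inPlane (sub_one_ne_add_one hn i) (Or.inl rfl) (Or.inr (Or.inr rfl))
  have j3 := h.join_subset_inPlane (ne_add_one hn i) (Or.inr (Or.inl rfl)) (Or.inr (Or.inr rfl))
  have hE : ∀ m, inPlane Z i ⊆ onEdge Z m ↔ m = i - 1 ∨ m = i := by
    refine fun m => ⟨fun hm => ?_, ?_⟩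
    · have k1 := h.eq_of_subset_onEdge (sub_one_ne hn i) j1 hm
      have k2 := h.eq_of_subset_onEdge (sub_one_ne_add_one hn i) j2 hm
      have k3 := h.eq_of_subset_onEdge (ne_add_one hn i) j3 hm
      have a3 := val_add_one_cases (by omega) m
      omega
    · have := h.subset_onEdge_of_inPlane (subset_refl (inPlane Z i))
      rintro (rfl | rfl)
      exacts [this.1, this.2]
  refine ⟨hE, fun m hm => ?_, fun m => ⟨fun hm => ?_, fun hm => hm ▸ subset_rfl⟩⟩
  · have k1 := h.eq_of_subset_throughPoint (sub_one_ne hn i) j1 hm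
    have k2 := h.eq_of_subset_throughPoint (sub_one_ne_add_one hn i) j2 hm
    have k3 := h.eq_of_subset_throughPoint (ne_add_one hn i) j3 hm
    omega
  · have k1 := (hE _).1 (h.subset_onEdge_of_inPlane hm).1
    have k2 := (hE _).1 (h.subset_onEdge_of_inPlane hm).2
    have a3 := val_sub_one_cases (by omega) m
    omega

theorem data_onEdge_inter_onEdge (h : IsGeneric Z) {i j : Fin n}
    (hij : Disjoint (edge i) (edge j)) :
    (∀ m, onEdge Z i ∩ onEdge Z j ⊆ onEdge Z m ↔ m = i ∨ m = j) ∧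
      (∀ m, ¬ onEdge Z i ∩ onEdge Z j ⊆ throughPoint Z m) ∧
      ∀ m, ¬ onEdge Z i ∩ onEdge Z j ⊆ inPlane Z m := by
  have hn := h.four_le
  rw [disjoint_edge_edge] at hij
  have a1 := val_add_one_cases (by omega) i
  have a2 := val_add_one_cases (by omega) j
  have hE : ∀ m, onEdge Z i ∩ onEdge Z j ⊆ onEdge Z m ↔ m = i ∨ m = j := by
    refine fun m => ⟨fun hm => ?_, ?_⟩
    · have key : ∀ a b, (a = i ∨ a = i + 1) → (b = j ∨ b = j + 1) →
          m = a ∨ m = b ∨ m + 1 = a ∨ m + 1 = b := by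
        intro a b ha hb
        refine h.eq_of_subset_onEdge (S := onEdge Z i ∩ onEdge Z j) (by omega)
          (fun V hV => ⟨?_, ?_⟩) hm
        · exact h.onEdge_of_mem_edge ha hV.1
        · exact h.onEdge_of_mem_edge hb hV.2
      have k1 := key i j (Or.inl rfl) (Or.inl rfl)
      have k2 := key i (j + 1) (Or.inl rfl) (Or.inr rfl)
      have k3 := key (i + 1) j (Or.inr rfl) (Or.inl rfl)
      have k4 := key (i + 1) (j + 1) (Or.inr rfl) (Or.inr rfl)
      have a3 := val_add_one_cases (by omega) m
      omega
    · rintro (rfl | rfl)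
      exacts [Set.inter_subset_left, Set.inter_subset_right]
  refine ⟨hE, fun m hm => ?_, fun m hm => ?_⟩
  · have k1 := (hE _).1 (h.subset_onEdge_of_throughPoint hm).1
    have k2 := (hE _).1 (h.subset_onEdge_of_throughPoint hm).2
    have a3 := val_sub_one_cases (by omega) m
    omega
  · have k1 := (hE _).1 (h.subset_onEdge_of_inPlane hm).1
    have k2 := (hE _).1 (h.subset_onEdge_of_inPlane hm).2
    have a3 := val_sub_one_cases (by omega) m
    omega

theorem data_throughPoint_inter_inPlane (h : IsGeneric Z) (i : Fin n) :
    (∀ m, throughPoint Z i ∩ inPlane Z i ⊆ onEdge Z m ↔ m = i - 1 ∨ m = i) ∧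
      ∀ m, throughPoint Z i ∩ inPlane Z i ⊆ throughPoint Z m ↔ m = i := by
  have hn := h.four_le
  have a1 := val_add_one_cases (by omega) i
  have a2 := val_sub_one_cases (by omega) i
  have j1 : throughPoint Z (i - 1) ∩ throughPoint Z i ⊆ throughPoint Z i ∩ inPlane Z i :=
    fun V hV => ⟨hV.2, h.join_subset_inPlane (sub_one_ne hn i) (Or.inl rfl)
      (Or.inr (Or.inl rfl)) hV⟩
  have j3 : throughPoint Z i ∩ throughPoint Z (i + 1) ⊆ throughPoint Z i ∩ inPlane Z i :=
    fun V hV => ⟨hV.1, h.join_subset_inPlane (ne_add_one hn i) (Or.inr (Or.inl rfl))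
      (Or.inr (Or.inr rfl)) hV⟩
  refine ⟨fun m => ⟨fun hm => ?_, ?_⟩, fun m => ⟨fun hm => ?_, ?_⟩⟩
  · have k1 := h.eq_of_subset_onEdge (sub_one_ne hn i) j1 hm
    have k3 := h.eq_of_subset_onEdge (ne_add_one hn i) j3 hm
    have a3 := val_add_one_cases (by omega) m
    omega
  · have := h.subset_onEdge_of_inPlane (Set.inter_subset_right (s := throughPoint Z i)
      (t := inPlane Z i))
    rintro (rfl | rfl)
    exacts [this.1, this.2]
  · have k1 := h.eq_of_subset_throughPoint (sub_one_ne hn i) j1 hm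
    have k3 := h.eq_of_subset_throughPoint (ne_add_one hn i) j3 hm
    omega
  · rintro rfl
    exact Set.inter_subset_left

theorem data_throughPoint_inter_onEdge (h : IsGeneric Z) {i j : Fin n} (hij : i ∉ edge j) :
    (∀ m, throughPoint Z i ∩ onEdge Z j ⊆ onEdge Z m ↔ m = i - 1 ∨ m = i ∨ m = j) ∧
      (∀ m, throughPoint Z i ∩ onEdge Z j ⊆ throughPoint Z m ↔ m = i) ∧
      ¬ throughPoint Z i ∩ onEdge Z j ⊆ inPlane Z i := by
  have hn := h.four_le
  rw [mem_edge, not_or] at hij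
  have a1 := val_add_one_cases (by omega) i
  have a2 := val_sub_one_cases (by omega) i
  have a4 := val_add_one_cases (by omega) j
  have j1 : throughPoint Z i ∩ throughPoint Z j ⊆ throughPoint Z i ∩ onEdge Z j :=
    fun V hV => ⟨hV.1, h.onEdge_of_mem_edge (Or.inl rfl) hV.2⟩
  have j2 : throughPoint Z i ∩ throughPoint Z (j + 1) ⊆ throughPoint Z i ∩ onEdge Z j :=
    fun V hV => ⟨hV.1, h.onEdge_of_mem_edge (Or.inr rfl) hV.2⟩
  refine ⟨fun m => ⟨fun hm => ?_, ?_⟩, fun m => ⟨fun hm => ?_, ?_⟩, fun hm => ?_⟩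
  · have k1 := h.eq_of_subset_onEdge hij.1 j1 hm
    have k3 := h.eq_of_subset_onEdge hij.2 j2 hm
    have a3 := val_add_one_cases (by omega) m
    omega
  · have := h.subset_onEdge_of_throughPoint (Set.inter_subset_left (s := throughPoint Z i)
      (t := onEdge Z j))
    rintro (rfl | rfl | rfl)
    exacts [this.1, this.2, Set.inter_subset_right]
  · have k1 := h.eq_of_subset_throughPoint hij.1 j1 hm
    have k3 := h.eq_of_subset_throughPoint hij.2 j2 hm
    omega
  · rintro rfl
    exact Set.inter_subset_left
  · have k1 := h.eq_of_subset_inPlane hij.1 j1 hm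
    have k2 := h.eq_of_subset_inPlane hij.2 j2 hm
    omega

theorem data_join (h : IsGeneric Z) {i j : Fin n} (hij : i ≠ j)
    (hV : V ∈ throughPoint Z i ∩ throughPoint Z j) (m : Fin n) :
    V ∈ throughPoint Z m ↔ m = i ∨ m = j :=
  h.noFourCoplanar.mem_join_iff h.four_le hij hV.1 hV.2

theorem data_inPlane_inter_inPlane (h : IsGeneric Z) {i j : Fin n}
    (hij : Disjoint (corner i) (corner j)) (hV : V ∈ inPlane Z i ∩ inPlane Z j) :
    (∀ m, V ∉ throughPoint Z m) ∧ ∀ m, V ∈ inPlane Z m ↔ m = i ∨ m = j := by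
  have hn := h.four_le
  have hI := h.noFourCoplanar
  rw [disjoint_corner_corner] at hij
  have a1 := val_add_one_cases (by omega) i
  have a2 := val_sub_one_cases (by omega) i
  have a3 := val_add_one_cases (by omega) j
  have a4 := val_sub_one_cases (by omega) j
  refine ⟨fun m hm => ?_, fun m => ⟨fun hm => ?_, ?_⟩⟩
  · have k1 := hI.mem_corner hn hm hV.1
    have k2 := hI.mem_corner hn hm hV.2
    omega
  · have hE := fun m => h.onEdge_eq_or_of_four (V := V) (a := i - 1) (b := i) (c := j - 1) (d := j)
      (m := m) (by omega) (by omega) (by omega) (by omega) (by omega) (by omega)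
      (hI.onEdge_pred_of_inPlane hn hV.1) (hI.onEdge_of_inPlane hn hV.1)
      (hI.onEdge_pred_of_inPlane hn hV.2) (hI.onEdge_of_inPlane hn hV.2)
    have k1 := hE _ (hI.onEdge_pred_of_inPlane hn hm)
    have k2 := hE _ (hI.onEdge_of_inPlane hn hm)
    have a5 := val_sub_one_cases (by omega) m
    omega
  · rintro (rfl | rfl)
    exacts [hV.1, hV.2]

/-- Only three edges are evident, so the bound of four would permit one more. Such an edge would be
disjoint from the corner and from edge `j`, which positivity rules out by
`CyclicallyPositive.not_meets`. -/
theorem data_throughPoint_inter_inPlane_inter_onEdge (h : IsGeneric Z) {i j : Fin n}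
    (hij : Disjoint (corner i) (edge j))
    (hV : V ∈ throughPoint Z i ∩ inPlane Z i ∩ onEdge Z j) :
    (∀ m, V ∈ onEdge Z m ↔ m = i - 1 ∨ m = i ∨ m = j) ∧ ∀ m, V ∈ throughPoint Z m ↔ m = i := by
  have hn := h.four_le
  have hI := h.noFourCoplanar
  obtain ⟨⟨hVi, hVP⟩, hVj⟩ := hV
  have hij' := disjoint_corner_edge.1 hij
  have hu : ∀ m, V ∈ throughPoint Z m → m = i := by
    intro m hm
    by_contra e
    have k1 := hI.mem_corner hn hm hVP
    have k2 := (hI.meets_join_iff hn e (ne_add_one hn j) hm hVi).1 hVj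
    omega
  refine ⟨fun m => ⟨fun hm => ?_, ?_⟩, fun m => ⟨hu m, ?_⟩⟩
  · by_contra! e
    have d1 := h.disjoint_corner_edge_of_inPlane hVP hm
      (fun e => ne_add_one hn i (hu _ e).symm) (fun e => sub_one_ne hn i (hu _ e)) e.1 e.2.1
    have hi : ∀ {j : Fin n}, Disjoint (corner i) (edge j) → i ∉ edge j := fun hd =>
      Set.disjoint_left.1 hd (Or.inr (Or.inl rfl))
    have d2 := h.disjoint_edge_of_mem hu hVi hVj hm (hi hij) (hi d1) e.2.2.symm
    obtain ⟨ε, hc⟩ := h.positive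
    exact hc.not_meets hI hn hij d1 d2 hVi hVP hVj hm
  · rintro (rfl | rfl | rfl)
    exacts [hI.onEdge_pred_of_mem hn hVi, hI.onEdge_of_mem hn hVi, hVj]
  · rintro rfl
    exact hVi

/-- The four evident edges exhaust the bound. That the line avoids the corner plane is again a
consequence of positivity, and it separates (0, IV) from (0, III). -/
theorem data_throughPoint_inter_onEdge_inter_onEdge (h : IsGeneric Z) {i j k : Fin n}
    (hjk : Disjoint (edge j) (edge k)) (hij : i ∉ edge j) (hik : i ∉ edge k)
    (hV : V ∈ throughPoint Z i ∩ onEdge Z j ∩ onEdge Z k) :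
    (∀ m, V ∈ onEdge Z m ↔ m = i - 1 ∨ m = i ∨ m = j ∨ m = k) ∧
      (∀ m, V ∈ throughPoint Z m ↔ m = i) ∧ V ∉ inPlane Z i := by
  have hn := h.four_le
  have hI := h.noFourCoplanar
  obtain ⟨⟨hVi, hVj⟩, hVk⟩ := hV
  have hjk' := disjoint_edge_edge.1 hjk
  rw [mem_edge, not_or] at hij hik
  have a1 := val_sub_one_cases (by omega) i
  have a2 := val_add_one_cases (by omega) j
  have a3 := val_add_one_cases (by omega) k
  have hu : ∀ m, V ∈ throughPoint Z m → m = i := by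
    intro m hm
    by_contra e
    have k1 := (hI.meets_join_iff hn e (ne_add_one hn k) hm hVi).1 hVk
    have k2 := (hI.meets_join_iff hn e (ne_add_one hn j) hm hVi).1 hVj
    omega
  refine ⟨fun m => ⟨fun hm => ?_, ?_⟩, fun m => ⟨hu m, ?_⟩, fun hP => ?_⟩
  · exact h.onEdge_eq_or_of_four (by omega) (by omega) (by omega) (by omega) (by omega)
      (by omega) (hI.onEdge_pred_of_mem hn hVi) (hI.onEdge_of_mem hn hVi) hVj hVk hm
  · rintro (rfl | rfl | rfl | rfl)
    exacts [hI.onEdge_pred_of_mem hn hVi, hI.onEdge_of_mem hn hVi, hVj, hVk]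
  · rintro rfl
    exact hVi
  · have hd : ∀ m, V ∈ onEdge Z m → m ≠ i - 1 → m ≠ i → Disjoint (corner i) (edge m) :=
      fun m hm => h.disjoint_corner_edge_of_inPlane hP hm
        (fun e => ne_add_one hn i (hu _ e).symm) (fun e => sub_one_ne hn i (hu _ e))
    obtain ⟨ε, hc⟩ := h.positive
    exact hc.not_meets hI hn (hd j hVj (by omega) (by omega)) (hd k hVk (by omega) (by omega))
      hjk hVi hP hVj hVk

/-- A vertex or a second corner plane would bring two consecutive edges, and among the four edges
met only those at `i` are consecutive. So the vertex could only be `Z_i`, which positivity excludes.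
-/
theorem data_inPlane_inter_onEdge_inter_onEdge (h : IsGeneric Z) {i j k : Fin n}
    (hij : Disjoint (corner i) (edge j)) (hik : Disjoint (corner i) (edge k))
    (hjk : Disjoint (edge j) (edge k)) (hV : V ∈ inPlane Z i ∩ onEdge Z j ∩ onEdge Z k) :
    (∀ m, V ∈ onEdge Z m ↔ m = i - 1 ∨ m = i ∨ m = j ∨ m = k) ∧
      (∀ m, V ∉ throughPoint Z m) ∧ ∀ m, V ∈ inPlane Z m ↔ m = i := by
  have hn := h.four_le
  have hI := h.noFourCoplanar
  obtain ⟨⟨hVi, hVj⟩, hVk⟩ := hV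
  have hjk' := disjoint_edge_edge.1 hjk
  have hij' := disjoint_corner_edge.1 hij
  have hik' := disjoint_corner_edge.1 hik
  have a0 := val_add_one_cases (by omega) i
  have a1 := val_sub_one_cases (by omega) i
  have a2 := val_add_one_cases (by omega) j
  have a3 := val_add_one_cases (by omega) k
  have hE : ∀ m, V ∈ onEdge Z m → m = i - 1 ∨ m = i ∨ m = j ∨ m = k := fun m hm =>
    h.onEdge_eq_or_of_four (by omega) (by omega) (by omega) (by omega) (by omega)
      (by omega) (hI.onEdge_pred_of_inPlane hn hVi) (hI.onEdge_of_inPlane hn hVi) hVj hVk hm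
  refine ⟨fun m => ⟨hE m, ?_⟩, fun m hm => ?_, fun m => ⟨fun hm => ?_, ?_⟩⟩
  · rintro (rfl | rfl | rfl | rfl)
    exacts [hI.onEdge_pred_of_inPlane hn hVi, hI.onEdge_of_inPlane hn hVi, hVj, hVk]
  · have a4 := val_sub_one_cases (by omega) m
    have k1 := hE _ (hI.onEdge_pred_of_mem hn hm)
    have k2 := hE _ (hI.onEdge_of_mem hn hm)
    have hmi : m = i := by omega
    rw [hmi] at hm
    obtain ⟨ε, hc⟩ := h.positive
    exact hc.not_meets hI hn hij hik hjk hm hVi hVj hVk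
  · have a4 := val_sub_one_cases (by omega) m
    have k1 := hE _ (hI.onEdge_pred_of_inPlane hn hm)
    have k2 := hE _ (hI.onEdge_of_inPlane hn hm)
    omega
  · rintro rfl
    exact hVi

theorem data_four_edges (h : IsGeneric Z) {i j k l : Fin n}
    (dij : Disjoint (edge i) (edge j)) (dik : Disjoint (edge i) (edge k))
    (dil : Disjoint (edge i) (edge l)) (djk : Disjoint (edge j) (edge k))
    (djl : Disjoint (edge j) (edge l)) (dkl : Disjoint (edge k) (edge l))
    (hV : V ∈ onEdge Z i ∩ onEdge Z j ∩ onEdge Z k ∩ onEdge Z l) :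
    (∀ m, V ∈ onEdge Z m ↔ m = i ∨ m = j ∨ m = k ∨ m = l) ∧
      (∀ m, V ∉ throughPoint Z m) ∧ ∀ m, V ∉ inPlane Z m := by
  have hn := h.four_le
  have hI := h.noFourCoplanar
  rw [disjoint_edge_edge] at dij dik dil djk djl dkl
  have hE : ∀ m, V ∈ onEdge Z m → m = i ∨ m = j ∨ m = k ∨ m = l := fun m hm =>
    h.onEdge_eq_or_of_four dij.1 dik.1 dil.1 djk.1 djl.1 dkl.1 hV.1.1.1 hV.1.1.2 hV.1.2 hV.2 hm
  have key : ∀ m, V ∈ onEdge Z (m - 1) → V ∈ onEdge Z m → False := by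
    intro m h1 h2
    have a4 := val_sub_one_cases (by omega) m
    have a0 := val_add_one_cases (by omega) i
    have a1 := val_add_one_cases (by omega) j
    have a2 := val_add_one_cases (by omega) k
    have a3 := val_add_one_cases (by omega) l
    have k1 := hE _ h1
    have k2 := hE _ h2
    omega
  refine ⟨fun m => ⟨hE m, ?_⟩, fun m hm => ?_, fun m hm => ?_⟩
  · rintro (rfl | rfl | rfl | rfl)
    exacts [hV.1.1.1, hV.1.1.2, hV.1.2, hV.2]
  · exact key m (hI.onEdge_pred_of_mem hn hm) (hI.onEdge_of_mem hn hm)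
  · exact key m (hI.onEdge_pred_of_inPlane hn hm) (hI.onEdge_of_inPlane hn hm)

/-- The line of the pencil through `Z_i` is a test line with exactly three edges and one vertex; the
line through `Z_{i+1}` then removes the vertex. -/
theorem data_inPlane_inter_onEdge (h : IsGeneric Z) {i j : Fin n}
    (hij : Disjoint (corner i) (edge j)) :
    (∀ m, inPlane Z i ∩ onEdge Z j ⊆ onEdge Z m ↔ m = i - 1 ∨ m = i ∨ m = j) ∧
      (∀ m, ¬ inPlane Z i ∩ onEdge Z j ⊆ throughPoint Z m) ∧
      ∀ m, inPlane Z i ∩ onEdge Z j ⊆ inPlane Z m ↔ m = i := by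
  have hn := h.four_le
  have hI := h.noFourCoplanar
  have hij' := disjoint_corner_edge.1 hij
  obtain ⟨V, hV, hVi⟩ := hI.exists_mem_inPlane_onEdge hn hij (a := i) (Or.inr (Or.inl rfl))
  have hd := h.data_throughPoint_inter_inPlane_inter_onEdge hij ⟨⟨hVi, hV.1⟩, hV.2⟩
  have hE : ∀ m, inPlane Z i ∩ onEdge Z j ⊆ onEdge Z m ↔ m = i - 1 ∨ m = i ∨ m = j := by
    refine fun m => ⟨fun hm => (hd.1 m).1 (hm hV), ?_⟩
    have := h.subset_onEdge_of_inPlane (Set.inter_subset_left (s := inPlane Z i)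
      (t := onEdge Z j))
    rintro (rfl | rfl | rfl)
    exacts [this.1, this.2, Set.inter_subset_right]
  refine ⟨hE, fun m hm => ?_, fun m => ⟨fun hm => ?_, ?_⟩⟩
  · have e := (hd.2 m).1 (hm hV)
    subst e
    obtain ⟨W, hW, hWi⟩ := hI.exists_mem_inPlane_onEdge hn hij (a := m + 1) (Or.inr (Or.inr rfl))
    have k := (hI.meets_join_iff hn (ne_add_one hn m) (ne_add_one hn j) (hm hW) hWi).1 hW.2
    omega
  · have a0 := val_add_one_cases (by omega) i
    have a1 := val_sub_one_cases (by omega) i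
    have a2 := val_sub_one_cases (by omega) m
    have a3 := val_add_one_cases (by omega) j
    have k1 := (hE _).1 (h.subset_onEdge_of_inPlane hm).1
    have k2 := (hE _).1 (h.subset_onEdge_of_inPlane hm).2
    omega
  · rintro rfl
    exact Set.inter_subset_left

/-- The test lines are the transversals through the two ends of edge `i`. They are of type (0, IV),
so they meet exactly four edges, and only the three given ones are common to both. -/
theorem data_three_edges (h : IsGeneric Z) {i j k : Fin n} (dij : Disjoint (edge i) (edge j))
    (dik : Disjoint (edge i) (edge k)) (djk : Disjoint (edge j) (edge k)) :
    (∀ m, onEdge Z i ∩ onEdge Z j ∩ onEdge Z k ⊆ onEdge Z m ↔ m = i ∨ m = j ∨ m = k) ∧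
      (∀ m, ¬ onEdge Z i ∩ onEdge Z j ∩ onEdge Z k ⊆ throughPoint Z m) ∧
      ∀ m, ¬ onEdge Z i ∩ onEdge Z j ∩ onEdge Z k ⊆ inPlane Z m := by
  have hn := h.four_le
  have hI := h.noFourCoplanar
  have dij' := disjoint_edge_edge.1 dij
  have dik' := disjoint_edge_edge.1 dik
  have djk' := disjoint_edge_edge.1 djk
  have a0 := val_add_one_cases (by omega) i
  have a1 := val_sub_one_cases (by omega) i
  have a2 := val_add_one_cases (by omega) j
  have a3 := val_add_one_cases (by omega) k
  have hE : ∀ m, onEdge Z i ∩ onEdge Z j ∩ onEdge Z k ⊆ onEdge Z m ↔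
      m = i ∨ m = j ∨ m = k := by
    refine fun m => ⟨fun hm => ?_, ?_⟩
    · have key : ∀ a, (a = i ∨ a = i + 1) → m = a - 1 ∨ m = a ∨ m = j ∨ m = k := by
        intro a ha
        have haj : a ∉ edge j := by
          rw [mem_edge]
          omega
        have hak : a ∉ edge k := by
          rw [mem_edge]
          omega
        obtain ⟨U, hU⟩ := hI.throughPoint_inter_onEdge_inter_onEdge_eq_singleton hn djk haj hak
        have hUm : U ∈ throughPoint Z a ∩ onEdge Z j ∩ onEdge Z k := hU ▸ rfl
        exact ((h.data_throughPoint_inter_onEdge_inter_onEdge djk haj hak hUm).1 m).1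
          (hm ⟨⟨h.onEdge_of_mem_edge ha hUm.1.1, hUm.1.2⟩, hUm.2⟩)
      have k1 := key i (Or.inl rfl)
      have k2 := key (i + 1) (Or.inr rfl)
      rw [add_sub_cancel_right] at k2
      omega
    · rintro (rfl | rfl | rfl)
      exacts [fun V hV => hV.1.1, fun V hV => hV.1.2, fun V hV => hV.2]
  refine ⟨hE, fun m hm => ?_, fun m hm => ?_⟩
  · have k1 := (hE _).1 (h.subset_onEdge_of_throughPoint hm).1
    have k2 := (hE _).1 (h.subset_onEdge_of_throughPoint hm).2
    have a4 := val_sub_one_cases (by omega) m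
    omega
  · have k1 := (hE _).1 (h.subset_onEdge_of_inPlane hm).1
    have k2 := (hE _).1 (h.subset_onEdge_of_inPlane hm).2
    have a4 := val_sub_one_cases (by omega) m
    omega

end IsGeneric

end GenericData

/-! ### Closed strata are the listed components. -/

section ClosedStrata

variable {n : ℕ} [NeZero n] {Z : Matrix (Fin n) (Fin 4) ℝ}

namespace IsGeneric

variable {V W : Gr ℂ 4} {C D : Set (Gr ℂ 4)}

theorem algebraicBoundary_eq (h : IsGeneric Z) : algebraicBoundary Z = ⋃ i, onEdge Z i := by
  obtain ⟨ε, hc⟩ := h.positive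
  exact hc.algebraicBoundary_eq h.noFourCoplanar h.four_le

theorem isClosedStratum_onEdge (h : IsGeneric Z) (i : Fin n) :
    IsClosedStratum (algebraicBoundary Z) (onEdge Z i) := by
  refine .component ?_
  rw [h.algebraicBoundary_eq]
  refine (mem_componentsIn_iUnion (fun i => h.noFourCoplanar.isClosed_onEdge h.four_le i)
    (fun i => h.noFourCoplanar.isIrreducible_onEdge h.four_le i) (fun i j hij => ?_) _).2 ⟨i, rfl⟩
  rw [((h.data_onEdge i).1 j).1 hij]

theorem onEdge_pred_inter_onEdge (h : IsGeneric Z) (i : Fin n) :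
    onEdge Z (i - 1) ∩ onEdge Z i = ⋃ b : Bool, cond b (throughPoint Z i) (inPlane Z i) := by
  have hn := h.four_le
  have hI := h.noFourCoplanar
  ext V
  simp only [Set.mem_iUnion, Bool.exists_bool, cond_true, cond_false]
  constructor
  · rintro ⟨h1, h2⟩
    exact (hI.mem_or_inPlane hn h1 h2).symm
  · rintro (h1 | h1)
    · exact ⟨hI.onEdge_pred_of_inPlane hn h1, hI.onEdge_of_inPlane hn h1⟩
    · exact ⟨hI.onEdge_pred_of_mem hn h1, hI.onEdge_of_mem hn h1⟩

/-- The vertex locus and the corner plane locus do not contain one another, so both are components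
of the intersection of consecutive edge hypersurfaces. -/
theorem isClosedStratum_cond (h : IsGeneric Z) (i : Fin n) (b : Bool) :
    IsClosedStratum (algebraicBoundary Z) (cond b (throughPoint Z i) (inPlane Z i)) := by
  have hn := h.four_le
  have hI := h.noFourCoplanar
  refine .inter (h.isClosedStratum_onEdge (i - 1)) (h.isClosedStratum_onEdge i) ?_
  rw [h.onEdge_pred_inter_onEdge]
  refine (mem_componentsIn_iUnion ?_ ?_ ?_ _).2 ⟨b, rfl⟩
  · rintro (_ | _)
    exacts [hI.isClosed_inPlane hn i, isClosed_throughPoint i]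
  · rintro (_ | _)
    exacts [hI.isIrreducible_inPlane hn i, hI.isIrreducible_throughPoint hn i]
  · rintro (_ | _) (_ | _) hs
    exacts [rfl, absurd hs ((h.data_inPlane i).2.1 i), absurd hs ((h.data_throughPoint i).2.2 i),
      rfl]

theorem isClosedStratum_inter (h : IsGeneric Z) {t : StratumType}
    (hC : IsClosedStratum (algebraicBoundary Z) C) (hD : IsClosedStratum (algebraicBoundary Z) D)
    (hS : C ∩ D ∈ strataOfType Z t) (ht : t ≠ .dim0typeVI) :
    IsClosedStratum (algebraicBoundary Z) (C ∩ D) :=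
  .inter hC hD (mem_componentsIn_self (h.isIrreducible_of_mem hS ht))

/-- Every locus is built from edges, vertices and corner planes by successive intersections. The
intermediate loci are irreducible, so each of them is a stratum as a whole; only the last
intersection for (0, VI) breaks up. -/
theorem isClosedStratum_of_listed (h : IsGeneric Z) (hC : Listed Z C) :
    IsClosedStratum (algebraicBoundary Z) C := by
  have hn := h.four_le
  have hI := h.noFourCoplanar
  have L := h.isClosedStratum_onEdge
  have P := fun i => h.isClosedStratum_cond i false
  have V := fun i => h.isClosedStratum_cond i true
  have VP : ∀ i, IsClosedStratum (algebraicBoundary Z) (throughPoint Z i ∩ inPlane Z i) :=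
    fun i => h.isClosedStratum_inter (t := .dim1typeI) (V i) (P i)
      (h.mem_strataOfType_dim1typeI.2 ⟨i, rfl⟩) (by simp)
  have LL : ∀ i j, Disjoint (edge i) (edge j) →
      IsClosedStratum (algebraicBoundary Z) (onEdge Z i ∩ onEdge Z j) := fun i j hij =>
    h.isClosedStratum_inter (t := .dim2typeIII) (L i) (L j) ⟨i, j, hij, rfl⟩ (by simp)
  have LLL : ∀ i j k, Disjoint (edge i) (edge j) → Disjoint (edge i) (edge k) →
      Disjoint (edge j) (edge k) →
      IsClosedStratum (algebraicBoundary Z) (onEdge Z i ∩ onEdge Z j ∩ onEdge Z k) :=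
    fun i j k hij hik hjk => h.isClosedStratum_inter (t := .dim1typeIV) (LL i j hij) (L k)
      ⟨i, j, k, hij, hik, hjk, rfl⟩ (by simp)
  have VL : ∀ i j, i ∉ edge j →
      IsClosedStratum (algebraicBoundary Z) (throughPoint Z i ∩ onEdge Z j) := fun i j hij =>
    h.isClosedStratum_inter (t := .dim1typeII) (V i) (L j) ⟨i, j, hij, rfl⟩ (by simp)
  have PL : ∀ i j, Disjoint (corner i) (edge j) →
      IsClosedStratum (algebraicBoundary Z) (inPlane Z i ∩ onEdge Z j) := fun i j hij =>
    h.isClosedStratum_inter (t := .dim1typeIII) (P i) (L j) ⟨i, j, hij, rfl⟩ (by simp)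
  obtain ⟨t, S, hS, hC⟩ := hC
  by_cases ht : t = .dim0typeVI
  · subst ht
    obtain ⟨i, j, k, l, dij, dik, dil, djk, djl, dkl, rfl⟩ := hS
    exact .inter (LLL i j k dij dik djk) (L l) hC
  rw [h.componentsIn_of_mem hS ht, Set.mem_singleton_iff] at hC
  subst hC
  cases t
  case dim3typeI =>
    obtain ⟨i, rfl⟩ := hS
    exact L i
  case dim2typeI =>
    obtain ⟨i, rfl⟩ := hS
    exact V i
  case dim2typeII =>
    obtain ⟨i, rfl⟩ := hS
    exact P i
  case dim2typeIII =>
    obtain ⟨i, j, hij, rfl⟩ := hS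
    exact LL i j hij
  case dim1typeI =>
    obtain ⟨i, rfl⟩ := h.mem_strataOfType_dim1typeI.1 hS
    exact VP i
  case dim1typeII =>
    obtain ⟨i, j, hij, rfl⟩ := hS
    exact VL i j hij
  case dim1typeIII =>
    obtain ⟨i, j, hij, rfl⟩ := hS
    exact PL i j hij
  case dim1typeIV =>
    obtain ⟨i, j, k, hij, hik, hjk, rfl⟩ := hS
    exact LLL i j k hij hik hjk
  case dim0typeI =>
    obtain ⟨i, j, hij, rfl⟩ := hS
    exact h.isClosedStratum_inter (t := .dim0typeI) (V i) (V j) ⟨i, j, hij, rfl⟩ (by simp)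
  case dim0typeII =>
    obtain ⟨i, j, hij, rfl⟩ := hS
    exact h.isClosedStratum_inter (t := .dim0typeII) (P i) (P j) ⟨i, j, hij, rfl⟩ (by simp)
  case dim0typeIII =>
    obtain ⟨i, j, hij, rfl⟩ := h.mem_strataOfType_dim0typeIII.1 hS
    exact h.isClosedStratum_inter (t := .dim0typeIII) (VP i) (L j) hS (by simp)
  case dim0typeIV =>
    obtain ⟨i, j, k, hjk, hij, hik, rfl⟩ := hS
    exact h.isClosedStratum_inter (t := .dim0typeIV) (VL i j hij) (L k)
      ⟨i, j, k, hjk, hij, hik, rfl⟩ (by simp)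
  case dim0typeV =>
    obtain ⟨i, j, k, hij, hik, hjk, rfl⟩ := hS
    exact h.isClosedStratum_inter (t := .dim0typeV) (PL i j hij) (L k)
      ⟨i, j, k, hij, hik, hjk, rfl⟩ (by simp)
  case dim0typeVI => exact absurd rfl ht

/-- A set of lines which contains with a line every line satisfying the same incidences. -/
def Saturated (Z : Matrix (Fin n) (Fin 4) ℝ) (C : Set (Gr ℂ 4)) : Prop :=
  ∀ V ∈ C, ∀ W, Specializes Z V W → W ∈ C

theorem Saturated.inter (hC : Saturated Z C) (hD : Saturated Z D) : Saturated Z (C ∩ D) :=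
  fun V hV W hW => ⟨hC V hV.1 W hW, hD V hV.2 W hW⟩

theorem saturated_onEdge (i : Fin n) : Saturated Z (onEdge Z i) := fun _ hV _ hW => hW.1 i hV

theorem saturated_throughPoint (i : Fin n) : Saturated Z (throughPoint Z i) :=
  fun _ hV _ hW => hW.2.1 i hV

theorem saturated_inPlane (i : Fin n) : Saturated Z (inPlane Z i) := fun _ hV _ hW => hW.2.2 i hV

theorem saturated_of_mem (h : IsGeneric Z) {t : StratumType} (hS : C ∈ strataOfType Z t) :
    Saturated Z C := by
  have L := saturated_onEdge (Z := Z)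
  have V := saturated_throughPoint (Z := Z)
  have P := saturated_inPlane (Z := Z)
  cases t
  case dim3typeI =>
    obtain ⟨i, rfl⟩ := hS
    exact L i
  case dim2typeI =>
    obtain ⟨i, rfl⟩ := hS
    exact V i
  case dim2typeII =>
    obtain ⟨i, rfl⟩ := hS
    exact P i
  case dim2typeIII =>
    obtain ⟨i, j, hij, rfl⟩ := hS
    exact (L i).inter (L j)
  case dim1typeI =>
    obtain ⟨i, rfl⟩ := h.mem_strataOfType_dim1typeI.1 hS
    exact (V i).inter (P i)
  case dim1typeII =>
    obtain ⟨i, j, hij, rfl⟩ := hS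
    exact (V i).inter (L j)
  case dim1typeIII =>
    obtain ⟨i, j, hij, rfl⟩ := hS
    exact (P i).inter (L j)
  case dim1typeIV =>
    obtain ⟨i, j, k, hij, hik, hjk, rfl⟩ := hS
    exact ((L i).inter (L j)).inter (L k)
  case dim0typeI =>
    obtain ⟨i, j, hij, rfl⟩ := hS
    exact (V i).inter (V j)
  case dim0typeII =>
    obtain ⟨i, j, hij, rfl⟩ := hS
    exact (P i).inter (P j)
  case dim0typeIII =>
    obtain ⟨i, j, hij, rfl⟩ := h.mem_strataOfType_dim0typeIII.1 hS
    exact ((V i).inter (P i)).inter (L j)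
  case dim0typeIV =>
    obtain ⟨i, j, k, hjk, hij, hik, rfl⟩ := hS
    exact ((V i).inter (L j)).inter (L k)
  case dim0typeV =>
    obtain ⟨i, j, k, hij, hik, hjk, rfl⟩ := hS
    exact ((P i).inter (L j)).inter (L k)
  case dim0typeVI =>
    obtain ⟨i, j, k, l, dij, dik, dil, djk, djl, dkl, rfl⟩ := hS
    exact (((L i).inter (L j)).inter (L k)).inter (L l)

/-- The two transversals of four disjoint edges have the same incidences, so neither point alone is
stable under specialization; these points must be treated separately. -/
theorem Listed.saturated_or (h : IsGeneric Z) (hC : Listed Z C) :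
    Saturated Z C ∨ ∃ U, C = {U} := by
  obtain ⟨t, S, hS, hC⟩ := hC
  by_cases ht : t = .dim0typeVI
  · subst ht
    obtain ⟨U, -, rfl⟩ := (h.mem_componentsIn_of_dim_eq_zero hS rfl C).1 hC
    exact Or.inr ⟨U, rfl⟩
  · rw [h.componentsIn_of_mem hS ht, Set.mem_singleton_iff] at hC
    exact Or.inl (hC ▸ h.saturated_of_mem hS)

theorem finite_strataOfType (t : StratumType) : (strataOfType Z t).Finite := by
  cases t
  all_goals simp only [strataOfType]
  case dim3typeI =>
    exact (Set.finite_range fun i => meetsLine Z i (i + 1)).subset fun S ⟨i, hS⟩ => ⟨i, hS.symm⟩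
  case dim2typeI =>
    exact (Set.finite_range fun i => throughPoint Z i).subset fun S ⟨i, hS⟩ => ⟨i, hS.symm⟩
  case dim2typeII =>
    exact (Set.finite_range fun i => inPlane Z i).subset fun S ⟨i, hS⟩ => ⟨i, hS.symm⟩
  case dim2typeIII =>
    exact (Set.finite_range fun p : Fin n × Fin n => meetsLine Z p.1 (p.1 + 1) ∩
      meetsLine Z p.2 (p.2 + 1)).subset fun S ⟨i, j, _, hS⟩ => ⟨(i, j), hS.symm⟩
  case dim1typeI =>
    exact (Set.finite_range fun i => throughPoint Z i ∩ meetsLine Z (i - 1) (i + 1)).subset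
      fun S ⟨i, hS⟩ => ⟨i, hS.symm⟩
  case dim1typeII =>
    exact (Set.finite_range fun p : Fin n × Fin n => throughPoint Z p.1 ∩
      meetsLine Z p.2 (p.2 + 1)).subset fun S ⟨i, j, _, hS⟩ => ⟨(i, j), hS.symm⟩
  case dim1typeIII =>
    exact (Set.finite_range fun p : Fin n × Fin n => inPlane Z p.1 ∩
      meetsLine Z p.2 (p.2 + 1)).subset fun S ⟨i, j, _, hS⟩ => ⟨(i, j), hS.symm⟩
  case dim1typeIV =>
    exact (Set.finite_range fun p : Fin n × Fin n × Fin n => meetsLine Z p.1 (p.1 + 1) ∩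
      meetsLine Z p.2.1 (p.2.1 + 1) ∩ meetsLine Z p.2.2 (p.2.2 + 1)).subset
      fun S ⟨i, j, k, _, _, _, hS⟩ => ⟨(i, j, k), hS.symm⟩
  case dim0typeI =>
    exact (Set.finite_range fun p : Fin n × Fin n => throughPoint Z p.1 ∩
      throughPoint Z p.2).subset fun S ⟨i, j, _, hS⟩ => ⟨(i, j), hS.symm⟩
  case dim0typeII =>
    exact (Set.finite_range fun p : Fin n × Fin n => inPlane Z p.1 ∩
      inPlane Z p.2).subset fun S ⟨i, j, _, hS⟩ => ⟨(i, j), hS.symm⟩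
  case dim0typeIII =>
    exact (Set.finite_range fun p : Fin n × Fin n => throughPoint Z p.1 ∩
      meetsLine Z (p.1 - 1) (p.1 + 1) ∩ meetsLine Z p.2 (p.2 + 1)).subset
      fun S ⟨i, j, _, hS⟩ => ⟨(i, j), hS.symm⟩
  case dim0typeIV =>
    exact (Set.finite_range fun p : Fin n × Fin n × Fin n => throughPoint Z p.1 ∩
      meetsLine Z p.2.1 (p.2.1 + 1) ∩ meetsLine Z p.2.2 (p.2.2 + 1)).subset
      fun S ⟨i, j, k, _, _, _, hS⟩ => ⟨(i, j, k), hS.symm⟩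
  case dim0typeV =>
    exact (Set.finite_range fun p : Fin n × Fin n × Fin n => inPlane Z p.1 ∩
      meetsLine Z p.2.1 (p.2.1 + 1) ∩ meetsLine Z p.2.2 (p.2.2 + 1)).subset
      fun S ⟨i, j, k, _, _, _, hS⟩ => ⟨(i, j, k), hS.symm⟩
  case dim0typeVI =>
    exact (Set.finite_range fun p : Fin n × Fin n × Fin n × Fin n => meetsLine Z p.1 (p.1 + 1) ∩
      meetsLine Z p.2.1 (p.2.1 + 1) ∩ meetsLine Z p.2.2.1 (p.2.2.1 + 1) ∩
      meetsLine Z p.2.2.2 (p.2.2.2 + 1)).subset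
      fun S ⟨i, j, k, l, _, _, _, _, _, _, hS⟩ => ⟨(i, j, k, l), hS.symm⟩

theorem finite_univ_stratumType : (Set.univ : Set StratumType).Finite := by
  refine (Set.toFinite {.dim3typeI, .dim2typeI, .dim2typeII, .dim2typeIII, .dim1typeI,
    .dim1typeII, .dim1typeIII, .dim1typeIV, .dim0typeI, .dim0typeII, .dim0typeIII,
    .dim0typeIV, .dim0typeV, .dim0typeVI}).subset fun t _ => ?_
  cases t <;> simp

theorem finite_listed (h : IsGeneric Z) : {C | Listed Z C}.Finite := by
  have : {C | Listed Z C} = ⋃ t ∈ (Set.univ : Set StratumType), ⋃ S ∈ strataOfType Z t,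
      componentsIn S := by
    ext C
    simp [Listed]
  rw [this]
  refine finite_univ_stratumType.biUnion fun t _ => (finite_strataOfType t).biUnion fun S hS => ?_
  by_cases ht : t = .dim0typeVI
  · subst ht
    refine ((h.finite_of_dim_eq_zero hS rfl).1.image fun U => ({U} : Set _)).subset fun C hC => ?_
    obtain ⟨U, hU, rfl⟩ := (h.mem_componentsIn_of_dim_eq_zero hS rfl C).1 hC
    exact ⟨U, hU, rfl⟩
  · rw [h.componentsIn_of_mem hS ht]
    exact Set.finite_singleton S

theorem Listed.isClosed (h : IsGeneric Z) (hC : Listed Z C) : IsClosed C := by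
  obtain ⟨t, S, hS, hC⟩ := hC
  by_cases ht : t = .dim0typeVI
  · subst ht
    obtain ⟨U, -, rfl⟩ := (h.mem_componentsIn_of_dim_eq_zero hS rfl C).1 hC
    exact Gr.isClosed_singleton U
  · rw [h.componentsIn_of_mem hS ht, Set.mem_singleton_iff] at hC
    exact hC ▸ h.isClosed_of_mem hS

theorem Listed.isIrreducible (hC : Listed Z C) : IsIrreducible C := by
  obtain ⟨t, S, hS, hC⟩ := hC
  exact (maximal_of_mem_componentsIn hC).prop.1

/-- A saturated part of the boundary is the union of the listed components it contains. -/
theorem exists_listed_subset (h : IsGeneric Z) (hC : Saturated Z C)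
    (hb : C ⊆ ⋃ i, onEdge Z i) (hV : V ∈ C) : ∃ M, Listed Z M ∧ V ∈ M ∧ M ⊆ C := by
  obtain ⟨i, hi⟩ := Set.mem_iUnion.1 (hb hV)
  obtain ⟨M, hM, hVM, hle⟩ := h.exists_listed hi
  exact ⟨M, hM, hVM, fun W hW => hC V hV W (hle W hW)⟩

/-- A stable set is covered by the finitely many listed components it contains. These are closed, so
an irreducible component lies in one of them and equals it by maximality. -/
theorem listed_of_mem_componentsIn (h : IsGeneric Z) (hC : Saturated Z C)
    (hb : C ⊆ ⋃ i, onEdge Z i) (hD : D ∈ componentsIn C) : Listed Z D := by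
  have hmax := maximal_of_mem_componentsIn hD
  have hfin : Finite {M | Listed Z M ∧ M ⊆ C} :=
    (h.finite_listed.subset fun M (hM : Listed Z M ∧ M ⊆ C) => hM.1).to_subtype
  obtain ⟨⟨M, hM, hMC⟩, hDM⟩ := hmax.prop.1.exists_subset_of_subset_iUnion
    (F := fun M : {M | Listed Z M ∧ M ⊆ C} => M.1) (fun M => M.2.1.isClosed h) (by
      intro V hV
      obtain ⟨M, hM, hVM, hMC⟩ := h.exists_listed_subset hC hb (hmax.prop.2 hV)
      exact Set.mem_iUnion.2 ⟨⟨M, hM, hMC⟩, hVM⟩)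
  have : D = M := subset_antisymm hDM (hmax.le_of_ge ⟨hM.isIrreducible, hMC⟩ hDM)
  exact this ▸ hM

/-- Induction on the construction: the intersection of two stable sets is stable, and if one of the
two strata is a point, the new stratum is that point. -/
theorem listed_of_isClosedStratum (h : IsGeneric Z)
    (hC : IsClosedStratum (algebraicBoundary Z) C) :
    Listed Z C ∧ C ⊆ ⋃ i, onEdge Z i := by
  induction hC with
  | component hC =>
    rw [h.algebraicBoundary_eq] at hC
    refine ⟨h.listed_of_mem_componentsIn ?_ subset_rfl hC, (maximal_of_mem_componentsIn hC).prop.2⟩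
    intro V hV W hW
    obtain ⟨i, hi⟩ := Set.mem_iUnion.1 hV
    exact Set.mem_iUnion.2 ⟨i, hW.1 i hi⟩
  | @inter C D E _ _ hE ihC ihD =>
    have hmax := maximal_of_mem_componentsIn hE
    have hEb : E ⊆ ⋃ i, onEdge Z i := fun V hV => ihC.2 (hmax.prop.2 hV).1
    refine ⟨?_, hEb⟩
    have hsing : ∀ {U : Gr ℂ 4}, Listed Z {U} → E ⊆ {U} → Listed Z E := by
      intro U hU hEU
      rwa [(Set.Nonempty.subset_singleton_iff hmax.prop.1.nonempty).1 hEU]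
    rcases ihC.1.saturated_or h with hC | ⟨U, rfl⟩
    · rcases ihD.1.saturated_or h with hD | ⟨U, rfl⟩
      · exact h.listed_of_mem_componentsIn (hC.inter hD) (fun V hV => ihC.2 hV.1) hE
      · exact hsing ihD.1 fun V hV => (hmax.prop.2 hV).2
    · exact hsing ihC.1 fun V hV => (hmax.prop.2 hV).1

theorem isClosedStratum_iff (h : IsGeneric Z) :
    IsClosedStratum (algebraicBoundary Z) C ↔ Listed Z C :=
  ⟨fun hC => (h.listed_of_isClosedStratum hC).1, h.isClosedStratum_of_listed⟩

theorem algebraicBoundary_eq_sUnion (h : IsGeneric Z) :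
    algebraicBoundary Z = ⋃₀ {C | IsClosedStratum (algebraicBoundary Z) C} := by
  apply Set.Subset.antisymm
  · conv_lhs => rw [h.algebraicBoundary_eq]
    exact Set.iUnion_subset fun i => Set.subset_sUnion_of_mem (h.isClosedStratum_onEdge i)
  · refine Set.sUnion_subset fun C hC => ?_
    rw [h.algebraicBoundary_eq]
    exact (h.listed_of_isClosedStratum hC).2

theorem inter_eq_sUnion (h : IsGeneric Z) (hC : IsClosedStratum (algebraicBoundary Z) C)
    (hD : IsClosedStratum (algebraicBoundary Z) D) :
    C ∩ D = ⋃₀ {E | IsClosedStratum (algebraicBoundary Z) E ∧ E ⊆ C ∩ D} := by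
  refine Set.Subset.antisymm ?_ (Set.sUnion_subset fun E hE => hE.2)
  intro V hV
  obtain ⟨hC', hCb⟩ := h.listed_of_isClosedStratum hC
  obtain ⟨hD', -⟩ := h.listed_of_isClosedStratum hD
  rcases hC'.saturated_or h with hCs | ⟨U, rfl⟩
  · rcases hD'.saturated_or h with hDs | ⟨U, rfl⟩
    · obtain ⟨M, hM, hVM, hMC⟩ := h.exists_listed_subset (hCs.inter hDs)
        (fun V hV => hCb hV.1) hV
      exact ⟨M, ⟨h.isClosedStratum_of_listed hM, hMC⟩, hVM⟩
    · obtain rfl : V = U := hV.2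
      exact ⟨{V}, ⟨hD, Set.singleton_subset_iff.2 hV⟩, rfl⟩
  · obtain rfl : V = U := hV.1
    exact ⟨{V}, ⟨hC, Set.singleton_subset_iff.2 hV⟩, rfl⟩

end IsGeneric

end ClosedStrata

/-! ### Distinguishing the types. -/

/-- An invariant of the loci which determines their type. -/
def StratumType.code : StratumType → ℕ × ℕ
  | .dim3typeI => (5, 1)
  | .dim2typeI => (2, 2)
  | .dim2typeII => (4, 2)
  | .dim2typeIII => (5, 2)
  | .dim1typeI => (1, 2)
  | .dim1typeII => (2, 3)
  | .dim1typeIII => (4, 3)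
  | .dim1typeIV => (5, 3)
  | .dim0typeI => (0, 0)
  | .dim0typeII => (3, 0)
  | .dim0typeIII => (1, 3)
  | .dim0typeIV => (2, 4)
  | .dim0typeV => (4, 4)
  | .dim0typeVI => (5, 4)

theorem StratumType.code_injective : Function.Injective StratumType.code := by
  intro t t' h
  cases t <;> cases t' <;> first | rfl | exact absurd h (by decide)

section TypeCode

variable {n : ℕ} [NeZero n] {Z : Matrix (Fin n) (Fin 4) ℝ}

open Classical in
/-- The invariant of a component of a locus, in terms of the incidences of its members. -/
noncomputable def typeCode (Z : Matrix (Fin n) (Fin 4) ℝ) (C : Set (Gr ℂ 4)) : ℕ × ℕ :=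
  if ∃ i j, i ≠ j ∧ C ⊆ throughPoint Z i ∧ C ⊆ throughPoint Z j then (0, 0)
  else if ∃ i, C ⊆ throughPoint Z i ∧ C ⊆ inPlane Z i then (1, {m | C ⊆ onEdge Z m}.ncard)
  else if ∃ i, C ⊆ throughPoint Z i then (2, {m | C ⊆ onEdge Z m}.ncard)
  else if ∃ i j, i ≠ j ∧ C ⊆ inPlane Z i ∧ C ⊆ inPlane Z j then (3, 0)
  else if ∃ i, C ⊆ inPlane Z i then (4, {m | C ⊆ onEdge Z m}.ncard)
  else (5, {m | C ⊆ onEdge Z m}.ncard)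

variable {C : Set (Gr ℂ 4)}

theorem ncard_of_forall {s : Finset (Fin n)} (hE : ∀ m, C ⊆ onEdge Z m ↔ m ∈ s) :
    {m | C ⊆ onEdge Z m}.ncard = s.card := by
  rw [← Set.ncard_coe_finset]
  congr 1
  ext m
  exact hE m

theorem typeCode_of_two_points {i j : Fin n} (hij : i ≠ j) (hi : C ⊆ throughPoint Z i)
    (hj : C ⊆ throughPoint Z j) : typeCode Z C = (0, 0) :=
  if_pos ⟨i, j, hij, hi, hj⟩

theorem typeCode_of_point_of_plane {i : Fin n} {s : Finset (Fin n)}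
    (hE : ∀ m, C ⊆ onEdge Z m ↔ m ∈ s) (hA : ∀ m, C ⊆ throughPoint Z m ↔ m = i)
    (hB : C ⊆ inPlane Z i) : typeCode Z C = (1, s.card) := by
  rw [typeCode, if_neg, if_pos ⟨i, (hA i).2 rfl, hB⟩, ncard_of_forall hE]
  rintro ⟨a, b, hab, ha, hb⟩
  exact hab (((hA a).1 ha).trans ((hA b).1 hb).symm)

theorem typeCode_of_point {i : Fin n} {s : Finset (Fin n)}
    (hE : ∀ m, C ⊆ onEdge Z m ↔ m ∈ s) (hA : ∀ m, C ⊆ throughPoint Z m ↔ m = i)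
    (hB : ¬ C ⊆ inPlane Z i) : typeCode Z C = (2, s.card) := by
  rw [typeCode, if_neg, if_neg, if_pos ⟨i, (hA i).2 rfl⟩, ncard_of_forall hE]
  · rintro ⟨a, ha, ha'⟩
    exact hB ((hA a).1 ha ▸ ha')
  · rintro ⟨a, b, hab, ha, hb⟩
    exact hab (((hA a).1 ha).trans ((hA b).1 hb).symm)

theorem typeCode_of_two_planes {i j : Fin n} (hij : i ≠ j) (hA : ∀ m, ¬ C ⊆ throughPoint Z m)
    (hi : C ⊆ inPlane Z i) (hj : C ⊆ inPlane Z j) : typeCode Z C = (3, 0) := by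
  rw [typeCode, if_neg, if_neg, if_neg, if_pos ⟨i, j, hij, hi, hj⟩]
  · exact fun ⟨a, ha⟩ => hA a ha
  · exact fun ⟨a, ha, _⟩ => hA a ha
  · exact fun ⟨a, b, _, ha, _⟩ => hA a ha

theorem typeCode_of_plane {i : Fin n} {s : Finset (Fin n)}
    (hE : ∀ m, C ⊆ onEdge Z m ↔ m ∈ s) (hA : ∀ m, ¬ C ⊆ throughPoint Z m)
    (hB : ∀ m, C ⊆ inPlane Z m ↔ m = i) : typeCode Z C = (4, s.card) := by
  rw [typeCode, if_neg, if_neg, if_neg, if_neg, if_pos ⟨i, (hB i).2 rfl⟩, ncard_of_forall hE]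
  · rintro ⟨a, b, hab, ha, hb⟩
    exact hab (((hB a).1 ha).trans ((hB b).1 hb).symm)
  · exact fun ⟨a, ha⟩ => hA a ha
  · exact fun ⟨a, ha, _⟩ => hA a ha
  · exact fun ⟨a, b, _, ha, _⟩ => hA a ha

theorem typeCode_of_edges {s : Finset (Fin n)} (hE : ∀ m, C ⊆ onEdge Z m ↔ m ∈ s)
    (hA : ∀ m, ¬ C ⊆ throughPoint Z m) (hB : ∀ m, ¬ C ⊆ inPlane Z m) :
    typeCode Z C = (5, s.card) := by
  rw [typeCode, if_neg, if_neg, if_neg, if_neg, if_neg, ncard_of_forall hE]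
  · exact fun ⟨a, ha⟩ => hB a ha
  · exact fun ⟨a, _, _, ha, _⟩ => hB a ha
  · exact fun ⟨a, ha⟩ => hA a ha
  · exact fun ⟨a, ha, _⟩ => hA a ha
  · exact fun ⟨a, b, _, ha, _⟩ => hA a ha

theorem card_triple {a b c : Fin n} (hab : a ≠ b) (hac : a ≠ c) (hbc : b ≠ c) :
    ({a, b, c} : Finset (Fin n)).card = 3 := Finset.card_eq_three.2 ⟨a, b, c, hab, hac, hbc, rfl⟩

theorem card_quadruple {a b c d : Fin n} (hab : a ≠ b) (hac : a ≠ c) (had : a ≠ d) (hbc : b ≠ c)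
    (hbd : b ≠ d) (hcd : c ≠ d) : ({a, b, c, d} : Finset (Fin n)).card = 4 := by
  rw [Finset.card_insert_of_notMem (by simp [hab, hac, had]), card_triple hbc hbd hcd]

namespace IsGeneric

variable {S : Set (Gr ℂ 4)}

/-- The first entry of the code records which vertices and corner planes are common to the
component, the second the number of common edges, suppressed where the first is decisive. -/
theorem typeCode_eq (h : IsGeneric Z) {t : StratumType} (hS : S ∈ strataOfType Z t)
    (hC : C ∈ componentsIn S) : typeCode Z C = t.code := by
  have hn := h.four_le
  have hI := h.noFourCoplanar
  by_cases h0 : t.dim = 0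
  · obtain ⟨U, hU, rfl⟩ := (h.mem_componentsIn_of_dim_eq_zero hS h0 C).1 hC
    cases t
    case dim0typeI =>
      obtain ⟨i, j, hij, rfl⟩ := hS
      exact typeCode_of_two_points hij (Set.singleton_subset_iff.2 hU.1)
        (Set.singleton_subset_iff.2 hU.2)
    case dim0typeII =>
      obtain ⟨i, j, hij, rfl⟩ := hS
      have hd := h.data_inPlane_inter_inPlane hij hU
      refine typeCode_of_two_planes (disjoint_corner_corner.1 hij).2.1.2.1 ?_
        (Set.singleton_subset_iff.2 hU.1) (Set.singleton_subset_iff.2 hU.2)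
      simpa only [Set.singleton_subset_iff] using hd.1
    case dim0typeIII =>
      obtain ⟨i, j, hij, rfl⟩ := h.mem_strataOfType_dim0typeIII.1 hS
      have hd := h.data_throughPoint_inter_inPlane_inter_onEdge hij hU
      have hij' := disjoint_corner_edge.1 hij
      rw [typeCode_of_point_of_plane (s := {i - 1, i, j}) (i := i)
        (by simpa [Set.singleton_subset_iff] using hd.1)
        (by simpa only [Set.singleton_subset_iff] using hd.2)
        (Set.singleton_subset_iff.2 hU.1.2), card_triple (sub_one_ne hn i) hij'.1 hij'.2.2.1]
      rfl
    case dim0typeIV =>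
      obtain ⟨i, j, k, hjk, hij, hik, rfl⟩ := hS
      have hd := h.data_throughPoint_inter_onEdge_inter_onEdge hjk hij hik hU
      have hjk' := disjoint_edge_edge.1 hjk
      rw [mem_edge, not_or] at hij hik
      rw [typeCode_of_point (s := {i - 1, i, j, k}) (i := i)
        (by simpa [Set.singleton_subset_iff] using hd.1)
        (by simpa only [Set.singleton_subset_iff] using hd.2.1)
        (by simpa only [Set.singleton_subset_iff] using hd.2.2),
        card_quadruple (sub_one_ne hn i) (fun e => hij.2 (by rw [← e, sub_add_cancel]))
        (fun e => hik.2 (by rw [← e, sub_add_cancel])) hij.1 hik.1 hjk'.1]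
      rfl
    case dim0typeV =>
      obtain ⟨i, j, k, hij, hik, hjk, rfl⟩ := hS
      have hd := h.data_inPlane_inter_onEdge_inter_onEdge hij hik hjk hU
      have hjk' := disjoint_edge_edge.1 hjk
      have hij' := disjoint_corner_edge.1 hij
      have hik' := disjoint_corner_edge.1 hik
      rw [typeCode_of_plane (s := {i - 1, i, j, k}) (i := i)
        (by simpa [Set.singleton_subset_iff] using hd.1)
        (by simpa only [Set.singleton_subset_iff] using hd.2.1)
        (by simpa only [Set.singleton_subset_iff] using hd.2.2),
        card_quadruple (sub_one_ne hn i) hij'.1 hik'.1 hij'.2.2.1 hik'.2.2.1 hjk'.1]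
      rfl
    case dim0typeVI =>
      obtain ⟨i, j, k, l, dij, dik, dil, djk, djl, dkl, rfl⟩ := hS
      have hd := h.data_four_edges dij dik dil djk djl dkl hU
      rw [typeCode_of_edges (s := {i, j, k, l})
        (by simpa [Set.singleton_subset_iff] using hd.1)
        (by simpa only [Set.singleton_subset_iff] using hd.2.1)
        (by simpa only [Set.singleton_subset_iff] using hd.2.2),
        card_quadruple (disjoint_edge_edge.1 dij).1 (disjoint_edge_edge.1 dik).1
          (disjoint_edge_edge.1 dil).1 (disjoint_edge_edge.1 djk).1 (disjoint_edge_edge.1 djl).1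
          (disjoint_edge_edge.1 dkl).1]
      rfl
    all_goals exact absurd h0 (by decide)
  have ht : t ≠ .dim0typeVI := fun e => h0 (by rw [e]; rfl)
  rw [h.componentsIn_of_mem hS ht, Set.mem_singleton_iff] at hC
  subst hC
  cases t
  case dim3typeI =>
    obtain ⟨i, rfl⟩ := hS
    have hd := h.data_onEdge i
    exact typeCode_of_edges (s := {i}) (by simpa using hd.1) hd.2.1 hd.2.2
  case dim2typeI =>
    obtain ⟨i, rfl⟩ := hS
    have hd := h.data_throughPoint i
    rw [typeCode_of_point (s := {i - 1, i}) (by simpa using hd.1) hd.2.1 (hd.2.2 i),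
      Finset.card_pair (sub_one_ne hn i)]
    rfl
  case dim2typeII =>
    obtain ⟨i, rfl⟩ := hS
    have hd := h.data_inPlane i
    rw [typeCode_of_plane (s := {i - 1, i}) (by simpa using hd.1) hd.2.1 hd.2.2,
      Finset.card_pair (sub_one_ne hn i)]
    rfl
  case dim2typeIII =>
    obtain ⟨i, j, hij, rfl⟩ := hS
    have hd := h.data_onEdge_inter_onEdge hij
    rw [typeCode_of_edges (s := {i, j}) (by simpa using hd.1) hd.2.1 hd.2.2,
      Finset.card_pair (disjoint_edge_edge.1 hij).1]
    rfl
  case dim1typeI =>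
    obtain ⟨i, rfl⟩ := h.mem_strataOfType_dim1typeI.1 hS
    have hd := h.data_throughPoint_inter_inPlane i
    rw [typeCode_of_point_of_plane (s := {i - 1, i}) (by simpa using hd.1) hd.2
      Set.inter_subset_right, Finset.card_pair (sub_one_ne hn i)]
    rfl
  case dim1typeII =>
    obtain ⟨i, j, hij, rfl⟩ := hS
    have hd := h.data_throughPoint_inter_onEdge hij
    rw [mem_edge, not_or] at hij
    rw [typeCode_of_point (s := {i - 1, i, j}) (by simpa using hd.1) hd.2.1 hd.2.2,
      card_triple (sub_one_ne hn i) (fun e => hij.2 (by rw [← e, sub_add_cancel])) hij.1]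
    rfl
  case dim1typeIII =>
    obtain ⟨i, j, hij, rfl⟩ := hS
    have hd := h.data_inPlane_inter_onEdge hij
    have hij' := disjoint_corner_edge.1 hij
    rw [typeCode_of_plane (s := {i - 1, i, j}) (by simpa using hd.1) hd.2.1 hd.2.2,
      card_triple (sub_one_ne hn i) hij'.1 hij'.2.2.1]
    rfl
  case dim1typeIV =>
    obtain ⟨i, j, k, hij, hik, hjk, rfl⟩ := hS
    have hd := h.data_three_edges hij hik hjk
    rw [typeCode_of_edges (s := {i, j, k}) (by simpa using hd.1) hd.2.1 hd.2.2,
      card_triple (disjoint_edge_edge.1 hij).1 (disjoint_edge_edge.1 hik).1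
        (disjoint_edge_edge.1 hjk).1]
    rfl
  all_goals exact absurd rfl h0

/-- Either of the two transversals meets exactly the four defining edges, so the pair can be
recovered from one of its points. -/
theorem eq_of_mem_dim0typeVI (h : IsGeneric Z) (hS : S ∈ strataOfType Z .dim0typeVI) {U : Gr ℂ 4}
    (hU : U ∈ S) : S = {V | ∀ m, U ∈ onEdge Z m → V ∈ onEdge Z m} := by
  obtain ⟨i, j, k, l, dij, dik, dil, djk, djl, dkl, rfl⟩ := hS
  have hd := h.data_four_edges dij dik dil djk djl dkl hU
  ext V
  constructor
  · rintro hV m hm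
    rcases (hd.1 m).1 hm with rfl | rfl | rfl | rfl
    exacts [hV.1.1.1, hV.1.1.2, hV.1.2, hV.2]
  · intro hV
    exact ⟨⟨⟨hV i hU.1.1.1, hV j hU.1.1.2⟩, hV k hU.1.2⟩, hV l hU.2⟩

theorem eq_of_mem_componentsIn (h : IsGeneric Z) {t t' : StratumType} {S' : Set (Gr ℂ 4)}
    (hS : S ∈ strataOfType Z t) (hS' : S' ∈ strataOfType Z t') (hC : C ∈ componentsIn S)
    (hC' : C ∈ componentsIn S') : t = t' ∧ S = S' := by
  have ht : t = t' := StratumType.code_injective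
    ((h.typeCode_eq hS hC).symm.trans (h.typeCode_eq hS' hC'))
  subst ht
  refine ⟨rfl, ?_⟩
  by_cases ht : t = .dim0typeVI
  · subst ht
    obtain ⟨U, hU, rfl⟩ := (h.mem_componentsIn_of_dim_eq_zero hS rfl C).1 hC
    have hU' : U ∈ S' := (maximal_of_mem_componentsIn hC').prop.2 rfl
    rw [h.eq_of_mem_dim0typeVI hS hU, h.eq_of_mem_dim0typeVI hS' hU']
  · rw [h.componentsIn_of_mem hS ht] at hC
    rw [h.componentsIn_of_mem hS' ht] at hC'
    exact hC.symm.trans hC'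

/-! ### Dimensions -/

/-- Equality would make one closed set a component of loci of different types. -/
theorem ssubset_of_subset (h : IsGeneric Z) {t t' : StratumType} {S' : Set (Gr ℂ 4)}
    (hS : S ∈ strataOfType Z t) (hS' : S' ∈ strataOfType Z t') (ht : t ≠ .dim0typeVI)
    (ht' : t' ≠ .dim0typeVI) (hne : t ≠ t') (hsub : S ⊆ S') : S ⊂ S' := by
  refine hsub.ssubset_of_ne fun e => hne ?_
  subst e
  exact (h.eq_of_mem_componentsIn hS hS' (mem_componentsIn_self (h.isIrreducible_of_mem hS ht))
    (mem_componentsIn_self (h.isIrreducible_of_mem hS' ht'))).1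

theorem succ_le_topologicalKrullDim (h : IsGeneric Z) {t t' : StratumType} {S' : Set (Gr ℂ 4)}
    (hS : S ∈ strataOfType Z t) (hS' : S' ∈ strataOfType Z t') (ht : t ≠ .dim0typeVI)
    (ht' : t' ≠ .dim0typeVI) (hne : t ≠ t') (hsub : S ⊆ S') {d : ℕ}
    (hd : (d : WithBot ℕ∞) ≤ topologicalKrullDim S) :
    ((d + 1 : ℕ) : WithBot ℕ∞) ≤ topologicalKrullDim S' :=
  _root_.succ_le_topologicalKrullDim (h.isClosed_of_mem hS) (h.isIrreducible_of_mem hS' ht')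
    (h.ssubset_of_subset hS hS' ht ht' hne hsub) hd

theorem topologicalKrullDim_le_of_subset (h : IsGeneric Z) {t t' : StratumType}
    {S' : Set (Gr ℂ 4)} (hS : S ∈ strataOfType Z t) (hS' : S' ∈ strataOfType Z t')
    (ht : t ≠ .dim0typeVI) (ht' : t' ≠ .dim0typeVI) (hne : t ≠ t') (hsub : S ⊆ S') {d : ℕ}
    (hd : topologicalKrullDim S' ≤ ((d + 1 : ℕ) : WithBot ℕ∞)) :
    topologicalKrullDim S ≤ (d : WithBot ℕ∞) :=
  topologicalKrullDim_le_of_ssubset (h.isClosed_of_mem hS) (h.isIrreducible_of_mem hS' ht')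
    (h.ssubset_of_subset hS hS' ht ht' hne hsub) hd

theorem topologicalKrullDim_of_dim_eq_zero (h : IsGeneric Z) {t : StratumType}
    (hS : S ∈ strataOfType Z t) (ht : t.dim = 0) : topologicalKrullDim S = 0 :=
  topologicalKrullDim_of_finite (h.finite_of_dim_eq_zero hS ht).1
    (h.finite_of_dim_eq_zero hS ht).2 fun U _ => Gr.isClosed_singleton U

/-- A hypersurface is a proper closed subset of the irreducible Grassmannian of dimension at most 4.
-/
theorem topologicalKrullDim_onEdge_le (h : IsGeneric Z) (i : Fin n) :
    topologicalKrullDim (onEdge Z i) ≤ (3 : ℕ) := by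
  refine topologicalKrullDim_le_of_ssubset (T := Set.univ)
    (h.noFourCoplanar.isClosed_onEdge h.four_le i) Gr.isIrreducible_univ ?_ ?_
  · refine (Set.subset_univ _).ssubset_of_ne fun e => ?_
    exact ne_add_one h.four_le i
      (((h.data_onEdge (i + 1)).1 i).1 (e ▸ Set.subset_univ _))
  · exact (topologicalKrullDim_subspace_le _ _).trans Gr.topologicalKrullDim_le

/-- Each locus contains a point locus of type (0, I), (0, III) or (0, IV), strictly because the
types differ. In the same way the higher lower bounds use a sublocus one dimension smaller, and the
upper bounds a locus one dimension larger. -/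
theorem one_le_topologicalKrullDim (h : IsGeneric Z) {t : StratumType} (hS : S ∈ strataOfType Z t)
    (ht : t.dim = 1) : ((1 : ℕ) : WithBot ℕ∞) ≤ topologicalKrullDim S := by
  have hn := h.four_le
  have key : ∀ {t' : StratumType} {S' : Set (Gr ℂ 4)}, S' ∈ strataOfType Z t' → t'.dim = 0 →
      t' ≠ .dim0typeVI → S' ⊆ S → ((1 : ℕ) : WithBot ℕ∞) ≤ topologicalKrullDim S := by
    intro t' S' hS' ht' hne hsub
    refine h.succ_le_topologicalKrullDim hS' hS hne (by rintro rfl; exact absurd ht (by decide))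
      (by rintro rfl; omega) hsub (d := 0) ?_
    rw [h.topologicalKrullDim_of_dim_eq_zero hS' ht']
    rfl
  cases t
  case dim1typeI =>
    obtain ⟨i, rfl⟩ := h.mem_strataOfType_dim1typeI.1 hS
    exact key (t' := .dim0typeI) ⟨i, i + 1, ne_add_one hn i, rfl⟩ rfl (by simp) fun V hV =>
      ⟨hV.1, h.join_subset_inPlane (ne_add_one hn i) (Or.inr (Or.inl rfl))
        (Or.inr (Or.inr rfl)) hV⟩
  case dim1typeII =>
    obtain ⟨i, j, hij, rfl⟩ := hS
    exact key (t' := .dim0typeI) ⟨i, j, fun e => hij (Or.inl e), rfl⟩ rfl (by simp) fun V hV =>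
      ⟨hV.1, h.onEdge_of_mem_edge (Or.inl rfl) hV.2⟩
  case dim1typeIII =>
    obtain ⟨i, j, hij, rfl⟩ := hS
    exact key (h.mem_strataOfType_dim0typeIII.2 ⟨i, j, hij, rfl⟩) rfl (by simp) fun V hV =>
      ⟨hV.1.2, hV.2⟩
  case dim1typeIV =>
    obtain ⟨i, j, k, hij, hik, hjk, rfl⟩ := hS
    exact key (t' := .dim0typeIV) ⟨i, j, k, hjk, Set.disjoint_left.1 hij (Or.inl rfl),
      Set.disjoint_left.1 hik (Or.inl rfl), rfl⟩ rfl (by simp) fun V hV =>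
      ⟨⟨h.onEdge_of_mem_edge (Or.inl rfl) hV.1.1, hV.1.2⟩, hV.2⟩
  all_goals exact absurd ht (by decide)

theorem two_le_topologicalKrullDim (h : IsGeneric Z) {t : StratumType} (hS : S ∈ strataOfType Z t)
    (ht : t.dim = 2) : ((2 : ℕ) : WithBot ℕ∞) ≤ topologicalKrullDim S := by
  have key : ∀ {t' : StratumType} {S' : Set (Gr ℂ 4)}, S' ∈ strataOfType Z t' → t'.dim = 1 →
      S' ⊆ S → ((2 : ℕ) : WithBot ℕ∞) ≤ topologicalKrullDim S := by
    intro t' S' hS' ht' hsub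
    exact h.succ_le_topologicalKrullDim hS' hS (by rintro rfl; exact absurd ht' (by decide))
      (by rintro rfl; exact absurd ht (by decide)) (by rintro rfl; omega) hsub
      (h.one_le_topologicalKrullDim hS' ht')
  cases t
  case dim2typeI =>
    obtain ⟨i, rfl⟩ := hS
    exact key (h.mem_strataOfType_dim1typeI.2 ⟨i, rfl⟩) rfl Set.inter_subset_left
  case dim2typeII =>
    obtain ⟨i, rfl⟩ := hS
    exact key (h.mem_strataOfType_dim1typeI.2 ⟨i, rfl⟩) rfl Set.inter_subset_right
  case dim2typeIII =>
    obtain ⟨i, j, hij, rfl⟩ := hS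
    exact key (t' := .dim1typeII) ⟨i, j, Set.disjoint_left.1 hij (Or.inl rfl), rfl⟩ rfl fun V hV =>
      ⟨h.onEdge_of_mem_edge (Or.inl rfl) hV.1, hV.2⟩
  all_goals exact absurd ht (by decide)

theorem three_le_topologicalKrullDim (h : IsGeneric Z) {t : StratumType} (hS : S ∈ strataOfType Z t)
    (ht : t.dim = 3) : ((3 : ℕ) : WithBot ℕ∞) ≤ topologicalKrullDim S := by
  cases t
  case dim3typeI =>
    have hS2 := hS
    obtain ⟨i, rfl⟩ := hS2
    exact h.succ_le_topologicalKrullDim (t := .dim2typeI) ⟨i, rfl⟩ hS (by simp) (by simp) (by simp)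
      (fun V hV => h.onEdge_of_mem_edge (Or.inl rfl) hV) (h.two_le_topologicalKrullDim (t := .dim2typeI) ⟨i, rfl⟩ rfl)
  all_goals exact absurd ht (by decide)

theorem topologicalKrullDim_le_two (h : IsGeneric Z) {t : StratumType}
    (hS : S ∈ strataOfType Z t) (ht : t.dim = 2) :
    topologicalKrullDim S ≤ ((2 : ℕ) : WithBot ℕ∞) := by
  have key : ∀ i : Fin n, S ⊆ onEdge Z i → topologicalKrullDim S ≤ ((2 : ℕ) : WithBot ℕ∞) := by
    intro i hsub
    exact h.topologicalKrullDim_le_of_subset (t' := .dim3typeI) hS ⟨i, rfl⟩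
      (by rintro rfl; exact absurd ht (by decide)) (by simp)
      (by rintro rfl; exact absurd ht (by decide)) hsub (h.topologicalKrullDim_onEdge_le i)
  cases t
  case dim2typeI =>
    obtain ⟨i, rfl⟩ := hS
    exact key i fun V hV => h.onEdge_of_mem_edge (Or.inl rfl) hV
  case dim2typeII =>
    obtain ⟨i, rfl⟩ := hS
    exact key i fun V hV =>
      h.noFourCoplanar.onEdge_of_inPlane h.four_le hV
  case dim2typeIII =>
    obtain ⟨i, j, hij, rfl⟩ := hS
    exact key i Set.inter_subset_left
  all_goals exact absurd ht (by decide)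

theorem topologicalKrullDim_le_one (h : IsGeneric Z) {t : StratumType}
    (hS : S ∈ strataOfType Z t) (ht : t.dim = 1) :
    topologicalKrullDim S ≤ ((1 : ℕ) : WithBot ℕ∞) := by
  have key : ∀ {t' : StratumType} {S' : Set (Gr ℂ 4)}, S' ∈ strataOfType Z t' → t'.dim = 2 →
      S ⊆ S' → topologicalKrullDim S ≤ ((1 : ℕ) : WithBot ℕ∞) := by
    intro t' S' hS' ht' hsub
    exact h.topologicalKrullDim_le_of_subset hS hS' (by rintro rfl; exact absurd ht (by decide))
      (by rintro rfl; exact absurd ht' (by decide)) (by rintro rfl; omega) hsub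
      (h.topologicalKrullDim_le_two hS' ht')
  cases t
  case dim1typeI =>
    obtain ⟨i, rfl⟩ := h.mem_strataOfType_dim1typeI.1 hS
    exact key (t' := .dim2typeI) ⟨i, rfl⟩ rfl Set.inter_subset_left
  case dim1typeII =>
    obtain ⟨i, j, hij, rfl⟩ := hS
    exact key (t' := .dim2typeI) ⟨i, rfl⟩ rfl Set.inter_subset_left
  case dim1typeIII =>
    obtain ⟨i, j, hij, rfl⟩ := hS
    exact key (t' := .dim2typeII) ⟨i, rfl⟩ rfl Set.inter_subset_left
  case dim1typeIV =>
    obtain ⟨i, j, k, hij, hik, hjk, rfl⟩ := hS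
    exact key (t' := .dim2typeIII) ⟨i, j, hij, rfl⟩ rfl Set.inter_subset_left
  all_goals exact absurd ht (by decide)

theorem topologicalKrullDim_eq (h : IsGeneric Z) {t : StratumType} (hS : S ∈ strataOfType Z t) :
    topologicalKrullDim S = (t.dim : WithBot ℕ∞) := by
  have ht : t.dim = 0 ∨ t.dim = 1 ∨ t.dim = 2 ∨ t.dim = 3 := by cases t <;> decide
  rcases ht with ht | ht | ht | ht
  · rw [h.topologicalKrullDim_of_dim_eq_zero hS ht, ht]
    rfl
  · rw [ht]
    exact (h.topologicalKrullDim_le_one hS ht).antisymm (h.one_le_topologicalKrullDim hS ht)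
  · rw [ht]
    exact (h.topologicalKrullDim_le_two hS ht).antisymm (h.two_le_topologicalKrullDim hS ht)
  · rw [ht]
    refine le_antisymm ?_ (h.three_le_topologicalKrullDim hS ht)
    cases t
    case dim3typeI =>
      obtain ⟨i, rfl⟩ := hS
      exact h.topologicalKrullDim_onEdge_le i
    all_goals exact absurd ht (by decide)

end IsGeneric

end TypeCode

/-! ### Sets of pairwise related elements -/

section Counting

open Classical in
/-- The `k`-element sets whose distinct elements are related. -/
noncomputable def pairwiseSets {α : Type*} [Fintype α] (R : α → α → Prop) (k : ℕ) :
    Finset (Finset α) :=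
  {s | s.card = k ∧ ∀ i ∈ s, ∀ j ∈ s, i ≠ j → R i j}

theorem mem_pairwiseSets {α : Type*} [Fintype α] {R : α → α → Prop} {k : ℕ} {s : Finset α} :
    s ∈ pairwiseSets R k ↔ s.card = k ∧ ∀ i ∈ s, ∀ j ∈ s, i ≠ j → R i j := by
  simp [pairwiseSets]

-- Double counting of the pairs of an element and a set containing it: removing the element leaves a
-- set of size `k` all of whose members are related to it.
open Classical in
theorem succ_mul_card_pairwiseSets {α : Type*} [Fintype α] {R : α → α → Prop} {k N : ℕ}
    (hirr : ∀ i, ¬ R i i) (hsymm : ∀ i j, R i j → R j i)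
    (hN : ∀ i, ((pairwiseSets R k).filter fun s => ∀ j ∈ s, R i j).card = N) :
    (k + 1) * (pairwiseSets R (k + 1)).card = Fintype.card α * N := by
  rw [← Finset.sum_card (B := pairwiseSets R (k + 1)) (n := N)]
  · rw [Finset.sum_congr rfl fun s hs => (mem_pairwiseSets.1 hs).1, Finset.sum_const, smul_eq_mul,
      mul_comm]
  · intro i
    rw [← hN i]
    symm
    refine Finset.card_bij (fun s _ => insert i s) ?_ ?_ ?_
    · intro s hs
      rw [Finset.mem_filter, mem_pairwiseSets] at hs ⊢
      obtain ⟨⟨hk, hR⟩, hi⟩ := hs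
      have his : i ∉ s := fun h => hirr i (hi i h)
      refine ⟨⟨by rw [Finset.card_insert_of_notMem his, hk], ?_⟩, Finset.mem_insert_self i s⟩
      intro a ha b hb hab
      rw [Finset.mem_insert] at ha hb
      rcases ha with rfl | ha <;> rcases hb with rfl | hb
      exacts [absurd rfl hab, hi b hb, hsymm _ _ (hi a ha), hR a ha b hb hab]
    · intro s hs t ht hst
      rw [Finset.mem_filter] at hs ht
      have his : i ∉ s := fun h => hirr i (hs.2 i h)
      have hit : i ∉ t := fun h => hirr i (ht.2 i h)
      rw [← Finset.erase_insert his, hst, Finset.erase_insert hit]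
    · intro t ht
      rw [Finset.mem_filter, mem_pairwiseSets] at ht
      obtain ⟨⟨hk, hR⟩, hi⟩ := ht
      refine ⟨t.erase i, ?_, Finset.insert_erase hi⟩
      rw [Finset.mem_filter, mem_pairwiseSets]
      refine ⟨⟨by rw [Finset.card_erase_of_mem hi, hk, Nat.add_sub_cancel], fun a ha b hb =>
        hR a (Finset.mem_of_mem_erase ha) b (Finset.mem_of_mem_erase hb)⟩, fun j hj =>
        hR i hi j (Finset.mem_of_mem_erase hj) (Finset.ne_of_mem_erase hj).symm⟩

/-- The `k`-element subsets of `{0, …, m - 1}` without consecutive elements. -/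
def sparseSets (m k : ℕ) : Finset (Finset ℕ) :=
  ((Finset.range m).powersetCard k).filter fun s => ∀ a ∈ s, a + 1 ∉ s

theorem mem_sparseSets {m k : ℕ} {s : Finset ℕ} :
    s ∈ sparseSets m k ↔ (∀ a ∈ s, a < m) ∧ s.card = k ∧ ∀ a ∈ s, a + 1 ∉ s := by
  simp [sparseSets, Finset.mem_powersetCard, Finset.subset_iff, and_assoc]

/-- The alternatives are whether `m + 1` belongs to the set. If it does, `m` does not, and removing
it leaves a subset of the first `m` numbers. -/
theorem sparseSets_add_two (m k : ℕ) : sparseSets (m + 2) (k + 1) =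
    sparseSets (m + 1) (k + 1) ∪ (sparseSets m k).image (insert (m + 1)) := by
  ext s
  rw [Finset.mem_union, Finset.mem_image]
  constructor
  · intro hs
    rw [mem_sparseSets] at hs
    obtain ⟨h1, h2, h3⟩ := hs
    by_cases hm : m + 1 ∈ s
    · refine Or.inr ⟨s.erase (m + 1), ?_, Finset.insert_erase hm⟩
      rw [mem_sparseSets]
      refine ⟨fun a ha => ?_, by rw [Finset.card_erase_of_mem hm, h2, Nat.add_sub_cancel],
        fun a ha hb => h3 a (Finset.mem_of_mem_erase ha) (Finset.mem_of_mem_erase hb)⟩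
      rw [Finset.mem_erase] at ha
      have := h1 a ha.2
      have : a ≠ m := fun e => h3 a ha.2 (e ▸ hm)
      omega
    · refine Or.inl (mem_sparseSets.2 ⟨fun a ha => ?_, h2, h3⟩)
      have := h1 a ha
      have : a ≠ m + 1 := fun e => hm (e ▸ ha)
      omega
  · rintro (hs | ⟨t, ht, rfl⟩)
    · rw [mem_sparseSets] at hs ⊢
      exact ⟨fun a ha => (hs.1 a ha).trans (Nat.lt_succ_self _), hs.2⟩
    · rw [mem_sparseSets] at ht ⊢
      obtain ⟨h1, h2, h3⟩ := ht
      have hm : m + 1 ∉ t := fun h => by have := h1 _ h; omega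
      refine ⟨fun a ha => ?_, by rw [Finset.card_insert_of_notMem hm, h2], fun a ha hb => ?_⟩
      · rcases Finset.mem_insert.1 ha with rfl | ha
        · omega
        · have := h1 a ha
          omega
      · rcases Finset.mem_insert.1 ha with rfl | ha <;> rcases Finset.mem_insert.1 hb with hb | hb
        · omega
        · have := h1 _ hb
          omega
        · have := h1 a ha
          omega
        · exact h3 a ha hb

/-- The recursion on the largest element is Pascal's rule. -/
theorem card_sparseSets (m k : ℕ) : (sparseSets m k).card = (m + 1 - k).choose k := by
  induction m using Nat.strong_induction_on generalizing k with
  | _ m ih =>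
    rcases k with _ | k
    · have : sparseSets m 0 = {∅} := by
        ext s
        rw [mem_sparseSets, Finset.mem_singleton, Finset.card_eq_zero]
        exact ⟨fun h => h.2.1, fun h => by subst h; simp⟩
      rw [this]
      simp
    rcases m with _ | _ | m
    · have : sparseSets 0 (k + 1) = ∅ := by
        simp [sparseSets]
      rw [this]
      simp
    · rcases k with _ | k
      · rfl
      · have : sparseSets 1 (k + 2) = ∅ := by
          simp [sparseSets]
        rw [zero_add, this, Finset.card_empty, Nat.choose_eq_zero_of_lt (by omega)]
    · rw [sparseSets_add_two, Finset.card_union_of_disjoint, Finset.card_image_of_injOn,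
        ih (m + 1) (by omega), ih m (by omega)]
      · rcases Nat.lt_or_ge (m + 1) k with hk | hk
        · rw [Nat.choose_eq_zero_of_lt (by omega), Nat.choose_eq_zero_of_lt (by omega),
            Nat.choose_eq_zero_of_lt (by omega)]
        · obtain ⟨r, hr⟩ := Nat.exists_eq_add_of_le hk
          rw [show m + 1 + 1 - (k + 1) = r by omega, show m + 1 - k = r by omega,
            show m + 2 + 1 - (k + 1) = r + 1 by omega, Nat.choose_succ_succ, add_comm]
      · intro s hs t ht hst
        have h1 : m + 1 ∉ s := fun h => by have := (mem_sparseSets.1 hs).1 _ h; omega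
        have h2 : m + 1 ∉ t := fun h => by have := (mem_sparseSets.1 ht).1 _ h; omega
        rw [← Finset.erase_insert h1, hst, Finset.erase_insert h2]
      · rw [Finset.disjoint_left]
        intro s hs hs'
        obtain ⟨t, -, rfl⟩ := Finset.mem_image.1 hs'
        have := (mem_sparseSets.1 hs).1 (m + 1) (Finset.mem_insert_self _ _)
        omega

variable {n : ℕ} [NeZero n]

theorem sub_val_add_one (hn : 2 ≤ n) (i j : Fin n) (h : (j - i).val + 1 < n) :
    (j + 1 - i).val = (j - i).val + 1 := by
  rw [add_sub_right_comm]
  have := val_add_one_cases hn (j - i)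
  omega

theorem sub_val_eq_iff (i : Fin n) {j k : Fin n} : (j - i).val = (k - i).val ↔ j = k := by
  rw [← Fin.ext_iff, sub_left_inj]

-- Subtracting `i + c` straightens an arc of `m` edges to the interval from `0` to `m - 1`, and
-- disjointness becomes absence of consecutive numbers. As `1 ≤ c`, the arc omits `i`, so its two
-- ends are not cyclic neighbours.
open Classical in
theorem card_filter_pairwiseSets (hn : 2 ≤ n) (i : Fin n) {c m : ℕ} (k : ℕ) (hc : 1 ≤ c)
    (hm : c + m ≤ n) :
    ((pairwiseSets (fun a b : Fin n => Disjoint (edge a) (edge b)) k).filter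
      fun s => ∀ j ∈ s, c ≤ (j - i).val ∧ (j - i).val < c + m).card = (m + 1 - k).choose k := by
  rw [← card_sparseSets]
  have hinj : ∀ {s : Finset (Fin n)}, (∀ j ∈ s, c ≤ (j - i).val ∧ (j - i).val < c + m) →
      Set.InjOn (fun j : Fin n => (j - i).val - c) s := by
    intro s hs a ha b hb hab
    have h1 := hs a ha
    have h2 := hs b hb
    have : (a - i).val - c = (b - i).val - c := hab
    exact (sub_val_eq_iff i).1 (by omega)
  have hval : ∀ a, a < m → (Fin.ofNat n (a + c) + i - i).val = a + c := by
    intro a ha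
    rw [add_sub_cancel_right, Fin.ofNat]
    exact Nat.mod_eq_of_lt (by omega)
  refine Finset.card_bij (fun s _ => s.image fun j => (j - i).val - c) ?_ ?_ ?_
  · intro s hs
    rw [Finset.mem_filter, mem_pairwiseSets] at hs
    obtain ⟨⟨hk, hR⟩, hi⟩ := hs
    rw [mem_sparseSets]
    refine ⟨fun a ha => ?_, by rw [Finset.card_image_of_injOn (hinj hi), hk], fun a ha hb => ?_⟩
    · obtain ⟨j, hj, rfl⟩ := Finset.mem_image.1 ha
      have := hi j hj
      omega
    · obtain ⟨j, hj, rfl⟩ := Finset.mem_image.1 ha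
      obtain ⟨l, hl, hlj⟩ := Finset.mem_image.1 hb
      have h1 := hi j hj
      have h2 := hi l hl
      have h3 : l = j + 1 := (sub_val_eq_iff i).1 (by
        rw [sub_val_add_one hn i j (by omega)]
        omega)
      have h4 : j ≠ l := by
        rintro rfl
        omega
      exact (disjoint_edge_edge.1 (hR j hj l hl h4)).2.2 h3.symm
  · intro s hs t ht hst
    rw [Finset.mem_filter] at hs ht
    have : Set.InjOn (fun j : Fin n => (j - i).val - c) ↑(s ∪ t) := by
      apply hinj
      intro j hj
      rcases Finset.mem_union.1 hj with hj | hj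
      exacts [hs.2 j hj, ht.2 j hj]
    rw [← Finset.coe_inj]
    refine (this.image_eq_image_iff (by simp) (by simp)).1 ?_
    rw [← Finset.coe_image, ← Finset.coe_image]
    exact congrArg _ hst
  · intro t ht
    rw [mem_sparseSets] at ht
    obtain ⟨h1, h2, h3⟩ := ht
    have him : (t.image fun a => Fin.ofNat n (a + c) + i).image (fun j => (j - i).val - c) = t := by
      rw [Finset.image_image]
      refine (Finset.image_congr fun a ha => ?_).trans Finset.image_id
      simp only [Function.comp, hval a (h1 a ha), Nat.add_sub_cancel, id]
    refine ⟨t.image fun a => Fin.ofNat n (a + c) + i, ?_, him⟩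
    have hi : ∀ j ∈ t.image (fun a => Fin.ofNat n (a + c) + i),
        c ≤ (j - i).val ∧ (j - i).val < c + m := by
      intro j hj
      obtain ⟨a, ha, rfl⟩ := Finset.mem_image.1 hj
      have := h1 a ha
      rw [hval a this]
      omega
    rw [Finset.mem_filter, mem_pairwiseSets]
    refine ⟨⟨?_, ?_⟩, hi⟩
    · rw [← Finset.card_image_of_injOn (hinj hi), him, h2]
    · intro x hx y hy hxy
      obtain ⟨a, ha, rfl⟩ := Finset.mem_image.1 hx
      obtain ⟨b, hb, rfl⟩ := Finset.mem_image.1 hy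
      have ka := hval a (h1 a ha)
      have kb := hval b (h1 b hb)
      have la := h1 a ha
      have lb := h1 b hb
      have key : ∀ {a b : ℕ}, a ∈ t → b ∈ t → a < m → b < m →
          Fin.ofNat n (a + c) + i ≠ Fin.ofNat n (b + c) + i + 1 := by
        intro a b ha hb la lb e
        have ka := hval a la
        have kb := hval b lb
        rw [e] at ka
        have := val_add_one_cases hn (Fin.ofNat n (b + c) + i - i)
        rw [← add_sub_right_comm] at this
        have hab : a = b + 1 := by omega
        exact h3 b hb (hab ▸ ha)
      exact disjoint_edge_edge.2 ⟨hxy, key ha hb la lb, (key hb ha lb la).symm⟩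

/-- Cyclic differences in a form accessible to `omega`. The lemmas that follow use it to describe
each disjointness relation as membership in an arc. -/
theorem val_sub_cases (i j : Fin n) :
    (i.val ≤ j.val ∧ (j - i).val + i.val = j.val) ∨
      (j.val < i.val ∧ (j - i).val + i.val = j.val + n) := by
  have h : (j - i + i).val = j.val := by rw [sub_add_cancel]
  rw [Fin.val_add] at h
  have h1 := (j - i).isLt
  have h2 := i.isLt
  have h3 := j.isLt
  rcases Nat.lt_or_ge ((j - i).val + i.val) n with h4 | h4
  · rw [Nat.mod_eq_of_lt h4] at h
    omega
  · rw [Nat.mod_eq_sub_mod h4, Nat.mod_eq_of_lt (by omega)] at h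
    omega

theorem notMem_edge_iff (hn : 4 ≤ n) {i j : Fin n} :
    i ∉ edge j ↔ 1 ≤ (j - i).val ∧ (j - i).val < 1 + (n - 2) := by
  have h1 := val_sub_cases i j
  have h2 := val_add_one_cases (by omega) j
  rw [mem_edge, not_or]
  omega

theorem disjoint_edge_edge_iff (hn : 4 ≤ n) {i j : Fin n} :
    Disjoint (edge i) (edge j) ↔ 2 ≤ (j - i).val ∧ (j - i).val < 2 + (n - 3) := by
  have h1 := val_sub_cases i j
  have h2 := val_add_one_cases (by omega) j
  have h3 := val_add_one_cases (by omega) i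
  rw [disjoint_edge_edge]
  omega

theorem disjoint_corner_edge_iff (hn : 4 ≤ n) {i j : Fin n} :
    Disjoint (corner i) (edge j) ↔ 2 ≤ (j - i).val ∧ (j - i).val < 2 + (n - 4) := by
  have h1 := val_sub_cases i j
  have h2 := val_add_one_cases (by omega) j
  have h3 := val_add_one_cases (by omega) i
  have h4 := val_sub_one_cases (by omega) i
  rw [disjoint_corner_edge]
  omega

theorem disjoint_corner_corner_iff (hn : 4 ≤ n) {i j : Fin n} :
    Disjoint (corner i) (corner j) ↔ 3 ≤ (j - i).val ∧ (j - i).val < 3 + (n - 5) := by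
  have h1 := val_sub_cases i j
  have h2 := val_add_one_cases (by omega) j
  have h3 := val_add_one_cases (by omega) i
  have h4 := val_sub_one_cases (by omega) i
  have h5 := val_sub_one_cases (by omega) j
  rw [disjoint_corner_corner]
  omega

/-- The edges disjoint from a given one form an arc of `n - 3`, so the remaining `k` edges can be
chosen in `(n - 2 - k).choose k` ways. -/
theorem card_pairwiseSets_edge (hn : 4 ≤ n) (k : ℕ) :
    (k + 1) * (pairwiseSets (fun a b : Fin n => Disjoint (edge a) (edge b)) (k + 1)).card =
      n * (n - 2 - k).choose k := by
  classical
  rw [succ_mul_card_pairwiseSets (N := (n - 2 - k).choose k)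
    (fun i h => (disjoint_edge_edge.1 h).1 rfl) (fun i j h => h.symm), Fintype.card_fin]
  intro i
  simp only [disjoint_edge_edge_iff hn (i := i)]
  rw [card_filter_pairwiseSets (by omega) i k (by omega) (by omega)]
  congr 1
  omega

theorem pairwiseSets_one {α : Type*} [Fintype α] (R R' : α → α → Prop) :
    pairwiseSets R 1 = pairwiseSets R' 1 := by
  ext s
  rw [mem_pairwiseSets, mem_pairwiseSets]
  refine and_congr_right fun h => ?_
  obtain ⟨a, rfl⟩ := Finset.card_eq_one.1 h
  simp

theorem card_pairwiseSets_corner (hn : 4 ≤ n) :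
    2 * (pairwiseSets (fun a b : Fin n => Disjoint (corner a) (corner b)) 2).card =
      n * (n - 5) := by
  classical
  rw [succ_mul_card_pairwiseSets (N := n - 5)
    (fun i h => (disjoint_corner_corner.1 h).2.1.2.1 rfl) (fun i j h => h.symm), Fintype.card_fin]
  intro i
  rw [pairwiseSets_one _ fun a b : Fin n => Disjoint (edge a) (edge b)]
  simp only [disjoint_corner_corner_iff hn (i := i)]
  by_cases h : n = 4
  · rw [Finset.filter_false_of_mem, Finset.card_empty]
    · omega
    · intro s hs hj
      obtain ⟨a, rfl⟩ := Finset.card_eq_one.1 (mem_pairwiseSets.1 hs).1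
      have := hj a (Finset.mem_singleton_self a)
      omega
  · rw [card_filter_pairwiseSets (by omega) i 1 (by omega) (by omega)]
    simp

theorem card_pairwiseSets_edge_two (hn : 4 ≤ n) :
    (pairwiseSets (fun a b : Fin n => Disjoint (edge a) (edge b)) 2).card = n.choose 2 - n := by
  have h := card_pairwiseSets_edge hn 1
  have h2 := Nat.choose_succ_right_eq n 1
  rw [Nat.choose_one_right] at h h2
  obtain ⟨m, hm⟩ := Nat.exists_eq_add_of_le' hn
  have e1 : n - 2 - 1 = m + 1 := by omega
  have e2 : n - 1 = m + 3 := by omega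
  rw [e1] at h
  rw [e2] at h2
  refine (Nat.sub_eq_of_eq_add ?_).symm
  nlinarith

theorem card_pairwiseSets_edge_three (hn : 4 ≤ n) :
    (pairwiseSets (fun a b : Fin n => Disjoint (edge a) (edge b)) 3).card =
      n.choose 3 - n * (n - 3) := by
  have h := card_pairwiseSets_edge hn 2
  have h2 := Nat.choose_succ_right_eq n 1
  have h3 := Nat.choose_succ_right_eq n 2
  have h4 := Nat.choose_succ_right_eq (n - 2 - 2) 1
  rw [Nat.choose_one_right] at h2 h4
  refine (Nat.sub_eq_of_eq_add ?_).symm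
  -- The smallest case is checked numerically; from `n = 5` on the substitution `n = m + 5` makes
  -- the subtractions exact.
  rcases Nat.eq_or_lt_of_le hn with rfl | hn
  · norm_num at *
    omega
  obtain ⟨m, hm⟩ := Nat.exists_eq_add_of_le' hn
  have e1 : n - 2 - 2 = m + 1 := by omega
  have e2 : n - 1 = m + 4 := by omega
  have e3 : n - 2 = m + 3 := by omega
  have e4 : n - 3 = m + 2 := by omega
  rw [e2] at h2
  rw [e1] at h h4
  rw [e3] at h3
  rw [e4]
  set x := (pairwiseSets (fun a b : Fin n => Disjoint (edge a) (edge b)) (2 + 1)).card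
  have h5 : 6 * x = n * ((m + 1) * m) := by
    rw [show (m + 1) * m = (m + 1).choose 2 * 2 by rw [h4, Nat.add_sub_cancel]]
    linarith
  have h6 : 6 * n.choose 3 = n * (m + 4) * (m + 3) := by
    rw [← h2]
    linarith
  have h7 : 6 * n.choose 3 = 6 * (x + n * (m + 2)) := by
    rw [h6, mul_add 6 x, h5, hm]
    ring
  omega

theorem card_pairwiseSets_edge_four (hn : 4 ≤ n) :
    (pairwiseSets (fun a b : Fin n => Disjoint (edge a) (edge b)) 4).card =
      n * (n - 5) * (n - 6) * (n - 7) / 24 := by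
  have h := card_pairwiseSets_edge hn 3
  have h2 := Nat.choose_succ_right_eq (n - 5) 1
  have h3 := Nat.choose_succ_right_eq (n - 5) 2
  rw [Nat.choose_one_right, Nat.sub_sub] at h2
  rw [Nat.sub_sub] at h h3
  refine (Nat.div_eq_of_eq_mul_right (by norm_num) ?_).symm
  rw [mul_assoc n, ← h2, mul_assoc n, mul_right_comm _ _ (n - 7), ← h3]
  linarith

end Counting

/-! ### The number of loci of each type. -/

section CountLoci

theorem encard_setOf_eq {α β : Type*} (A : Finset α) (F : α → β) (hF : Set.InjOn F A) :
    {S | ∃ a ∈ A, S = F a}.encard = (A.card : ℕ∞) := by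
  rw [← Set.encard_coe_eq_coe_finsetCard, ← hF.encard_image]
  congr 1
  ext S
  simp [eq_comm]

theorem encard_setOf_eq_index {n : ℕ} {β : Type*} (F : Fin n → β) (hF : Function.Injective F) :
    {S | ∃ i, S = F i}.encard = (n : ℕ∞) := by
  have := encard_setOf_eq Finset.univ F hF.injOn
  simpa using this

theorem encard_setOf_eq_sigma {n N : ℕ} {α β : Type*} (A : Fin n → Finset α) (F : Fin n → α → β)
    (hA : ∀ i, (A i).card = N)
    (hF : ∀ i j s t, s ∈ A i → t ∈ A j → F i s = F j t → i = j ∧ s = t) :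
    {S | ∃ i, ∃ s ∈ A i, S = F i s}.encard = ((n * N : ℕ) : ℕ∞) := by
  have h := encard_setOf_eq (Finset.univ.sigma A) (fun p => F p.1 p.2) (by
    rintro ⟨i, s⟩ hs ⟨j, t⟩ ht hst
    rw [Finset.mem_coe, Finset.mem_sigma] at hs ht
    obtain ⟨rfl, rfl⟩ := hF i j s t hs.2 ht.2 hst
    rfl)
  rw [Finset.card_sigma, Finset.sum_congr rfl fun i _ => hA i, Finset.sum_const, Finset.card_univ,
    Fintype.card_fin, smul_eq_mul] at h
  rw [← h]
  congr 1
  ext S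
  simp

variable {n : ℕ} [NeZero n] {Z : Matrix (Fin n) (Fin 4) ℝ} {V : Gr ℂ 4} {S : Set (Gr ℂ 4)}

open Classical in
/-- The sets of `k` pairwise disjoint edges with a given relation to a vertex. -/
noncomputable def linkedEdges (P : Fin n → Fin n → Prop) (k : ℕ) (i : Fin n) :
    Finset (Finset (Fin n)) :=
  (pairwiseSets (fun a b : Fin n => Disjoint (edge a) (edge b)) k).filter fun s => ∀ j ∈ s, P i j

theorem exists_linkedEdges_one {P : Fin n → Fin n → Prop} {i : Fin n}
    {F : Finset (Fin n) → Prop} :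
    (∃ s ∈ linkedEdges P 1 i, F s) ↔ ∃ j, P i j ∧ F {j} := by
  classical
  constructor
  · rintro ⟨s, hs, hF⟩
    rw [linkedEdges, Finset.mem_filter, mem_pairwiseSets] at hs
    obtain ⟨j, rfl⟩ := Finset.card_eq_one.1 hs.1.1
    exact ⟨j, hs.2 j (Finset.mem_singleton_self j), hF⟩
  · rintro ⟨j, hj, hF⟩
    refine ⟨{j}, ?_, hF⟩
    rw [linkedEdges, Finset.mem_filter, mem_pairwiseSets]
    simpa using hj

theorem pair_mem_pairwiseSets {α : Type*} [Fintype α] [DecidableEq α] {R : α → α → Prop}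
    (hsymm : ∀ a b, R a b → R b a) {a b : α} (hab : a ≠ b) :
    {a, b} ∈ pairwiseSets R 2 ↔ R a b := by
  rw [mem_pairwiseSets, Finset.card_pair hab]
  constructor
  · exact fun h => h.2 a (by simp) b (by simp) hab
  · refine fun h => ⟨rfl, ?_⟩
    intro x hx y hy hxy
    rw [Finset.mem_insert, Finset.mem_singleton] at hx hy
    rcases hx with rfl | rfl <;> rcases hy with rfl | rfl
    exacts [absurd rfl hxy, h, hsymm _ _ h, absurd rfl hxy]

theorem exists_linkedEdges_two {P : Fin n → Fin n → Prop} {i : Fin n}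
    {F : Finset (Fin n) → Prop} :
    (∃ s ∈ linkedEdges P 2 i, F s) ↔
      ∃ j k, Disjoint (edge j) (edge k) ∧ P i j ∧ P i k ∧ F {j, k} := by
  classical
  constructor
  · rintro ⟨s, hs, hF⟩
    rw [linkedEdges, Finset.mem_filter] at hs
    obtain ⟨j, k, hjk, rfl⟩ := Finset.card_eq_two.1 (mem_pairwiseSets.1 hs.1).1
    exact ⟨j, k, (pair_mem_pairwiseSets (fun _ _ h => h.symm) hjk).1 hs.1, hs.2 j (by simp),
      hs.2 k (by simp), hF⟩
  · rintro ⟨j, k, hjk, hj, hk, hF⟩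
    refine ⟨{j, k}, ?_, hF⟩
    rw [linkedEdges, Finset.mem_filter,
      pair_mem_pairwiseSets (fun _ _ h => h.symm) (disjoint_edge_edge.1 hjk).1]
    simp [hjk, hj, hk]

/-- The edges avoiding a vertex form an arc of `n - 2`; for those avoiding a whole corner, below,
the arc has `n - 4` elements. -/
theorem card_linkedEdges_notMem_edge (hn : 4 ≤ n) (k : ℕ) (i : Fin n) :
    (linkedEdges (fun i j => i ∉ edge j) k i).card = (n - 1 - k).choose k := by
  rw [linkedEdges]
  simp only [notMem_edge_iff hn]
  rw [card_filter_pairwiseSets (by omega) i k (by omega) (by omega)]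
  congr 1
  omega

theorem card_linkedEdges_disjoint_corner (hn : 4 ≤ n) (k : ℕ) (i : Fin n) :
    (linkedEdges (fun i j => Disjoint (corner i) (edge j)) k i).card = (n - 3 - k).choose k := by
  rw [linkedEdges]
  simp only [disjoint_corner_edge_iff hn]
  rw [card_filter_pairwiseSets (by omega) i k (by omega) (by omega)]
  congr 1
  omega

theorem notMem_of_mem_linkedEdges {P : Fin n → Fin n → Prop} {k : ℕ} {i : Fin n}
    (hP : ∀ j, P i j → i ∉ edge j) {s : Finset (Fin n)} (hs : s ∈ linkedEdges P k i) :
    i ∉ s ∧ i - 1 ∉ s := by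
  classical
  rw [linkedEdges, Finset.mem_filter] at hs
  refine ⟨fun h => hP i (hs.2 i h) (Or.inl rfl), fun h => hP _ (hs.2 _ h) (Or.inr ?_)⟩
  exact (sub_add_cancel i 1).symm

theorem onEdges_singleton (i : Fin n) : onEdges Z {i} = onEdge Z i := by
  ext V
  simp [onEdges]

theorem exists_pairwiseSets_two {α : Type*} [Fintype α] [DecidableEq α] {R : α → α → Prop}
    (hirr : ∀ a, ¬ R a a) (hsymm : ∀ a b, R a b → R b a) {F : Finset α → Prop} :
    (∃ s ∈ pairwiseSets R 2, F s) ↔ ∃ a b, R a b ∧ F {a, b} := by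
  constructor
  · rintro ⟨s, hs, hF⟩
    obtain ⟨a, b, hab, rfl⟩ := Finset.card_eq_two.1 (mem_pairwiseSets.1 hs).1
    exact ⟨a, b, (pair_mem_pairwiseSets hsymm hab).1 hs, hF⟩
  · rintro ⟨a, b, hab, hF⟩
    refine ⟨{a, b}, (pair_mem_pairwiseSets hsymm ?_).2 hab, hF⟩
    rintro rfl
    exact hirr a hab

theorem exists_pairwiseSets_three {F : Finset (Fin n) → Prop} :
    (∃ s ∈ pairwiseSets (fun a b : Fin n => Disjoint (edge a) (edge b)) 3, F s) ↔
      ∃ i j k : Fin n, Disjoint (edge i) (edge j) ∧ Disjoint (edge i) (edge k) ∧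
        Disjoint (edge j) (edge k) ∧ F {i, j, k} := by
  constructor
  · rintro ⟨s, hs, hF⟩
    obtain ⟨h1, h2⟩ := mem_pairwiseSets.1 hs
    obtain ⟨i, j, k, hij, hik, hjk, rfl⟩ := Finset.card_eq_three.1 h1
    exact ⟨i, j, k, h2 _ (by simp) _ (by simp) hij, h2 _ (by simp) _ (by simp) hik,
      h2 _ (by simp) _ (by simp) hjk, hF⟩
  · rintro ⟨i, j, k, hij, hik, hjk, hF⟩
    exact ⟨{i, j, k}, mem_pairwiseSets.2 ⟨Finset.card_eq_three.2 ⟨i, j, k,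
      (disjoint_edge_edge.1 hij).1, (disjoint_edge_edge.1 hik).1, (disjoint_edge_edge.1 hjk).1,
      rfl⟩, edgesDisjoint_triple hij hik hjk⟩, hF⟩

theorem exists_pairwiseSets_four {F : Finset (Fin n) → Prop} :
    (∃ s ∈ pairwiseSets (fun a b : Fin n => Disjoint (edge a) (edge b)) 4, F s) ↔
      ∃ i j k l : Fin n, Disjoint (edge i) (edge j) ∧ Disjoint (edge i) (edge k) ∧
        Disjoint (edge i) (edge l) ∧ Disjoint (edge j) (edge k) ∧ Disjoint (edge j) (edge l) ∧
        Disjoint (edge k) (edge l) ∧ F {i, j, k, l} := by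
  constructor
  · rintro ⟨s, hs, hF⟩
    obtain ⟨h1, h2⟩ := mem_pairwiseSets.1 hs
    obtain ⟨i, t, hit, rfl, ht⟩ := Finset.card_eq_succ.1 h1
    obtain ⟨j, k, l, hjk, hjl, hkl, rfl⟩ := Finset.card_eq_three.1 ht
    simp only [Finset.mem_insert, Finset.mem_singleton, not_or] at hit
    exact ⟨i, j, k, l, h2 _ (by simp) _ (by simp) hit.1, h2 _ (by simp) _ (by simp) hit.2.1,
      h2 _ (by simp) _ (by simp) hit.2.2, h2 _ (by simp) _ (by simp) hjk,
      h2 _ (by simp) _ (by simp) hjl, h2 _ (by simp) _ (by simp) hkl, hF⟩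
  · rintro ⟨i, j, k, l, dij, dik, dil, djk, djl, dkl, hF⟩
    refine ⟨{i, j, k, l}, mem_pairwiseSets.2 ⟨?_, edgesDisjoint_quadruple dij dik dil djk djl dkl⟩,
      hF⟩
    exact card_quadruple (disjoint_edge_edge.1 dij).1 (disjoint_edge_edge.1 dik).1
      (disjoint_edge_edge.1 dil).1 (disjoint_edge_edge.1 djk).1 (disjoint_edge_edge.1 djl).1
      (disjoint_edge_edge.1 dkl).1

namespace IsGeneric

/-- Different index data give different loci: `i` is the only index with `F i s ⊆ G i`, where `G` is
the vertex or corner plane locus. The edges common to the locus then return `s`, because the two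
extra edges `i - 1` and `i` contain the vertex and never belong to `s`. -/
theorem encard_linkedEdges {P : Fin n → Fin n → Prop} {k N : ℕ}
    (hP : ∀ i j, P i j → i ∉ edge j) (hN : ∀ i, (linkedEdges P k i).card = N)
    (F : Fin n → Finset (Fin n) → Set (Gr ℂ 4)) (G : Fin n → Set (Gr ℂ 4))
    (hF : ∀ i, ∀ s ∈ linkedEdges P k i,
      (∀ m, F i s ⊆ onEdge Z m ↔ m = i - 1 ∨ m = i ∨ m ∈ s) ∧ ∀ m, F i s ⊆ G m ↔ m = i) :
    {S | ∃ i, ∃ s ∈ linkedEdges P k i, S = F i s}.encard = ((n * N : ℕ) : ℕ∞) := by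
  refine encard_setOf_eq_sigma (linkedEdges P k) F hN ?_
  intro i j s t hs ht e
  obtain rfl : i = j := ((hF j t ht).2 i).1 (e ▸ ((hF i s hs).2 i).2 rfl)
  refine ⟨rfl, ?_⟩
  have h1 := notMem_of_mem_linkedEdges (hP i) hs
  have h2 := notMem_of_mem_linkedEdges (hP i) ht
  ext m
  have h3 := (hF i s hs).1 m
  rw [e, (hF i t ht).1 m] at h3
  by_cases k1 : m = i - 1
  · subst k1
    exact iff_of_false h1.2 h2.2
  by_cases k2 : m = i
  · subst k2
    exact iff_of_false h1.1 h2.1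
  · simpa [k1, k2] using h3.symm

/-- A locus cut out by edges alone remembers its index set as the set of all edges met by its
members. -/
theorem encard_onEdges (A : Finset (Finset (Fin n)))
    (hA : ∀ s ∈ A, ∀ m, onEdges Z s ⊆ onEdge Z m ↔ m ∈ s) :
    {S | ∃ s ∈ A, S = onEdges Z s}.encard = (A.card : ℕ∞) := by
  refine encard_setOf_eq A _ fun s hs t ht e => ?_
  ext m
  rw [← hA s hs, ← hA t ht]
  exact Iff.of_eq (congrArg (· ⊆ onEdge Z m) e)

theorem encard_throughPoint_inter_onEdge (h : IsGeneric Z) :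
    (strataOfType Z .dim1typeII).encard = (StratumType.count n .dim1typeII : ℕ∞) := by
  have key := encard_linkedEdges (Z := Z) (k := 1) (P := fun i j => i ∉ edge j) (fun _ _ => id)
    (card_linkedEdges_notMem_edge h.four_le 1) (fun i s => throughPoint Z i ∩ onEdges Z s)
    (throughPoint Z) fun i s hs => by
      obtain ⟨j, hj, rfl⟩ := exists_linkedEdges_one.1 ⟨s, hs, (rfl : s = s)⟩
      have hd := h.data_throughPoint_inter_onEdge hj
      rw [onEdges_singleton]
      simpa using ⟨hd.1, hd.2.1⟩
  simp only [exists_linkedEdges_one, onEdges_singleton, Nat.choose_one_right, Nat.sub_sub] at key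
  exact key

theorem encard_inPlane_inter_onEdge (h : IsGeneric Z) :
    (strataOfType Z .dim1typeIII).encard = (StratumType.count n .dim1typeIII : ℕ∞) := by
  have key := encard_linkedEdges (Z := Z) (k := 1) (P := fun i j => Disjoint (corner i) (edge j))
    (fun i j hij => Set.disjoint_left.1 hij (Or.inr (Or.inl rfl)))
    (card_linkedEdges_disjoint_corner h.four_le 1) (fun i s => inPlane Z i ∩ onEdges Z s)
    (inPlane Z) fun i s hs => by
      obtain ⟨j, hj, rfl⟩ := exists_linkedEdges_one.1 ⟨s, hs, (rfl : s = s)⟩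
      have hd := h.data_inPlane_inter_onEdge hj
      rw [onEdges_singleton]
      simpa using ⟨hd.1, hd.2.2⟩
  simp only [exists_linkedEdges_one, onEdges_singleton, Nat.choose_one_right, Nat.sub_sub] at key
  exact key

theorem encard_throughPoint_inter_inPlane_inter_onEdge (h : IsGeneric Z) :
    (strataOfType Z .dim0typeIII).encard = (StratumType.count n .dim0typeIII : ℕ∞) := by
  have key := encard_linkedEdges (Z := Z) (k := 1) (P := fun i j => Disjoint (corner i) (edge j))
    (fun i j hij => Set.disjoint_left.1 hij (Or.inr (Or.inl rfl)))
    (card_linkedEdges_disjoint_corner h.four_le 1)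
    (fun i s => throughPoint Z i ∩ inPlane Z i ∩ onEdges Z s)
    (throughPoint Z) fun i s hs => by
      obtain ⟨j, hj, rfl⟩ := exists_linkedEdges_one.1 ⟨s, hs, (rfl : s = s)⟩
      obtain ⟨U, hU⟩ := h.exists_eq_singleton (h.mem_strataOfType_dim0typeIII.2 ⟨i, j, hj, rfl⟩) rfl
        (by simp)
      have hd := h.data_throughPoint_inter_inPlane_inter_onEdge hj (V := U) (by rw [hU]; rfl)
      rw [onEdges_singleton, hU]
      simpa using hd
  simp only [exists_linkedEdges_one, onEdges_singleton, Nat.choose_one_right, Nat.sub_sub] at key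
  refine (congrArg Set.encard ?_).trans key
  ext S
  exact h.mem_strataOfType_dim0typeIII

theorem encard_throughPoint_inter_onEdge_inter_onEdge (h : IsGeneric Z) :
    (strataOfType Z .dim0typeIV).encard = (StratumType.count n .dim0typeIV : ℕ∞) := by
  have key := encard_linkedEdges (Z := Z) (k := 2) (P := fun i j => i ∉ edge j) (fun _ _ => id)
    (card_linkedEdges_notMem_edge h.four_le 2) (fun i s => throughPoint Z i ∩ onEdges Z s)
    (throughPoint Z) fun i s hs => by
      obtain ⟨j, k, hjk, hj, hk, rfl⟩ := exists_linkedEdges_two.1 ⟨s, hs, (rfl : s = s)⟩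
      obtain ⟨U, hU⟩ := h.exists_eq_singleton (t := .dim0typeIV) ⟨i, j, k, hjk, hj, hk, rfl⟩ rfl
        (by simp)
      have hd := h.data_throughPoint_inter_onEdge_inter_onEdge hjk hj hk (V := U) (by
        change U ∈ throughPoint Z i ∩ meetsLine Z j (j + 1) ∩ meetsLine Z k (k + 1)
        rw [hU]; rfl)
      rw [onEdges_pair, ← Set.inter_assoc]
      change _ ∩ meetsLine Z j (j + 1) ∩ meetsLine Z k (k + 1) = _ at hU
      rw [show throughPoint Z i ∩ onEdge Z j ∩ onEdge Z k = {U} from hU]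
      simpa using ⟨hd.1, hd.2.1⟩
  simp only [exists_linkedEdges_two, onEdges_pair, Nat.sub_sub, ← Set.inter_assoc] at key
  exact key

theorem encard_inPlane_inter_onEdge_inter_onEdge (h : IsGeneric Z) :
    (strataOfType Z .dim0typeV).encard = (StratumType.count n .dim0typeV : ℕ∞) := by
  have key := encard_linkedEdges (Z := Z) (k := 2) (P := fun i j => Disjoint (corner i) (edge j))
    (fun i j hij => Set.disjoint_left.1 hij (Or.inr (Or.inl rfl)))
    (card_linkedEdges_disjoint_corner h.four_le 2) (fun i s => inPlane Z i ∩ onEdges Z s)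
    (inPlane Z) fun i s hs => by
      obtain ⟨j, k, hjk, hj, hk, rfl⟩ := exists_linkedEdges_two.1 ⟨s, hs, (rfl : s = s)⟩
      obtain ⟨U, hU⟩ := h.exists_eq_singleton (t := .dim0typeV) ⟨i, j, k, hj, hk, hjk, rfl⟩ rfl
        (by simp)
      have hd := h.data_inPlane_inter_onEdge_inter_onEdge hj hk hjk (V := U) (by
        change U ∈ inPlane Z i ∩ meetsLine Z j (j + 1) ∩ meetsLine Z k (k + 1)
        rw [hU]; rfl)
      rw [onEdges_pair, ← Set.inter_assoc]
      rw [show inPlane Z i ∩ onEdge Z j ∩ onEdge Z k = {U} from hU]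
      simpa using ⟨hd.1, hd.2.2⟩
  simp only [exists_linkedEdges_two, onEdges_pair, Nat.sub_sub, ← Set.inter_assoc] at key
  refine (congrArg Set.encard ?_).trans key
  ext S
  refine exists_congr fun i => exists_congr fun j => exists_congr fun k => ?_
  exact ⟨fun ⟨h1, h2, h3, h4⟩ => ⟨h3, h1, h2, h4⟩, fun ⟨h1, h2, h3, h4⟩ => ⟨h2, h3, h1, h4⟩⟩

theorem encard_two_edges (h : IsGeneric Z) :
    (strataOfType Z .dim2typeIII).encard = (StratumType.count n .dim2typeIII : ℕ∞) := by
  have key := encard_onEdges (pairwiseSets (fun a b : Fin n => Disjoint (edge a) (edge b)) 2)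
    fun s hs m => by
      obtain ⟨i, j, hij, rfl⟩ := (exists_pairwiseSets_two
        (fun a ha => (disjoint_edge_edge.1 ha).1 rfl) fun _ _ h => h.symm).1 ⟨s, hs, (rfl : s = s)⟩
      rw [onEdges_pair, (h.data_onEdge_inter_onEdge hij).1]
      simp
  rw [card_pairwiseSets_edge_two h.four_le] at key
  refine (congrArg Set.encard ?_).trans key
  ext S
  rw [Set.mem_ofPred_eq, exists_pairwiseSets_two (fun a ha => (disjoint_edge_edge.1 ha).1 rfl)
    fun _ _ h => h.symm]
  simp only [onEdges_pair]
  exact Iff.rfl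

theorem encard_three_edges (h : IsGeneric Z) :
    (strataOfType Z .dim1typeIV).encard = (StratumType.count n .dim1typeIV : ℕ∞) := by
  have key := encard_onEdges (pairwiseSets (fun a b : Fin n => Disjoint (edge a) (edge b)) 3)
    fun s hs m => by
      obtain ⟨i, j, k, hij, hik, hjk, rfl⟩ :=
        exists_pairwiseSets_three.1 ⟨s, hs, (rfl : s = s)⟩
      rw [onEdges_triple, (h.data_three_edges hij hik hjk).1]
      simp
  rw [card_pairwiseSets_edge_three h.four_le] at key
  simp only [exists_pairwiseSets_three, onEdges_triple] at key
  exact key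

theorem encard_four_edges (h : IsGeneric Z) :
    (strataOfType Z .dim0typeVI).encard = (StratumType.count n .dim0typeVI : ℕ∞) := by
  have key := encard_onEdges (pairwiseSets (fun a b : Fin n => Disjoint (edge a) (edge b)) 4)
    fun s hs m => by
      obtain ⟨i, j, k, l, dij, dik, dil, djk, djl, dkl, rfl⟩ :=
        exists_pairwiseSets_four.1 ⟨s, hs, (rfl : s = s)⟩
      rw [onEdges_quadruple]
      obtain ⟨U, hU⟩ := (h.finite_of_dim_eq_zero (t := .dim0typeVI)
        ⟨i, j, k, l, dij, dik, dil, djk, djl, dkl, rfl⟩ rfl).2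
      have hd := fun V => (h.data_four_edges dij dik dil djk djl dkl (V := V))
      simp only [Finset.mem_insert, Finset.mem_singleton]
      exact ⟨fun hm => ((hd U hU).1 m).1 (hm hU), fun hm V hV => ((hd V hV).1 m).2 hm⟩
  rw [card_pairwiseSets_edge_four h.four_le] at key
  simp only [exists_pairwiseSets_four, onEdges_quadruple] at key
  exact key

theorem encard_two_points (h : IsGeneric Z) :
    (strataOfType Z .dim0typeI).encard = (StratumType.count n .dim0typeI : ℕ∞) := by
  have key := encard_setOf_eq (pairwiseSets (fun a b : Fin n => a ≠ b) 2)
    (fun s => {V | ∀ i ∈ s, V ∈ throughPoint Z i}) (by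
      intro s hs t ht e
      obtain ⟨i, j, hij, rfl⟩ := (exists_pairwiseSets_two (fun a ha => ha rfl)
        fun _ _ h => h.symm).1 ⟨s, hs, (rfl : s = s)⟩
      obtain ⟨k, l, hkl, rfl⟩ := (exists_pairwiseSets_two (fun a ha => ha rfl)
        fun _ _ h => h.symm).1 ⟨t, ht, (rfl : t = t)⟩
      obtain ⟨U, hU⟩ := (h.finite_of_dim_eq_zero (t := .dim0typeI) ⟨i, j, hij, rfl⟩ rfl).2
      have hU' : U ∈ {V | ∀ a ∈ ({k, l} : Finset (Fin n)), V ∈ throughPoint Z a} := by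
        beta_reduce at e
        rw [← e]
        simpa using hU
      ext m
      rw [Finset.mem_insert, Finset.mem_singleton, Finset.mem_insert, Finset.mem_singleton,
        ← h.data_join hij hU, ← h.data_join hkl ⟨hU' k (by simp), hU' l (by simp)⟩])
  have hcard : (pairwiseSets (fun a b : Fin n => a ≠ b) 2).card = n.choose 2 := by
    have : pairwiseSets (fun a b : Fin n => a ≠ b) 2 = Finset.univ.powersetCard 2 := by
      ext s
      simp [mem_pairwiseSets, Finset.mem_powersetCard]
    rw [this, Finset.card_powersetCard, Finset.card_univ, Fintype.card_fin]
  rw [hcard] at key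
  refine (congrArg Set.encard ?_).trans key
  ext S
  rw [Set.mem_ofPred_eq, exists_pairwiseSets_two (fun a ha => ha rfl) fun _ _ h => h.symm]
  refine exists_congr fun i => exists_congr fun j => and_congr_right fun _ => ?_
  rw [show throughPoint Z i ∩ throughPoint Z j =
    {V | ∀ a ∈ ({i, j} : Finset (Fin n)), V ∈ throughPoint Z a} by ext V; simp]

theorem encard_two_planes (h : IsGeneric Z) :
    (strataOfType Z .dim0typeII).encard = (StratumType.count n .dim0typeII : ℕ∞) := by
  have hirr : ∀ i : Fin n, ¬ Disjoint (corner i) (corner i) := fun i hi =>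
    (disjoint_corner_corner.1 hi).2.1.2.1 rfl
  have key := encard_setOf_eq
    (pairwiseSets (fun a b : Fin n => Disjoint (corner a) (corner b)) 2)
    (fun s => {V | ∀ i ∈ s, V ∈ inPlane Z i}) (by
      intro s hs t ht e
      obtain ⟨i, j, hij, rfl⟩ := (exists_pairwiseSets_two hirr
        fun _ _ h => h.symm).1 ⟨s, hs, (rfl : s = s)⟩
      obtain ⟨k, l, hkl, rfl⟩ := (exists_pairwiseSets_two hirr
        fun _ _ h => h.symm).1 ⟨t, ht, (rfl : t = t)⟩
      obtain ⟨U, hU⟩ := (h.finite_of_dim_eq_zero (t := .dim0typeII) ⟨i, j, hij, rfl⟩ rfl).2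
      have hU' : U ∈ {V | ∀ a ∈ ({k, l} : Finset (Fin n)), V ∈ inPlane Z a} := by
        beta_reduce at e
        rw [← e]
        simpa using hU
      ext m
      rw [Finset.mem_insert, Finset.mem_singleton, Finset.mem_insert, Finset.mem_singleton,
        ← (h.data_inPlane_inter_inPlane hij hU).2,
        ← (h.data_inPlane_inter_inPlane hkl ⟨hU' k (by simp), hU' l (by simp)⟩).2])
  have hcard : (pairwiseSets (fun a b : Fin n => Disjoint (corner a) (corner b)) 2).card =
      n * (n - 5) / 2 := by
    rw [← card_pairwiseSets_corner h.four_le, Nat.mul_div_cancel_left _ (by norm_num)]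
  rw [hcard] at key
  refine (congrArg Set.encard ?_).trans key
  ext S
  rw [Set.mem_ofPred_eq, exists_pairwiseSets_two hirr fun _ _ h => h.symm]
  refine exists_congr fun i => exists_congr fun j => and_congr_right fun _ => ?_
  rw [show inPlane Z i ∩ inPlane Z j =
    {V | ∀ a ∈ ({i, j} : Finset (Fin n)), V ∈ inPlane Z a} by ext V; simp]

theorem encard_strataOfType (h : IsGeneric Z) (t : StratumType) :
    (strataOfType Z t).encard = (StratumType.count n t : ℕ∞) := by
  cases t
  case dim3typeI =>
    exact encard_setOf_eq_index (onEdge Z) fun i j e =>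
      ((h.data_onEdge j).1 i).1 e.symm.subset
  case dim2typeI =>
    exact encard_setOf_eq_index (throughPoint Z) fun i j e =>
      ((h.data_throughPoint j).2.1 i).1 e.symm.subset
  case dim2typeII =>
    exact encard_setOf_eq_index (inPlane Z) fun i j e =>
      ((h.data_inPlane j).2.2 i).1 e.symm.subset
  case dim1typeI =>
    have key := encard_setOf_eq_index (fun i => throughPoint Z i ∩ inPlane Z i) fun i j e =>
      ((h.data_throughPoint_inter_inPlane j).2 i).1 (e.symm.subset.trans Set.inter_subset_left)
    refine (congrArg Set.encard ?_).trans key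
    ext S
    exact h.mem_strataOfType_dim1typeI
  case dim2typeIII => exact h.encard_two_edges
  case dim1typeII => exact h.encard_throughPoint_inter_onEdge
  case dim1typeIII => exact h.encard_inPlane_inter_onEdge
  case dim1typeIV => exact h.encard_three_edges
  case dim0typeI => exact h.encard_two_points
  case dim0typeII => exact h.encard_two_planes
  case dim0typeIII => exact h.encard_throughPoint_inter_inPlane_inter_onEdge
  case dim0typeIV => exact h.encard_throughPoint_inter_onEdge_inter_onEdge
  case dim0typeV => exact h.encard_inPlane_inter_onEdge_inter_onEdge
  case dim0typeVI => exact h.encard_four_edges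

end IsGeneric

end CountLoci

/-! ### The number of types in each dimension. -/

namespace StratumType

theorem encard_univ : (Set.univ : Set StratumType).encard = 14 := by
  rw [show (Set.univ : Set StratumType) = {.dim3typeI, .dim2typeI, .dim2typeII, .dim2typeIII,
    .dim1typeI, .dim1typeII, .dim1typeIII, .dim1typeIV, .dim0typeI, .dim0typeII, .dim0typeIII,
    .dim0typeIV, .dim0typeV, .dim0typeVI} by ext t; cases t <;> simp]
  repeat rw [Set.encard_insert_of_notMem (by simp)]
  rw [Set.encard_singleton]
  rfl

theorem encard_dim_eq_three : {t : StratumType | t.dim = 3}.encard = 1 := by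
  rw [show {t : StratumType | t.dim = 3} = {.dim3typeI} by ext t; cases t <;> simp [dim]]
  rw [Set.encard_singleton]

theorem encard_dim_eq_two : {t : StratumType | t.dim = 2}.encard = 3 := by
  rw [show {t : StratumType | t.dim = 2} = {.dim2typeI, .dim2typeII, .dim2typeIII} by
    ext t; cases t <;> simp [dim]]
  repeat rw [Set.encard_insert_of_notMem (by simp)]
  rw [Set.encard_singleton]
  rfl

theorem encard_dim_eq_one : {t : StratumType | t.dim = 1}.encard = 4 := by
  rw [show {t : StratumType | t.dim = 1} = {.dim1typeI, .dim1typeII, .dim1typeIII, .dim1typeIV} by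
    ext t; cases t <;> simp [dim]]
  repeat rw [Set.encard_insert_of_notMem (by simp)]
  rw [Set.encard_singleton]
  rfl

theorem encard_dim_eq_zero : {t : StratumType | t.dim = 0}.encard = 6 := by
  rw [show {t : StratumType | t.dim = 0} = {.dim0typeI, .dim0typeII, .dim0typeIII, .dim0typeIV,
    .dim0typeV, .dim0typeVI} by ext t; cases t <;> simp [dim]]
  repeat rw [Set.encard_insert_of_notMem (by simp)]
  rw [Set.encard_singleton]
  rfl

end StratumType

theorem theorem3p5 (n : ℕ) [NeZero n] (hn : 4 ≤ n) (Z : Matrix (Fin n) (Fin 4) ℝ)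
    (hZ : TotallyPositive Z) (hgen : GeneralPosition Z) :
    -- there are 14 types; 1, 3, 4, 6 of them in dimensions 3, 2, 1, 0
    ((Set.univ : Set StratumType).encard = 14 ∧
      {t : StratumType | t.dim = 3}.encard = 1 ∧ {t : StratumType | t.dim = 2}.encard = 3 ∧
      {t : StratumType | t.dim = 1}.encard = 4 ∧ {t : StratumType | t.dim = 0}.encard = 6) ∧
    -- the closed strata stratify the algebraic boundary
    algebraicBoundary Z = ⋃₀ {C | IsClosedStratum (algebraicBoundary Z) C} ∧
    (∀ C D, IsClosedStratum (algebraicBoundary Z) C → IsClosedStratum (algebraicBoundary Z) D →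
      C ∩ D = ⋃₀ {E | IsClosedStratum (algebraicBoundary Z) E ∧ E ⊆ C ∩ D}) ∧
    -- the closed strata are exactly the irreducible components of the listed loci
    (∀ C, IsClosedStratum (algebraicBoundary Z) C ↔
      ∃ t, ∃ S ∈ strataOfType Z t, C ∈ componentsIn S) ∧
    -- no closed stratum occurs in two different listed loci
    (∀ t t' S S' C, S ∈ strataOfType Z t → S' ∈ strataOfType Z t' →
      C ∈ componentsIn S → C ∈ componentsIn S' → t = t' ∧ S = S') ∧
    -- the loci are closed of the stated dimension, and irreducible, except that those of
    -- type (0, VI) are pairs of points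
    (∀ t, ∀ S ∈ strataOfType Z t, IsClosed S ∧ topologicalKrullDim S = (t.dim : WithBot ℕ∞) ∧
      (t ≠ StratumType.dim0typeVI → IsIrreducible S) ∧
      (t = StratumType.dim0typeVI → S.encard = 2)) ∧
    -- the number of strata of each type
    (∀ t, (strataOfType Z t).encard = (StratumType.count n t : ℕ∞)) := by
  have h := isGeneric_of_totallyPositive hn hZ hgen
  refine ⟨⟨StratumType.encard_univ, StratumType.encard_dim_eq_three, StratumType.encard_dim_eq_two,
    StratumType.encard_dim_eq_one, StratumType.encard_dim_eq_zero⟩,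
    h.algebraicBoundary_eq_sUnion, fun C D hC hD => h.inter_eq_sUnion hC hD,
    fun C => h.isClosedStratum_iff, fun t t' S S' C hS hS' hC hC' =>
      h.eq_of_mem_componentsIn hS hS' hC hC',
    fun t S hS => ⟨h.isClosed_of_mem hS, h.topologicalKrullDim_eq hS, h.isIrreducible_of_mem hS, ?_⟩,
    h.encard_strataOfType⟩
  rintro rfl
  exact h.encard_dim0typeVI hS
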